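/- Let $M$ be a smooth $8$-manifold with a smooth (not necessarily torsion-free) $\mathrm{Spin}(7)$-structure, i.e. a $4$-form $\Phi$ that near every point is given, in a smooth local frame, by the standard Cayley form $$\Phi_0 = dx_{1234}+dx_{1256}-dx_{1278}+dx_{1357}+dx_{1368}+dx_{1458}-dx_{1467}-dx_{2358}+dx_{2367}+dx_{2457}+dx_{2468}-dx_{3456}+dx_{3478}+dx_{5678}$$ on $\mathbb{R}^8$. Let $g$ be the induced Riemannian metric, $\nabla$ its Levi-Civita connection, and $\exp$ its exponential map. Let $$u\times v=\tfrac12\bigl(u^\flat\wedge v^\flat-{*}(u^\flat\wedge v^\flat\wedge\Phi)\bigr),\qquad u\times v\times w=(u\lrcorner(v\lrcorner(w\lrcorner\Phi)))^\sharp$$ be the two- and threefold cross products, let $\Lambda^2_7M\subset\Lambda^2T^*M$ be the rank $7$ subbundle spanned by the $u\times v$, and let $\tau\in\Omega^4(M,\Lambda^2_7M)$, $$\tau(a,b,c,d)=-a\times(b\times c\times d)+g(a,b)\,c\times d+g(a,c)\,d\times b+g(a,d)\,b\times c.$$ Let $X$ be a closed (compact, without boundary) embedded Cayley submanifold of $M$,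 i.e. a $4$-dimensional submanifold with $\Phi|_X=\mathrm{vol}_X$ for an orientation of $X$, which we fix. Let $\nu_X$ be its normal bundle with the induced connection $\nabla^\perp$, and let $E=\{\alpha\in\Lambda^2_7M|_X:\alpha|_{TX}=0\}$. For $s\in\Gamma(\nu_X)$ put $\exp_s(x)=\exp_x(s(x))$ and, where this is defined, $F(s)=(\exp_s)^*\tau\in\Omega^4(X,\Lambda^2_7M|_X)$, where the fibres of $\Lambda^2_7M$ at $\exp_x(s(x))$ and at $x$ are identified by parallel transport along $t\mapsto\exp_x(ts(x))$, $t\in[0,1]$, with respect to the connection on $\Lambda^2_7M$ induced by $\nabla$. Then the following hold. 1. The fibres of $E$ have dimension $4$, and there is a (unique) linear operator $D\colon\Gamma(\nu_X)\to\Gamma(E)$ with $$Ds=\sum_{i=1}^4 e_i\times\nabla^\perp_{e_i}s+\sum_{i=5}^8(\nabla_s\Phi)(e_i,e_2,e_3,e_4)\,(e_i\times e_1)$$ for every positive orthonormal frame $(e_1,\dots,e_4)$ of $X$ and every orthonormal frame $(e_5,\dots,e_8)$ of $\nu_X$. 2. There is an open neighbourhood $U\subseteq\nu_X$ of the zero section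 that $\exp$ maps diffeomorphically onto an open subset of $M$, such that for every $s\in\Gamma(\nu_X)$ with $s(X)\subseteq U$ the map $\exp_s\colon X\to M$ is a smooth embedding whose image $X_s=\exp_s(X)$ is Cayley if and only if $F(s)=0$. The map $s\mapsto X_s$ is a bijection from the set of all such $s$ with $F(s)=0$ onto the moduli space of local deformations of $X$ as a Cayley submanifold, i.e. the set of Cayley submanifolds of the form $X_s$. 3. For every $s\in\Gamma(\nu_X)$, $\frac{d}{dt}F(ts)\big|_{t=0}=\mathrm{vol}_X\otimes Ds$, where the difference quotients converge uniformly on $X$. 4. Consequently the Zariski tangent space at $X$ of this moduli space, i.e. the kernel of the linearisation $s\mapsto\frac{d}{dt}F(ts)|_{t=0}$ of $F$ at $0$, is equal to $\ker D$. -/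

import Mathlib

open scoped Manifold ContDiff Topology
open Module

noncomputable section

namespace CayleyDeformation

/-! ### The model form on `ℝ⁸` and `Spin(7)`-structures -/

/-- The constant form `dx_{ijkl} = dx_i ∧ dx_j ∧ dx_k ∧ dx_l` on `ℝ⁸` (indices start at `0`). -/
def dx (i j k l : Fin 8) (v : Fin 4 → Fin 8 → ℝ) : ℝ :=
  Matrix.det (Matrix.of fun a c : Fin 4 => v a (![i, j, k, l] c))

/-- The Cayley form `Φ₀` on `ℝ⁸`. -/
def phi0 (v : Fin 4 → Fin 8 → ℝ) : ℝ :=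
  dx 0 1 2 3 v + dx 0 1 4 5 v - dx 0 1 6 7 v + dx 0 2 4 6 v + dx 0 2 5 7 v + dx 0 3 4 7 v
    - dx 0 3 5 6 v - dx 1 2 4 7 v + dx 1 2 5 6 v + dx 1 3 4 6 v + dx 1 3 5 7 v
    - dx 2 3 4 5 v + dx 2 3 6 7 v + dx 4 5 6 7 v

/-- The model space of `8`-manifolds. -/
abbrev R8 := EuclideanSpace ℝ (Fin 8)

/-- The model space of `4`-manifolds. -/
abbrev R4 := EuclideanSpace ℝ (Fin 4)

section Ambient

variable {M : Type*} [TopologicalSpace M] [ChartedSpace R8 M]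

/-- `Λ²T*_q M`. -/
abbrev Form2 (q : M) := TangentSpace (𝓡 8) q [⋀^Fin 2]→ₗ[ℝ] ℝ

/-- `Λ⁴T*_q M`. -/
abbrev Form4 (q : M) := TangentSpace (𝓡 8) q [⋀^Fin 4]→ₗ[ℝ] ℝ

/-- `b` is a `Spin(7)`-frame of `T_q M`: the isomorphism `T_q M ≅ ℝ⁸` given by `b` pulls `Φ₀`
back to `Φ`. -/
def IsSpin7Frame (Φ : Π q : M, Form4 q) (q : M) (b : Basis (Fin 8) ℝ (TangentSpace (𝓡 8) q)) :
    Prop :=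
  ∀ v : Fin 4 → TangentSpace (𝓡 8) q, Φ q v = phi0 fun a => b.repr (v a)

variable [IsManifold (𝓡 8) ∞ M]

/-- The `4`-form `Φ` is a (smooth, not necessarily torsion-free) `Spin(7)`-structure: around each
point there is a smooth local frame that identifies `Φ` pointwise with `Φ₀`. -/
def IsSpin7Structure (Φ : Π q : M, Form4 q) : Prop :=
  ∀ q₀ : M, ∃ W : Set M, IsOpen W ∧ q₀ ∈ W ∧
    ∃ b : Fin 8 → Π q : M, TangentSpace (𝓡 8) q,
      (∀ i, ContMDiffOn (𝓡 8) (𝓡 8).tangent ∞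
        (fun q => (⟨q, b i q⟩ : TangentBundle (𝓡 8) M)) W) ∧
      ∀ q ∈ W, ∃ B : Basis (Fin 8) ℝ (TangentSpace (𝓡 8) q),
        (∀ i, B i = b i q) ∧ IsSpin7Frame Φ q B

open Classical in
/-- A chosen `Spin(7)`-frame at `q` (any basis if there is none). -/
def spin7Frame (Φ : Π q : M, Form4 q) (q : M) : Basis (Fin 8) ℝ (TangentSpace (𝓡 8) q) :=
  if h : ∃ b : Basis (Fin 8) ℝ (TangentSpace (𝓡 8) q), IsSpin7Frame Φ q b then h.choose
  else (EuclideanSpace.basisFun (Fin 8) ℝ).toBasis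

/-- The Riemannian metric `g = g(Φ)`: the pullback of the standard inner product of `ℝ⁸` by a
`Spin(7)`-frame.  It does not depend on the frame, as `Spin(7) ⊆ SO(8)`. -/
def metric (Φ : Π q : M, Form4 q) (q : M) (u v : TangentSpace (𝓡 8) q) : ℝ :=
  ∑ i, (spin7Frame Φ q).repr u i * (spin7Frame Φ q).repr v i

/-- The length `√g(u,u)`. -/
def len (Φ : Π q : M, Form4 q) (q : M) (u : TangentSpace (𝓡 8) q) : ℝ :=
  Real.sqrt (metric Φ q u u)

/-! ### Cross products -/

/-- `u♭ ∧ v♭`. -/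
def flatWedge (Φ : Π q : M, Form4 q) (q : M) (u v : TangentSpace (𝓡 8) q) : Form2 q where
  toFun w := metric Φ q u (w 0) * metric Φ q v (w 1) - metric Φ q u (w 1) * metric Φ q v (w 0)
  map_update_add' := by
    intro _ w i x y
    fin_cases i <;> simp [Function.update, metric, mul_add, add_mul, Finset.sum_add_distrib] <;> ring
  map_update_smul' := by
    intro _ w i c x
    have key : ∀ a b : TangentSpace (𝓡 8) q, metric Φ q a (c • b) = c * metric Φ q a b := by
      intro a b
      simp only [metric, Finset.mul_sum, map_smul, Finsupp.smul_apply, smul_eq_mul]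
      exact Finset.sum_congr rfl fun _ _ => by ring
    fin_cases i <;> simp [Function.update, key] <;> ring
  map_eq_zero_of_eq' := by
    intro w i j h hij
    fin_cases i <;> fin_cases j <;> simp_all

/-- The `2`-fold cross product `u × v = 2π₇(u♭ ∧ v♭) = ½ (u♭ ∧ v♭ - *(u♭ ∧ v♭ ∧ Φ))`.  As `Φ` is
self-dual, `*(u♭ ∧ v♭ ∧ Φ)` is the `2`-form `Φ(u, v, ·, ·)`. -/
def cross2 (Φ : Π q : M, Form4 q) (q : M) (u v : TangentSpace (𝓡 8) q) : Form2 q :=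
  (1 / 2 : ℝ) • (flatWedge Φ q u v - ((Φ q).curryLeft u).curryLeft v)

/-- The subspace `Λ²₇` of `Λ²T*_q M`: the image of `π₇`, spanned by the cross products. -/
def Lambda27 (Φ : Π q : M, Form4 q) (q : M) : Submodule ℝ (Form2 q) :=
  Submodule.span ℝ {α | ∃ u v, α = cross2 Φ q u v}

/-- The `3`-fold cross product `u × v × w = (u ⌟ (v ⌟ (w ⌟ Φ)))♯`. -/
def cross3 (Φ : Π q : M, Form4 q) (q : M) (u v w : TangentSpace (𝓡 8) q) :
    TangentSpace (𝓡 8) q :=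
  ∑ k, Φ q ![w, v, u, spin7Frame Φ q k] • spin7Frame Φ q k

/-- The `Λ²₇`-valued `4`-form `τ` (the `4`-fold cross product). -/
def tau (Φ : Π q : M, Form4 q) (q : M) (v : Fin 4 → TangentSpace (𝓡 8) q) : Form2 q :=
  -cross2 Φ q (v 0) (cross3 Φ q (v 1) (v 2) (v 3))
    + metric Φ q (v 0) (v 1) • cross2 Φ q (v 2) (v 3)
    + metric Φ q (v 0) (v 2) • cross2 Φ q (v 3) (v 1)
    + metric Φ q (v 0) (v 3) • cross2 Φ q (v 1) (v 2)

/-! ### The Levi-Civita connection in charts -/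

/-- The components of a tangent vector at `q` in the preferred chart at `p`. -/
def toCoords (p q : M) : TangentSpace (𝓡 8) q →L[ℝ] R8 :=
  (trivializationAt R8 (TangentSpace (𝓡 8)) p).continuousLinearMapAt ℝ q

/-- The tangent vector at `q` with given components in the preferred chart at `p`. -/
def ofCoords (p q : M) : R8 →L[ℝ] TangentSpace (𝓡 8) q :=
  (trivializationAt R8 (TangentSpace (𝓡 8)) p).symmL ℝ q

/-- The metric in the chart at `p`, as a function of the coordinates `y`. -/
def metricCoords (Φ : Π q : M, Form4 q) (p : M) (u v : R8) (y : R8) : ℝ :=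
  metric Φ ((extChartAt (𝓡 8) p).symm y) (ofCoords p _ u) (ofCoords p _ v)

/-- The Christoffel symbols `Γ(u,v)` of the Levi-Civita connection of `g(Φ)` in the chart at `p`,
at the point `q` of that chart:
`g(Γ(u,v), w) = ½ (∂_u g(v,w) + ∂_v g(u,w) - ∂_w g(u,v))` for all `w`; the vector is written out
in an orthonormal basis `w = b_k`. -/
def christoffel (Φ : Π q : M, Form4 q) (p q : M) (u v : R8) : R8 :=
  let y := extChartAt (𝓡 8) p q
  let b : Fin 8 → R8 := fun k => toCoords p q (spin7Frame Φ q k)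
  ∑ k, ((1 / 2 : ℝ) * (fderiv ℝ (metricCoords Φ p v (b k)) y u
      + fderiv ℝ (metricCoords Φ p u (b k)) y v
      - fderiv ℝ (metricCoords Φ p u v) y (b k))) • b k

/-- `(∇_w Φ)(v₀, v₁, v₂, v₃)` at the point `p`, computed in the chart at `p`. -/
def nablaPhi (Φ : Π q : M, Form4 q) (p : M) (w : TangentSpace (𝓡 8) p)
    (v : Fin 4 → TangentSpace (𝓡 8) p) : ℝ :=
  fderiv ℝ (fun y : R8 => Φ ((extChartAt (𝓡 8) p).symm y)
      fun i => ofCoords p _ (toCoords p p (v i))) (extChartAt (𝓡 8) p p) (toCoords p p w)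
    - ∑ i, Φ p (Function.update v i
        (ofCoords p p (christoffel Φ p p (toCoords p p w) (toCoords p p (v i)))))

/-- The velocity at time `t` of a curve, in the chart at the point `γ t`. -/
def velocity (γ : ℝ → M) (t : ℝ) : R8 :=
  deriv (fun r => extChartAt (𝓡 8) (γ t) (γ r)) t

/-- `γ` is of class `C²` near `t` and satisfies the geodesic equation at `t`. -/
def IsGeodesicAt (Φ : Π q : M, Form4 q) (γ : ℝ → M) (t : ℝ) : Prop :=
  ContMDiffAt 𝓘(ℝ, ℝ) (𝓡 8) 2 γ t ∧
    deriv (deriv fun r => extChartAt (𝓡 8) (γ t) (γ r)) t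
      + christoffel Φ (γ t) (γ t) (velocity γ t) (velocity γ t) = 0

/-- `γ : [0,1] → M` is the geodesic with initial velocity `p ∈ TM`. -/
def IsGeodesicFrom (Φ : Π q : M, Form4 q) (p : TangentBundle (𝓡 8) M) (γ : ℝ → M) : Prop :=
  tangentMap 𝓘(ℝ, ℝ) (𝓡 8) γ ⟨0, (1 : ℝ)⟩ = p ∧ ∀ t ∈ Set.Icc (0 : ℝ) 1, IsGeodesicAt Φ γ t

/-- `exp` is defined at `p`. -/
def ExpDefined (Φ : Π q : M, Form4 q) (p : TangentBundle (𝓡 8) M) : Prop :=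
  ∃ γ : ℝ → M, IsGeodesicFrom Φ p γ

open Classical in
/-- The exponential map of the metric `g(Φ)` (the base point where it is not defined). -/
def expMap (Φ : Π q : M, Form4 q) (p : TangentBundle (𝓡 8) M) : M :=
  if h : ExpDefined Φ p then h.choose 1 else p.proj

/-! ### Parallel transport in `Λ²₇M` -/

/-- The components, in the chart at `γ t`, of the Levi-Civita covariant derivative at time `t`
of the family of `2`-forms `β` along `γ`. -/
def covDerivForm (Φ : Π q : M, Form4 q) (γ : ℝ → M) (β : Π r, Form2 (γ r)) (t : ℝ)
    (a b : R8) : ℝ :=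
  deriv (fun r => β r ![ofCoords (γ t) (γ r) a, ofCoords (γ t) (γ r) b]) t
    - β t ![ofCoords (γ t) (γ t) (christoffel Φ (γ t) (γ t) (velocity γ t) a),
        ofCoords (γ t) (γ t) b]
    - β t ![ofCoords (γ t) (γ t) a,
        ofCoords (γ t) (γ t) (christoffel Φ (γ t) (γ t) (velocity γ t) b)]

/-- The section `β` of `Λ²₇M` along `γ` is parallel at time `t` for the connection on `Λ²₇M`
induced by the Levi-Civita connection `∇`, i.e. the `Λ²₇`-part of `∇_{γ'} β` vanishes: `∇_{γ'} β`
is orthogonal to `Λ²₇`. -/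
def IsParallelAt (Φ : Π q : M, Form4 q) (γ : ℝ → M) (β : Π r, Form2 (γ r)) (t : ℝ) : Prop :=
  β t ∈ Lambda27 Φ (γ t) ∧
  (∀ a b : R8, DifferentiableAt ℝ
    (fun r => β r ![ofCoords (γ t) (γ r) a, ofCoords (γ t) (γ r) b]) t) ∧
  ∀ η ∈ Lambda27 Φ (γ t), ∑ c, ∑ d,
    covDerivForm Φ γ β t (toCoords (γ t) (γ t) (spin7Frame Φ (γ t) c))
      (toCoords (γ t) (γ t) (spin7Frame Φ (γ t) d))
      * η ![spin7Frame Φ (γ t) c, spin7Frame Φ (γ t) d] = 0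

/-- `α ∈ Λ²₇` at `exp p` is carried to `α₀` by parallel transport in `Λ²₇M`, back along the
geodesic `t ↦ exp (t p)`, `t ∈ [0,1]`. -/
def IsTransported (Φ : Π q : M, Form4 q) (p : TangentBundle (𝓡 8) M)
    (α : Form2 (expMap Φ p)) (α₀ : Form2 p.proj) : Prop :=
  ∃ (γ : ℝ → M) (β : Π r, Form2 (γ r)), IsGeodesicFrom Φ p γ ∧
    (∀ t ∈ Set.Icc (0 : ℝ) 1, IsParallelAt Φ γ β t) ∧
    (⟨γ 1, β 1⟩ : Σ q : M, Form2 q) = ⟨expMap Φ p, α⟩ ∧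
    (⟨γ 0, β 0⟩ : Σ q : M, Form2 q) = ⟨p.proj, α₀⟩

open Classical in
/-- Parallel transport in `Λ²₇M` from `exp p` to the base point of `p`. -/
def transport (Φ : Π q : M, Form4 q) (p : TangentBundle (𝓡 8) M)
    (α : Form2 (expMap Φ p)) : Form2 p.proj :=
  if h : ∃ α₀, IsTransported Φ p α α₀ then h.choose else 0

end Ambient

section Submanifold

variable {M : Type*} [TopologicalSpace M] [ChartedSpace R8 M] [IsManifold (𝓡 8) ∞ M]
variable {X : Type*} [TopologicalSpace X] [ChartedSpace R4 X] [IsManifold (𝓡 4) ∞ X]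

/-! ### Cayley submanifolds -/

/-- The differential of `f : X → M` at `x`. -/
abbrev dmap (f : X → M) (x : X) : TangentSpace (𝓡 4) x →L[ℝ] TangentSpace (𝓡 8) (f x) :=
  mfderiv (𝓡 4) (𝓡 8) f x

/-- `f` is a smooth embedding: smooth, with injective differentials, and a homeomorphism onto its
image. -/
def IsSmoothEmb (f : X → M) : Prop :=
  ContMDiff (𝓡 4) (𝓡 8) ∞ f ∧ (∀ x, Function.Injective (dmap f x)) ∧ Topology.IsEmbedding f

/-- The pointwise orientations `o` of the tangent spaces form an orientation of `X`: around each
point there is a positive smooth local frame. -/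
def IsOrientation (o : Π x : X, Orientation ℝ (TangentSpace (𝓡 4) x) (Fin 4)) : Prop :=
  ∀ x₀ : X, ∃ W : Set X, IsOpen W ∧ x₀ ∈ W ∧
    ∃ b : Fin 4 → Π x : X, TangentSpace (𝓡 4) x,
      (∀ i, ContMDiffOn (𝓡 4) (𝓡 4).tangent ∞
        (fun x => (⟨x, b i x⟩ : TangentBundle (𝓡 4) X)) W) ∧
      ∀ x ∈ W, ∃ B : Basis (Fin 4) ℝ (TangentSpace (𝓡 4) x),
        (∀ i, B i = b i x) ∧ B.orientation = o x

/-- `e` is a positive orthonormal basis of `T_x X` for the metric induced by `f`. -/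
def IsPosOrthonormal (Φ : Π q : M, Form4 q) (f : X → M)
    (o : Π x : X, Orientation ℝ (TangentSpace (𝓡 4) x) (Fin 4)) (x : X)
    (e : Basis (Fin 4) ℝ (TangentSpace (𝓡 4) x)) : Prop :=
  (∀ i j, metric Φ (f x) (dmap f x (e i)) (dmap f x (e j)) = if i = j then 1 else 0) ∧
    e.orientation = o x

open Classical in
/-- The volume form `vol_X` of the induced metric and the orientation `o`. -/
def vol (Φ : Π q : M, Form4 q) (f : X → M)
    (o : Π x : X, Orientation ℝ (TangentSpace (𝓡 4) x) (Fin 4)) (x : X)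
    (v : Fin 4 → TangentSpace (𝓡 4) x) : ℝ :=
  if h : ∃ e : Basis (Fin 4) ℝ (TangentSpace (𝓡 4) x), IsPosOrthonormal Φ f o x e
  then h.choose.det v else 0

/-- `o` is an orientation of `X` with `Φ|_X = vol_X`. -/
def IsCayleyOrientation (Φ : Π q : M, Form4 q) (f : X → M)
    (o : Π x : X, Orientation ℝ (TangentSpace (𝓡 4) x) (Fin 4)) : Prop :=
  IsOrientation o ∧
    ∀ (x : X) (v : Fin 4 → TangentSpace (𝓡 4) x),
      Φ (f x) (fun i => dmap f x (v i)) = vol Φ f o x v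

/-- The embedded submanifold `f : X → M` is Cayley. -/
def IsCayley (Φ : Π q : M, Form4 q) (f : X → M) : Prop :=
  IsSmoothEmb f ∧
    ∃ o : Π x : X, Orientation ℝ (TangentSpace (𝓡 4) x) (Fin 4), IsCayleyOrientation Φ f o

/-! ### The normal bundle, the bundle `E`, and the operator -/

/-- `n ∈ T_{f x} M` is normal to `X`. -/
def IsNormal (Φ : Π q : M, Form4 q) (f : X → M) (x : X) (n : TangentSpace (𝓡 8) (f x)) : Prop :=
  ∀ w : TangentSpace (𝓡 4) x, metric Φ (f x) n (dmap f x w) = 0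

/-- `Γ(ν_X)`: the smooth sections of `TM|_X` with normal values.  Smoothness is smoothness of the
components in each chart of `M`. -/
def NormalSections (Φ : Π q : M, Form4 q) (f : X → M) :
    Submodule ℝ (Π x : X, TangentSpace (𝓡 8) (f x)) where
  carrier := {s | (∀ p : M, ContMDiffOn (𝓡 4) 𝓘(ℝ, R8) ∞ (fun x => toCoords p (f x) (s x))
      (f ⁻¹' (chartAt R8 p).source)) ∧ ∀ x, IsNormal Φ f x (s x)}
  zero_mem' := by
    refine ⟨fun p => ?_, fun x w => by simp [metric]⟩
    simpa using contMDiffOn_const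
  add_mem' := by
    rintro s t ⟨hs, hs'⟩ ⟨ht, ht'⟩
    refine ⟨fun p => ?_, fun x w => ?_⟩
    · refine ((hs p).add (ht p)).congr fun x _ => ?_
      simp
    · have h1 := hs' x w
      have h2 := ht' x w
      simp only [metric] at h1 h2 ⊢
      simp [add_mul, Finset.sum_add_distrib, h1, h2]
  smul_mem' := by
    rintro c s ⟨hs, hs'⟩
    refine ⟨fun p => ?_, fun x w => ?_⟩
    · refine (contMDiffOn_const (I := 𝓡 4) (M := X) (I' := 𝓘(ℝ, ℝ)) (c := c) |>.smul (hs p)).congr fun x _ => ?_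
      simp
    · have h1 := hs' x w
      simp only [metric] at h1 ⊢
      simp [mul_assoc, ← Finset.mul_sum, h1]

/-- The fibre `E_x = {α ∈ Λ²₇ : α|_{T_x X} = 0}`. -/
def bundleE (Φ : Π q : M, Form4 q) (f : X → M) (x : X) : Submodule ℝ (Form2 (f x)) where
  carrier := {α | α ∈ Lambda27 Φ (f x) ∧ ∀ u v, α ![dmap f x u, dmap f x v] = 0}
  zero_mem' := ⟨Submodule.zero_mem _, by simp⟩
  add_mem' := fun ha hb => ⟨Submodule.add_mem _ ha.1 hb.1, fun u v => by
    simp [ha.2 u v, hb.2 u v]⟩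
  smul_mem' := fun c _ ha => ⟨Submodule.smul_mem _ c ha.1, fun u v => by simp [ha.2 u v]⟩

/-- `Γ(E)`: the smooth sections of `Λ²M|_X` with values in `E`.  Smoothness is smoothness of the
components in each chart of `M`. -/
def SectionsE (Φ : Π q : M, Form4 q) (f : X → M) : Submodule ℝ (Π x : X, Form2 (f x)) where
  carrier := {α | (∀ (p : M) (a b : R8), ContMDiffOn (𝓡 4) 𝓘(ℝ, ℝ) ∞
      (fun x => α x ![ofCoords p (f x) a, ofCoords p (f x) b]) (f ⁻¹' (chartAt R8 p).source)) ∧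
      ∀ x, α x ∈ bundleE Φ f x}
  zero_mem' := ⟨fun p a b => by simpa using contMDiffOn_const, fun x => Submodule.zero_mem _⟩
  add_mem' := fun ha hb => ⟨fun p a b => ((ha.1 p a b).add (hb.1 p a b)).congr fun x _ => by simp,
    fun x => Submodule.add_mem _ (ha.2 x) (hb.2 x)⟩
  smul_mem' := fun c _ ha => ⟨fun p a b =>
    (contMDiffOn_const (I := 𝓡 4) (M := X) (I' := 𝓘(ℝ, ℝ)) (c := c) |>.smul (ha.1 p a b)).congr fun x _ => by simp,
    fun x => Submodule.smul_mem _ c (ha.2 x)⟩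

/-- `∇_w s` for a section `s` of `TM|_X` and `w ∈ T_x X`, with the Levi-Civita connection of
`M`, computed in the chart at `f x`. -/
def covAlong (Φ : Π q : M, Form4 q) (f : X → M) (s : Π x : X, TangentSpace (𝓡 8) (f x)) (x : X)
    (w : TangentSpace (𝓡 4) x) : TangentSpace (𝓡 8) (f x) :=
  ofCoords (f x) (f x)
    ((show R8 from mfderiv (𝓡 4) 𝓘(ℝ, R8) (fun y => toCoords (f x) (f y) (s y)) x w)
      + christoffel Φ (f x) (f x) (toCoords (f x) (f x) (dmap f x w))
          (toCoords (f x) (f x) (s x)))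

open Classical in
/-- The orthogonal projection of `T_{f x} M` onto the normal space of `X`. -/
def normalPart (Φ : Π q : M, Form4 q) (f : X → M) (x : X) (v : TangentSpace (𝓡 8) (f x)) :
    TangentSpace (𝓡 8) (f x) :=
  if h : ∃ n, IsNormal Φ f x n ∧ ∃ w, v = dmap f x w + n then h.choose else 0

/-- `∇^⊥_w s`, with the connection on the normal bundle induced by `∇`. -/
def covPerp (Φ : Π q : M, Form4 q) (f : X → M) (s : Π x : X, TangentSpace (𝓡 8) (f x)) (x : X)
    (w : TangentSpace (𝓡 4) x) : TangentSpace (𝓡 8) (f x) :=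
  normalPart Φ f x (covAlong Φ f s x w)

/-- `(e₁, …, e₄)` is a positive orthonormal basis of `T_x X` and `(n₁, …, n₄) = (e₅, …, e₈)` is an
orthonormal basis of the normal space at `x`. -/
def IsAdaptedFrame (Φ : Π q : M, Form4 q) (f : X → M)
    (o : Π x : X, Orientation ℝ (TangentSpace (𝓡 4) x) (Fin 4)) (x : X)
    (e : Basis (Fin 4) ℝ (TangentSpace (𝓡 4) x)) (n : Fin 4 → TangentSpace (𝓡 8) (f x)) : Prop :=
  IsPosOrthonormal Φ f o x e ∧ (∀ i, IsNormal Φ f x (n i)) ∧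
    ∀ i j, metric Φ (f x) (n i) (n j) = if i = j then 1 else 0

/-- `∑_{i=1}^4 e_i × ∇^⊥_{e_i} s + ∑_{i=5}^8 (∇_s Φ)(e_i, e_2, e_3, e_4) (e_i × e_1)` at `x`. -/
def operatorFormula (Φ : Π q : M, Form4 q) (f : X → M)
    (s : Π x : X, TangentSpace (𝓡 8) (f x)) (x : X)
    (e : Fin 4 → TangentSpace (𝓡 4) x) (n : Fin 4 → TangentSpace (𝓡 8) (f x)) : Form2 (f x) :=
  ∑ i, cross2 Φ (f x) (dmap f x (e i)) (covPerp Φ f s x (e i))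
    + ∑ i, nablaPhi Φ (f x) (s x) ![n i, dmap f x (e 1), dmap f x (e 2), dmap f x (e 3)]
        • cross2 Φ (f x) (n i) (dmap f x (e 0))

/-! ### The deformation map -/

/-- `exp_s : X → M`, `x ↦ exp_x (s x)`. -/
def expSec (Φ : Π q : M, Form4 q) (f : X → M) (s : Π x : X, TangentSpace (𝓡 8) (f x)) (x : X) :
    M :=
  expMap Φ (⟨f x, s x⟩ : TangentBundle (𝓡 8) M)

/-- The deformation map `F(s) = (exp_s)^* τ`, a `4`-form on `X` with values in `Λ²₇M|_X`; the
fibres of `Λ²₇M` at `exp_x (s x)` and at `x` are identified by parallel transport along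
`t ↦ exp_x (t s(x))`. -/
def deformationMap (Φ : Π q : M, Form4 q) (f : X → M) (s : Π x : X, TangentSpace (𝓡 8) (f x))
    (x : X) (v : Fin 4 → TangentSpace (𝓡 4) x) : Form2 (f x) :=
  transport Φ (⟨f x, s x⟩ : TangentBundle (𝓡 8) M)
    (tau Φ (expSec Φ f s x) fun i => dmap (expSec Φ f s) x (v i))

/-- The total space of the normal bundle, as a subset of `TM`. -/
def normalBundle (Φ : Π q : M, Form4 q) (f : X → M) : Set (TangentBundle (𝓡 8) M) :=
  {p | ∃ (x : X) (n : TangentSpace (𝓡 8) (f x)), IsNormal Φ f x n ∧ p = ⟨f x, n⟩}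

/-- `U` is an open neighbourhood of the zero section in the normal bundle that `exp` maps
diffeomorphically onto an open subset of `M`. -/
def IsTubularNeighbourhood (Φ : Π q : M, Form4 q) (f : X → M)
    (U : Set (TangentBundle (𝓡 8) M)) : Prop :=
  (∀ x : X, (⟨f x, 0⟩ : TangentBundle (𝓡 8) M) ∈ U) ∧
  (∃ O : Set (TangentBundle (𝓡 8) M), IsOpen O ∧ U = O ∩ normalBundle Φ f ∧
    (∀ p ∈ O, ExpDefined Φ p) ∧ ContMDiffOn (𝓡 8).tangent (𝓡 8) ∞ (expMap Φ) O) ∧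
  IsOpen (expMap Φ '' U) ∧
  ∃ r : M → TangentBundle (𝓡 8) M,
    ContMDiffOn (𝓡 8) (𝓡 8).tangent ∞ r (expMap Φ '' U) ∧ ∀ p ∈ U, r (expMap Φ p) = p

/-- `Γ(U) = {s ∈ Γ(ν_X) : s(X) ⊆ U}`. -/
def sectionsIn (Φ : Π q : M, Form4 q) (f : X → M) (U : Set (TangentBundle (𝓡 8) M)) :
    Set (Π x : X, TangentSpace (𝓡 8) (f x)) :=
  {s | s ∈ NormalSections Φ f ∧ ∀ x, (⟨f x, s x⟩ : TangentBundle (𝓡 8) M) ∈ U}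

/-- The moduli space of all local deformations of `X` as a Cayley submanifold: the submanifolds
`X_s = exp_s(X)`, `s ∈ Γ(U)`, that are Cayley. -/
def moduliSpace (Φ : Π q : M, Form4 q) (f : X → M) (U : Set (TangentBundle (𝓡 8) M)) :
    Set (Set M) :=
  {Y | ∃ s ∈ sectionsIn Φ f U, IsCayley Φ (expSec Φ f s) ∧ Y = Set.range (expSec Φ f s)}

/-- `L` is the derivative `d/dt F(ts)|_{t=0}` of the deformation map `F` at `0` in the direction
`s`, where the difference quotients converge uniformly on `X`. -/
def IsLinearisation (Φ : Π q : M, Form4 q) (f : X → M) (s : Π x : X, TangentSpace (𝓡 8) (f x))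
    (L : Π x : X, (Fin 4 → TangentSpace (𝓡 4) x) → Form2 (f x)) : Prop :=
  ∀ ε > (0 : ℝ), ∀ᶠ t in 𝓝 (0 : ℝ), ∀ (x : X) (v : Fin 4 → TangentSpace (𝓡 4) x)
    (a b : TangentSpace (𝓡 8) (f x)),
    |(deformationMap Φ f (t • s) x v - deformationMap Φ f 0 x v - t • L x v) ![a, b]|
      ≤ ε * |t| * (∏ i, len Φ (f x) (dmap f x (v i))) * len Φ (f x) a * len Φ (f x) b

/-- The Zariski tangent space at `X` of the moduli space of local Cayley deformations of `X`: the
kernel of the linearisation at `0` of the deformation map, whose zero set is the moduli space. -/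
def zariskiTangentSpace (Φ : Π q : M, Form4 q) (f : X → M) : Set (NormalSections Φ f) :=
  {s | IsLinearisation Φ f s fun _ _ => 0}

end Submanifold

end CayleyDeformation

end

/-!
Everything is reduced to algebra on `ℝ⁸` by coframes, i.e. linear isomorphisms `T_q M → ℝ⁸` that
pull the standard form `Φ₀` back to `Φ`.

*Algebra.* `Λ²₇` is spanned by the forms `ω_k = ⟪J_k ·, ·⟫` of seven complex structures `J_k` that
satisfy the Clifford relations, and both `Φ₀` and `τ` can be written in terms of the `ω_k`. A
linear map that preserves `Φ₀` is orthogonal (`inner_map_of_phi_map`), so the metric of `Φ` is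
well defined, and a coframe carries metric, cross products and `τ` to those of the model
(`IsCoframe`). The components `fourfold k` of `τ` satisfy `∑ fourfold² + Φ₀² = 1` on orthonormal
frames (`sum_fourfold_sq`). Hence `τ` vanishes on a `4`-plane if and only if it is calibrated up
to orientation, which makes Cayley submanifolds the zeros of `τ` (`isCayley_iff_tau_eq_zero`).

*Geometry.* Smooth local coframes exist (`IsLocalCoframe`), and in terms of them the Christoffel
symbols are explicit (`christoffel_eq`). Geodesics are obtained, together with their smooth
dependence on the initial data, from the inverse function theorem on a space of paths
(`exists_second_order_flow`); parallel transport solves a linear equation along them, preserves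
the metric and differs from the identity by `O(|v|)`. A chart with these data is an `IsExpChart`
(`exists_expChart`). The exponential map is a local diffeomorphism along the zero section of the
normal bundle and injective near the compact `X` (`exists_tubularNeighbourhood`). Since parallel
transport is injective, `F(s) = 0` says that `τ` vanishes on the tangent spaces of `X_s`, i.e.
that `X_s` is Cayley, and `X_s` determines `s` (`exists_moduli_description`).

*Linearisation.* Since `τ` vanishes on `X`, transport contributes to `F(ts)` to second order in
`t` only. Taylor expansion in an `IsExpChart` shows that `F(ts)` is `t` times an explicit form,
`linForm`, up to an error `O(t²)` that is locally uniform (`exists_linearisation_bound`), hence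
uniform on the compact `X`. In a coframe, the variation of a tangent frame of `X` is the covariant
derivative of `s` plus a skew endomorphism of `ℝ⁸` given by the connection. The tangential part of
the covariant derivative drops out, its normal part gives `e_i × ∇^⊥_{e_i} s`, and the effect of a
skew endomorphism on `τ` is that on `Φ` evaluated at normal vectors (`sum_fourfold_update_skew`),
which is the term with `∇_s Φ` (`nablaPhi_eq`). So `linForm` is the formula for `D` in every
adapted frame (`linForm_eq_operatorFormula`).

As a derivative, `linForm` depends on no chart or frame. Therefore the formula for `D` is
independent of the frame, `D` is linear, `D s` is smooth, and the linearisation of `F` is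
`vol_X ⊗ D`; as `vol_X` is `1` on positive orthonormal frames, its kernel is that of `D`. The fibres of `E`
are `4`-dimensional because `n ↦ n × e₁` is an isomorphism from the normal space onto them
(`finrank_bundleE`).
-/

noncomputable section

namespace CayleyDeformation

/-! ### The model: `Λ²₇` and the cross products on `ℝ⁸` -/

/-- The matrices of the seven complex structures of `ℝ⁸` that span `Λ²₇`, acting on `u`. -/
def complexStructureFun : Fin 7 → R8 → R8 :=
  ![fun u => !₂[-u 1, u 0, u 3, -u 2, u 5, -u 4, -u 7, u 6],
    fun u => !₂[-u 2, -u 3, u 0, u 1, u 6, u 7, -u 4, -u 5],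
    fun u => !₂[-u 3, u 2, -u 1, u 0, u 7, -u 6, u 5, -u 4],
    fun u => !₂[-u 4, -u 5, -u 6, -u 7, u 0, u 1, u 2, u 3],
    fun u => !₂[-u 5, u 4, -u 7, u 6, -u 1, u 0, -u 3, u 2],
    fun u => !₂[-u 6, u 7, u 4, -u 5, -u 2, u 3, u 0, -u 1],
    fun u => !₂[-u 7, -u 6, u 5, u 4, -u 3, -u 2, u 1, u 0]]

/-- The complex structures `J₁, …, J₇` of `ℝ⁸`.  They satisfy the Clifford relations, and the
`2`-forms `⟪J_k u, v⟫` are a basis of `Λ²₇`. -/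
def J (k : Fin 7) : R8 →L[ℝ] R8 :=
  LinearMap.toContinuousLinearMap
    { toFun := complexStructureFun k
      map_add' := by
        intro u v
        ext i
        fin_cases k <;> fin_cases i <;> simp [complexStructureFun] <;> ring
      map_smul' := by
        intro c u
        ext i
        fin_cases k <;> fin_cases i <;> simp [complexStructureFun] }

/-- The `2`-form `ω_k(u, v) = ⟪J_k u, v⟫` on `ℝ⁸`. -/
def om (k : Fin 7) (u v : R8) : ℝ := inner ℝ (J k u) v

theorem inner_eq_sum (u v : R8) : inner ℝ u v = ∑ i, u i * v i := by
  simp [PiLp.inner_apply, mul_comm]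

theorem J_apply (k : Fin 7) (u : R8) : J k u = complexStructureFun k u := rfl

theorem inner_J_left (k : Fin 7) (u v : R8) : inner ℝ (J k u) v = -inner ℝ u (J k v) := by
  simp only [inner_eq_sum, J_apply, Fin.sum_univ_eight]
  fin_cases k <;> simp [complexStructureFun] <;> ring

theorem inner_J_J (k l : Fin 7) (u : R8) :
    inner ℝ (J k u) (J l u) = if k = l then inner ℝ u u else 0 := by
  simp only [inner_eq_sum, J_apply, Fin.sum_univ_eight]
  fin_cases k <;> fin_cases l <;> simp [complexStructureFun] <;> ring

@[simp] theorem om_add_left (k : Fin 7) (u v w : R8) : om k (u + v) w = om k u w + om k v w := by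
  simp [om, inner_add_left]

@[simp] theorem om_add_right (k : Fin 7) (u v w : R8) : om k u (v + w) = om k u v + om k u w := by
  simp [om, inner_add_right]

@[simp] theorem om_smul_left (k : Fin 7) (c : ℝ) (u v : R8) : om k (c • u) v = c * om k u v := by
  simp [om, real_inner_smul_left]

@[simp] theorem om_smul_right (k : Fin 7) (c : ℝ) (u v : R8) : om k u (c • v) = c * om k u v := by
  simp [om, real_inner_smul_right]

@[simp] theorem om_sub_left (k : Fin 7) (u v w : R8) : om k (u - v) w = om k u w - om k v w := by
  simp [om, inner_sub_left]

@[simp] theorem om_sub_right (k : Fin 7) (u v w : R8) : om k u (v - w) = om k u v - om k u w := by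
  simp [om, inner_sub_right]

@[simp] theorem om_zero_right (k : Fin 7) (v : R8) : om k v 0 = 0 := by simp [om]

theorem om_swap (k : Fin 7) (u v : R8) : om k u v = -om k v u := by
  simp only [om]; rw [inner_J_left, real_inner_comm]

@[simp] theorem om_self (k : Fin 7) (u : R8) : om k u u = 0 := by
  have := om_swap k u u; linarith

theorem om_sum_right {ι : Type*} (s : Finset ι) (k : Fin 7) (u : R8) (g : ι → R8) :
    om k u (∑ i ∈ s, g i) = ∑ i ∈ s, om k u (g i) := by simp [om, inner_sum]

theorem om_J (k l : Fin 7) (u : R8) : om k u (J l u) = if k = l then inner ℝ u u else 0 :=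
  inner_J_J k l u

/-- `ω_k` as an alternating form. -/
def omForm (k : Fin 7) : R8 [⋀^Fin 2]→ₗ[ℝ] ℝ where
  toFun w := om k (w 0) (w 1)
  map_update_add' := by
    intro _ w i x y
    fin_cases i <;> simp [Function.update]
  map_update_smul' := by
    intro _ w i c x
    fin_cases i <;> simp [Function.update]
  map_eq_zero_of_eq' := by
    intro w i j h hij
    fin_cases i <;> fin_cases j <;> simp_all

/-- The coordinate functions of `ℝ⁸` selected by `i`. -/
def coordSel (i : Fin 4 → Fin 8) : R8 →ₗ[ℝ] (Fin 4 → ℝ) where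
  toFun u c := u (i c)
  map_add' _ _ := rfl
  map_smul' _ _ := rfl

/-- `dx_{ijkl}` as an alternating form. -/
def dxForm (i j k l : Fin 8) : R8 [⋀^Fin 4]→ₗ[ℝ] ℝ :=
  (Matrix.detRowAlternating (n := Fin 4) (R := ℝ)).compLinearMap (coordSel ![i, j, k, l])

/-- The Cayley form on `ℝ⁸`, as an alternating form. -/
def phi : R8 [⋀^Fin 4]→ₗ[ℝ] ℝ :=
  dxForm 0 1 2 3 + dxForm 0 1 4 5 - dxForm 0 1 6 7 + dxForm 0 2 4 6 + dxForm 0 2 5 7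
    + dxForm 0 3 4 7 - dxForm 0 3 5 6 - dxForm 1 2 4 7 + dxForm 1 2 5 6 + dxForm 1 3 4 6
    + dxForm 1 3 5 7 - dxForm 2 3 4 5 + dxForm 2 3 6 7 + dxForm 4 5 6 7

theorem phi_eq_phi0 (v : Fin 4 → R8) : phi v = phi0 fun a => ⇑(v a) := rfl

theorem dx_vec (i j k l : Fin 8) (u v a b : Fin 8 → ℝ) :
    dx i j k l ![u, v, a, b] =
      (u i * v j - u j * v i) * (a k * b l - a l * b k)
      - (u i * v k - u k * v i) * (a j * b l - a l * b j)
      + (u i * v l - u l * v i) * (a j * b k - a k * b j)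
      + (u j * v k - u k * v j) * (a i * b l - a l * b i)
      - (u j * v l - u l * v j) * (a i * b k - a k * b i)
      + (u k * v l - u l * v k) * (a i * b j - a j * b i) := by
  simp [dx, Matrix.det_succ_row_zero, Fin.sum_univ_succ, Fin.succAbove]
  ring

/-- The Cayley form in terms of the `2`-forms `ω_k`: the operator `α ↦ α - *(α ∧ Φ)` is four times
the projection to `Λ²₇`. -/
theorem phi_vec (u v a b : R8) :
    phi ![u, v, a, b] = inner ℝ u a * inner ℝ v b - inner ℝ u b * inner ℝ v a
      - ∑ k, om k u v * om k a b := by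
  have h : (fun c => ⇑(![u, v, a, b] c) : Fin 4 → Fin 8 → ℝ) = ![⇑u, ⇑v, ⇑a, ⇑b] := by
    funext c; fin_cases c <;> rfl
  rw [phi_eq_phi0, h]
  simp only [phi0, dx_vec, inner_eq_sum, om, J_apply, Fin.sum_univ_eight, Fin.sum_univ_seven]
  simp [complexStructureFun]
  ring

theorem phi_swap_left (u v a b : R8) : phi ![u, v, a, b] = -phi ![v, u, a, b] := by
  rw [phi_vec, phi_vec, ← sub_eq_zero]
  have h : ∑ k, om k u v * om k a b = -∑ k, om k v u * om k a b := by
    rw [← Finset.sum_neg_distrib]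
    exact Finset.sum_congr rfl fun k _ => by rw [om_swap k u v]; ring
  rw [h]; ring

theorem phi_swap_right (u v a b : R8) : phi ![u, v, a, b] = -phi ![u, v, b, a] := by
  rw [phi_vec, phi_vec, ← sub_eq_zero]
  have h : ∑ k, om k u v * om k a b = -∑ k, om k u v * om k b a := by
    rw [← Finset.sum_neg_distrib]
    exact Finset.sum_congr rfl fun k _ => by rw [om_swap k a b]; ring
  rw [h]; ring

theorem phi_swap_middle (u v a b : R8) : phi ![u, v, a, b] = -phi ![u, a, v, b] := by
  have h := phi.map_swap ![u, a, v, b] (i := 1) (j := 2) (by decide)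
  rw [← h]
  congr 1
  funext c; fin_cases c <;> rfl

theorem phi_self_left (u a b : R8) : phi ![u, u, a, b] = 0 := by
  have := phi_swap_left u u a b; linarith

theorem phi_self_right (u v a : R8) : phi ![u, v, a, a] = 0 := by
  have := phi_swap_right u v a a; linarith

theorem phi_self_middle (u v a : R8) : phi ![u, v, v, a] = 0 := by
  have := phi_swap_middle u v v a; linarith

/-- The threefold cross product of `ℝ⁸`: the vector dual to `x ↦ Φ₀(x, u, v, w)`. -/
def triple (u v w : R8) : R8 :=
  ∑ l, om l u v • J l w - inner ℝ u w • v + inner ℝ v w • u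

theorem inner_triple (u v w x : R8) : inner ℝ (triple u v w) x = phi ![x, u, v, w] := by
  have h : phi ![x, u, v, w] = -phi ![u, v, w, x] := by
    rw [phi_swap_left, phi_swap_middle, phi_swap_right]; ring
  rw [h, phi_vec, triple, inner_add_left, inner_sub_left, sum_inner]
  simp only [real_inner_smul_left]
  rw [show ∑ k, om k u v * om k w x = ∑ k, om k u v * inner ℝ (J k w) x from rfl]
  ring

theorem triple_cyclic (u v w : R8) : triple u v w = triple v w u :=
  ext_inner_right ℝ fun x => by
    rw [inner_triple, inner_triple, phi_swap_middle, phi_swap_right]; ring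

theorem triple_swap (u v w : R8) : triple u v w = -triple v u w :=
  ext_inner_right ℝ fun x => by
    rw [inner_neg_left, inner_triple, inner_triple, phi_swap_middle]

theorem triple_add_left (u u' v w : R8) : triple (u + u') v w = triple u v w + triple u' v w := by
  simp only [triple, om_add_left, add_smul, Finset.sum_add_distrib, inner_add_left, smul_add]
  abel

theorem triple_smul_left (c : ℝ) (u v w : R8) : triple (c • u) v w = c • triple u v w := by
  simp only [triple, om_smul_left, mul_smul, real_inner_smul_left, ← Finset.smul_sum, smul_sub,
    smul_add]
  rw [smul_comm _ c]

theorem triple_self_left (u w : R8) : triple u u w = 0 := by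
  have h := triple_swap u u w
  rwa [eq_neg_iff_add_eq_zero, ← two_smul ℝ, smul_eq_zero_iff_right two_ne_zero] at h

theorem triple_self_right (u w : R8) : triple u w w = 0 := by
  rw [triple_cyclic, triple_self_left]

theorem triple_add_middle (u v v' w : R8) : triple u (v + v') w = triple u v w + triple u v' w := by
  rw [triple_cyclic, triple_add_left, ← triple_cyclic u, ← triple_cyclic u]

theorem triple_smul_middle (c : ℝ) (u v w : R8) : triple u (c • v) w = c • triple u v w := by
  rw [triple_cyclic, triple_smul_left, ← triple_cyclic u]

theorem triple_add_right (u v w w' : R8) : triple u v (w + w') = triple u v w + triple u v w' := by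
  rw [triple_cyclic, triple_add_middle, ← triple_cyclic u, ← triple_cyclic u]

theorem triple_smul_right (c : ℝ) (u v w : R8) : triple u v (c • w) = c • triple u v w := by
  rw [triple_cyclic, triple_smul_middle, ← triple_cyclic u]

/-- The cross product of `a` with `u × v × a`, for a repeated argument `a`; this makes `τ`
alternating. -/
theorem om_triple (k : Fin 7) (a u v : R8) :
    om k a (triple u v a) = inner ℝ a a * om k u v - inner ℝ u a * om k a v
      + inner ℝ v a * om k a u := by
  rw [triple, om_add_right, om_sub_right, om_sum_right]
  simp only [om_smul_right, om_J]
  simp [mul_comm]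

/-- The twofold cross product has the length of `u ∧ v`; the seven `ω_k(u, v)` are its coordinates.
-/
theorem sum_om_sq (u v : R8) :
    ∑ k, om k u v ^ 2 = inner ℝ u u * inner ℝ v v - inner ℝ u v ^ 2 := by
  have h := phi_vec u v u v
  have h0 : phi ![u, v, u, v] = 0 := by rw [phi_swap_middle, phi_self_left, neg_zero]
  rw [h0, Finset.sum_congr rfl fun k _ => (sq (om k u v)).symm, real_inner_comm u v] at h
  linarith

theorem inner_sum_smul_J (c : Fin 7 → ℝ) (w : R8) :
    inner ℝ (∑ l, c l • J l w) (∑ l, c l • J l w) = (∑ l, c l ^ 2) * inner ℝ w w := by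
  simp only [sum_inner, inner_sum, real_inner_smul_left, real_inner_smul_right, inner_J_J]
  simp [Finset.sum_mul, sq, mul_assoc]

/-- The threefold cross product of orthogonal vectors is an isometry in the appropriate sense. -/
theorem inner_triple_self {u v w : R8} (huv : inner ℝ u v = 0) (huw : inner ℝ u w = 0)
    (hvw : inner ℝ v w = 0) :
    inner ℝ (triple u v w) (triple u v w) = inner ℝ u u * inner ℝ v v * inner ℝ w w := by
  have h : triple u v w = ∑ l, om l u v • J l w := by simp [triple, huw, hvw]
  rw [h, inner_sum_smul_J, sum_om_sq, huv]; ring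

/-- The components of twice the fourfold cross product `τ` with respect to `ω_k`. -/
def fourfoldFun (k : Fin 7) (a b c d : R8) : ℝ :=
  -om k a (triple b c d) + inner ℝ a b * om k c d + inner ℝ a c * om k d b
    + inner ℝ a d * om k b c

theorem fourfoldFun_self_left (k : Fin 7) (a c d : R8) : fourfoldFun k a a c d = 0 := by
  rw [fourfoldFun, triple_cyclic, om_triple, om_swap k d a, real_inner_comm a c,
    real_inner_comm a d]; ring

theorem fourfoldFun_self_middle (k : Fin 7) (a b d : R8) : fourfoldFun k a b b d = 0 := by
  rw [fourfoldFun, triple_self_left, om_swap k d b]; simp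

theorem fourfoldFun_self_right (k : Fin 7) (a b c : R8) : fourfoldFun k a b c c = 0 := by
  rw [fourfoldFun, triple_self_right, om_swap k c b]; simp

theorem fourfoldFun_add_0 (k : Fin 7) (a a' b c d : R8) :
    fourfoldFun k (a + a') b c d = fourfoldFun k a b c d + fourfoldFun k a' b c d := by
  simp only [fourfoldFun, om_add_left, inner_add_left]; ring

theorem fourfoldFun_add_1 (k : Fin 7) (a b b' c d : R8) :
    fourfoldFun k a (b + b') c d = fourfoldFun k a b c d + fourfoldFun k a b' c d := by
  simp only [fourfoldFun, om_add_left, om_add_right, inner_add_right, triple_add_left]; ring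

theorem fourfoldFun_add_2 (k : Fin 7) (a b c c' d : R8) :
    fourfoldFun k a b (c + c') d = fourfoldFun k a b c d + fourfoldFun k a b c' d := by
  simp only [fourfoldFun, om_add_left, om_add_right, inner_add_right, triple_add_middle]; ring

theorem fourfoldFun_add_3 (k : Fin 7) (a b c d d' : R8) :
    fourfoldFun k a b c (d + d') = fourfoldFun k a b c d + fourfoldFun k a b c d' := by
  simp only [fourfoldFun, om_add_left, om_add_right, inner_add_right, triple_add_right]; ring

/-- Twice the component of the fourfold cross product `τ` along `ω_k`, as an alternating form. -/
def fourfold (k : Fin 7) : R8 [⋀^Fin 4]→ₗ[ℝ] ℝ where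
  toFun v := fourfoldFun k (v 0) (v 1) (v 2) (v 3)
  map_update_add' := by
    intro inst w i x y
    obtain rfl : inst = fun a b => instDecidableEqFin 4 a b := Subsingleton.elim _ _
    fin_cases i <;> simp [Function.update, fourfoldFun_add_0, fourfoldFun_add_1, fourfoldFun_add_2,
      fourfoldFun_add_3]
  map_update_smul' := by
    intro inst w i c x
    obtain rfl : inst = fun a b => instDecidableEqFin 4 a b := Subsingleton.elim _ _
    fin_cases i <;> simp [Function.update, fourfoldFun, real_inner_smul_left,
      real_inner_smul_right, triple_smul_left, triple_smul_middle, triple_smul_right] <;> ring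
  map_eq_zero_of_eq' := by
    -- The alternation in adjacent slots gives the antisymmetry in adjacent slots.
    have s1 : ∀ a b c d, fourfoldFun k a b c d = -fourfoldFun k b a c d := fun a b c d => by
      have h := fourfoldFun_self_left k (a + b) c d
      rw [fourfoldFun_add_0, fourfoldFun_add_1, fourfoldFun_add_1, fourfoldFun_self_left,
        fourfoldFun_self_left] at h
      linarith
    have s2 : ∀ a b c d, fourfoldFun k a b c d = -fourfoldFun k a c b d := fun a b c d => by
      have h := fourfoldFun_self_middle k a (b + c) d
      rw [fourfoldFun_add_1, fourfoldFun_add_2, fourfoldFun_add_2, fourfoldFun_self_middle,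
        fourfoldFun_self_middle] at h
      linarith
    have key : ∀ a b c d, (a = b ∨ a = c ∨ a = d ∨ b = c ∨ b = d ∨ c = d) →
        fourfoldFun k a b c d = 0 := by
      rintro a b c d (rfl | rfl | rfl | rfl | rfl | rfl)
      · exact fourfoldFun_self_left ..
      · rw [s2, fourfoldFun_self_left, neg_zero]
      · rw [s1, s2, fourfoldFun_self_right, neg_zero, neg_zero]
      · exact fourfoldFun_self_middle ..
      · rw [s2, fourfoldFun_self_right, neg_zero]
      · exact fourfoldFun_self_right ..
    clear s1 s2
    intro w i j h hij
    apply key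
    fin_cases i <;> fin_cases j <;> simp_all

theorem fourfold_apply (k : Fin 7) (v : Fin 4 → R8) :
    fourfold k v = fourfoldFun k (v 0) (v 1) (v 2) (v 3) := rfl

/-- The fourfold cross product measures the failure of a `4`-plane to be calibrated. -/
theorem sum_fourfold_sq {v : Fin 4 → R8} (hv : Orthonormal ℝ v) :
    ∑ k, fourfold k v ^ 2 = 1 - phi v ^ 2 := by
  have o : ∀ i j, inner ℝ (v i) (v j) = if i = j then (1 : ℝ) else 0 := orthonormal_iff_ite.1 hv
  have e : phi v = phi ![v 0, v 1, v 2, v 3] := by congr 1; funext i; fin_cases i <;> rfl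
  have h : ∀ k, fourfold k v = -om k (v 0) (triple (v 1) (v 2) (v 3)) := fun k => by
    rw [fourfold_apply, fourfoldFun, o, o, o]; simp
  have h3 : inner ℝ (triple (v 1) (v 2) (v 3)) (triple (v 1) (v 2) (v 3)) = (1 : ℝ) := by
    rw [inner_triple_self (by rw [o]; simp) (by rw [o]; simp) (by rw [o]; simp), o, o, o]; simp
  rw [Finset.sum_congr rfl fun k _ => by rw [h k, neg_sq], sum_om_sq, h3, o, real_inner_comm,
    inner_triple, e]
  simp

/-- A calibrated orthonormal frame is closed under the threefold cross product. -/
theorem triple_of_calibrated {v : Fin 4 → R8} (hv : Orthonormal ℝ v) (h : phi v = 1) :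
    triple (v 1) (v 2) (v 3) = v 0 := by
  have o : ∀ i j, inner ℝ (v i) (v j) = if i = j then (1 : ℝ) else 0 := orthonormal_iff_ite.1 hv
  have e : phi v = phi ![v 0, v 1, v 2, v 3] := by congr 1; funext i; fin_cases i <;> rfl
  have h3 : inner ℝ (triple (v 1) (v 2) (v 3)) (triple (v 1) (v 2) (v 3)) = (1 : ℝ) := by
    rw [inner_triple_self (by rw [o]; simp) (by rw [o]; simp) (by rw [o]; simp), o, o, o]; simp
  rw [← sub_eq_zero, ← inner_self_eq_zero (𝕜 := ℝ), inner_sub_left, inner_sub_right,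
    inner_sub_right, h3, real_inner_comm (triple (v 1) (v 2) (v 3)), inner_triple, ← e, h, o]
  simp

/-! ### `Spin(7)` is contained in `SO(8)` -/

/-- The squared components of the Cayley form in an orthonormal basis. -/
def phiSq (b : OrthonormalBasis (Fin 8) ℝ R8) (m i j k : Fin 8) : ℝ :=
  phi ![b m, b i, b j, b k] ^ 2

theorem phiSq_swap_left (b : OrthonormalBasis (Fin 8) ℝ R8) (m i j k : Fin 8) :
    phiSq b m i j k = phiSq b i m j k := by
  rw [phiSq, phi_swap_left, neg_sq, phiSq]

theorem phiSq_swap_middle (b : OrthonormalBasis (Fin 8) ℝ R8) (m i j k : Fin 8) :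
    phiSq b m i j k = phiSq b m j i k := by
  rw [phiSq, phi_swap_middle, neg_sq, phiSq]

theorem phiSq_swap_right (b : OrthonormalBasis (Fin 8) ℝ R8) (m i j k : Fin 8) :
    phiSq b m i j k = phiSq b m i k j := by
  rw [phiSq, phi_swap_right, neg_sq, phiSq]

/-- The components of the Cayley form in three fixed distinct directions of an orthonormal basis
are the coordinates of the unit vector `b i × b j × b k`. -/
theorem sum_phiSq (b : OrthonormalBasis (Fin 8) ℝ R8) (i j k : Fin 8) :
    ∑ m, phiSq b m i j k = if i ≠ j ∧ i ≠ k ∧ j ≠ k then 1 else 0 := by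
  have o : ∀ i j, inner ℝ (b i) (b j) = if i = j then (1 : ℝ) else 0 :=
    orthonormal_iff_ite.1 b.orthonormal
  split_ifs with h
  · have h1 := inner_triple_self (u := b i) (v := b j) (w := b k) (by rw [o, if_neg h.1])
      (by rw [o, if_neg h.2.1]) (by rw [o, if_neg h.2.2])
    rw [o, o, o, ← b.sum_inner_mul_inner] at h1
    simp only [if_true, mul_one] at h1
    rw [← h1]
    refine Finset.sum_congr rfl fun m _ => ?_
    rw [phiSq, ← inner_triple, sq, real_inner_comm (triple _ _ _) (b m)]
  · refine Finset.sum_eq_zero fun m _ => ?_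
    have : i = j ∨ i = k ∨ j = k := by tauto
    rcases this with rfl | rfl | rfl
    · rw [phiSq, phi_self_middle]; simp
    · rw [phiSq, phi_swap_right, phi_self_middle]; simp
    · rw [phiSq, phi_self_right]; simp

/-- If two orthonormal bases are proportional after a linear map preserving the Cayley form, the
factors of proportionality `√λ_i = exp (l_i / 2)` are all `1`.  With `P` and `Q` the squared
components of the form in the two bases and `x = λ_m λ_i λ_j λ_k`, one has `P = x Q`, and `P` and
`Q` have the same partial sums, so that `∑ Q (x - 1) log x = 0`; all terms are nonnegative. -/
theorem log_scale_eq_zero (b b' : OrthonormalBasis (Fin 8) ℝ R8) (l : Fin 8 → ℝ)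
    (h : ∀ m i j k, phiSq b m i j k = Real.exp (l m + l i + l j + l k) * phiSq b' m i j k)
    (i : Fin 8) : l i = 0 := by
  set P := phiSq b with hP
  set Q := phiSq b' with hQ
  have hd : ∀ i j k, ∑ m, P m i j k = ∑ m, Q m i j k := fun i j k => by
    rw [hP, hQ, sum_phiSq, sum_phiSq]
  -- The partial sums of `P` and `Q` agree, so each summand of `log x` contributes nothing.
  have s0 : ∑ i, ∑ j, ∑ k, ∑ m, (P m i j k - Q m i j k) * l i = 0 :=
    Finset.sum_eq_zero fun i _ => Finset.sum_eq_zero fun j _ => Finset.sum_eq_zero fun k _ => by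
      rw [← Finset.sum_mul, Finset.sum_sub_distrib, hd]; simp
  have s1 : ∑ i, ∑ j, ∑ k, ∑ m, (P m i j k - Q m i j k) * l j = 0 :=
    Finset.sum_eq_zero fun i _ => Finset.sum_eq_zero fun j _ => Finset.sum_eq_zero fun k _ => by
      rw [← Finset.sum_mul, Finset.sum_sub_distrib, hd]; simp
  have s2 : ∑ i, ∑ j, ∑ k, ∑ m, (P m i j k - Q m i j k) * l k = 0 :=
    Finset.sum_eq_zero fun i _ => Finset.sum_eq_zero fun j _ => Finset.sum_eq_zero fun k _ => by
      rw [← Finset.sum_mul, Finset.sum_sub_distrib, hd]; simp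
  have s3 : ∑ i, ∑ j, ∑ k, ∑ m, (P m i j k - Q m i j k) * l m = 0 := by
    refine Finset.sum_eq_zero fun i _ => Finset.sum_eq_zero fun j _ => ?_
    rw [Finset.sum_comm]
    refine Finset.sum_eq_zero fun m _ => ?_
    have e : ∀ k, (P m i j k - Q m i j k) * l m = (P k i j m - Q k i j m) * l m := fun k => by
      have a1 : ∀ b : OrthonormalBasis (Fin 8) ℝ R8, phiSq b m i j k = phiSq b k i j m :=
          fun b => by
        rw [phiSq_swap_right, phiSq_swap_middle, phiSq_swap_left, phiSq_swap_middle,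
          phiSq_swap_right, phiSq_swap_middle]
      rw [hP, hQ, a1, a1]
    rw [Finset.sum_congr rfl fun k _ => e k, ← Finset.sum_mul, Finset.sum_sub_distrib, hd]; simp
  have s : ∑ i, ∑ j, ∑ k, ∑ m, (P m i j k - Q m i j k) * (l m + l i + l j + l k) = 0 := by
    have : ∑ i, ∑ j, ∑ k, ∑ m, (P m i j k - Q m i j k) * (l m + l i + l j + l k) =
        (∑ i, ∑ j, ∑ k, ∑ m, (P m i j k - Q m i j k) * l m)
        + (∑ i, ∑ j, ∑ k, ∑ m, (P m i j k - Q m i j k) * l i)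
        + (∑ i, ∑ j, ∑ k, ∑ m, (P m i j k - Q m i j k) * l j)
        + ∑ i, ∑ j, ∑ k, ∑ m, (P m i j k - Q m i j k) * l k := by
      simp only [← Finset.sum_add_distrib, mul_add]
    rw [this, s0, s1, s2, s3]; simp
  -- `P - Q = (exp t - 1) Q` with `Q ≥ 0`, and `exp t - 1` has the sign of `t`.
  have hnn : ∀ i j k m, 0 ≤ (P m i j k - Q m i j k) * (l m + l i + l j + l k) := by
    intro i j k m
    rw [h]
    have hq : 0 ≤ Q m i j k := sq_nonneg _
    set t := l m + l i + l j + l k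
    have : 0 ≤ (Real.exp t - 1) * t := by
      rcases le_total 0 t with ht | ht
      · exact mul_nonneg (by linarith [Real.add_one_le_exp t]) ht
      · exact mul_nonneg_of_nonpos_of_nonpos (by linarith [Real.exp_le_one_iff.2 ht]) ht
    nlinarith
  have hz : ∀ i j k m, Q m i j k * (l m + l i + l j + l k) = 0 := by
    intro i j k m
    have z1 := (Finset.sum_eq_zero_iff_of_nonneg fun i _ => Finset.sum_nonneg fun j _ =>
      Finset.sum_nonneg fun k _ => Finset.sum_nonneg fun m _ => hnn i j k m).1 s i
        (Finset.mem_univ _)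
    have z2 := (Finset.sum_eq_zero_iff_of_nonneg fun j _ =>
      Finset.sum_nonneg fun k _ => Finset.sum_nonneg fun m _ => hnn i j k m).1 z1 j
        (Finset.mem_univ _)
    have z3 := (Finset.sum_eq_zero_iff_of_nonneg fun k _ => Finset.sum_nonneg fun m _ =>
      hnn i j k m).1 z2 k (Finset.mem_univ _)
    have z4 := (Finset.sum_eq_zero_iff_of_nonneg fun m _ => hnn i j k m).1 z3 m
      (Finset.mem_univ _)
    rw [h] at z4
    set t := l m + l i + l j + l k
    rcases eq_or_ne t 0 with ht | ht
    · rw [ht, mul_zero]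
    · have : Real.exp t - 1 ≠ 0 := by
        rw [sub_ne_zero, Ne, Real.exp_eq_one_iff]; exact ht
      have hq : Q m i j k = 0 := by
        have : Q m i j k * ((Real.exp t - 1) * t) = 0 := by linarith
        exact (mul_eq_zero.1 this).resolve_right (mul_ne_zero ‹_› ht)
      rw [hq, zero_mul]
  -- Summing `Q (l m + l i + l j + l k) = 0` over `m` and `k` gives a linear relation for `l`,
  -- because all partial sums of `Q` are `0` or `1`.
  have hfin : ∀ i j, i ≠ j → 4 * (l i + l j) + 2 * ∑ k, l k = 0 := by
    intro i j hij
    have e1 : ∑ k, ∑ m, Q m i j k * (l m + l i + l j + l k) = 0 :=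
      Finset.sum_eq_zero fun k _ => Finset.sum_eq_zero fun m _ => hz i j k m
    have e2 : ∑ k, ∑ m, Q m i j k * (l m + l i + l j + l k) =
        (∑ k, ∑ m, Q m i j k * l m) + ∑ k, (∑ m, Q m i j k) * (l i + l j + l k) := by
      simp only [Finset.sum_mul, ← Finset.sum_add_distrib]
      exact Finset.sum_congr rfl fun k _ => Finset.sum_congr rfl fun m _ => by ring
    have e3 : ∑ k, ∑ m, Q m i j k * l m = ∑ m, (∑ k, Q k i j m) * l m := by
      rw [Finset.sum_comm]
      refine Finset.sum_congr rfl fun m _ => ?_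
      rw [Finset.sum_mul]
      refine Finset.sum_congr rfl fun k _ => ?_
      rw [hQ, phiSq_swap_right, phiSq_swap_middle, phiSq_swap_left, phiSq_swap_middle,
          phiSq_swap_right, phiSq_swap_middle]
    have e4 : ∀ g : Fin 8 → ℝ, ∑ k, (∑ m, Q m i j k) * g k = (∑ k, g k) - g i - g j := by
      intro g
      have : ∀ k, (∑ m, Q m i j k) * g k
          = g k - (if k = i then g k else 0) - (if k = j then g k else 0) := by
        intro k
        rw [hQ, sum_phiSq]
        by_cases h1 : k = i
        · subst h1; simp [hij]
        · by_cases h2 : k = j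
          · subst h2; simp [h1]
          · simp [h1, h2, hij, Ne.symm h1, Ne.symm h2]
      rw [Finset.sum_congr rfl fun k _ => this k]
      simp [Finset.sum_sub_distrib]
    rw [e2, e3, e4, e4, Finset.sum_add_distrib] at e1
    simp only [Finset.sum_const, Finset.card_univ, Fintype.card_fin, nsmul_eq_mul] at e1
    push_cast at e1
    linarith
  -- The relations for `(i, k)` and `(j, k)` force `l i = l j`; a constant `l` then vanishes.
  have heq : ∀ j, j ≠ i → l j = l i := by
    intro j hj
    obtain ⟨k, hk⟩ : ∃ k : Fin 8, k ∉ ({i, j} : Finset (Fin 8)) := by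
      by_contra! hc
      have : (Finset.univ : Finset (Fin 8)) ⊆ {i, j} := fun x _ => hc x
      have := (Finset.card_le_card this).trans Finset.card_le_two
      simp at this
    simp only [Finset.mem_insert, Finset.mem_singleton, not_or] at hk
    have h1 := hfin i k (Ne.symm hk.1)
    have h2 := hfin j k (Ne.symm hk.2)
    linarith
  obtain ⟨j, hj⟩ := exists_ne i
  have h1 := hfin i j hj.symm
  have h2 : ∑ k, l k = 8 * l i := by
    rw [Finset.sum_congr rfl fun k _ => show l k = l i from
      if hk : k = i then by rw [hk] else heq k hk]
    simp
  rw [h2, heq j hj] at h1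
  linarith

/-- A linear automorphism of `ℝ⁸` that preserves the Cayley form is orthogonal. -/
theorem inner_map_of_phi_map (A : R8 →ₗ[ℝ] R8) (hA : Function.Injective A)
    (h : ∀ v : Fin 4 → R8, phi (fun i => A (v i)) = phi v) (u v : R8) :
    inner ℝ (A u) (A v) = inner ℝ u v := by
  -- Diagonalise `AᵀA`: its eigenbasis `e` is mapped to orthogonal vectors of length `√λ_i`, which
  -- are rescaled to an orthonormal basis `e'`. It remains to see that `λ_i = 1`.
  set S : R8 →ₗ[ℝ] R8 := A.adjoint ∘ₗ A with hS
  have hSym : S.IsSymmetric := fun x y => by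
    simp [hS, LinearMap.adjoint_inner_left, LinearMap.adjoint_inner_right]
  have hn : Module.finrank ℝ R8 = 8 := by simp
  set e := hSym.eigenvectorBasis hn
  set lam := hSym.eigenvalues hn
  have o : ∀ i j, inner ℝ (e i) (e j) = if i = j then (1 : ℝ) else 0 :=
    orthonormal_iff_ite.1 e.orthonormal
  have hin : ∀ i j, inner ℝ (A (e i)) (A (e j)) = if i = j then lam i else 0 := by
    intro i j
    rw [← LinearMap.adjoint_inner_left]
    change inner ℝ (S (e i)) (e j) = _
    rw [hSym.apply_eigenvectorBasis hn i]
    rw [inner_smul_left, o]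
    split_ifs <;> simp [lam]
  have hpos : ∀ i, 0 < lam i := fun i => by
    have := hin i i
    rw [if_pos rfl] at this
    rw [← this]
    refine real_inner_self_pos.2 fun h0 => ?_
    have h1 : e i = 0 := hA (by rw [h0, map_zero])
    have := o i i
    rw [h1] at this; simp at this
  set c : Fin 8 → ℝ := fun i => (Real.sqrt (lam i))⁻¹
  have hc : ∀ i, c i * c i * lam i = 1 := fun i => by
    have := Real.mul_self_sqrt (hpos i).le
    have h2 := (Real.sqrt_pos.2 (hpos i)).ne'
    simp only [c]; field_simp; rw [sq]; exact this.symm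
  have hor : Orthonormal ℝ fun i => c i • A (e i) := by
    rw [orthonormal_iff_ite]
    intro i j
    rw [real_inner_smul_left, real_inner_smul_right, hin]
    split_ifs with hij
    · subst hij; rw [← mul_assoc, hc]
    · simp
  set e' : OrthonormalBasis (Fin 8) ℝ R8 := OrthonormalBasis.mk hor (by
    have := hor.linearIndependent.span_eq_top_of_card_eq_finrank (by simp)
    rw [this]) with he'
  have e'_apply : ∀ i, e' i = c i • A (e i) := fun i => by rw [he', OrthonormalBasis.coe_mk]
  have hAe : ∀ i, A (e i) = Real.sqrt (lam i) • e' i := fun i => by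
    have h2 := (Real.sqrt_pos.2 (hpos i)).ne'
    rw [e'_apply, smul_smul, mul_inv_cancel₀ h2, one_smul]
  have key : ∀ i, Real.log (lam i) = 0 := by
    refine log_scale_eq_zero e e' (fun i => Real.log (lam i)) fun m i j k => ?_
    have h1 := h ![e m, e i, e j, e k]
    have h2 : (fun a => A (![e m, e i, e j, e k] a)) = fun a =>
        ![Real.sqrt (lam m), Real.sqrt (lam i), Real.sqrt (lam j), Real.sqrt (lam k)] a •
          ![e' m, e' i, e' j, e' k] a := by
      funext a; fin_cases a <;> simp [hAe]
    rw [h2] at h1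
    have h3 := phi.map_smul_univ
      ![Real.sqrt (lam m), Real.sqrt (lam i), Real.sqrt (lam j), Real.sqrt (lam k)]
      ![e' m, e' i, e' j, e' k]
    rw [phiSq, ← h1, h3, phiSq, smul_eq_mul, mul_pow]
    congr 1
    rw [Fin.prod_univ_four, Real.exp_add, Real.exp_add, Real.exp_add, Real.exp_log (hpos _),
      Real.exp_log (hpos _), Real.exp_log (hpos _), Real.exp_log (hpos _)]
    simp [mul_pow, Real.sq_sqrt (hpos _).le]
  have hone : ∀ i, lam i = 1 := fun i => by
    rw [← Real.exp_log (hpos i), key, Real.exp_zero]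
  have hid : S = LinearMap.id := by
    refine e.toBasis.ext fun i => ?_
    rw [OrthonormalBasis.coe_toBasis, hSym.apply_eigenvectorBasis hn i]
    change ((lam i : ℝ) : ℝ) • e i = e i
    rw [hone, one_smul]
  rw [← LinearMap.adjoint_inner_left]
  change inner ℝ (S u) v = _
  rw [hid]; rfl

/-! ### Calibrated frames -/

/-- An even permutation that moves a given index to the first place. -/
def evenPerm : Fin 4 → Equiv.Perm (Fin 4) :=
  ![1, Equiv.swap 0 1 * Equiv.swap 2 3, Equiv.swap 0 2 * Equiv.swap 1 3,
    Equiv.swap 0 3 * Equiv.swap 1 2]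

theorem evenPerm_sign (i : Fin 4) : Equiv.Perm.sign (evenPerm i) = 1 := by
  fin_cases i <;> decide

theorem evenPerm_zero (i : Fin 4) : evenPerm i 0 = i := by
  fin_cases i <;> decide

theorem map_update_evenPerm (F : R8 [⋀^Fin 4]→ₗ[ℝ] ℝ) (v : Fin 4 → R8) (i : Fin 4) (w : R8) :
    F (Function.update v i w) = F (Function.update (v ∘ evenPerm i) 0 w) := by
  have h := F.map_perm (Function.update v i w) (evenPerm i)
  rw [evenPerm_sign, one_smul] at h
  rw [← h, Function.update_comp_equiv]
  congr 2
  rw [Equiv.symm_apply_eq, evenPerm_zero]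

/-- `v` is an orthonormal basis of a Cayley plane in `ℝ⁸`. -/
structure IsCalibrated (v : Fin 4 → R8) : Prop where
  orthonormal : Orthonormal ℝ v
  phi_eq : phi v = 1

theorem update_vec4 {α : Type*} (a b c d x : α) :
    Function.update ![a, b, c, d] 0 x = ![x, b, c, d] ∧
    Function.update ![a, b, c, d] 1 x = ![a, x, c, d] ∧
    Function.update ![a, b, c, d] 2 x = ![a, b, x, d] ∧
    Function.update ![a, b, c, d] 3 x = ![a, b, c, x] := by
  refine ⟨?_, ?_, ?_, ?_⟩ <;> funext i <;> fin_cases i <;> rfl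

theorem phi_swap_02 (u v a b : R8) : phi ![u, v, a, b] = -phi ![a, v, u, b] := by
  rw [phi_swap_left, phi_swap_middle, phi_swap_left, neg_neg]

theorem phi_swap_03 (u v a b : R8) : phi ![u, v, a, b] = -phi ![b, v, a, u] := by
  rw [phi_swap_right, phi_swap_02, phi_swap_right, neg_neg]

theorem sum_phi_update (a : R8 → R8) (x y z w : R8) :
    ∑ m, phi (Function.update ![x, y, z, w] m (a (![x, y, z, w] m))) =
      phi ![a x, y, z, w] + phi ![x, a y, z, w] + phi ![x, y, a z, w] + phi ![x, y, z, a w] := by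
  rw [Fin.sum_univ_four, (update_vec4 ..).1, (update_vec4 ..).2.1, (update_vec4 ..).2.2.1,
    (update_vec4 ..).2.2.2]
  simp only [Matrix.cons_val_zero, Matrix.cons_val_one, Matrix.cons_val]

namespace IsCalibrated

theorem inner_eq {v : Fin 4 → R8} (hv : IsCalibrated v) (i j : Fin 4) :
    inner ℝ (v i) (v j) = if i = j then (1 : ℝ) else 0 :=
  orthonormal_iff_ite.1 hv.orthonormal i j

theorem comp_evenPerm {v : Fin 4 → R8} (hv : IsCalibrated v) (i : Fin 4) :
    IsCalibrated (v ∘ evenPerm i) where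
  orthonormal := hv.orthonormal.comp _ (evenPerm i).injective
  phi_eq := by
    have h := phi.map_perm v (evenPerm i)
    rw [evenPerm_sign, one_smul] at h
    rw [h, hv.phi_eq]

theorem triple_eq {v : Fin 4 → R8} (hv : IsCalibrated v) : triple (v 1) (v 2) (v 3) = v 0 :=
  triple_of_calibrated hv.orthonormal hv.phi_eq

/-- The first cousin principle: when one vector of a calibrated frame is replaced by `w`, only the
component of `w` along that vector contributes to `Φ₀`. -/
theorem phi_update {v : Fin 4 → R8} (hv : IsCalibrated v) (i : Fin 4) (w : R8) :
    phi (Function.update v i w) = inner ℝ (v i) w := by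
  rw [map_update_evenPerm]
  set v' := v ∘ evenPerm i with hv'
  have h : Function.update v' 0 w = ![w, v' 1, v' 2, v' 3] := by
    funext j; fin_cases j <;> rfl
  rw [h, ← inner_triple, (hv.comp_evenPerm i).triple_eq, Function.comp_apply, evenPerm_zero]

theorem fourfold_eq_zero {v : Fin 4 → R8} (hv : IsCalibrated v) (k : Fin 7) :
    fourfold k v = 0 := by
  have h := sum_fourfold_sq hv.orthonormal
  rw [hv.phi_eq, one_pow, sub_self] at h
  have := (Finset.sum_eq_zero_iff_of_nonneg fun k _ => sq_nonneg _).1 h k (Finset.mem_univ _)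
  exact pow_eq_zero_iff two_ne_zero |>.1 this

theorem fourfold_update {v : Fin 4 → R8} (hv : IsCalibrated v) (k : Fin 7) (i : Fin 4)
    {w : R8} (hw : ∀ j, inner ℝ w (v j) = 0) :
    fourfold k (Function.update v i w) = om k (v i) w := by
  rw [map_update_evenPerm]
  set v' := v ∘ evenPerm i with hv'
  have hw' : ∀ j, inner ℝ w (v' j) = 0 := fun j => hw _
  rw [fourfold_apply]
  simp only [Function.update_self]
  rw [Function.update_of_ne (by decide), Function.update_of_ne (by decide),
    Function.update_of_ne (by decide), fourfoldFun, (hv.comp_evenPerm i).triple_eq, hw', hw', hw',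
    hv', Function.comp_apply, evenPerm_zero, om_swap]
  ring

theorem fourfold_update_frame {v : Fin 4 → R8} (hv : IsCalibrated v) (k : Fin 7) (i j : Fin 4) :
    fourfold k (Function.update v i (v j)) = 0 := by
  by_cases h : i = j
  · subst h; rw [Function.update_eq_self, hv.fourfold_eq_zero]
  · refine (fourfold k).map_eq_zero_of_eq _ (i := i) (j := j) ?_ h
    rw [Function.update_self, Function.update_of_ne (Ne.symm h)]

/-- Tangential variations do not change the fourfold cross product. -/
theorem fourfold_update_sum {v : Fin 4 → R8} (hv : IsCalibrated v) (k : Fin 7) (i : Fin 4)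
    (c : Fin 4 → ℝ) :
    fourfold k (Function.update v i (∑ j, c j • v j)) = 0 := by
  rw [(fourfold k).map_update_sum]
  refine Finset.sum_eq_zero fun j _ => ?_
  rw [(fourfold k).map_update_smul, hv.fourfold_update_frame, smul_zero]

/-- The cross product of a tangent and a normal vector vanishes on the Cayley plane. -/
theorem sum_om_mul_om {v : Fin 4 → R8} (hv : IsCalibrated v) (i j l : Fin 4)
    {w : R8} (hw : ∀ j, inner ℝ w (v j) = 0) :
    ∑ k, om k (v i) w * om k (v j) (v l) = 0 := by
  have h := phi_vec (v i) w (v j) (v l)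
  have z : phi ![v i, w, v j, v l] = 0 := by
    rw [phi_swap_left, ← neg_eq_zero, neg_neg]
    by_cases h1 : i = j
    · rw [h1, phi_self_middle]
    by_cases h2 : i = l
    · rw [h2, phi_swap_right, phi_self_middle, neg_zero]
    by_cases h3 : j = l
    · rw [h3, phi_self_right]
    -- `w` replaces the fourth member of a permuted frame
    obtain ⟨σ, s1, s2, s3⟩ : ∃ σ : Equiv.Perm (Fin 4), σ 1 = i ∧ σ 2 = j ∧ σ 3 = l := by
      clear hw hv h
      revert i j l; decide
    have e : ![w, v i, v j, v l] = Function.update v (σ 0) w ∘ σ := by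
      rw [Function.update_comp_equiv]
      funext a
      fin_cases a <;> simp [Function.update, s1, s2, s3]
    rw [e, phi.map_perm, hv.phi_update, real_inner_comm, hw, smul_zero]
  rw [z, hw, hw] at h
  linarith

/-- The map `w ↦ v₀ × w` is injective on the orthogonal complement of `v₀`. -/
theorem eq_zero_of_om_eq_zero {v : Fin 4 → R8} (hv : IsCalibrated v) {w : R8}
    (hw : inner ℝ (v 0) w = 0) (h : ∀ k, om k (v 0) w = 0) : w = 0 := by
  have h1 := sum_om_sq (v 0) w
  rw [hw, hv.inner_eq] at h1
  simp only [h, if_true] at h1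
  rw [← inner_self_eq_zero (𝕜 := ℝ)]
  simpa using h1.symm

/-- A tangent frame and a normal frame of a Cayley plane span `ℝ⁸`. -/
theorem sum_inner_smul {v : Fin 4 → R8} (hv : IsCalibrated v)
    {n : Fin 4 → R8} (hn : Orthonormal ℝ n) (hvn : ∀ i j, inner ℝ (n i) (v j) = 0) (w : R8) :
    ∑ i, inner ℝ (v i) w • v i + ∑ j, inner ℝ (n j) w • n j = w := by
  have ho : Orthonormal ℝ (Sum.elim v n) := by
    rw [orthonormal_iff_ite]
    have on := orthonormal_iff_ite.1 hn
    rintro (i | i) (j | j)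
    · simp [hv.inner_eq, Sum.inl.injEq]
    · simp [real_inner_comm (n j), hvn]
    · simp [hvn]
    · simp [on, Sum.inr.injEq]
  set b : OrthonormalBasis (Fin 4 ⊕ Fin 4) ℝ R8 := OrthonormalBasis.mk ho (by
    have := ho.linearIndependent.span_eq_top_of_card_eq_finrank (by simp)
    rw [this]) with hb
  have h := b.sum_repr' w
  rw [Fintype.sum_sum_type] at h
  simpa [hb] using h

/-- The algebraic identity behind the linearisation: the variation of the fourfold cross product of
a Cayley frame under a skew endomorphism `a` is expressed by the variation of the Cayley form. -/
theorem sum_fourfold_update_skew {v : Fin 4 → R8} (hv : IsCalibrated v) (k : Fin 7)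
    {n : Fin 4 → R8} (hn : Orthonormal ℝ n) (hvn : ∀ i j, inner ℝ (n i) (v j) = 0) (a : R8 →ₗ[ℝ] R8)
    (ha : ∀ u w, inner ℝ (a u) w = -inner ℝ u (a w)) :
    ∑ i, fourfold k (Function.update v i (a (v i))) =
      ∑ j, (∑ m, phi (Function.update ![n j, v 1, v 2, v 3] m (a (![n j, v 1, v 2, v 3] m))))
        * om k (n j) (v 0) := by
  have hT := hv.triple_eq
  -- `C` is the variation of `v₁ × v₂ × v₃ = v₀`.
  set C : R8 := triple (a (v 1)) (v 2) (v 3) + triple (v 1) (a (v 2)) (v 3)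
    + triple (v 1) (v 2) (a (v 3)) with hC
  have hC_inner : ∀ x, inner ℝ C x = phi ![x, a (v 1), v 2, v 3] + phi ![x, v 1, a (v 2), v 3]
      + phi ![x, v 1, v 2, a (v 3)] := fun x => by
    rw [hC, inner_add_left, inner_add_left, inner_triple, inner_triple, inner_triple]
  have hv0 : ∀ x, phi ![x, v 1, v 2, v 3] = inner ℝ (v 0) x := fun x => by
    rw [← inner_triple, hT]
  -- The terms of `τ` that contain inner products combine by the skewness of `a`; what is left is
  -- the cross product of `v₀` with the defect `a v₀ - C`.
  have lhs : ∑ i, fourfold k (Function.update v i (a (v i))) = om k (v 0) (a (v 0) - C) := by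
    rw [Fin.sum_univ_four]
    simp only [fourfold_apply, fourfoldFun, Function.update, Fin.isValue]
    simp [hv.inner_eq, hT, hC]
    rw [om_swap k (a (v 0)) (v 0), om_swap k (v 3) (v 1)]
    have e1 := ha (v 0) (v 1)
    have e2 := ha (v 0) (v 2)
    have e3 := ha (v 0) (v 3)
    rw [e1, e2, e3]
    ring
  -- Up to a multiple of `v₀` the defect is normal, so only its normal components contribute.
  have tang : ∀ i, i ≠ 0 → inner ℝ (v i) (a (v 0) - C) = 0 := by
    have e : ∀ i, inner ℝ (v i) (a (v 0)) = -inner ℝ (v 0) (a (v i)) := fun i => by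
      rw [← ha, real_inner_comm]
    have z2 : ∀ x y w, phi ![x, y, x, w] = 0 := fun x y w => by
      rw [phi_swap_middle, phi_self_left, neg_zero]
    have z3 : ∀ x y w, phi ![x, y, w, x] = 0 := fun x y w => by rw [phi_swap_right, z2, neg_zero]
    intro i hi
    rw [inner_sub_right, e, real_inner_comm C, hC_inner]
    obtain rfl | rfl | rfl : i = 1 ∨ i = 2 ∨ i = 3 := by revert i; decide
    · rw [phi_self_left, phi_self_left, phi_swap_left, hv0]; ring
    · rw [z2, z2, phi_swap_02, hv0]; ring
    · rw [z3, z3, phi_swap_03, hv0]; ring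
  have dec := hv.sum_inner_smul hn hvn (a (v 0) - C)
  rw [lhs]
  conv_lhs => rw [← dec]
  rw [om_add_right, om_sum_right, om_sum_right]
  simp only [om_smul_right]
  have z : ∑ i, inner ℝ (v i) (a (v 0) - C) * om k (v 0) (v i) = 0 :=
    Finset.sum_eq_zero fun i _ => by
      by_cases hi : i = 0
      · rw [hi, om_self, mul_zero]
      · rw [tang i hi, zero_mul]
  rw [z, zero_add]
  refine Finset.sum_congr rfl fun j _ => ?_
  have e : ∑ m, phi (Function.update ![n j, v 1, v 2, v 3] m (a (![n j, v 1, v 2, v 3] m)))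
      = phi ![a (n j), v 1, v 2, v 3] + inner ℝ C (n j) := by
    rw [sum_phi_update, hC_inner]
    ring
  rw [e, hv0, om_swap k (n j) (v 0), inner_sub_right, real_inner_comm C,
    real_inner_comm (a (v 0)) (n j), ha (v 0)]
  ring

end IsCalibrated

/-! ### Coframes -/

theorem alternatingMap_sum_apply {V ι κ : Type*} [AddCommGroup V] [Module ℝ V]
    (s : Finset κ) (F : κ → V [⋀^ι]→ₗ[ℝ] ℝ) (v : ι → V) : (∑ k ∈ s, F k) v = ∑ k ∈ s, F k v := by
  classical
  induction s using Finset.induction_on with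
  | empty => simp
  | insert a s ha ih =>
    rw [Finset.sum_insert ha, Finset.sum_insert ha, AlternatingMap.add_apply, ih]

section Coframe

variable {M : Type*} [TopologicalSpace M] [ChartedSpace R8 M]

/-- A linear isomorphism `T_q M ≅ ℝ⁸` that pulls the model form back to `Φ`. -/
structure IsCoframe (Φ : Π q : M, Form4 q) (q : M) (L : TangentSpace (𝓡 8) q →ₗ[ℝ] R8) : Prop where
  bijective : Function.Bijective L
  form_eq : ∀ v, Φ q v = phi fun i => L (v i)

/-- The `2`-form with components `c` with respect to the pullbacks of the `ω_k`. -/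
def pullForm (q : M) (L : TangentSpace (𝓡 8) q →ₗ[ℝ] R8) (c : Fin 7 → ℝ) : Form2 q :=
  ∑ k, c k • (omForm k).compLinearMap L

theorem pullForm_apply (q : M) (L : TangentSpace (𝓡 8) q →ₗ[ℝ] R8) (c : Fin 7 → ℝ)
    (a b : TangentSpace (𝓡 8) q) : pullForm q L c ![a, b] = ∑ k, c k * om k (L a) (L b) := by
  simp only [pullForm]
  rw [alternatingMap_sum_apply]
  refine Finset.sum_congr rfl fun k _ => ?_
  rw [AlternatingMap.smul_apply, AlternatingMap.compLinearMap_apply, smul_eq_mul]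
  rfl

theorem form2_ext {q : M} {α β : Form2 q} (h : ∀ a b, α ![a, b] = β ![a, b]) : α = β := by
  ext v
  have : v = ![v 0, v 1] := by funext i; fin_cases i <;> rfl
  rw [this, h]

namespace IsCoframe

variable {Φ : Π q : M, Form4 q} {q : M} {L : TangentSpace (𝓡 8) q →ₗ[ℝ] R8}

/-- The linear isomorphism underlying a coframe. -/
def equiv (hL : IsCoframe Φ q L) : TangentSpace (𝓡 8) q ≃ₗ[ℝ] R8 :=
  LinearEquiv.ofBijective L hL.bijective

@[simp] theorem map_equiv_symm (hL : IsCoframe Φ q L) (u : R8) : L (hL.equiv.symm u) = u :=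
  hL.equiv.apply_symm_apply u

theorem spin7Frame_spec (hL : IsCoframe Φ q L) : IsSpin7Frame Φ q (spin7Frame Φ q) := by
  have h : ∃ b : Basis (Fin 8) ℝ (TangentSpace (𝓡 8) q), IsSpin7Frame Φ q b := by
    refine ⟨Basis.ofEquivFun (hL.equiv.trans (WithLp.linearEquiv 2 ℝ (Fin 8 → ℝ))), fun v => ?_⟩
    rw [hL.form_eq, phi_eq_phi0]
    rfl
  have h1 : spin7Frame Φ q = h.choose := dif_pos h
  rw [h1]
  exact h.choose_spec

/-- The metric, defined through a chosen frame, is the pullback of the model metric by every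
coframe: two coframes differ by an element of `Spin(7) ⊆ SO(8)`. -/
theorem metric_eq (hL : IsCoframe Φ q L) (u v : TangentSpace (𝓡 8) q) :
    metric Φ q u v = inner ℝ (L u) (L v) := by
  set b := spin7Frame Φ q with hb
  let e : TangentSpace (𝓡 8) q ≃ₗ[ℝ] R8 :=
    b.equivFun.trans (WithLp.linearEquiv 2 ℝ (Fin 8 → ℝ)).symm
  have he : ∀ w, Φ q w = phi fun i => e (w i) := fun w => hL.spin7Frame_spec w
  -- The two coframes `L` and `e` differ by an automorphism that preserves `Φ₀`.
  have h := inner_map_of_phi_map (L ∘ₗ e.symm.toLinearMap)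
    (hL.bijective.injective.comp e.symm.injective) (fun w => by
      have h1 := he fun i => e.symm (w i)
      rw [hL.form_eq] at h1
      simpa using h1) (e u) (e v)
  simp only [LinearMap.comp_apply, LinearEquiv.coe_coe, LinearEquiv.symm_apply_apply] at h
  rw [h, inner_eq_sum]
  rfl

theorem spin7Frame_orthonormal (hL : IsCoframe Φ q L) :
    Orthonormal ℝ fun i => L (spin7Frame Φ q i) := by
  rw [orthonormal_iff_ite]
  intro i j
  rw [← hL.metric_eq, metric]
  simp [Finsupp.single_apply]

/-- The image of the chosen frame in `ℝ⁸`. -/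
def onb (hL : IsCoframe Φ q L) : OrthonormalBasis (Fin 8) ℝ R8 :=
  OrthonormalBasis.mk hL.spin7Frame_orthonormal (by
    have := hL.spin7Frame_orthonormal.linearIndependent.span_eq_top_of_card_eq_finrank (by simp)
    rw [this])

@[simp] theorem onb_apply (hL : IsCoframe Φ q L) (i : Fin 8) :
    hL.onb i = L (spin7Frame Φ q i) := by simp [onb]

theorem cross2_eq (hL : IsCoframe Φ q L) (u v : TangentSpace (𝓡 8) q) :
    cross2 Φ q u v = pullForm q L fun k => (1 / 2) * om k (L u) (L v) := by
  refine form2_ext fun a b => ?_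
  have h1 : ((Φ q).curryLeft u).curryLeft v ![a, b] = phi ![L u, L v, L a, L b] := by
    change Φ q ![u, v, a, b] = _
    rw [hL.form_eq]
    congr 1
    funext i; fin_cases i <;> rfl
  have h2 : flatWedge Φ q u v ![a, b] =
      inner ℝ (L u) (L a) * inner ℝ (L v) (L b) - inner ℝ (L u) (L b) * inner ℝ (L v) (L a) := by
    simp only [← hL.metric_eq]; rfl
  rw [pullForm_apply, cross2, AlternatingMap.smul_apply, AlternatingMap.sub_apply, h1, h2, phi_vec,
    smul_eq_mul, sub_sub_cancel, Finset.mul_sum]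
  exact Finset.sum_congr rfl fun k _ => by ring

theorem cross2_apply (hL : IsCoframe Φ q L) (u v a b : TangentSpace (𝓡 8) q) :
    cross2 Φ q u v ![a, b] = 1 / 2 * ∑ k, om k (L u) (L v) * om k (L a) (L b) := by
  rw [hL.cross2_eq, pullForm_apply, Finset.mul_sum]
  exact Finset.sum_congr rfl fun k _ => by ring

theorem map_cross3 (hL : IsCoframe Φ q L) (u v w : TangentSpace (𝓡 8) q) :
    L (cross3 Φ q u v w) = triple (L u) (L v) (L w) := by
  rw [cross3, map_sum, ← hL.onb.sum_repr' (triple (L u) (L v) (L w))]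
  refine Finset.sum_congr rfl fun i _ => ?_
  rw [map_smul, onb_apply, real_inner_comm, inner_triple, hL.form_eq]
  congr 1
  rw [phi_swap_left, phi_swap_middle, phi_swap_right, phi_swap_left, phi_swap_middle,
    phi_swap_left, neg_neg, neg_neg, neg_neg]
  congr 1
  funext i; fin_cases i <;> rfl

theorem tau_eq (hL : IsCoframe Φ q L) (v : Fin 4 → TangentSpace (𝓡 8) q) :
    tau Φ q v = pullForm q L fun k => (1 / 2) * fourfold k fun i => L (v i) := by
  refine form2_ext fun a b => ?_
  have e : tau Φ q v ![a, b] = -cross2 Φ q (v 0) (cross3 Φ q (v 1) (v 2) (v 3)) ![a, b]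
      + metric Φ q (v 0) (v 1) * cross2 Φ q (v 2) (v 3) ![a, b]
      + metric Φ q (v 0) (v 2) * cross2 Φ q (v 3) (v 1) ![a, b]
      + metric Φ q (v 0) (v 3) * cross2 Φ q (v 1) (v 2) ![a, b] := rfl
  rw [e, pullForm_apply]
  simp only [hL.cross2_apply, hL.metric_eq, hL.map_cross3, fourfold_apply, fourfoldFun,
    Finset.mul_sum, ← Finset.sum_neg_distrib, ← Finset.sum_add_distrib]
  exact Finset.sum_congr rfl fun k _ => by ring

/-- In an orthonormal basis the `ω_k` are orthogonal with squared length `8`, counted over all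
ordered pairs. -/
theorem om_sum (k l : Fin 7) (b : OrthonormalBasis (Fin 8) ℝ R8) :
    ∑ c, ∑ d, om k (b c) (b d) * om l (b c) (b d) = if k = l then 8 else 0 := by
  have h : ∀ c, ∑ d, om k (b c) (b d) * om l (b c) (b d) = if k = l then 1 else 0 := fun c => by
    have := b.sum_inner_mul_inner (J k (b c)) (J l (b c))
    rw [inner_J_J] at this
    have h1 : inner ℝ (b c) (b c) = (1 : ℝ) := by
      rw [real_inner_self_eq_norm_sq, b.orthonormal.1, one_pow]
    rw [h1] at this
    rw [← this]
    exact Finset.sum_congr rfl fun d _ => by rw [om, om, real_inner_comm (J l (b c))]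
  rw [Finset.sum_congr rfl fun c _ => h c]
  split_ifs <;> simp

theorem pullForm_mem (hL : IsCoframe Φ q L) (c : Fin 7 → ℝ) :
    pullForm q L c ∈ Lambda27 Φ q := by
  -- `ω_k` is a multiple of the cross product of `e₀` and `J_k e₀`.
  set e : R8 := EuclideanSpace.single 0 1
  have he : inner ℝ e e = (1 : ℝ) := by simp [e]
  have h : pullForm q L c = ∑ k, (2 * c k) •
      cross2 Φ q (hL.equiv.symm e) (hL.equiv.symm (J k e)) := by
    refine form2_ext fun a b => ?_
    rw [pullForm_apply, alternatingMap_sum_apply]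
    refine Finset.sum_congr rfl fun k _ => ?_
    rw [AlternatingMap.smul_apply, hL.cross2_apply]
    simp only [map_equiv_symm, om_J, he, smul_eq_mul, ite_mul, one_mul, zero_mul,
      Finset.sum_ite_eq', Finset.mem_univ, if_true]
    ring
  rw [h]
  exact Submodule.sum_mem _ fun k _ => Submodule.smul_mem _ _
    (Submodule.subset_span ⟨_, _, rfl⟩)

theorem mem_Lambda27_iff (hL : IsCoframe Φ q L) {α : Form2 q} :
    α ∈ Lambda27 Φ q ↔ ∃ c, α = pullForm q L c := by
  constructor
  · intro h
    induction h using Submodule.span_induction with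
    | mem x hx => obtain ⟨u, v, rfl⟩ := hx; exact ⟨_, hL.cross2_eq u v⟩
    | zero => exact ⟨0, by simp [pullForm]⟩
    | add x y _ _ hx hy =>
      obtain ⟨c, rfl⟩ := hx
      obtain ⟨d, rfl⟩ := hy
      exact ⟨c + d, by simp [pullForm, add_smul, Finset.sum_add_distrib]⟩
    | smul r x _ hx =>
      obtain ⟨c, rfl⟩ := hx
      exact ⟨r • c, by simp [pullForm, Finset.smul_sum, smul_smul]⟩
  · rintro ⟨c, rfl⟩; exact hL.pullForm_mem c

/-- The components of an element of `Λ²₇` are recovered by contraction with `ω_k`. -/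
theorem coeff_pullForm (hL : IsCoframe Φ q L) (c : Fin 7 → ℝ) (k : Fin 7)
    (b : OrthonormalBasis (Fin 8) ℝ R8) :
    ∑ i, ∑ j, pullForm q L c ![hL.equiv.symm (b i), hL.equiv.symm (b j)] * om k (b i) (b j)
      = 8 * c k := by
  simp only [pullForm_apply, map_equiv_symm, Finset.sum_mul]
  have : ∀ i, ∑ j, ∑ l, c l * om l (b i) (b j) * om k (b i) (b j)
      = ∑ l, c l * ∑ j, om l (b i) (b j) * om k (b i) (b j) := fun i => by
    rw [Finset.sum_comm]
    simp only [Finset.mul_sum, mul_assoc]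
  simp only [this]
  rw [Finset.sum_comm]
  simp only [← Finset.mul_sum, om_sum]
  simp [mul_comm]

theorem pullForm_injective (hL : IsCoframe Φ q L) : Function.Injective (pullForm q L) := by
  intro c d h
  funext k
  have h1 := hL.coeff_pullForm c k (EuclideanSpace.basisFun (Fin 8) ℝ)
  rw [h, hL.coeff_pullForm] at h1
  linarith

end IsCoframe

/-- The trace of a bilinear map does not depend on the orthonormal basis. -/
theorem sum_orthonormalBasis_eq {W : Type*} [AddCommGroup W] [Module ℝ W]
    (S : R8 →ₗ[ℝ] R8 →ₗ[ℝ] W) (b b' : OrthonormalBasis (Fin 8) ℝ R8) :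
    ∑ i, S (b i) (b i) = ∑ i, S (b' i) (b' i) := by
  have h : ∀ i, S (b i) (b i) = ∑ j, ∑ k, (inner ℝ (b' j) (b i) * inner ℝ (b i) (b' k)) •
      S (b' j) (b' k) := fun i => by
    conv_lhs => rw [← b'.sum_repr' (b i)]
    simp only [map_sum, map_smul, LinearMap.sum_apply, LinearMap.smul_apply, Finset.smul_sum,
      smul_smul]
    rw [Finset.sum_comm]
    refine Finset.sum_congr rfl fun j _ => Finset.sum_congr rfl fun k _ => ?_
    rw [real_inner_comm (b' k), mul_comm]
  rw [Finset.sum_congr rfl fun i _ => h i, Finset.sum_comm]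
  refine Finset.sum_congr rfl fun j _ => ?_
  rw [Finset.sum_comm]
  simp only [← Finset.sum_smul, b.sum_inner_mul_inner]
  simp [orthonormal_iff_ite.1 b'.orthonormal]

end Coframe

/-! ### The Levi-Civita connection of a coframe on an open subset of `ℝ⁸` -/

/-- The derivative of the metric `⟪θ b, θ c⟫` in the direction `a`. -/
def dMetric (θ : R8 → R8 →L[ℝ] R8) (y a b c : R8) : ℝ :=
  inner ℝ (fderiv ℝ θ y a b) (θ y c) + inner ℝ (θ y b) (fderiv ℝ θ y a c)

/-- The Christoffel symbols with lowered last index. -/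
def koszul (θ : R8 → R8 →L[ℝ] R8) (y u v w : R8) : ℝ :=
  1 / 2 * (dMetric θ y u v w + dMetric θ y v u w - dMetric θ y w u v)

/-- The Christoffel symbols of the metric `⟪θ ·, θ ·⟫`. -/
def gam (θ : R8 → R8 →L[ℝ] R8) (y u v : R8) : R8 :=
  ∑ k, koszul θ y u v ((θ y).inverse (EuclideanSpace.single k 1)) •
    (θ y).inverse (EuclideanSpace.single k 1)

/-- The covariant derivative of the coframe, `(∇_w θ) u`. -/
def kap (θ : R8 → R8 →L[ℝ] R8) (y w u : R8) : R8 := fderiv ℝ θ y w u - θ y (gam θ y w u)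

/-- The connection matrix of the frame dual to `θ`. -/
def conn (θ : R8 → R8 →L[ℝ] R8) (y w u : R8) : R8 := kap θ y w ((θ y).inverse u)

variable {θ : R8 → R8 →L[ℝ] R8} {y : R8}

theorem dMetric_symm (a b c : R8) : dMetric θ y a b c = dMetric θ y a c b := by
  rw [dMetric, dMetric, real_inner_comm, real_inner_comm (θ y b), add_comm]

theorem koszul_symm (u v w : R8) : koszul θ y u v w = koszul θ y v u w := by
  rw [koszul, koszul, dMetric_symm w]; ring

theorem koszul_add_right (u v w w' : R8) :
    koszul θ y u v (w + w') = koszul θ y u v w + koszul θ y u v w' := by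
  simp only [koszul, dMetric, map_add, inner_add_right, inner_add_left,
    add_apply]; ring

theorem koszul_smul_right (c : ℝ) (u v w : R8) :
    koszul θ y u v (c • w) = c * koszul θ y u v w := by
  simp only [koszul, dMetric, map_smul, real_inner_smul_left, real_inner_smul_right,
    smul_apply]; ring

theorem koszul_add_left (u u' v w : R8) :
    koszul θ y (u + u') v w = koszul θ y u v w + koszul θ y u' v w := by
  simp only [koszul, dMetric, map_add, inner_add_right, inner_add_left,
    add_apply]; ring

theorem koszul_smul_left (c : ℝ) (u v w : R8) :
    koszul θ y (c • u) v w = c * koszul θ y u v w := by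
  simp only [koszul, dMetric, map_smul, real_inner_smul_left, real_inner_smul_right,
    smul_apply]; ring

theorem gam_symm (u v : R8) : gam θ y u v = gam θ y v u := by
  simp only [gam, koszul_symm u v]

theorem gam_add_left (u u' v : R8) : gam θ y (u + u') v = gam θ y u v + gam θ y u' v := by
  simp only [gam, koszul_add_left, add_smul, Finset.sum_add_distrib]

theorem gam_smul_left (c : ℝ) (u v : R8) : gam θ y (c • u) v = c • gam θ y u v := by
  simp only [gam, koszul_smul_left, mul_smul, Finset.smul_sum]

theorem gam_add_right (u v v' : R8) : gam θ y u (v + v') = gam θ y u v + gam θ y u v' := by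
  rw [gam_symm, gam_add_left, gam_symm v, gam_symm v']

theorem gam_smul_right (c : ℝ) (u v : R8) : gam θ y u (c • v) = c • gam θ y u v := by
  rw [gam_symm, gam_smul_left, gam_symm v]

theorem inverse_apply_self (h : (θ y).IsInvertible) (u : R8) : (θ y).inverse (θ y u) = u := by
  rw [← ContinuousLinearMap.comp_apply, h.inverse_comp_self]; rfl

theorem apply_inverse (h : (θ y).IsInvertible) (u : R8) : θ y ((θ y).inverse u) = u := by
  rw [← ContinuousLinearMap.comp_apply, h.self_comp_inverse]; rfl

/-- The defining property of the Christoffel symbols: lowering an index gives the Koszul formula.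
-/
theorem inner_gam (h : (θ y).IsInvertible) (u v w : R8) :
    inner ℝ (θ y (gam θ y u v)) (θ y w) = koszul θ y u v w := by
  have hw : w = ∑ k, (θ y w k) • (θ y).inverse (EuclideanSpace.single k 1) := by
    conv_lhs => rw [← inverse_apply_self h w,
      ← (EuclideanSpace.basisFun (Fin 8) ℝ).sum_repr (θ y w)]
    simp [map_sum]
  have hl : ∀ g : Fin 8 → R8, ∀ c : Fin 8 → ℝ, koszul θ y u v (∑ k, c k • g k) =
      ∑ k, c k * koszul θ y u v (g k) := by
    intro g c
    let K : R8 →ₗ[ℝ] ℝ := { toFun := koszul θ y u v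
                            map_add' := koszul_add_right u v
                            map_smul' := fun c w => koszul_smul_right c u v w }
    change K _ = ∑ k, c k * K (g k)
    simp
  conv_rhs => rw [hw]
  rw [hl, gam, map_sum, sum_inner]
  refine Finset.sum_congr rfl fun k _ => ?_
  rw [map_smul, apply_inverse h, real_inner_smul_left, EuclideanSpace.inner_single_left]
  simp [mul_comm]

/-- The Levi-Civita connection is metric. -/
theorem kap_skew (h : (θ y).IsInvertible) (w u v : R8) :
    inner ℝ (kap θ y w u) (θ y v) + inner ℝ (θ y u) (kap θ y w v) = 0 := by
  rw [kap, kap, inner_sub_left, inner_sub_right, inner_gam h, real_inner_comm (θ y (gam θ y w v)),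
    inner_gam h]
  simp only [koszul]
  have h1 : dMetric θ y w u v = inner ℝ (fderiv ℝ θ y w u) (θ y v)
    + inner ℝ (θ y u) (fderiv ℝ θ y w v) := rfl
  linarith [dMetric_symm (θ := θ) (y := y) w v u]

/-- The Levi-Civita connection is the only torsion-free metric connection. -/
theorem gam_unique (h : (θ y).IsInvertible) (Γ : R8 → R8 → R8) (hs : ∀ u v, Γ u v = Γ v u)
    (hm : ∀ w u v, inner ℝ (fderiv ℝ θ y w u - θ y (Γ w u)) (θ y v)
      + inner ℝ (θ y u) (fderiv ℝ θ y w v - θ y (Γ w v)) = 0) (u v : R8) :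
    Γ u v = gam θ y u v := by
  -- The difference of two such connections is symmetric in the first two arguments and skew in the
  -- last two, hence zero.
  set B : R8 → R8 → R8 → ℝ := fun w v u => inner ℝ (θ y (Γ w v - gam θ y w v)) (θ y u) with hB
  have b1 : ∀ w v u, B w v u = B v w u := fun w v u => by
    simp only [hB]; rw [hs, gam_symm]
  have b2 : ∀ w v u, B w v u = -B w u v := fun w v u => by
    have e1 := hm w v u
    have e2 := kap_skew h w v u
    simp only [hB, kap, map_sub, inner_sub_left, inner_sub_right] at e1 e2 ⊢
    rw [real_inner_comm (θ y (Γ w u)), real_inner_comm (θ y (gam θ y w u))] at *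
    linarith
  have b3 : ∀ w v u, B w v u = 0 := fun w v u => by
    have e : B w v u = -B w v u := by
      conv_lhs => rw [b1, b2, b1, b2, b1, b2]
      ring
    linarith
  have hz : θ y (Γ u v - gam θ y u v) = 0 := by
    rw [← inner_self_eq_zero (𝕜 := ℝ)]
    exact b3 u v _
  have := inverse_apply_self h (Γ u v - gam θ y u v)
  rw [hz, map_zero] at this
  exact (sub_eq_zero.1 this.symm)

theorem conn_skew (h : (θ y).IsInvertible) (w u v : R8) :
    inner ℝ (conn θ y w u) v = -inner ℝ u (conn θ y w v) := by
  have := kap_skew h w ((θ y).inverse u) ((θ y).inverse v)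
  rw [apply_inverse h, apply_inverse h] at this
  rw [conn, conn]; linarith

theorem conn_apply (h : (θ y).IsInvertible) (w u : R8) : conn θ y w (θ y u) = kap θ y w u := by
  rw [conn, inverse_apply_self h]

/-- The connection matrix as a linear map. -/
def connLin (θ : R8 → R8 →L[ℝ] R8) (y w : R8) : R8 →ₗ[ℝ] R8 where
  toFun := conn θ y w
  map_add' u v := by
    simp only [conn, kap, map_add, gam_add_right]; abel
  map_smul' c u := by
    simp only [conn, kap, map_smul, gam_smul_right, smul_sub, RingHom.id_apply]

@[simp] theorem connLin_apply (w u : R8) : connLin θ y w u = conn θ y w u := rfl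

theorem conn_smul_left (c : ℝ) (w u : R8) : conn θ y (c • w) u = c • conn θ y w u := by
  simp only [conn, kap, map_smul, gam_smul_left, smul_sub, smul_apply]

/-- The coframe in other coordinates: `χ` is the coordinate change. -/
def changeCoframe (θ : R8 → R8 →L[ℝ] R8) (χ : R8 → R8) (y : R8) : R8 →L[ℝ] R8 :=
  (θ (χ y)).comp (fderiv ℝ χ y)

theorem fderiv_changeCoframe {χ : R8 → R8} (hθ : DifferentiableAt ℝ θ (χ y))
    (hχ : ContDiffAt ℝ 2 χ y) (w u : R8) :
    fderiv ℝ (changeCoframe θ χ) y w u =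
      fderiv ℝ θ (χ y) (fderiv ℝ χ y w) (fderiv ℝ χ y u)
        + θ (χ y) (fderiv ℝ (fderiv ℝ χ) y w u) := by
  have h1 : HasFDerivAt (fun y => θ (χ y)) ((fderiv ℝ θ (χ y)).comp (fderiv ℝ χ y)) y :=
    hθ.hasFDerivAt.comp y (hχ.differentiableAt (by norm_num)).hasFDerivAt
  have h2 : HasFDerivAt (fderiv ℝ χ) (fderiv ℝ (fderiv ℝ χ) y) y :=
    ((hχ.fderiv_right (m := 1) (by norm_num)).differentiableAt (by norm_num)).hasFDerivAt
  have h3 := h1.clm_comp h2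
  have h4 : fderiv ℝ (changeCoframe θ χ) y = _ := h3.fderiv
  rw [h4]
  simp [add_comm]

/-- The transformation law of the Christoffel symbols. -/
theorem fderiv_gam_changeCoframe {χ : R8 → R8} (hθ : DifferentiableAt ℝ θ (χ y))
    (hχ : ContDiffAt ℝ 2 χ y) (h : (θ (χ y)).IsInvertible) (h' : (fderiv ℝ χ y).IsInvertible)
    (u v : R8) :
    fderiv ℝ χ y (gam (changeCoframe θ χ) y u v) =
      gam θ (χ y) (fderiv ℝ χ y u) (fderiv ℝ χ y v) + fderiv ℝ (fderiv ℝ χ) y u v := by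
  set D := fderiv ℝ χ y with hD
  have hinv : ∀ x, D (D.inverse x) = x := fun x => by
    rw [← ContinuousLinearMap.comp_apply, h'.self_comp_inverse]; rfl
  have hi : ((changeCoframe θ χ) y).IsInvertible := h.comp h'
  have hsym : ∀ u v, fderiv ℝ (fderiv ℝ χ) y u v = fderiv ℝ (fderiv ℝ χ) y v u := by
    intro u v
    exact (hχ.isSymmSndFDerivAt (by simp)) u v
  -- The right-hand side, carried back by `D`, is a torsion-free metric connection for the new
  -- coframe.
  have := gam_unique hi
    (fun u v => D.inverse (gam θ (χ y) (D u) (D v) + fderiv ℝ (fderiv ℝ χ) y u v))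
    (fun u v => by rw [gam_symm, hsym]) (fun w u v => by
      have e : ∀ w u, fderiv ℝ (changeCoframe θ χ) y w u - changeCoframe θ χ y
          (D.inverse (gam θ (χ y) (D w) (D u) + fderiv ℝ (fderiv ℝ χ) y w u))
          = kap θ (χ y) (D w) (D u) := fun w u => by
        rw [fderiv_changeCoframe hθ hχ, changeCoframe, ContinuousLinearMap.comp_apply, ← hD, hinv,
          map_add, kap]
        abel
      rw [e, e]
      exact kap_skew h _ _ _) u v
  rw [← this, hinv]

/-- The covariant derivative of the coframe is a tensor. -/
theorem kap_changeCoframe {χ : R8 → R8} (hθ : DifferentiableAt ℝ θ (χ y))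
    (hχ : ContDiffAt ℝ 2 χ y) (h : (θ (χ y)).IsInvertible) (h' : (fderiv ℝ χ y).IsInvertible)
    (w u : R8) :
    kap (changeCoframe θ χ) y w u = kap θ (χ y) (fderiv ℝ χ y w) (fderiv ℝ χ y u) := by
  have e : ∀ x, changeCoframe θ χ y x = θ (χ y) (fderiv ℝ χ y x) := fun _ => rfl
  rw [kap, fderiv_changeCoframe hθ hχ, e, fderiv_gam_changeCoframe hθ hχ h h', kap, map_add]
  abel

/-! ### Tangent vectors in charts -/

section Charts

variable {M : Type*} [TopologicalSpace M] [ChartedSpace R8 M]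

/-- The coordinate change from the chart at `q` to the chart at `p`. -/
def transition (q p : M) (y : R8) : R8 := extChartAt (𝓡 8) p ((extChartAt (𝓡 8) q).symm y)

theorem transition_apply {q p x : M} (h : x ∈ (chartAt R8 q).source) :
    transition q p (extChartAt (𝓡 8) q x) = extChartAt (𝓡 8) p x := by
  rw [transition, (extChartAt (𝓡 8) q).left_inv (by rwa [extChartAt_source])]

theorem symm_mem_source {p : M} {y : R8} (hy : y ∈ (extChartAt (𝓡 8) p).target) :
    (extChartAt (𝓡 8) p).symm y ∈ (chartAt R8 p).source := by
  have := (extChartAt (𝓡 8) p).map_target hy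
  rwa [extChartAt_source] at this

theorem chart_mem_target {p q : M} (hq : q ∈ (chartAt R8 p).source) :
    extChartAt (𝓡 8) p q ∈ (extChartAt (𝓡 8) p).target :=
  (extChartAt (𝓡 8) p).map_source (by rwa [extChartAt_source])

theorem symm_chart {p q : M} (hq : q ∈ (chartAt R8 p).source) :
    (extChartAt (𝓡 8) p).symm (extChartAt (𝓡 8) p q) = q :=
  (extChartAt (𝓡 8) p).left_inv (by rwa [extChartAt_source])

theorem chart_symm {p : M} {y : R8} (hy : y ∈ (extChartAt (𝓡 8) p).target) :
    extChartAt (𝓡 8) p ((extChartAt (𝓡 8) p).symm y) = y :=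
  (extChartAt (𝓡 8) p).right_inv hy

variable [IsManifold (𝓡 8) ∞ M]

theorem toCoords_ofCoords {p q : M} (h : q ∈ (chartAt R8 p).source) (u : R8) :
    toCoords p q (ofCoords p q u) = u :=
  Bundle.Trivialization.continuousLinearMapAt_symmL _ h u

theorem ofCoords_toCoords {p q : M} (h : q ∈ (chartAt R8 p).source) (u : TangentSpace (𝓡 8) q) :
    ofCoords p q (toCoords p q u) = u :=
  Bundle.Trivialization.symmL_continuousLinearMapAt _ h u

theorem toCoords_eq_change {p q : M} (h : q ∈ (chartAt R8 p).source) (u : R8) :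
    toCoords p q u = tangentCoordChange (𝓡 8) q p q u := by
  rw [toCoords, TangentBundle.continuousLinearMapAt_trivializationAt_eq_core h]
  rfl

theorem toCoords_bijective {p q : M} (h : q ∈ (chartAt R8 p).source) :
    Function.Bijective (toCoords p q) :=
  ⟨fun u v huv => by rw [← ofCoords_toCoords h u, huv, ofCoords_toCoords h],
    fun u => ⟨_, toCoords_ofCoords h u⟩⟩

theorem transition_contDiffAt {q p x : M} (hq : x ∈ (chartAt R8 q).source)
    (hp : x ∈ (chartAt R8 p).source) : ContDiffAt ℝ ∞ (transition q p) (extChartAt (𝓡 8) q x) := by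
  have h := contDiffWithinAt_ext_coord_change (I := 𝓡 8) (n := ∞) p q
    (y := extChartAt (𝓡 8) q x) (by
      rw [PartialEquiv.trans_source]
      refine ⟨(extChartAt (𝓡 8) q).map_source (by rwa [extChartAt_source]), ?_⟩
      rw [Set.mem_preimage, (extChartAt (𝓡 8) q).left_inv (by rwa [extChartAt_source]),
        extChartAt_source]
      exact hp)
  rw [modelWithCornersSelf_coe, Set.range_id, contDiffWithinAt_univ] at h
  exact h

theorem hasFDerivAt_transition {q p x : M} (hq : x ∈ (chartAt R8 q).source)
    (hp : x ∈ (chartAt R8 p).source) :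
    HasFDerivAt (transition q p) (tangentCoordChange (𝓡 8) q p x) (extChartAt (𝓡 8) q x) := by
  have h := hasFDerivWithinAt_tangentCoordChange (I := 𝓡 8) (x := q) (y := p) (z := x)
    (by rw [extChartAt_source, extChartAt_source]; exact ⟨hq, hp⟩)
  rw [modelWithCornersSelf_coe, Set.range_id, hasFDerivWithinAt_univ] at h
  exact h

theorem toCoords_eq_fderiv {q p x : M} (hq : x ∈ (chartAt R8 q).source)
    (hp : x ∈ (chartAt R8 p).source) (u : TangentSpace (𝓡 8) x) :
    toCoords p x u = fderiv ℝ (transition q p) (extChartAt (𝓡 8) q x) (toCoords q x u) := by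
  rw [(hasFDerivAt_transition hq hp).fderiv]
  refine (toCoords_eq_change hp u).trans (Eq.trans (tangentCoordChange_comp ?_).symm
    (congrArg _ (toCoords_eq_change hq u).symm))
  rw [extChartAt_source, extChartAt_source, extChartAt_source]
  exact ⟨⟨mem_chart_source R8 x, hq⟩, hp⟩

theorem fderiv_transition_isInvertible {q p x : M} (hq : x ∈ (chartAt R8 q).source)
    (hp : x ∈ (chartAt R8 p).source) :
    (fderiv ℝ (transition q p) (extChartAt (𝓡 8) q x)).IsInvertible := by
  have e : ∀ a b : M, x ∈ (chartAt R8 a).source → x ∈ (chartAt R8 b).source → ∀ u : R8,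
      fderiv ℝ (transition a b) (extChartAt (𝓡 8) a x) u = toCoords b x (ofCoords a x u) :=
    fun a b ha hb u => by rw [toCoords_eq_fderiv ha hb, toCoords_ofCoords ha]
  refine ⟨ContinuousLinearEquiv.equivOfInverse _
    (fderiv ℝ (transition p q) (extChartAt (𝓡 8) p x)) ?_ ?_, rfl⟩
  · intro u
    rw [e q p hq hp, e p q hp hq, ofCoords_toCoords hp, toCoords_ofCoords hq]
  · intro u
    rw [e q p hq hp, e p q hp hq, ofCoords_toCoords hq, toCoords_ofCoords hp]

/-- `θ` is a smooth coframe on the part `Ω` of the chart at `p`. -/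
structure IsLocalCoframe (Φ : Π q : M, Form4 q) (p : M) (Ω : Set R8) (θ : R8 → R8 →L[ℝ] R8) :
    Prop where
  isOpen : IsOpen Ω
  subset : Ω ⊆ (extChartAt (𝓡 8) p).target
  contDiffOn : ContDiffOn ℝ ∞ θ Ω
  coframe : ∀ y ∈ Ω, IsCoframe Φ ((extChartAt (𝓡 8) p).symm y)
    ((θ y).toLinearMap ∘ₗ (toCoords p ((extChartAt (𝓡 8) p).symm y)).toLinearMap)

theorem IsLocalCoframe.at {Φ : Π q : M, Form4 q} {p q : M} {Ω : Set R8}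
    {θ : R8 → R8 →L[ℝ] R8} (h : IsLocalCoframe Φ p Ω θ) (hq : q ∈ (chartAt R8 p).source)
    (hΩ : extChartAt (𝓡 8) p q ∈ Ω) :
    IsCoframe Φ q ((θ (extChartAt (𝓡 8) p q)).toLinearMap ∘ₗ (toCoords p q).toLinearMap) := by
  have := h.coframe _ hΩ
  rwa [symm_chart hq] at this

theorem IsLocalCoframe.isInvertible {Φ : Π q : M, Form4 q} {p : M} {Ω : Set R8}
    {θ : R8 → R8 →L[ℝ] R8} (h : IsLocalCoframe Φ p Ω θ) {y : R8} (hy : y ∈ Ω) :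
    (θ y).IsInvertible := by
  have h1 := (h.coframe y hy).bijective
  have h2 := toCoords_bijective (symm_mem_source (h.subset hy))
  have h3 : Function.Bijective (θ y) := by
    rw [LinearMap.coe_comp] at h1
    exact (Function.Bijective.of_comp_iff _ h2).1 h1
  exact ⟨(LinearEquiv.ofBijective (θ y).toLinearMap h3).toContinuousLinearEquiv, by ext; rfl⟩

theorem contDiffOn_section_coords {W : Set M} (hW : IsOpen W)
    {b : Π q : M, TangentSpace (𝓡 8) q}
    (hb : ContMDiffOn (𝓡 8) (𝓡 8).tangent ∞ (fun q => (⟨q, b q⟩ : TangentBundle (𝓡 8) M)) W)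
    (p : M) :
    ContDiffOn ℝ ∞ (fun y => toCoords p ((extChartAt (𝓡 8) p).symm y)
      (b ((extChartAt (𝓡 8) p).symm y)))
      ((extChartAt (𝓡 8) p).target ∩ (extChartAt (𝓡 8) p).symm ⁻¹' W) := by
  have h1 := ((trivializationAt R8 (TangentSpace (𝓡 8)) p).contMDiffOn_section_iff
    (n := ∞) (IB := 𝓡 8) (s := b) (a := W ∩ (chartAt R8 p).source)
    (hW.inter (chartAt R8 p).open_source) Set.inter_subset_right).1 (hb.mono Set.inter_subset_left)
  have h2 := h1.comp ((contMDiffOn_extChartAt_symm (I := 𝓡 8) (n := ∞) p).mono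
    (t := (extChartAt (𝓡 8) p).target ∩ (extChartAt (𝓡 8) p).symm ⁻¹' W) Set.inter_subset_left)
    (fun y hy => ⟨hy.2, symm_mem_source hy.1⟩)
  rw [contMDiffOn_iff_contDiffOn] at h2
  refine h2.congr fun y hy => ?_
  have h3 := Bundle.Trivialization.coe_linearMapAt_of_mem (R := ℝ)
    (trivializationAt R8 (TangentSpace (𝓡 8)) p) (b := (extChartAt (𝓡 8) p).symm y)
    (symm_mem_source hy.1)
  exact congrFun h3 _

/-- Every point has a smooth coframe in a neighbourhood of it inside any chart around it: the
coordinates with respect to the smooth frame in which `Φ` is standard. -/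
theorem exists_localCoframe {Φ : Π q : M, Form4 q} (hΦ : IsSpin7Structure Φ) {p q : M}
    (hq : q ∈ (chartAt R8 p).source) :
    ∃ Ω θ, IsLocalCoframe Φ p Ω θ ∧ extChartAt (𝓡 8) p q ∈ Ω := by
  obtain ⟨W, hW, hqW, b, hb, hB⟩ := hΦ q
  set ψ := (extChartAt (𝓡 8) p).symm with hψ
  set Ω := (extChartAt (𝓡 8) p).target ∩ ψ ⁻¹' W with hΩ
  have hΩo : IsOpen Ω :=
    (continuousOn_extChartAt_symm p).isOpen_inter_preimage (isOpen_extChartAt_target p) hW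
  -- `B y` sends the standard basis to the frame at `y`; the coframe is its inverse.
  let β : Fin 8 → R8 → R8 := fun i y => toCoords p (ψ y) (b i (ψ y))
  have hβ : ∀ i, ContDiffOn ℝ ∞ (β i) Ω := fun i => contDiffOn_section_coords hW (hb i) p
  let B : R8 → R8 →L[ℝ] R8 := fun y => ∑ i, (EuclideanSpace.proj i : R8 →L[ℝ] ℝ).smulRight (β i y)
  have hBapp : ∀ y u, B y u = ∑ i, u i • β i y := fun y u => by
    simp [B]
  have hBs : ContDiffOn ℝ ∞ B Ω := by
    refine ContDiffOn.sum fun i _ => ?_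
    exact contDiffOn_const.smulRight (hβ i)
  have hinv : ∀ y ∈ Ω, (B y).IsInvertible ∧ IsCoframe Φ (ψ y)
      ((B y).inverse.toLinearMap ∘ₗ (toCoords p (ψ y)).toLinearMap) := by
    intro y hy
    obtain ⟨b', hb', hs⟩ := hB (ψ y) hy.2
    have hsrc := symm_mem_source hy.1
    have hsum : ∀ v : TangentSpace (𝓡 8) (ψ y),
        B y (WithLp.toLp 2 (b'.equivFun v)) = toCoords p (ψ y) v := fun v => by
      conv_rhs => rw [← b'.sum_equivFun v, map_sum]
      rw [hBapp]
      refine Finset.sum_congr rfl fun i _ => ?_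
      rw [map_smul, hb']
    have hbij : Function.Bijective (B y) := by
      have hsurj : Function.Surjective (B y) := fun w => by
        obtain ⟨v, rfl⟩ := (toCoords_bijective hsrc).2 w
        exact ⟨_, hsum v⟩
      exact ⟨(LinearMap.injective_iff_surjective (f := (B y).toLinearMap)).2 hsurj, hsurj⟩
    have hI : (B y).IsInvertible :=
      ⟨(LinearEquiv.ofBijective (B y).toLinearMap hbij).toContinuousLinearEquiv, by ext; rfl⟩
    have hinvapp : ∀ v, (B y).inverse (toCoords p (ψ y) v) = WithLp.toLp 2 (b'.equivFun v) :=
      fun v => by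
        rw [← hsum, ← ContinuousLinearMap.comp_apply, hI.inverse_comp_self]; rfl
    refine ⟨hI, ?_, fun v => ?_⟩
    · rw [LinearMap.coe_comp]
      refine Function.Bijective.comp ?_ (toCoords_bijective hsrc)
      refine ⟨fun u v huv => ?_, fun u => ⟨B y u, ?_⟩⟩
      · have := congrArg (B y) huv
        change B y ((B y).inverse u) = B y ((B y).inverse v) at this
        rwa [← ContinuousLinearMap.comp_apply, ← ContinuousLinearMap.comp_apply,
          hI.self_comp_inverse] at this
      · change (B y).inverse (B y u) = u
        rw [← ContinuousLinearMap.comp_apply, hI.inverse_comp_self]; rfl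
    · rw [hs v, phi_eq_phi0]
      congr 1
      funext a
      change _ = ⇑((B y).inverse (toCoords p (ψ y) (v a)))
      rw [hinvapp]
      rfl
  refine ⟨Ω, fun y => (B y).inverse, ⟨hΩo, Set.inter_subset_left, fun y hy => ?_,
    fun y hy => (hinv y hy).2⟩, chart_mem_target hq, ?_⟩
  · exact ((hinv y hy).1.contDiffAt_map_inverse).comp_contDiffWithinAt y (hBs y hy)
  · rw [Set.mem_preimage, hψ, symm_chart hq]; exact hqW

/-- A local coframe in the chart at `p` is one in every other chart, by the transition map. -/
theorem IsLocalCoframe.change {Φ : Π q : M, Form4 q} {p : M} {Ω : Set R8}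
    {θ : R8 → R8 →L[ℝ] R8} (h : IsLocalCoframe Φ p Ω θ) (q : M) :
    IsLocalCoframe Φ q ((extChartAt (𝓡 8) q).target ∩ (extChartAt (𝓡 8) q).symm ⁻¹'
      ((chartAt R8 p).source ∩ extChartAt (𝓡 8) p ⁻¹' Ω)) (changeCoframe θ (transition q p)) := by
  have ho : IsOpen ((chartAt R8 p).source ∩ extChartAt (𝓡 8) p ⁻¹' Ω) := by
    have := (continuousOn_extChartAt (I := 𝓡 8) p).isOpen_inter_preimage
      (isOpen_extChartAt_source p) h.isOpen
    rwa [extChartAt_source] at this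
  refine ⟨(continuousOn_extChartAt_symm q).isOpen_inter_preimage (isOpen_extChartAt_target q) ho,
    Set.inter_subset_left, fun y hy => ?_, fun y hy => ?_⟩
  · have hq := symm_mem_source hy.1
    have hχ := transition_contDiffAt hq hy.2.1
    rw [chart_symm hy.1] at hχ
    have hθ : ContDiffAt ℝ ∞ θ (transition q p y) :=
      (h.contDiffOn _ hy.2.2).contDiffAt (h.isOpen.mem_nhds hy.2.2)
    exact ((hθ.comp y hχ).clm_comp (hχ.fderiv_right (m := ∞) (by simp))).contDiffWithinAt
  · have hq := symm_mem_source hy.1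
    have h1 := h.at hy.2.1 hy.2.2
    have e : ∀ u, toCoords p ((extChartAt (𝓡 8) q).symm y) u =
        fderiv ℝ (transition q p) y (toCoords q ((extChartAt (𝓡 8) q).symm y) u) := fun u => by
      rw [toCoords_eq_fderiv hq hy.2.1, chart_symm hy.1]
    convert h1 using 1
    ext1 u
    change θ (transition q p y) (fderiv ℝ (transition q p) y (toCoords q _ u)) = _
    rw [← e]
    rfl

theorem IsLocalCoframe.metricCoords_eq {Φ : Π q : M, Form4 q} {p : M} {Ω : Set R8}
    {θ : R8 → R8 →L[ℝ] R8} (h : IsLocalCoframe Φ p Ω θ) (u v : R8) {y : R8} (hy : y ∈ Ω) :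
    metricCoords Φ p u v y = inner ℝ (θ y u) (θ y v) := by
  rw [metricCoords, (h.coframe y hy).metric_eq]
  have := symm_mem_source (h.subset hy)
  simp only [LinearMap.comp_apply, ContinuousLinearMap.coe_coe]
  rw [toCoords_ofCoords this, toCoords_ofCoords this]

theorem IsLocalCoframe.contDiffAt {Φ : Π q : M, Form4 q} {p : M} {Ω : Set R8}
    {θ : R8 → R8 →L[ℝ] R8} (h : IsLocalCoframe Φ p Ω θ) {y : R8} (hy : y ∈ Ω) :
    ContDiffAt ℝ ∞ θ y :=
  (h.contDiffOn y hy).contDiffAt (h.isOpen.mem_nhds hy)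

theorem IsLocalCoframe.differentiableAt {Φ : Π q : M, Form4 q} {p : M} {Ω : Set R8}
    {θ : R8 → R8 →L[ℝ] R8} (h : IsLocalCoframe Φ p Ω θ) {y : R8} (hy : y ∈ Ω) :
    DifferentiableAt ℝ θ y :=
  (h.contDiffAt hy).differentiableAt (by simp)

theorem IsLocalCoframe.fderiv_metricCoords {Φ : Π q : M, Form4 q} {p : M} {Ω : Set R8}
    {θ : R8 → R8 →L[ℝ] R8} (h : IsLocalCoframe Φ p Ω θ) (u v w : R8) {y : R8} (hy : y ∈ Ω) :
    fderiv ℝ (metricCoords Φ p u v) y w = dMetric θ y w u v := by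
  have he : metricCoords Φ p u v =ᶠ[𝓝 y] fun y => inner ℝ (θ y u) (θ y v) :=
    Filter.eventually_of_mem (h.isOpen.mem_nhds hy) fun z hz => h.metricCoords_eq u v hz
  have hd := (h.differentiableAt hy).hasFDerivAt
  have h1 : ∀ u, HasFDerivAt (fun y => θ y u) ((fderiv ℝ θ y).flip u) y := fun u => by
    simpa using hd.clm_apply (hasFDerivAt_const u y)
  rw [he.fderiv_eq, ((h1 u).inner ℝ (h1 v)).fderiv, dMetric]
  simp [add_comm]

/-- The Christoffel symbols computed from a local coframe. -/
theorem IsLocalCoframe.christoffel_eq {Φ : Π q : M, Form4 q} {p q : M} {Ω : Set R8}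
    {θ : R8 → R8 →L[ℝ] R8} (h : IsLocalCoframe Φ p Ω θ) (hq : q ∈ (chartAt R8 p).source)
    (hΩ : extChartAt (𝓡 8) p q ∈ Ω) (u v : R8) :
    christoffel Φ p q u v = gam θ (extChartAt (𝓡 8) p q) u v := by
  set y := extChartAt (𝓡 8) p q with hy
  have hL := h.at hq hΩ
  have hI := h.isInvertible hΩ
  -- Both sides are traces of `S`, over the frame that defines the metric and over the standard
  -- basis.
  let S : R8 →ₗ[ℝ] R8 →ₗ[ℝ] R8 := LinearMap.mk₂ ℝ
    (fun a b => koszul θ y u v ((θ y).inverse a) • (θ y).inverse b)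
    (fun a a' b => by rw [map_add, koszul_add_right, add_smul])
    (fun c a b => by rw [map_smul, koszul_smul_right, mul_smul])
    (fun a b b' => by rw [map_add, smul_add])
    (fun c a b => by rw [map_smul, smul_comm])
  have hb : ∀ k, (θ y).inverse (hL.onb k) = toCoords p q (spin7Frame Φ q k) := fun k => by
    rw [hL.onb_apply]
    exact inverse_apply_self hI _
  have h1 := sum_orthonormalBasis_eq S hL.onb (EuclideanSpace.basisFun (Fin 8) ℝ)
  have h2 : christoffel Φ p q u v = ∑ k, S (hL.onb k) (hL.onb k) := by
    rw [christoffel]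
    refine Finset.sum_congr rfl fun k _ => ?_
    change _ = koszul θ y u v ((θ y).inverse (hL.onb k)) • (θ y).inverse (hL.onb k)
    rw [hb, h.fderiv_metricCoords _ _ _ hΩ, h.fderiv_metricCoords _ _ _ hΩ,
      h.fderiv_metricCoords _ _ _ hΩ]
    rfl
  rw [h2, h1]
  simp [gam, S]

end Charts

/-! ### Smooth dependence of geodesics on their initial data -/

section Superposition

variable {K : Type} [TopologicalSpace K] [CompactSpace K]

/-- Pointwise application of a continuous family of operators. -/
def pointwiseApply (K E G : Type) [TopologicalSpace K] [CompactSpace K] [NormedAddCommGroup E]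
    [NormedSpace ℝ E] [NormedAddCommGroup G] [NormedSpace ℝ G] :
    C(K, E →L[ℝ] G) →L[ℝ] C(K, E) →L[ℝ] C(K, G) :=
  LinearMap.mkContinuous₂
    (LinearMap.mk₂ ℝ (fun (A : C(K, E →L[ℝ] G)) (h : C(K, E)) =>
        (⟨fun x => A x (h x), A.continuous.clm_apply h.continuous⟩ : C(K, G)))
      (fun A B h => by ext x; simp) (fun c A h => by ext x; simp) (fun A h k => by ext x; simp)
      (fun c A h => by ext x; simp)) 1 fun A h => by
    rw [one_mul, ContinuousMap.norm_le _ (by positivity)]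
    intro x
    exact (A x).le_of_opNorm_le_of_le (A.norm_coe_le_norm x) (h.norm_coe_le_norm x)

@[simp] theorem pointwiseApply_apply {E G : Type} [NormedAddCommGroup E] [NormedSpace ℝ E]
    [NormedAddCommGroup G] [NormedSpace ℝ G] (A : C(K, E →L[ℝ] G)) (h : C(K, E)) (x : K) :
    pointwiseApply K E G A h x = A x (h x) := rfl

/-- The derivative of `φ ↦ F ∘ φ` is pointwise application of `F'`; the remainder is estimated by
the mean value inequality at each point, uniformly by continuity of `φ ↦ F' ∘ φ`. -/
theorem hasFDerivAt_postcomp {E G : Type} [NormedAddCommGroup E] [NormedSpace ℝ E]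
    [NormedAddCommGroup G] [NormedSpace ℝ G] {F : C(E, G)} (hF : ContDiff ℝ 1 F) (φ : C(K, E)) :
    HasFDerivAt (fun φ : C(K, E) => F.comp φ)
      (pointwiseApply K E G
        ((⟨fderiv ℝ F, hF.continuous_fderiv (by norm_num)⟩ : C(E, E →L[ℝ] G)).comp φ)) φ := by
  set N' : C(K, E) → C(K, E →L[ℝ] G) :=
    fun φ => (⟨fderiv ℝ F, hF.continuous_fderiv (by norm_num)⟩ : C(E, E →L[ℝ] G)).comp φ with hN'
  have hcont : Continuous N' := ContinuousMap.continuous_postcomp _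
  rw [hasFDerivAt_iff_isLittleO_nhds_zero, Asymptotics.isLittleO_iff]
  intro ε hε
  obtain ⟨δ, hδ, hδ'⟩ := (Metric.continuousAt_iff (f := N') (a := φ)).1 hcont.continuousAt ε hε
  filter_upwards [Metric.ball_mem_nhds (0 : C(K, E)) hδ] with h hh
  rw [ContinuousMap.norm_le _ (by positivity)]
  intro x
  have hb : ∀ u ∈ Metric.ball (φ x) δ, ‖fderiv ℝ F u - fderiv ℝ F (φ x)‖ ≤ ε := by
    intro u hu
    have h1 : dist (φ + ContinuousMap.const K (u - φ x)) φ < δ := by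
      rw [dist_eq_norm, add_sub_cancel_left]
      refine lt_of_le_of_lt ((ContinuousMap.norm_le _ (norm_nonneg (u - φ x))).2 fun _ => le_rfl) ?_
      rwa [← dist_eq_norm]
    have h2 := ContinuousMap.dist_lt_iff hε |>.1 (hδ' h1) x
    rw [dist_eq_norm] at h2
    simpa [hN'] using h2.le
  have h3 := (convex_ball (φ x) δ).norm_image_sub_le_of_norm_fderiv_le'
    (f := F) (φ := fderiv ℝ F (φ x)) (C := ε)
    (fun u _ => (hF.differentiable (by norm_num)) u) hb (Metric.mem_ball_self hδ)
    (y := φ x + h x) (by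
      rw [Metric.mem_ball, dist_eq_norm, add_sub_cancel_left]
      rw [mem_ball_zero_iff] at hh
      exact (h.norm_coe_le_norm x).trans_lt hh)
  rw [add_sub_cancel_left] at h3
  calc ‖F (φ x + h x) - F (φ x) - fderiv ℝ F (φ x) (h x)‖ ≤ ε * ‖h x‖ := h3
    _ ≤ ε * ‖h‖ := by gcongr; exact h.norm_coe_le_norm x

theorem contDiff_postcomp_nat (n : ℕ) {E G : Type} [NormedAddCommGroup E] [NormedSpace ℝ E]
    [NormedAddCommGroup G] [NormedSpace ℝ G] {F : C(E, G)} (hF : ContDiff ℝ n F) :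
    ContDiff ℝ n (fun φ : C(K, E) => F.comp φ) := by
  induction n generalizing G with
  | zero =>
    exact contDiff_zero.2 (ContinuousMap.continuous_postcomp _)
  | succ n ih =>
    have h1 : ContDiff ℝ 1 F := hF.of_le (by norm_cast; omega)
    have hd := fun φ => hasFDerivAt_postcomp (K := K) h1 φ
    have h2 : ContDiff ℝ n (fderiv ℝ F) := hF.fderiv_right (by norm_cast)
    push_cast
    rw [contDiff_succ_iff_fderiv]
    refine ⟨fun φ => (hd φ).differentiableAt, by simp, ?_⟩
    rw [funext fun φ => (hd φ).fderiv]
    exact (pointwiseApply K E G).contDiff.comp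
      (ih (F := ⟨fderiv ℝ F, h1.continuous_fderiv (by norm_num)⟩) h2)

/-- Composition with a smooth function is a smooth map between spaces of continuous functions. -/
theorem contDiff_postcomp {E G : Type} [NormedAddCommGroup E] [NormedSpace ℝ E]
    [NormedAddCommGroup G] [NormedSpace ℝ G] {F : C(E, G)} (hF : ContDiff ℝ ∞ F) :
    ContDiff ℝ ∞ (fun φ : C(K, E) => F.comp φ) := by
  rw [contDiff_infty]
  exact fun n => contDiff_postcomp_nat n (hF.of_le (by exact_mod_cast le_top))

end Superposition

/-- The inverse function theorem for smooth maps, with a smooth inverse on an open set. -/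
theorem exists_smooth_localInverse {E G : Type*} [NormedAddCommGroup E] [NormedSpace ℝ E]
    [CompleteSpace E] [NormedAddCommGroup G] [NormedSpace ℝ G] {f : E → G} {s : Set E}
    (hs : IsOpen s) (hf : ContDiffOn ℝ ∞ f s) {a : E} (ha : a ∈ s) {f' : E ≃L[ℝ] G}
    (hf' : HasFDerivAt f (f' : E →L[ℝ] G) a) :
    ∃ e : OpenPartialHomeomorph E G, (∀ x, e x = f x) ∧ a ∈ e.source ∧ e.source ⊆ s ∧
      ContDiffOn ℝ ∞ e.symm e.target := by
  have hfa : ContDiffAt ℝ ∞ f a := hf.contDiffAt (hs.mem_nhds ha)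
  set e₀ := hfa.toOpenPartialHomeomorph f hf' (by simp)
  have he₀ : ∀ x, e₀ x = f x := fun x => rfl
  -- The derivative is invertible on an open set; there the inverse is smooth, not only at `f a`.
  set t := s ∩ (fderiv ℝ f) ⁻¹' (Set.range ((↑) : (E ≃L[ℝ] G) → E →L[ℝ] G)) with ht
  have hto : IsOpen t :=
    (hf.continuousOn_fderiv_of_isOpen hs (by simp)).isOpen_inter_preimage hs
      ContinuousLinearEquiv.isOpen
  have hat : a ∈ t := ⟨ha, f', hf'.fderiv.symm⟩
  refine ⟨e₀.restrOpen t hto, he₀, ?_, ?_, ?_⟩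
  · rw [OpenPartialHomeomorph.restrOpen_source]
    exact ⟨hfa.mem_toOpenPartialHomeomorph_source hf' (by simp), hat⟩
  · rw [OpenPartialHomeomorph.restrOpen_source]
    exact fun x hx => hx.2.1
  · intro z hz
    have hx := (e₀.restrOpen t hto).map_target hz
    rw [OpenPartialHomeomorph.restrOpen_source] at hx
    obtain ⟨D, hD⟩ := hx.2.2
    have hfx : ContDiffAt ℝ ∞ f ((e₀.restrOpen t hto).symm z) :=
      hf.contDiffAt (hs.mem_nhds hx.2.1)
    refine ((e₀.restrOpen t hto).contDiffAt_symm hz (f₀' := D) ?_ hfx).contDiffWithinAt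
    rw [hD]
    exact (hfx.differentiableAt (by simp)).hasFDerivAt

section Flow

/-- The time interval on which geodesics are constructed; it contains `[0, 1]` in its interior. -/
abbrev TimeInterval : Set ℝ := Set.Icc (-1 : ℝ) 2

variable {E : Type} [NormedAddCommGroup E]

/-- The extension of a path to `ℝ` by constants. -/
def extPath (α : C(TimeInterval, E)) : ℝ → E := Set.IccExtend (by norm_num) α

theorem continuous_extPath (α : C(TimeInterval, E)) : Continuous (extPath α) :=
  α.continuous.Icc_extend'

theorem extPath_of_mem (α : C(TimeInterval, E)) {t : ℝ} (ht : t ∈ TimeInterval) :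
    extPath α t = α ⟨t, ht⟩ := Set.IccExtend_of_mem _ _ ht

theorem norm_extPath_le (α : C(TimeInterval, E)) (t : ℝ) : ‖extPath α t‖ ≤ ‖α‖ :=
  α.norm_coe_le_norm _

variable [NormedSpace ℝ E] [CompleteSpace E]

theorem hasDerivAt_integral_extPath (α : C(TimeInterval, E)) (t : ℝ) :
    HasDerivAt (fun t => ∫ s in (0 : ℝ)..t, extPath α s) (extPath α t) t :=
  intervalIntegral.integral_hasDerivAt_right ((continuous_extPath α).intervalIntegrable _ _)
    ((continuous_extPath α).stronglyMeasurableAtFilter _ _) (continuous_extPath α).continuousAt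

/-- The operator that sends a path to its primitive that vanishes at time `0`. -/
def primitive (E : Type) [NormedAddCommGroup E] [NormedSpace ℝ E] [CompleteSpace E] :
    C(TimeInterval, E) →L[ℝ] C(TimeInterval, E) :=
  LinearMap.mkContinuous
    { toFun := fun α => ⟨fun t => ∫ s in (0 : ℝ)..t, extPath α s,
        (continuous_iff_continuousAt.2 fun t =>
          (hasDerivAt_integral_extPath α t).continuousAt).comp continuous_subtype_val⟩
      map_add' := fun α β => by
        ext t
        exact intervalIntegral.integral_add ((continuous_extPath α).intervalIntegrable _ _)
          ((continuous_extPath β).intervalIntegrable _ _)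
      map_smul' := fun c α => by
        ext t
        exact intervalIntegral.integral_smul c _ } 2 fun α => by
    rw [ContinuousMap.norm_le _ (by positivity)]
    intro t
    have h := intervalIntegral.norm_integral_le_of_norm_le_const (a := 0) (b := (t : ℝ))
      (f := extPath α) (C := ‖α‖) fun s _ => norm_extPath_le α s
    refine h.trans ?_
    rw [mul_comm]
    gcongr
    rw [sub_zero, abs_le]
    exact ⟨by linarith [t.2.1], t.2.2⟩

/-- Constant paths. -/
def constPath (E : Type) [NormedAddCommGroup E] [NormedSpace ℝ E] :
    E →L[ℝ] C(TimeInterval, E) :=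
  LinearMap.mkContinuous
    { toFun := fun v => ContinuousMap.const _ v
      map_add' := fun _ _ => rfl
      map_smul' := fun _ _ => rfl } 1 fun v => by
    rw [one_mul, ContinuousMap.norm_le _ (norm_nonneg v)]
    exact fun _ => le_rfl

/-- Velocity of a path with given initial velocity and acceleration. -/
def velPath (E : Type) [NormedAddCommGroup E] [NormedSpace ℝ E] [CompleteSpace E] :
    ((E × E) × C(TimeInterval, E)) →L[ℝ] C(TimeInterval, E) :=
  (constPath E).comp ((ContinuousLinearMap.snd ℝ E E).comp (ContinuousLinearMap.fst ℝ _ _))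
    + (primitive E).comp (ContinuousLinearMap.snd ℝ _ _)

/-- Position of a path with given initial position, initial velocity and acceleration. -/
def posPath (E : Type) [NormedAddCommGroup E] [NormedSpace ℝ E] [CompleteSpace E] :
    ((E × E) × C(TimeInterval, E)) →L[ℝ] C(TimeInterval, E) :=
  (constPath E).comp ((ContinuousLinearMap.fst ℝ E E).comp (ContinuousLinearMap.fst ℝ _ _))
    + (primitive E).comp (velPath E)

/-- Position and velocity of a path. -/
def phasePath (E : Type) [NormedAddCommGroup E] [NormedSpace ℝ E] [CompleteSpace E] :
    ((E × E) × C(TimeInterval, E)) →L[ℝ] C(TimeInterval, E × E) :=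
  ((ContinuousLinearMap.inl ℝ E E).compLeftContinuous ℝ TimeInterval).comp (posPath E)
    + ((ContinuousLinearMap.inr ℝ E E).compLeftContinuous ℝ TimeInterval).comp (velPath E)

theorem velPath_apply (p : (E × E) × C(TimeInterval, E)) (t : TimeInterval) :
    velPath E p t = p.1.2 + ∫ s in (0 : ℝ)..t, extPath p.2 s := rfl

theorem posPath_apply (p : (E × E) × C(TimeInterval, E)) (t : TimeInterval) :
    posPath E p t = p.1.1 + ∫ s in (0 : ℝ)..t, extPath (velPath E p) s := rfl

theorem phasePath_apply (p : (E × E) × C(TimeInterval, E)) (t : TimeInterval) :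
    phasePath E p t = (posPath E p t, velPath E p t) := by
  change ((posPath E p t, (0 : E)) + ((0 : E), velPath E p t)) = _
  simp

/-- Solutions of `y'' = F(y, y')` near a stationary solution exist on the whole time interval,
stay near the stationary solution, and depend smoothly on the initial data.  The unknown is the
acceleration `α`, and the equation is `α - F(y, y') = 0` with `(y, y')` an affine function of the
initial data and `α`; its linearisation at the stationary solution is the identity. -/
theorem exists_second_order_flow {F : E × E → E} (hF : ContDiff ℝ ∞ F) (y₀ : E)
    (hF0 : F (y₀, 0) = 0) (hF1 : fderiv ℝ F (y₀, 0) = 0) {δ : ℝ} (hδ : 0 < δ) :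
    ∃ r > 0, ∃ Y V : E × E → ℝ → E,
      (∀ z ∈ Metric.ball (y₀, (0 : E)) r, Y z 0 = z.1 ∧ V z 0 = z.2 ∧
        ∀ t ∈ Set.Ioo (-1 : ℝ) 2, HasDerivAt (Y z) (V z t) t ∧
          HasDerivAt (V z) (F (Y z t, V z t)) t ∧ ‖Y z t - y₀‖ < δ ∧ ‖V z t‖ < δ) ∧
      ContDiffOn ℝ ∞ (fun z => Y z 1) (Metric.ball (y₀, (0 : E)) r) := by
  let Fc : C(E × E, E) := ⟨F, hF.continuous⟩
  have hFc : ContDiff ℝ ∞ Fc := hF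
  let A := C(TimeInterval, E)
  -- `H (z, α) = (z, α - F(y, y'))`; solutions with initial data `z` are the preimages of `(z, 0)`.
  let H : (E × E) × A → (E × E) × A := fun p => (p.1, p.2 - Fc.comp (phasePath E p))
  have hN : ContDiff ℝ ∞ (fun p : (E × E) × A => Fc.comp (phasePath E p)) :=
    (contDiff_postcomp (K := TimeInterval) hFc).comp (phasePath E).contDiff
  have hH : ContDiff ℝ ∞ H := contDiff_fst.prodMk (contDiff_snd.sub hN)
  let a : (E × E) × A := ((y₀, 0), 0)
  have hvel0 : velPath E a = 0 := by
    ext t; rw [velPath_apply]; simp [a, extPath, Set.IccExtend]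
  have ha : phasePath E a = ContinuousMap.const _ (y₀, (0 : E)) := by
    ext1 t
    rw [phasePath_apply, hvel0, posPath_apply, hvel0]
    simp [a, extPath, Set.IccExtend]
  have hNa : Fc.comp (phasePath E a) = 0 := by
    rw [ha]; ext t; exact hF0
  have hHa : H a = a := by
    change (a.1, a.2 - Fc.comp (phasePath E a)) = a
    rw [hNa, sub_zero]
  -- The nonlinearity vanishes to first order at the stationary solution because `F` does.
  have hN' : HasFDerivAt (fun p : (E × E) × A => Fc.comp (phasePath E p))
      (0 : (E × E) × A →L[ℝ] A) a := by
    have h1 := (hasFDerivAt_postcomp (K := TimeInterval) (F := Fc) (hFc.of_le (by simp))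
      (phasePath E a)).comp a (phasePath E).hasFDerivAt
    refine h1.congr_fderiv (ContinuousLinearMap.ext fun p => ContinuousMap.ext fun t => ?_)
    rw [ContinuousLinearMap.comp_apply, pointwiseApply_apply, ha]
    change fderiv ℝ F (y₀, 0) _ = (0 : E)
    rw [hF1]; rfl
  have hH' : HasFDerivAt H
      ((ContinuousLinearEquiv.refl ℝ ((E × E) × A) : _ ≃L[ℝ] _) : _ →L[ℝ] _) a := by
    have h1 := (hasFDerivAt_fst (𝕜 := ℝ) (p := a)).prodMk
      ((hasFDerivAt_snd (𝕜 := ℝ) (p := a)).sub hN')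
    refine h1.congr_fderiv (ContinuousLinearMap.ext fun p => ?_)
    simp
  obtain ⟨e, he, hae, -, hes⟩ := exists_smooth_localInverse isOpen_univ hH.contDiffOn
    (Set.mem_univ a) hH'
  have hat : a ∈ e.target := by
    have := e.map_source hae
    rwa [he, hHa] at this
  have hea : e.symm a = a := by
    have := e.left_inv hae
    rwa [he, hHa] at this
  -- the phase path as a function of the initial data
  let i : E × E → (E × E) × A := fun z => (z, 0)
  have hi : Continuous i := by fun_prop
  have hia : i (y₀, 0) = a := rfl
  let S : E × E → (E × E) × A := fun z => e.symm (i z)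
  let O : Set (E × E) := i ⁻¹' e.target
  have hO : IsOpen O := e.open_target.preimage hi
  have hS : ContDiffOn ℝ ∞ S O :=
    hes.comp (contDiff_id.prodMk contDiff_const).contDiffOn fun z hz => hz
  have hS1 : ∀ z ∈ O, (S z).1 = z ∧ (S z).2 = Fc.comp (phasePath E (S z)) := by
    intro z hz
    have h1 := e.right_inv hz
    rw [he] at h1
    have h2 := congrArg Prod.fst h1
    have h3 := congrArg Prod.snd h1
    exact ⟨h2, sub_eq_zero.1 h3⟩
  have hcont : ContinuousAt (fun z => phasePath E (S z)) (y₀, (0 : E)) :=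
    (phasePath E).continuous.continuousAt.comp
      (hS.continuousOn.continuousAt (hO.mem_nhds hat))
  -- The phase path depends continuously on `z` in the sup norm, which gives the bound by `δ`.
  have hnear : ∀ᶠ z in 𝓝 (y₀, (0 : E)),
      dist (phasePath E (S z)) (phasePath E (S (y₀, 0))) < δ :=
    Metric.tendsto_nhds.1 hcont δ hδ
  obtain ⟨r, hr, hball⟩ := Metric.mem_nhds_iff.1
    (Filter.inter_mem (hO.mem_nhds hat) hnear)
  have hSa : S (y₀, 0) = a := hea
  refine ⟨r, hr, fun z t => z.1 + ∫ s in (0 : ℝ)..t, extPath (velPath E (S z)) s,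
    fun z t => z.2 + ∫ s in (0 : ℝ)..t, extPath (S z).2 s, fun z hz => ?_, ?_⟩
  · obtain ⟨hzO, hzd⟩ := hball hz
    obtain ⟨h1, h2⟩ := hS1 z hzO
    refine ⟨by simp, by simp, fun t ht => ?_⟩
    have htI : t ∈ TimeInterval := ⟨ht.1.le, ht.2.le⟩
    have hph : phasePath E (S z) ⟨t, htI⟩ = (z.1 + ∫ s in (0 : ℝ)..t, extPath (velPath E (S z)) s,
        z.2 + ∫ s in (0 : ℝ)..t, extPath (S z).2 s) := by
      rw [phasePath_apply, posPath_apply, velPath_apply, h1]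
    have hv : extPath (velPath E (S z)) t = z.2 + ∫ s in (0 : ℝ)..t, extPath (S z).2 s := by
      rw [extPath_of_mem _ htI, velPath_apply, h1]
    have hac : extPath (S z).2 t = F (phasePath E (S z) ⟨t, htI⟩) := by
      rw [extPath_of_mem _ htI]
      conv_lhs => rw [h2]
      rfl
    have hd := (ContinuousMap.dist_lt_iff hδ).1 hzd ⟨t, htI⟩
    rw [hSa, ha, hph] at hd
    rw [hph] at hac
    refine ⟨?_, ?_, ?_, ?_⟩
    · change HasDerivAt _ (z.2 + ∫ s in (0 : ℝ)..t, extPath (S z).2 s) t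
      rw [← hv]
      exact (hasDerivAt_integral_extPath _ t).const_add _
    · change HasDerivAt _ (F (z.1 + ∫ s in (0 : ℝ)..t, extPath (velPath E (S z)) s,
        z.2 + ∫ s in (0 : ℝ)..t, extPath (S z).2 s)) t
      rw [← hac]
      exact (hasDerivAt_integral_extPath _ t).const_add _
    · rw [← dist_eq_norm]
      exact (le_max_left _ _).trans_lt hd
    · rw [← dist_zero_right]
      exact (le_max_right _ _).trans_lt hd
  · have hE : ∀ z ∈ Metric.ball (y₀, (0 : E)) r,
        z.1 + ∫ s in (0 : ℝ)..1, extPath (velPath E (S z)) s =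
          (ContinuousMap.evalCLM ℝ (⟨1, by norm_num⟩ : TimeInterval)) (posPath E (S z)) := by
      intro z hz
      change _ = posPath E (S z) ⟨1, _⟩
      rw [posPath_apply, (hS1 z (hball hz).1).1]
    refine ContDiffOn.congr ?_ hE
    exact (ContinuousMap.evalCLM ℝ _).contDiff.comp_contDiffOn
      ((posPath E).contDiff.comp_contDiffOn (hS.mono fun z hz => (hball hz).1))

end Flow

section LinearODE

variable {E : Type} [NormedAddCommGroup E] [NormedSpace ℝ E] [CompleteSpace E]

theorem norm_primitive_le : ‖primitive E‖ ≤ 2 := LinearMap.mkContinuous_norm_le _ (by norm_num) _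

/-- A linear differential equation with small coefficient has solutions on the whole time
interval, with given value at time `1`. -/
theorem exists_linear_solution {A : ℝ → E →L[ℝ] E} (hA : Continuous A)
    (hb : ∀ t, ‖A t‖ ≤ 1 / 4) (c₁ : E) :
    ∃ c : ℝ → E, c 1 = c₁ ∧ ∀ t ∈ Set.Ioo (-1 : ℝ) 2, HasDerivAt c (A t (c t)) t ∧
      ‖c t‖ ≤ 2 * ‖c₁‖ := by
  -- Solve `d' = -A(1 - t) d`, `d(0) = c₁`, and reverse time. The integral equation is
  -- `(1 - T) d = c₁` with `‖T‖ ≤ 1/2`, since `‖A‖ ≤ 1/4` and integration has norm at most `2`.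
  let B : C(TimeInterval, E →L[ℝ] E) := ⟨fun t => -A (1 - t), by fun_prop⟩
  let T : C(TimeInterval, E) →L[ℝ] C(TimeInterval, E) :=
    (primitive E).comp (pointwiseApply TimeInterval E E B)
  have hTn : ∀ h, ‖T h‖ ≤ 1 / 2 * ‖h‖ := fun h => by
    have h1 : ‖pointwiseApply TimeInterval E E B h‖ ≤ 1 / 4 * ‖h‖ := by
      rw [ContinuousMap.norm_le _ (by positivity)]
      intro t
      rw [pointwiseApply_apply]
      refine ((B t).le_opNorm _).trans ?_
      have : ‖B t‖ ≤ 1 / 4 := by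
        change ‖-A (1 - t)‖ ≤ 1 / 4
        rw [norm_neg]; exact hb _
      gcongr
      exact h.norm_coe_le_norm t
    calc ‖T h‖ ≤ ‖primitive E‖ * ‖pointwiseApply TimeInterval E E B h‖ :=
          (primitive E).le_opNorm _
      _ ≤ 2 * (1 / 4 * ‖h‖) := by
          gcongr
          exact norm_primitive_le
      _ = 1 / 2 * ‖h‖ := by ring
  have hT : ‖T‖ < 1 :=
    (ContinuousLinearMap.opNorm_le_bound _ (by norm_num) hTn).trans_lt (by norm_num)
  obtain ⟨u, hu⟩ : ∃ u : (C(TimeInterval, E) →L[ℝ] C(TimeInterval, E))ˣ,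
      (u : C(TimeInterval, E) →L[ℝ] C(TimeInterval, E)) = 1 - T := ⟨Units.oneSub T hT, rfl⟩
  let d : C(TimeInterval, E) := (↑u⁻¹ : C(TimeInterval, E) →L[ℝ] C(TimeInterval, E))
    (constPath E c₁)
  have hd : d = constPath E c₁ + T d := by
    have h1 : (1 - T) d = constPath E c₁ := by
      rw [← hu]
      change ((u : C(TimeInterval, E) →L[ℝ] C(TimeInterval, E)) * ↑u⁻¹) _ = _
      rw [u.mul_inv]; rfl
    rw [← h1]
    simp
  have hdn : ‖d‖ ≤ 2 * ‖c₁‖ := by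
    have h1 : ‖constPath E c₁‖ ≤ ‖c₁‖ :=
      (ContinuousMap.norm_le _ (norm_nonneg _)).2 fun _ => le_rfl
    have h2 : ‖d‖ ≤ ‖constPath E c₁‖ + ‖T d‖ := by
      conv_lhs => rw [hd]
      exact norm_add_le _ _
    linarith [hTn d]
  let e : ℝ → E := fun t => c₁ + ∫ s in (0 : ℝ)..t, extPath (pointwiseApply TimeInterval E E B d) s
  have he : ∀ t (ht : t ∈ TimeInterval), d ⟨t, ht⟩ = e t := fun t ht => by
    conv_lhs => rw [hd]
    rfl
  refine ⟨fun t => e (1 - t), by simp [e], fun t ht => ?_⟩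
  have ht' : 1 - t ∈ TimeInterval := ⟨by linarith [ht.2], by linarith [ht.1]⟩
  constructor
  · have h1 : HasDerivAt e (-A (1 - (1 - t)) (e (1 - t))) (1 - t) := by
      have h2 := (hasDerivAt_integral_extPath (pointwiseApply TimeInterval E E B d)
        (1 - t)).const_add c₁
      rw [extPath_of_mem _ ht', pointwiseApply_apply, he] at h2
      exact h2
    have h3 := h1.scomp t ((hasDerivAt_id t).const_sub 1)
    have h4 : (1 : ℝ) - (1 - t) = t := by ring
    rw [h4, smul_neg, neg_smul, one_smul, neg_neg] at h3
    exact h3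
  · change ‖e (1 - t)‖ ≤ _
    rw [← he _ ht']
    exact (d.norm_coe_le_norm _).trans hdn

end LinearODE

/-- Solutions of `v' = F` with `‖F‖ ≤ ½ ‖v‖` at most double in unit time. -/
theorem norm_le_two_mul_of_deriv {E : Type} [NormedAddCommGroup E] [NormedSpace ℝ E]
    {v v' : ℝ → E} (hv : ∀ t ∈ Set.Icc (0 : ℝ) 1, HasDerivAt v (v' t) t)
    (hb : ∀ t ∈ Set.Icc (0 : ℝ) 1, ‖v' t‖ ≤ 1 / 2 * ‖v t‖) {t : ℝ} (ht : t ∈ Set.Icc (0 : ℝ) 1) :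
    ‖v t‖ ≤ 2 * ‖v 0‖ := by
  have h := norm_le_gronwallBound_of_norm_deriv_right_le (f := v) (f' := v') (δ := ‖v 0‖)
    (K := 1 / 2) (ε := 0) (a := 0) (b := 1)
    (fun t ht => (hv t ht).continuousAt.continuousWithinAt)
    (fun t ht => (hv t ⟨ht.1, ht.2.le⟩).hasDerivWithinAt) le_rfl
    (fun t ht => by simpa using hb t ⟨ht.1, ht.2.le⟩) t ht
  refine h.trans ?_
  rw [gronwallBound_ε0, mul_comm]
  gcongr
  have h1 : Real.exp (1 / 2 * (t - 0)) ≤ Real.exp (1 / 2) := by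
    apply Real.exp_le_exp.2; linarith [ht.2]
  have h2 : Real.exp (1 / 2) ≤ 2 := by
    have h3 : Real.exp (1 / 2) * Real.exp (1 / 2) = Real.exp 1 := by
      rw [← Real.exp_add]; norm_num
    nlinarith [Real.exp_one_lt_d9, Real.exp_pos (1 / 2)]
  exact h1.trans h2

/-- A continuous family of bihomogeneous maps is bounded over compact sets. -/
theorem exists_bound_of_bihomogeneous {B : R8 → R8 → R8 → R8} {K : Set R8} (hK : IsCompact K)
    (hB : ContinuousOn (fun p : R8 × R8 × R8 => B p.1 p.2.1 p.2.2) (K ×ˢ Set.univ))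
    (h1 : ∀ y ∈ K, ∀ (c : ℝ) u v, B y (c • u) v = c • B y u v)
    (h2 : ∀ y ∈ K, ∀ (c : ℝ) u v, B y u (c • v) = c • B y u v) :
    ∃ C > 0, ∀ y ∈ K, ∀ u v, ‖B y u v‖ ≤ C * ‖u‖ * ‖v‖ := by
  let S := Metric.closedBall (0 : R8) 1
  have hS : IsCompact S := isCompact_closedBall _ _
  obtain ⟨C, hC⟩ := (hK.prod (hS.prod hS)).exists_bound_of_continuousOn
    (hB.mono (Set.prod_mono le_rfl (Set.subset_univ _)))
  refine ⟨max C 1, by positivity, fun y hy u v => ?_⟩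
  have hmem : ∀ u : R8, ‖u‖⁻¹ • u ∈ S := fun u => by
    rw [mem_closedBall_zero_iff, norm_smul, norm_inv, norm_norm]
    exact inv_mul_le_one
  have hs : ∀ u : R8, u = ‖u‖ • (‖u‖⁻¹ • u) := fun u => by
    rcases eq_or_ne u 0 with rfl | hu
    · simp
    · rw [smul_smul, mul_inv_cancel₀ (norm_ne_zero_iff.2 hu), one_smul]
  conv_lhs => rw [hs u, hs v, h1 y hy, h2 y hy, norm_smul, norm_smul, norm_norm, norm_norm]
  have h3 := hC (y, ‖u‖⁻¹ • u, ‖v‖⁻¹ • v) ⟨hy, hmem u, hmem v⟩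
  calc ‖u‖ * (‖v‖ * ‖B y (‖u‖⁻¹ • u) (‖v‖⁻¹ • v)‖) ≤ ‖u‖ * (‖v‖ * max C 1) := by
        gcongr
        exact h3.trans (le_max_left _ _)
    _ = max C 1 * ‖u‖ * ‖v‖ := by ring

section CoframeODE

variable {θ : R8 → R8 →L[ℝ] R8} {Ω : Set R8}

theorem contDiffOn_inverse (hθ : ContDiffOn ℝ ∞ θ Ω) (hi : ∀ y ∈ Ω, (θ y).IsInvertible) :
    ContDiffOn ℝ ∞ (fun y => (θ y).inverse) Ω := fun y hy => by
  obtain ⟨e, he⟩ := hi y hy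
  have h := contDiffAt_map_inverse (n := ∞) (𝕜 := ℝ) e
  rw [he] at h
  exact h.comp_contDiffWithinAt y (hθ y hy)

theorem contDiffOn_koszul (hΩ : IsOpen Ω) (hθ : ContDiffOn ℝ ∞ θ Ω) {P : Type*}
    [NormedAddCommGroup P] [NormedSpace ℝ P] {s : Set P} {y u v w : P → R8}
    (hy : ContDiffOn ℝ ∞ y s) (hys : ∀ p ∈ s, y p ∈ Ω) (hu : ContDiffOn ℝ ∞ u s)
    (hv : ContDiffOn ℝ ∞ v s) (hw : ContDiffOn ℝ ∞ w s) :
    ContDiffOn ℝ ∞ (fun p => koszul θ (y p) (u p) (v p) (w p)) s := by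
  have h1 : ContDiffOn ℝ ∞ (fun p => θ (y p)) s := hθ.comp hy hys
  have h2 : ContDiffOn ℝ ∞ (fun p => fderiv ℝ θ (y p)) s :=
    (hθ.fderiv_of_isOpen hΩ (m := ∞) (by simp)).comp hy hys
  have h3 : ∀ {a b c : P → R8}, ContDiffOn ℝ ∞ a s → ContDiffOn ℝ ∞ b s → ContDiffOn ℝ ∞ c s →
      ContDiffOn ℝ ∞ (fun p => dMetric θ (y p) (a p) (b p) (c p)) s := fun ha hb hc =>
    (((h2.clm_apply ha).clm_apply hb).inner ℝ (h1.clm_apply hc)).add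
      ((h1.clm_apply hb).inner ℝ ((h2.clm_apply ha).clm_apply hc))
  exact contDiffOn_const.mul (((h3 hu hv hw).add (h3 hv hu hw)).sub (h3 hw hu hv))

theorem contDiffOn_gam (hΩ : IsOpen Ω) (hθ : ContDiffOn ℝ ∞ θ Ω)
    (hi : ∀ y ∈ Ω, (θ y).IsInvertible) {P : Type*}
    [NormedAddCommGroup P] [NormedSpace ℝ P] {s : Set P} {y u v : P → R8}
    (hy : ContDiffOn ℝ ∞ y s) (hys : ∀ p ∈ s, y p ∈ Ω) (hu : ContDiffOn ℝ ∞ u s)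
    (hv : ContDiffOn ℝ ∞ v s) :
    ContDiffOn ℝ ∞ (fun p => gam θ (y p) (u p) (v p)) s := by
  have h1 : ∀ k : Fin 8, ContDiffOn ℝ ∞
      (fun p => (θ (y p)).inverse (EuclideanSpace.single k 1)) s := fun k =>
    ((contDiffOn_inverse hθ hi).comp hy hys).clm_apply contDiffOn_const
  exact ContDiffOn.sum fun k _ => (contDiffOn_koszul hΩ hθ hy hys hu hv (h1 k)).smul (h1 k)

theorem contDiffOn_conn (hΩ : IsOpen Ω) (hθ : ContDiffOn ℝ ∞ θ Ω)
    (hi : ∀ y ∈ Ω, (θ y).IsInvertible) {P : Type*}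
    [NormedAddCommGroup P] [NormedSpace ℝ P] {s : Set P} {y u v : P → R8}
    (hy : ContDiffOn ℝ ∞ y s) (hys : ∀ p ∈ s, y p ∈ Ω) (hu : ContDiffOn ℝ ∞ u s)
    (hv : ContDiffOn ℝ ∞ v s) :
    ContDiffOn ℝ ∞ (fun p => conn θ (y p) (u p) (v p)) s := by
  have h1 : ContDiffOn ℝ ∞ (fun p => (θ (y p)).inverse (v p)) s :=
    ((contDiffOn_inverse hθ hi).comp hy hys).clm_apply hv
  have h2 : ContDiffOn ℝ ∞ (fun p => fderiv ℝ θ (y p)) s :=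
    (hθ.fderiv_of_isOpen hΩ (m := ∞) (by simp)).comp hy hys
  exact ((h2.clm_apply hu).clm_apply h1).sub
    ((hθ.comp hy hys).clm_apply (contDiffOn_gam hΩ hθ hi hy hys hu h1))

theorem exists_bound_gam (hΩ : IsOpen Ω) (hθ : ContDiffOn ℝ ∞ θ Ω)
    (hi : ∀ y ∈ Ω, (θ y).IsInvertible) {K : Set R8} (hK : IsCompact K) (hKΩ : K ⊆ Ω) :
    ∃ C > 0, ∀ y ∈ K, ∀ u v, ‖gam θ y u v‖ ≤ C * ‖u‖ * ‖v‖ :=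
  exists_bound_of_bihomogeneous hK
    (contDiffOn_gam hΩ hθ hi contDiff_fst.contDiffOn (fun _ hp => hKΩ hp.1)
      (contDiff_fst.comp contDiff_snd).contDiffOn
      (contDiff_snd.comp contDiff_snd).contDiffOn).continuousOn
    (fun _ _ c u v => gam_smul_left c u v) (fun _ _ c u v => gam_smul_right c u v)

theorem exists_bound_conn (hΩ : IsOpen Ω) (hθ : ContDiffOn ℝ ∞ θ Ω)
    (hi : ∀ y ∈ Ω, (θ y).IsInvertible) {K : Set R8} (hK : IsCompact K) (hKΩ : K ⊆ Ω) :
    ∃ C > 0, ∀ y ∈ K, ∀ u v, ‖conn θ y u v‖ ≤ C * ‖u‖ * ‖v‖ :=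
  exists_bound_of_bihomogeneous hK
    (contDiffOn_conn hΩ hθ hi contDiff_fst.contDiffOn (fun _ hp => hKΩ hp.1)
      (contDiff_fst.comp contDiff_snd).contDiffOn
      (contDiff_snd.comp contDiff_snd).contDiffOn).continuousOn
    (fun _ _ c u v => conn_smul_left c u v) (fun _ _ c u v => (connLin θ _ u).map_smul c v)

/-- The geodesic flow near a point of the zero section, in coordinates: geodesics with small
initial velocity exist on `(-1, 2)` and stay near the point, their speed at most doubles, and the
time-one map is smooth, with derivative `(u, v) ↦ u + v` along the zero section. -/
theorem exists_geodesic_flow (hΩ : IsOpen Ω) (hθ : ContDiffOn ℝ ∞ θ Ω)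
    (hi : ∀ y ∈ Ω, (θ y).IsInvertible) {y₀ : R8} (hy₀ : y₀ ∈ Ω) {η : ℝ} (hη : 0 < η) :
    ∃ r > 0, ∃ Y V : R8 × R8 → ℝ → R8,
      (∀ z ∈ Metric.ball (y₀, (0 : R8)) r, Y z 0 = z.1 ∧ V z 0 = z.2 ∧
        (∀ t ∈ Set.Ioo (-1 : ℝ) 2, HasDerivAt (Y z) (V z t) t ∧
          HasDerivAt (V z) (-gam θ (Y z t) (V z t) (V z t)) t ∧ Y z t ∈ Ω ∧
          ‖Y z t - y₀‖ < η ∧ ‖V z t‖ < η) ∧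
        ∀ t ∈ Set.Icc (0 : ℝ) 1, ‖V z t‖ ≤ 2 * ‖z.2‖) ∧
      ContDiffOn ℝ ∞ (fun z => Y z 1) (Metric.ball (y₀, (0 : R8)) r) ∧
      ∀ y : R8, (y, (0 : R8)) ∈ Metric.ball (y₀, (0 : R8)) r → Y (y, 0) 1 = y ∧
        HasFDerivAt (fun z => Y z 1)
          (ContinuousLinearMap.fst ℝ R8 R8 + ContinuousLinearMap.snd ℝ R8 R8) (y, 0) := by
  obtain ⟨ρ, hρ, hρΩ⟩ := Metric.isOpen_iff.1 hΩ y₀ hy₀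
  -- A cut-off makes the right-hand side `F` of the geodesic equation globally defined; since it is
  -- quadratic in the velocity, it vanishes to first order at `(y₀, 0)`.
  let χ : ContDiffBump y₀ := ⟨ρ / 4, ρ / 2, by positivity, by linarith⟩
  let F : R8 × R8 → R8 := fun p => -(χ p.1 • gam θ p.1 p.2 p.2)
  have hF : ContDiff ℝ ∞ F := by
    rw [contDiff_iff_contDiffAt]
    intro p
    by_cases hp : p.1 ∈ Ω
    · have h1 : ContDiffOn ℝ ∞ F (Ω ×ˢ Set.univ) :=
        ((χ.contDiff.comp contDiff_fst).contDiffOn.smul (contDiffOn_gam hΩ hθ hi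
          contDiff_fst.contDiffOn (fun p hp => hp.1) contDiff_snd.contDiffOn
          contDiff_snd.contDiffOn)).neg
      exact h1.contDiffAt ((hΩ.prod isOpen_univ).mem_nhds ⟨hp, trivial⟩)
    · have h1 : F =ᶠ[𝓝 p] fun _ => 0 := by
        have h2 : {q : R8 × R8 | ρ / 2 < dist q.1 y₀} ∈ 𝓝 p := by
          refine (isOpen_lt continuous_const (by fun_prop)).mem_nhds ?_
          by_contra hc
          exact hp (hρΩ (by
            rw [Metric.mem_ball]
            have : dist p.1 y₀ ≤ ρ / 2 := not_lt.1 hc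
            linarith))
        filter_upwards [h2] with q hq
        have : χ q.1 = 0 := χ.zero_of_le_dist (le_of_lt hq)
        simp [F, this]
      exact contDiffAt_const.congr_of_eventuallyEq h1
  have hgz : ∀ y, gam θ y 0 0 = 0 := fun y => by simpa using gam_smul_left (θ := θ) (y := y) 0 0 0
  have hF0 : F (y₀, 0) = 0 := by simp [F, hgz]
  obtain ⟨C, hC, hCb⟩ := exists_bound_gam hΩ hθ hi (isCompact_closedBall y₀ (ρ / 2))
    ((Metric.closedBall_subset_ball (by linarith)).trans hρΩ)
  have hFb : ∀ p, ‖F p‖ ≤ C * ‖p.2‖ * ‖p.2‖ := fun p => by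
    by_cases hp : p.1 ∈ Metric.closedBall y₀ (ρ / 2)
    · simp only [F, norm_neg, norm_smul]
      have h1 : ‖χ p.1‖ ≤ 1 := by
        rw [Real.norm_of_nonneg χ.nonneg]; exact χ.le_one
      calc ‖χ p.1‖ * ‖gam θ p.1 p.2 p.2‖ ≤ 1 * ‖gam θ p.1 p.2 p.2‖ := by gcongr
        _ ≤ _ := by rw [one_mul]; exact hCb _ hp _ _
    · have : χ p.1 = 0 := χ.zero_of_le_dist (by
        rw [Metric.mem_closedBall, not_le] at hp; exact hp.le)
      simp only [F, this, zero_smul, neg_zero, norm_zero]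
      positivity
  have hF1 : fderiv ℝ F (y₀, 0) = 0 := by
    refine HasFDerivAt.fderiv ?_
    rw [hasFDerivAt_iff_isLittleO_nhds_zero]
    have h1 : (fun h : R8 × R8 => F ((y₀, 0) + h) - F (y₀, 0) - (0 : R8 × R8 →L[ℝ] R8) h)
        =O[𝓝 0] fun h => ‖h‖ ^ 2 := by
      refine Asymptotics.IsBigO.of_bound C (Filter.Eventually.of_forall fun h => ?_)
      rw [hF0, sub_zero, zero_apply, sub_zero]
      refine (hFb _).trans ?_
      have : ‖((y₀, (0 : R8)) + h).2‖ ≤ ‖h‖ := by simpa using norm_snd_le h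
      rw [Real.norm_of_nonneg (by positivity), pow_two, ← mul_assoc]
      gcongr
    exact h1.trans_isLittleO (Asymptotics.isLittleO_norm_pow_id one_lt_two)
  -- The bound `1 / (2C)` gives `‖F(y, v)‖ ≤ C ‖v‖² ≤ ½ ‖v‖` along solutions.
  set δ := min (min (ρ / 4) η) (1 / (2 * C)) with hδ
  have hδ0 : 0 < δ := by positivity
  obtain ⟨r, hr, Y, V, hYV, hsm⟩ := exists_second_order_flow hF y₀ hF0 hF1 hδ0
  have hmul : ∀ z ∈ Metric.ball (y₀, (0 : R8)) r, ∀ t ∈ Set.Icc (0 : ℝ) 1,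
      ‖V z t‖ ≤ 2 * ‖z.2‖ := by
    intro z hz t ht
    obtain ⟨-, h0, h1⟩ := hYV z hz
    rw [← h0]
    refine norm_le_two_mul_of_deriv (v' := fun t => F (Y z t, V z t))
      (fun t ht => (h1 t ⟨by linarith [ht.1], by linarith [ht.2]⟩).2.1) (fun t ht => ?_) ht
    have h2 := (h1 t ⟨by linarith [ht.1], by linarith [ht.2]⟩).2.2.2
    have h3 : C * ‖V z t‖ ≤ 1 / 2 := by
      have h4 : ‖V z t‖ ≤ 1 / (2 * C) := h2.le.trans (min_le_right _ _)
      calc C * ‖V z t‖ ≤ C * (1 / (2 * C)) := by gcongr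
        _ = 1 / 2 := by field_simp
    exact (hFb _).trans (by gcongr)
  refine ⟨r, hr, Y, V, fun z hz => ?_, hsm, fun y hy => ?_⟩
  · obtain ⟨h0, h0', h1⟩ := hYV z hz
    refine ⟨h0, h0', fun t ht => ?_, hmul z hz⟩
    obtain ⟨h2, h3, h4, h5⟩ := h1 t ht
    have h6 : dist (Y z t) y₀ < ρ / 4 := by
      rw [dist_eq_norm]
      exact h4.trans_le ((min_le_left _ _).trans (min_le_left _ _))
    refine ⟨h2, ?_, hρΩ (by rw [Metric.mem_ball]; linarith),
      h4.trans_le ((min_le_left _ _).trans (min_le_right _ _)),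
      h5.trans_le ((min_le_left _ _).trans (min_le_right _ _))⟩
    have h7 : χ (Y z t) = 1 := χ.one_of_mem_closedBall (Metric.mem_closedBall.2 h6.le)
    simpa [F, h7] using h3
  · -- `Y z 1 = z.1 + z.2 + O(‖z.2‖²)`
    have hq : ∀ z ∈ Metric.ball (y₀, (0 : R8)) r,
        ‖Y z 1 - z.1 - z.2‖ ≤ 4 * C * ‖z.2‖ ^ 2 := by
      intro z hz
      obtain ⟨h0, h0', h1⟩ := hYV z hz
      have hVb : ∀ t ∈ Set.Icc (0 : ℝ) 1, ‖V z t - z.2‖ ≤ 4 * C * ‖z.2‖ ^ 2 := by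
        intro t ht
        have h2 := norm_image_sub_le_of_norm_deriv_le_segment_01' (f := fun s => V z (s * t))
          (f' := fun s => t • F (Y z (s * t), V z (s * t))) (C := 4 * C * ‖z.2‖ ^ 2)
          (fun s hs => by
            have hst : s * t ∈ Set.Icc (0 : ℝ) 1 :=
              ⟨mul_nonneg hs.1 ht.1, mul_le_one₀ hs.2 ht.1 ht.2⟩
            exact ((h1 (s * t) ⟨by linarith [hst.1], by linarith [hst.2]⟩).2.1.scomp s
              (by simpa using (hasDerivAt_id s).mul_const t)).hasDerivWithinAt)
          (fun s hs => by
            have hst : s * t ∈ Set.Icc (0 : ℝ) 1 :=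
              ⟨mul_nonneg hs.1 ht.1, mul_le_one₀ hs.2.le ht.1 ht.2⟩
            have h3 := hmul z hz _ hst
            have h4 := hFb (Y z (s * t), V z (s * t))
            rw [norm_smul, Real.norm_of_nonneg ht.1]
            calc t * ‖F (Y z (s * t), V z (s * t))‖
                ≤ 1 * (C * (2 * ‖z.2‖) * (2 * ‖z.2‖)) := by
                  gcongr
                  · exact ht.2
                  · exact h4.trans (by gcongr)
              _ = 4 * C * ‖z.2‖ ^ 2 := by ring)
        simpa [h0'] using h2
      have h5 := norm_image_sub_le_of_norm_deriv_le_segment_01' (f := fun s => Y z s - s • z.2)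
          (f' := fun s => V z s - z.2) (C := 4 * C * ‖z.2‖ ^ 2)
          (fun s hs => by
            refine HasDerivAt.hasDerivWithinAt ?_
            exact (h1 s ⟨by linarith [hs.1], by linarith [hs.2]⟩).1.sub
              (by simpa using (hasDerivAt_id s).smul_const z.2))
          (fun s hs => hVb s ⟨hs.1, hs.2.le⟩)
      rw [one_smul, zero_smul, sub_zero, h0] at h5
      rwa [sub_right_comm]
    have hE : Y (y, 0) 1 = y := by
      have := hq _ hy
      simp only [sub_zero, norm_zero, ne_eq, OfNat.ofNat_ne_zero, not_false_eq_true, zero_pow,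
        mul_zero] at this
      exact sub_eq_zero.1 (norm_le_zero_iff.1 this)
    refine ⟨hE, ?_⟩
    rw [hasFDerivAt_iff_isLittleO_nhds_zero]
    have h1 : (fun h : R8 × R8 => Y ((y, 0) + h) 1 - Y (y, 0) 1
        - (ContinuousLinearMap.fst ℝ R8 R8 + ContinuousLinearMap.snd ℝ R8 R8) h)
        =O[𝓝 0] fun h => ‖h‖ ^ 2 := by
      refine Asymptotics.IsBigO.of_bound (4 * C) ?_
      have h2 : ∀ᶠ h in 𝓝 (0 : R8 × R8), (y, (0 : R8)) + h ∈ Metric.ball (y₀, (0 : R8)) r := by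
        have : ContinuousAt (fun h : R8 × R8 => (y, (0 : R8)) + h) 0 := by fun_prop
        exact this.eventually (Metric.isOpen_ball.mem_nhds (by simpa using hy))
      filter_upwards [h2] with h hh
      have h3 := hq _ hh
      have h4 : Y ((y, 0) + h) 1 - Y (y, 0) 1
          - (ContinuousLinearMap.fst ℝ R8 R8 + ContinuousLinearMap.snd ℝ R8 R8) h =
          Y ((y, 0) + h) 1 - ((y, (0 : R8)) + h).1 - ((y, (0 : R8)) + h).2 := by
        rw [hE]
        simp only [add_apply, ContinuousLinearMap.coe_fst', ContinuousLinearMap.coe_snd',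
          Prod.fst_add, Prod.snd_add, zero_add]
        abel
      rw [h4]
      refine h3.trans ?_
      rw [Real.norm_of_nonneg (by positivity)]
      have : ‖((y, (0 : R8)) + h).2‖ ≤ ‖h‖ := by simpa using norm_snd_le h
      gcongr
    exact h1.trans_isLittleO (Asymptotics.isLittleO_norm_pow_id one_lt_two)

end CoframeODE

theorem eventually_mem_source {M : Type*} [TopologicalSpace M] [ChartedSpace R8 M] {γ : ℝ → M}
    {t : ℝ} {p : M} (hγ : ContinuousAt γ t) (hp : γ t ∈ (chartAt R8 p).source) :
    ∀ᶠ r in 𝓝 t, γ r ∈ (chartAt R8 p).source :=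
  hγ.eventually ((chartAt R8 p).open_source.mem_nhds hp)

section Curves

theorem differentiableAt_deriv {x : ℝ → R8} {t : ℝ} (hx : ContDiffAt ℝ 2 x t) :
    DifferentiableAt ℝ (deriv x) t := by
  have : ContDiffAt ℝ 1 (fderiv ℝ x) t := hx.fderiv_right (by norm_num)
  have h3 : deriv x = fun r => fderiv ℝ x r 1 := by
    funext r; exact fderiv_apply_one_eq_deriv.symm
  rw [h3]
  exact (this.differentiableAt (by norm_num)).clm_apply (differentiableAt_const _)

variable {M : Type*} [TopologicalSpace M] [ChartedSpace R8 M] [IsManifold (𝓡 8) ∞ M]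

theorem tangentBundle_ext {p : M} {a b : TangentBundle (𝓡 8) M}
    (ha : a.proj ∈ (chartAt R8 p).source) (h1 : a.proj = b.proj)
    (h2 : toCoords p a.proj a.2 = toCoords p b.proj b.2) : a = b := by
  obtain ⟨q, u⟩ := a
  obtain ⟨q', v⟩ := b
  obtain rfl : q = q' := h1
  exact congrArg _ ((toCoords_bijective ha).injective h2)

theorem contMDiffAt_chart {p q : M} {n : ℕ∞} (hq : q ∈ (chartAt R8 p).source) :
    ContMDiffAt (𝓡 8) 𝓘(ℝ, R8) n (extChartAt (𝓡 8) p) q :=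
  (contMDiffAt_extChartAt' (n := ∞) hq).of_le (by exact_mod_cast le_top)

theorem contMDiffAt_chart_symm {p : M} {y : R8} {n : ℕ∞} (hy : y ∈ (extChartAt (𝓡 8) p).target) :
    ContMDiffAt 𝓘(ℝ, R8) (𝓡 8) n (extChartAt (𝓡 8) p).symm y :=
  (((contMDiffOn_extChartAt_symm (n := ∞) p).contMDiffAt
    ((isOpen_extChartAt_target p).mem_nhds hy))).of_le (by exact_mod_cast le_top)

/-- The components of the differential of a map are the differential of its coordinates. -/
theorem toCoords_mfderiv {E H N : Type*} [NormedAddCommGroup E] [NormedSpace ℝ E]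
    [TopologicalSpace H] {I : ModelWithCorners ℝ E H} [TopologicalSpace N] [ChartedSpace H N]
    {f : N → M} {x : N} {p : M} (hx : f x ∈ (chartAt R8 p).source)
    (hf : MDifferentiableAt I (𝓡 8) f x) (w : TangentSpace I x) :
    toCoords p (f x) (mfderiv I (𝓡 8) f x w) =
      (show R8 from mfderiv I 𝓘(ℝ, R8) (fun y => extChartAt (𝓡 8) p (f y)) x w) := by
  have h1 := mfderiv_comp x
    ((contMDiffAt_chart (n := 1) hx).mdifferentiableAt (by simp)) hf
  have h2 : mfderiv (𝓡 8) 𝓘(ℝ, R8) (extChartAt (𝓡 8) p) (f x) =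
      tangentCoordChange (𝓡 8) (f x) p (f x) :=
    mfderiv_chartAt_eq_tangentCoordChange (I := 𝓡 8) hx
  change _ = (mfderiv I 𝓘(ℝ, R8) (extChartAt (𝓡 8) p ∘ f) x w : R8)
  rw [h1, h2]
  exact toCoords_eq_change hx _

theorem contDiffAt_chart_comp {γ : ℝ → M} {t : ℝ} {p : M}
    (hγ : ContMDiffAt 𝓘(ℝ, ℝ) (𝓡 8) 2 γ t) (hp : γ t ∈ (chartAt R8 p).source) :
    ContDiffAt ℝ 2 (fun r => extChartAt (𝓡 8) p (γ r)) t :=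
  contMDiffAt_iff_contDiffAt.1 ((contMDiffAt_chart (n := 2) hp).comp t hγ)

theorem deriv_chart_comp {γ : ℝ → M} {t : ℝ} {p q : M} (hγ : ContMDiffAt 𝓘(ℝ, ℝ) (𝓡 8) 2 γ t)
    (hq : γ t ∈ (chartAt R8 q).source) (hp : γ t ∈ (chartAt R8 p).source) :
    deriv (fun r => extChartAt (𝓡 8) p (γ r)) t =
      fderiv ℝ (transition q p) (extChartAt (𝓡 8) q (γ t))
        (deriv (fun r => extChartAt (𝓡 8) q (γ r)) t) := by
  have h1 : (fun r => extChartAt (𝓡 8) p (γ r)) =ᶠ[𝓝 t]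
      fun r => transition q p (extChartAt (𝓡 8) q (γ r)) := by
    filter_upwards [eventually_mem_source hγ.continuousAt hq] with r hr
    rw [transition_apply hr]
  rw [h1.deriv_eq]
  exact (((transition_contDiffAt hq hp).differentiableAt (by simp)).hasFDerivAt.comp_hasDerivAt t
    ((contDiffAt_chart_comp hγ hq).differentiableAt (by norm_num)).hasDerivAt).deriv

/-- The geodesic equation, formulated in the chart at `γ t` itself, may be tested in any chart with
a local coframe. -/
theorem isGeodesicAt_iff {Φ : Π q : M, Form4 q} {p : M} {Ω : Set R8} {θ : R8 → R8 →L[ℝ] R8}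
    (h : IsLocalCoframe Φ p Ω θ) {γ : ℝ → M} {t : ℝ} (hp : γ t ∈ (chartAt R8 p).source)
    (hΩ : extChartAt (𝓡 8) p (γ t) ∈ Ω) :
    IsGeodesicAt Φ γ t ↔ ContMDiffAt 𝓘(ℝ, ℝ) (𝓡 8) 2 γ t ∧
      deriv (deriv fun r => extChartAt (𝓡 8) p (γ r)) t =
        -gam θ (extChartAt (𝓡 8) p (γ t)) (deriv (fun r => extChartAt (𝓡 8) p (γ r)) t)
          (deriv (fun r => extChartAt (𝓡 8) p (γ r)) t) := by
  refine and_congr_right fun hγ => ?_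
  set q := γ t with hq
  have hqq : γ t ∈ (chartAt R8 q).source := mem_chart_source R8 q
  set χ := transition q p with hχ
  set x : ℝ → R8 := fun r => extChartAt (𝓡 8) q (γ r) with hx
  set y : ℝ → R8 := fun r => extChartAt (𝓡 8) p (γ r) with hy
  have hχt : χ (x t) = y t := transition_apply hqq
  -- In the chart at `q = γ t` the coframe is `changeCoframe θ χ`. The second derivatives of `χ` in
  -- the transformation law of the Christoffel symbols cancel those in `(χ ∘ x)''`.
  have hch := h.change q
  have hxΩ : extChartAt (𝓡 8) q q ∈ (extChartAt (𝓡 8) q).target ∩ (extChartAt (𝓡 8) q).symm ⁻¹'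
      ((chartAt R8 p).source ∩ extChartAt (𝓡 8) p ⁻¹' Ω) := by
    refine ⟨chart_mem_target hqq, ?_⟩
    rw [Set.mem_preimage, symm_chart hqq]
    exact ⟨hp, hΩ⟩
  have hgam : christoffel Φ q q (velocity γ t) (velocity γ t) =
      gam (changeCoframe θ χ) (x t) (deriv x t) (deriv x t) :=
    hch.christoffel_eq hqq hxΩ _ _
  have hi : (fderiv ℝ χ (x t)).IsInvertible := fderiv_transition_isInvertible hqq hp
  have hχ2 : ContDiffAt ℝ 2 χ (x t) :=
    (transition_contDiffAt hqq hp).of_le ENat.LEInfty.out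
  have hx2 : ContDiffAt ℝ 2 x t := contDiffAt_chart_comp hγ hqq
  -- the second derivative of `y = χ ∘ x`
  have hdy : deriv y =ᶠ[𝓝 t] fun r => fderiv ℝ χ (x r) (deriv x r) := by
    filter_upwards [eventually_mem_source hγ.continuousAt hqq,
      eventually_mem_source hγ.continuousAt hp,
      contMDiffAt_iff_contMDiffAt_nhds (by simp) |>.1 hγ] with r hr1 hr2 hr3
    exact deriv_chart_comp hr3 hr1 hr2
  have hdx : HasDerivAt x (deriv x t) t := (hx2.differentiableAt (by norm_num)).hasDerivAt
  have hdx1 : DifferentiableAt ℝ (deriv x) t := differentiableAt_deriv hx2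
  have hdd : deriv (deriv y) t = fderiv ℝ (fderiv ℝ χ) (x t) (deriv x t) (deriv x t)
      + fderiv ℝ χ (x t) (deriv (deriv x) t) := by
    rw [hdy.deriv_eq]
    have h4 : HasFDerivAt (fderiv ℝ χ) (fderiv ℝ (fderiv ℝ χ) (x t)) (x t) :=
      ((hχ2.fderiv_right (m := 1) (by norm_num)).differentiableAt (by norm_num)).hasFDerivAt
    exact ((h4.comp_hasDerivAt t hdx).clm_apply hdx1.hasDerivAt).deriv
  have hvel : deriv y t = fderiv ℝ χ (x t) (deriv x t) := hdy.eq_of_nhds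
  have hT := fderiv_gam_changeCoframe (θ := θ) (y := x t) (χ := χ)
    (by rw [hχt]; exact h.differentiableAt hΩ) hχ2 (by rw [hχt]; exact h.isInvertible hΩ) hi
    (deriv x t) (deriv x t)
  rw [hχt, ← hvel] at hT
  have hinj : Function.Injective (fderiv ℝ χ (x t)) := by
    obtain ⟨e, he⟩ := hi
    rw [← he]; exact e.injective
  rw [hgam, ← hinj.eq_iff, map_zero, eq_neg_iff_add_eq_zero]
  change fderiv ℝ χ (x t) (deriv (deriv x) t + _) = 0 ↔ _
  rw [map_add, hT, hdd]
  refine Eq.congr ?_ rfl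
  abel

end Curves

section Geodesics

variable {M : Type*} [TopologicalSpace M] [ChartedSpace R8 M] [IsManifold (𝓡 8) ∞ M]
variable {Φ : Π q : M, Form4 q} {p : M} {Ω : Set R8} {θ : R8 → R8 →L[ℝ] R8}

theorem contDiffAt_two_of_hasDerivAt {Y V G : ℝ → R8} {I : Set ℝ} (hI : IsOpen I)
    (hY : ∀ t ∈ I, HasDerivAt Y (V t) t) (hV : ∀ t ∈ I, HasDerivAt V (G t) t)
    (hG : ContinuousOn G I) {t : ℝ} (ht : t ∈ I) : ContDiffAt ℝ 2 Y t := by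
  have h1 : ContDiffOn ℝ (0 + 1) V I := by
    rw [contDiffOn_succ_iff_deriv_of_isOpen hI]
    refine ⟨fun t ht => (hV t ht).differentiableAt.differentiableWithinAt, by simp, ?_⟩
    rw [contDiffOn_zero]
    exact hG.congr fun t ht => (hV t ht).deriv
  have h2 : ContDiffOn ℝ (1 + 1) Y I := by
    rw [contDiffOn_succ_iff_deriv_of_isOpen hI]
    refine ⟨fun t ht => (hY t ht).differentiableAt.differentiableWithinAt, by simp, ?_⟩
    rw [zero_add] at h1
    exact h1.congr fun t ht => (hY t ht).deriv
  rw [one_add_one_eq_two] at h2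
  exact h2.contDiffAt (hI.mem_nhds ht)

/-- A solution of the geodesic equation in a chart, with the initial velocity `a`, is a geodesic
from `a`. -/
theorem isGeodesicFrom_of_solution (h : IsLocalCoframe Φ p Ω θ) {Y V : ℝ → R8}
    (hYV : ∀ t ∈ Set.Ioo (-1 : ℝ) 2, HasDerivAt Y (V t) t ∧
      HasDerivAt V (-gam θ (Y t) (V t) (V t)) t ∧ Y t ∈ Ω)
    {a : TangentBundle (𝓡 8) M} (ha : a.proj ∈ (chartAt R8 p).source)
    (h0 : Y 0 = extChartAt (𝓡 8) p a.proj) (h1 : V 0 = toCoords p a.proj a.2) :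
    IsGeodesicFrom Φ a (fun t => (extChartAt (𝓡 8) p).symm (Y t)) := by
  set γ : ℝ → M := fun t => (extChartAt (𝓡 8) p).symm (Y t) with hγ
  have hYc : ContinuousOn Y (Set.Ioo (-1 : ℝ) 2) := fun t ht =>
    (hYV t ht).1.continuousAt.continuousWithinAt
  have hVc : ContinuousOn V (Set.Ioo (-1 : ℝ) 2) := fun t ht =>
    (hYV t ht).2.1.continuousAt.continuousWithinAt
  have hG : ContinuousOn (fun t => -gam θ (Y t) (V t) (V t)) (Set.Ioo (-1 : ℝ) 2) := by
    have h2 : ContDiffOn ℝ ∞ (fun z : R8 × R8 => gam θ z.1 z.2 z.2) (Ω ×ˢ Set.univ) :=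
      contDiffOn_gam h.isOpen h.contDiffOn (fun y hy => h.isInvertible hy)
        contDiff_fst.contDiffOn (fun _ hp => hp.1)
        contDiff_snd.contDiffOn contDiff_snd.contDiffOn
    have h3 : Set.MapsTo (fun t => (Y t, V t)) (Set.Ioo (-1 : ℝ) 2) (Ω ×ˢ Set.univ) :=
      fun t ht => ⟨(hYV t ht).2.2, trivial⟩
    have h4 := h2.continuousOn.comp (hYc.prodMk hVc) h3
    exact h4.neg
  have hs : ∀ t ∈ Set.Ioo (-1 : ℝ) 2, γ t ∈ (chartAt R8 p).source := fun t ht =>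
    symm_mem_source (h.subset (hYV t ht).2.2)
  have hφ : ∀ t ∈ Set.Ioo (-1 : ℝ) 2, extChartAt (𝓡 8) p (γ t) = Y t := fun t ht =>
    chart_symm (h.subset (hYV t ht).2.2)
  have hφ' : ∀ t ∈ Set.Ioo (-1 : ℝ) 2, (fun r => extChartAt (𝓡 8) p (γ r)) =ᶠ[𝓝 t] Y :=
    fun t ht => Filter.eventually_of_mem (isOpen_Ioo.mem_nhds ht) hφ
  have hsm : ∀ t ∈ Set.Ioo (-1 : ℝ) 2, ContMDiffAt 𝓘(ℝ, ℝ) (𝓡 8) 2 γ t := fun t ht =>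
    (contMDiffAt_chart_symm (n := 2) (h.subset (hYV t ht).2.2)).comp t
      (contDiffAt_two_of_hasDerivAt isOpen_Ioo (fun t ht => (hYV t ht).1)
        (fun t ht => (hYV t ht).2.1) hG ht).contMDiffAt
  have hd : ∀ t ∈ Set.Ioo (-1 : ℝ) 2, deriv (fun r => extChartAt (𝓡 8) p (γ r)) t = V t :=
    fun t ht => (hφ' t ht).deriv_eq.trans (hYV t ht).1.deriv
  have h00 : (0 : ℝ) ∈ Set.Ioo (-1 : ℝ) 2 := by norm_num
  have hγ0 : γ 0 = a.proj := by
    change (extChartAt (𝓡 8) p).symm (Y 0) = _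
    rw [h0, symm_chart ha]
  refine ⟨?_, fun t ht => ?_⟩
  · refine tangentBundle_ext (p := p) (hs 0 h00) hγ0 ?_
    rw [← h1, ← hd 0 h00]
    have h3 := toCoords_mfderiv (p := p) (hs 0 h00)
      ((hsm 0 h00).mdifferentiableAt (by simp)) (1 : ℝ)
    refine h3.trans ?_
    rw [mfderiv_eq_fderiv]
    exact fderiv_apply_one_eq_deriv (𝕜 := ℝ) (f := fun r => extChartAt (𝓡 8) p (γ r))
  · have ht' : t ∈ Set.Ioo (-1 : ℝ) 2 := ⟨by linarith [ht.1], by linarith [ht.2]⟩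
    rw [isGeodesicAt_iff h (hs t ht') (by rw [hφ t ht']; exact (hYV t ht').2.2)]
    refine ⟨hsm t ht', ?_⟩
    rw [hφ t ht', hd t ht']
    have h4 : deriv (fun r => extChartAt (𝓡 8) p (γ r)) =ᶠ[𝓝 t] V :=
      Filter.eventually_of_mem (isOpen_Ioo.mem_nhds ht') hd
    exact h4.deriv_eq.trans (hYV t ht').2.1.deriv

theorem IsGeodesicFrom.apply_zero {a : TangentBundle (𝓡 8) M} {γ : ℝ → M}
    (h : IsGeodesicFrom Φ a γ) : γ 0 = a.proj := congrArg (fun a => a.proj) h.1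

theorem IsGeodesicFrom.deriv_zero {a : TangentBundle (𝓡 8) M} {γ : ℝ → M}
    (h : IsGeodesicFrom Φ a γ) (hp : a.proj ∈ (chartAt R8 p).source) :
    deriv (fun r => extChartAt (𝓡 8) p (γ r)) 0 = toCoords p a.proj a.2 := by
  obtain ⟨rfl, h⟩ := h
  have h3 := toCoords_mfderiv (f := γ) (x := 0) (p := p) hp
    ((h 0 (by simp)).1.mdifferentiableAt (by simp)) (1 : ℝ)
  refine Eq.trans ?_ h3.symm
  rw [mfderiv_eq_fderiv]
  exact fderiv_apply_one_eq_deriv.symm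

/-- Geodesics that agree up to first order at a time agree for a short while. -/
theorem geodesics_eq_right (h : IsLocalCoframe Φ p Ω θ) {γ γ' : ℝ → M} {t : ℝ}
    (ht : t ∈ Set.Ico (0 : ℝ) 1) (hγ : ∀ t ∈ Set.Icc (0 : ℝ) 1, IsGeodesicAt Φ γ t)
    (hγ' : ∀ t ∈ Set.Icc (0 : ℝ) 1, IsGeodesicAt Φ γ' t) (hp : γ t ∈ (chartAt R8 p).source)
    (hΩ : extChartAt (𝓡 8) p (γ t) ∈ Ω) (h0 : γ t = γ' t)
    (h1 : deriv (fun r => extChartAt (𝓡 8) p (γ r)) t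
      = deriv (fun r => extChartAt (𝓡 8) p (γ' r)) t) :
    ∃ ε > 0, ∀ r ∈ Set.Icc t (t + ε), γ r = γ' r := by
  have htI : t ∈ Set.Icc (0 : ℝ) 1 := ⟨ht.1, ht.2.le⟩
  -- Position and velocity solve a first-order system whose right-hand side is locally Lipschitz.
  let v : R8 × R8 → R8 × R8 := fun z => (z.2, -gam θ z.1 z.2 z.2)
  have hv : ContDiffOn ℝ ∞ v (Ω ×ˢ Set.univ) :=
    contDiff_snd.contDiffOn.prodMk (contDiffOn_gam h.isOpen h.contDiffOn
      (fun y hy => h.isInvertible hy) contDiff_fst.contDiffOn (fun _ hp => hp.1)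
      contDiff_snd.contDiffOn contDiff_snd.contDiffOn).neg
  let st : (ℝ → M) → ℝ → R8 × R8 := fun γ r => (extChartAt (𝓡 8) p (γ r),
    deriv (fun r => extChartAt (𝓡 8) p (γ r)) r)
  have hst : st γ t = st γ' t := Prod.ext (by simp only [st, h0]) h1
  have hvt : ContDiffAt ℝ 1 v (st γ t) :=
    (hv.contDiffAt ((h.isOpen.prod isOpen_univ).mem_nhds ⟨hΩ, trivial⟩)).of_le ENat.LEInfty.out
  obtain ⟨K, s, hs, hK⟩ := hvt.exists_lipschitzOnWith
  have key : ∀ γ : ℝ → M, (∀ t ∈ Set.Icc (0 : ℝ) 1, IsGeodesicAt Φ γ t) →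
      γ t ∈ (chartAt R8 p).source → extChartAt (𝓡 8) p (γ t) ∈ Ω → s ∈ 𝓝 (st γ t) →
      ∀ᶠ r in 𝓝 t, γ r ∈ (chartAt R8 p).source ∧ st γ r ∈ s ∧
        (r ∈ Set.Icc (0 : ℝ) 1 → HasDerivAt (st γ) (v (st γ r)) r) := by
    intro γ hγ hp hΩ hs
    have hc : ContinuousAt (st γ) t := by
      have h2 := contDiffAt_chart_comp (hγ t htI).1 hp
      exact h2.continuousAt.prodMk (differentiableAt_deriv h2).continuousAt
    have h3 : ∀ᶠ r in 𝓝 t, (st γ r).1 ∈ Ω :=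
      hc.fst.eventually (h.isOpen.mem_nhds hΩ)
    filter_upwards [eventually_mem_source (hγ t htI).1.continuousAt hp, hc.eventually hs, h3]
      with r hr1 hr2 hr3
    refine ⟨hr1, hr2, fun hr => ?_⟩
    have h4 := (isGeodesicAt_iff h hr1 hr3).1 (hγ r hr)
    have h5 := contDiffAt_chart_comp h4.1 hr1
    refine (h5.differentiableAt (by norm_num)).hasDerivAt.prodMk ?_
    change HasDerivAt (deriv fun r => extChartAt (𝓡 8) p (γ r)) (-gam θ _ _ _) r
    rw [← h4.2]
    exact (differentiableAt_deriv h5).hasDerivAt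
  have k1 := key γ hγ hp hΩ hs
  have k2 := key γ' hγ' (h0 ▸ hp) (h0 ▸ hΩ) (hst ▸ hs)
  obtain ⟨ε, hε, hball⟩ := Metric.eventually_nhds_iff.1 (k1.and k2)
  set ε' := min (ε / 2) (1 - t) with hε'
  have hε0 : 0 < ε' := lt_min (by positivity) (by linarith [ht.2])
  have hr : ∀ r ∈ Set.Icc t (t + ε'), dist r t < ε ∧ r ∈ Set.Icc (0 : ℝ) 1 := by
    intro r hr
    have h6 : ε' ≤ ε / 2 := min_le_left _ _
    have h7 : ε' ≤ 1 - t := min_le_right _ _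
    refine ⟨?_, by linarith [ht.1, hr.1], by linarith [hr.2]⟩
    rw [Real.dist_eq, abs_lt]
    constructor <;> linarith [hr.1, hr.2]
  have hd : ∀ r ∈ Set.Icc t (t + ε'), HasDerivAt (st γ) (v (st γ r)) r := fun r hr' =>
    (hball (hr r hr').1).1.2.2 (hr r hr').2
  have hd' : ∀ r ∈ Set.Icc t (t + ε'), HasDerivAt (st γ') (v (st γ' r)) r := fun r hr' =>
    (hball (hr r hr').1).2.2.2 (hr r hr').2
  have he := ODE_solution_unique_of_mem_Icc_right (v := fun _ => v) (s := fun _ => s) (K := K)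
    (a := t) (b := t + ε') (f := st γ) (g := st γ') (fun _ _ => hK)
    (fun r hr' => (hd r hr').continuousAt.continuousWithinAt)
    (fun r hr' => (hd r ⟨hr'.1, hr'.2.le⟩).hasDerivWithinAt)
    (fun r hr' => (hball (hr r ⟨hr'.1, hr'.2.le⟩).1).1.2.1)
    (fun r hr' => (hd' r hr').continuousAt.continuousWithinAt)
    (fun r hr' => (hd' r ⟨hr'.1, hr'.2.le⟩).hasDerivWithinAt)
    (fun r hr' => (hball (hr r ⟨hr'.1, hr'.2.le⟩).1).2.2.1) hst
  refine ⟨ε', hε0, fun r hr' => ?_⟩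
  have h8 := congrArg (fun z => (extChartAt (𝓡 8) p).symm z.1) (he hr')
  simp only [st] at h8
  rwa [symm_chart (hball (hr r hr').1).1.1, symm_chart (hball (hr r hr').1).2.1] at h8

/-- Geodesics are determined by their initial velocity. -/
theorem IsGeodesicFrom.eqOn [T2Space M] (hΦ : IsSpin7Structure Φ) {a : TangentBundle (𝓡 8) M}
    {γ γ' : ℝ → M} (hγ : IsGeodesicFrom Φ a γ) (hγ' : IsGeodesicFrom Φ a γ') :
    Set.EqOn γ γ' (Set.Icc 0 1) := by
  -- The set of times up to which the geodesics agree is closed and open to the right.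
  set S : Set ℝ := {t | ∀ s ∈ Set.Icc 0 t, γ s = γ' s} with hS
  have hc : ∀ {γ : ℝ → M}, IsGeodesicFrom Φ a γ → ContinuousOn γ (Set.Icc 0 1) :=
    fun hγ t ht => (hγ.2 t ht).1.continuousAt.continuousWithinAt
  have hZ : IsClosed (Set.Icc (0 : ℝ) 1 ∩ (fun t => (γ t, γ' t)) ⁻¹' Set.diagonal M) :=
    ((hc hγ).prodMk (hc hγ')).preimage_isClosed_of_isClosed isClosed_Icc isClosed_diagonal
  have h0 : γ 0 = γ' 0 := hγ.apply_zero.trans hγ'.apply_zero.symm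
  have hSub : Set.Icc (0 : ℝ) 1 ⊆ S := by
    refine IsClosed.Icc_subset_of_forall_mem_nhdsWithin ?_ ?_ ?_
    · refine isClosed_of_closure_subset fun t ht => ?_
      have htI : t ∈ Set.Icc (0 : ℝ) 1 :=
        isClosed_Icc.closure_subset (closure_mono Set.inter_subset_right ht)
      refine ⟨fun s hs => ?_, htI⟩
      rcases hs.2.eq_or_lt with rfl | hlt
      · have hsub : S ∩ Set.Icc 0 1 ⊆
            Set.Icc (0 : ℝ) 1 ∩ (fun t => (γ t, γ' t)) ⁻¹' Set.diagonal M :=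
          fun r hr => ⟨hr.2, hr.1 r ⟨hr.2.1, le_rfl⟩⟩
        exact (hZ.closure_subset (closure_mono hsub ht)).2
      · obtain ⟨r, hr1, hr2⟩ := mem_closure_iff.1 ht (Set.Ioi s) isOpen_Ioi hlt
        exact hr2.1 s ⟨hs.1, le_of_lt hr1⟩
    · intro s hs
      obtain rfl : s = 0 := le_antisymm hs.2 hs.1
      exact h0
    · rintro t ⟨htS, ht⟩
      have htI : t ∈ Set.Icc (0 : ℝ) 1 := ⟨ht.1, ht.2.le⟩
      have hpp := mem_chart_source R8 (γ t)
      obtain ⟨Ω, θ, h, hΩ⟩ := exists_localCoframe hΦ hpp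
      have ht0 : γ t = γ' t := htS t ⟨ht.1, le_rfl⟩
      have hdiff : ∀ {δ : ℝ → M}, IsGeodesicFrom Φ a δ → δ t ∈ (chartAt R8 (γ t)).source →
          HasDerivAt (fun r => extChartAt (𝓡 8) (γ t) (δ r))
            (deriv (fun r => extChartAt (𝓡 8) (γ t) (δ r)) t) t := fun hδ hs =>
        ((contDiffAt_chart_comp (hδ.2 t htI).1 hs).differentiableAt (by norm_num)).hasDerivAt
      -- The velocities at `t` agree: at `t = 0` by the initial condition, at later times because
      -- the derivative is determined by the values to the left.
      have ht1 : deriv (fun r => extChartAt (𝓡 8) (γ t) (γ r)) t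
          = deriv (fun r => extChartAt (𝓡 8) (γ t) (γ' r)) t := by
        rcases ht.1.eq_or_lt with rfl | hlt
        · have hpa : a.proj ∈ (chartAt R8 (γ 0)).source := hγ.apply_zero ▸ hpp
          rw [hγ.deriv_zero hpa, hγ'.deriv_zero hpa]
        · have e1 := (hdiff hγ hpp).hasDerivWithinAt (s := Set.Icc 0 t)
          have e2 := (hdiff hγ' (ht0 ▸ hpp)).hasDerivWithinAt (s := Set.Icc 0 t)
          have e3 := e2.congr (f₁ := fun r => extChartAt (𝓡 8) (γ t) (γ r))
            (fun s hs => by rw [htS s hs]) (by rw [ht0])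
          exact (uniqueDiffOn_Icc hlt t ⟨ht.1, le_rfl⟩).eq_deriv _ e1 e3
      obtain ⟨ε, hε, he⟩ := geodesics_eq_right h ht hγ.2 hγ'.2 hpp hΩ ht0 ht1
      refine Filter.mem_of_superset (Ioo_mem_nhdsGT (show t < t + ε by linarith)) ?_
      intro r hr s hs
      rcases le_total s t with hst | hst
      · exact htS s ⟨hs.1, hst⟩
      · exact he s ⟨hst, hs.2.trans hr.2.le⟩
  exact fun t ht => hSub ht t ⟨ht.1, le_rfl⟩

theorem expMap_eq [T2Space M] (hΦ : IsSpin7Structure Φ) {a : TangentBundle (𝓡 8) M} {γ : ℝ → M}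
    (hγ : IsGeodesicFrom Φ a γ) : expMap Φ a = γ 1 := by
  have h : ExpDefined Φ a := ⟨γ, hγ⟩
  have h1 : expMap Φ a = h.choose 1 := dif_pos h
  rw [h1]
  exact h.choose_spec.eqOn hΦ hγ (by simp)

end Geodesics

/-! ### Parallel transport in `Λ²₇M` -/

theorem abs_om_le (k : Fin 7) (u v : R8) : |om k u v| ≤ ‖u‖ * ‖v‖ := by
  have h : ‖J k u‖ = ‖u‖ := by
    have h1 : inner ℝ (J k u) (J k u) = inner ℝ u u := by rw [inner_J_J]; simp
    rw [real_inner_self_eq_norm_sq, real_inner_self_eq_norm_sq] at h1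
    exact (sq_eq_sq₀ (norm_nonneg _) (norm_nonneg _)).1 h1
  rw [om, ← h]
  exact abs_real_inner_le_norm _ _

/-- The entries of the connection matrix on `Λ²₇` defined by an endomorphism `a` of `ℝ⁸`, with
respect to the `ω_k`. -/
def connCoeff (a : R8 → R8) (k l : Fin 7) : ℝ :=
  -(1 / 8) * ∑ i, ∑ j, (om l (a (EuclideanSpace.basisFun (Fin 8) ℝ i))
      (EuclideanSpace.basisFun (Fin 8) ℝ j) + om l (EuclideanSpace.basisFun (Fin 8) ℝ i)
      (a (EuclideanSpace.basisFun (Fin 8) ℝ j))) *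
    om k (EuclideanSpace.basisFun (Fin 8) ℝ i) (EuclideanSpace.basisFun (Fin 8) ℝ j)

/-- The entries may be computed in any orthonormal basis, since they are traces. -/
theorem connCoeff_eq (a : R8 →ₗ[ℝ] R8) (k l : Fin 7) (b : OrthonormalBasis (Fin 8) ℝ R8) :
    connCoeff a k l = -(1 / 8) * ∑ i, ∑ j, (om l (a (b i)) (b j) + om l (b i) (a (b j))) *
      om k (b i) (b j) := by
  set e := EuclideanSpace.basisFun (Fin 8) ℝ
  have h1 : ∀ u u' : R8, ∑ j, (om l (a u) (e j) + om l u (a (e j))) * om k u' (e j) =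
      ∑ j, (om l (a u) (b j) + om l u (a (b j))) * om k u' (b j) := fun u u' => by
    let S : R8 →ₗ[ℝ] R8 →ₗ[ℝ] ℝ := LinearMap.mk₂ ℝ
      (fun x x' => (om l (a u) x + om l u (a x)) * om k u' x')
      (by intros; simp; ring) (by intros; simp; ring) (by intros; simp; ring)
      (by intros; simp; ring)
    exact sum_orthonormalBasis_eq S e b
  let S : R8 →ₗ[ℝ] R8 →ₗ[ℝ] ℝ := LinearMap.mk₂ ℝ
    (fun u u' => ∑ j, (om l (a u) (b j) + om l u (a (b j))) * om k u' (b j))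
    (by intros; simp only [map_add, om_add_left, ← Finset.sum_add_distrib]
        exact Finset.sum_congr rfl fun _ _ => by ring)
    (by intros; simp only [map_smul, om_smul_left, smul_eq_mul, Finset.mul_sum]
        exact Finset.sum_congr rfl fun _ _ => by ring)
    (by intros; simp only [om_add_left, ← Finset.sum_add_distrib]
        exact Finset.sum_congr rfl fun _ _ => by ring)
    (by intros; simp only [om_smul_left, smul_eq_mul, Finset.mul_sum]
        exact Finset.sum_congr rfl fun _ _ => by ring)
  rw [connCoeff]
  congr 1
  rw [Finset.sum_congr rfl fun i _ => h1 (e i) (e i)]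
  exact sum_orthonormalBasis_eq S e b

/-- The connection matrix on `Λ²₇` as an operator. -/
def connOp (a : R8 → R8) : (Fin 7 → ℝ) →L[ℝ] (Fin 7 → ℝ) :=
  ∑ k, ∑ l, connCoeff a k l •
    (ContinuousLinearMap.proj (R := ℝ) (φ := fun _ : Fin 7 => ℝ) l).smulRight
      (Pi.single k (1 : ℝ) : Fin 7 → ℝ)

theorem connOp_apply (a : R8 → R8) (c : Fin 7 → ℝ) (k : Fin 7) :
    connOp a c k = ∑ l, connCoeff a k l * c l := by
  simp [connOp, Pi.single_apply, Finset.sum_apply]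

theorem abs_connCoeff_le {a : R8 → R8} {B : ℝ} (hB : ∀ u, ‖a u‖ ≤ B * ‖u‖) (k l : Fin 7) :
    |connCoeff a k l| ≤ 16 * B := by
  set e := EuclideanSpace.basisFun (Fin 8) ℝ
  have he : ∀ i, ‖e i‖ = 1 := e.orthonormal.1
  have hB0 : 0 ≤ B := by
    have := (norm_nonneg _).trans (hB (e 0))
    rwa [he, mul_one] at this
  have h1 : ∀ i j, |(om l (a (e i)) (e j) + om l (e i) (a (e j))) * om k (e i) (e j)|
      ≤ 2 * B := fun i j => by
    have h2 := abs_om_le l (a (e i)) (e j)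
    have h3 := abs_om_le l (e i) (a (e j))
    have h4 := abs_om_le k (e i) (e j)
    have h5 := hB (e i)
    have h6 := hB (e j)
    rw [he] at h5 h6
    rw [he] at h2 h3
    rw [he, he, mul_one] at h4
    rw [abs_mul]
    calc _ ≤ (2 * B) * 1 := by
          gcongr
          exact (abs_add_le _ _).trans (by linarith)
      _ = _ := mul_one _
  rw [connCoeff, abs_mul]
  have h7 : |∑ i, ∑ j, (om l (a (e i)) (e j) + om l (e i) (a (e j))) * om k (e i) (e j)|
      ≤ ∑ _i : Fin 8, ∑ _j : Fin 8, 2 * B :=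
    (Finset.abs_sum_le_sum_abs _ _).trans (Finset.sum_le_sum fun i _ =>
      (Finset.abs_sum_le_sum_abs _ _).trans (Finset.sum_le_sum fun j _ => h1 i j))
  simp only [Finset.sum_const, Finset.card_univ, Fintype.card_fin, nsmul_eq_mul] at h7
  have h8 : |(-(1 / 8) : ℝ)| = 1 / 8 := by norm_num
  rw [h8]
  push_cast at h7
  linarith

theorem norm_connOp_le {a : R8 → R8} {B : ℝ} (hB : ∀ u, ‖a u‖ ≤ B * ‖u‖) :
    ‖connOp a‖ ≤ 112 * B := by
  have hB0 : 0 ≤ B := by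
    have := (abs_nonneg _).trans (abs_connCoeff_le hB 0 0)
    linarith
  refine ContinuousLinearMap.opNorm_le_bound _ (by positivity) fun c => ?_
  rw [pi_norm_le_iff_of_nonneg (by positivity)]
  intro k
  rw [connOp_apply, Real.norm_eq_abs]
  refine (Finset.abs_sum_le_sum_abs _ _).trans ?_
  have h1 : ∀ l ∈ Finset.univ, |connCoeff a k l * c l| ≤ 16 * B * ‖c‖ := fun l _ => by
    rw [abs_mul]
    gcongr
    · exact abs_connCoeff_le hB k l
    · exact norm_le_pi_norm c l
  refine (Finset.sum_le_sum h1).trans ?_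
  simp only [Finset.sum_const, Finset.card_univ, Fintype.card_fin, nsmul_eq_mul]
  push_cast
  linarith

theorem continuousOn_connOp {a : ℝ → R8 → R8} {s : Set ℝ}
    (ha : ∀ u, ContinuousOn (fun t => a t u) s) : ContinuousOn (fun t => connOp (a t)) s := by
  refine continuousOn_finsetSum _ fun k _ => continuousOn_finsetSum _ fun l _ => ?_
  suffices h : ContinuousOn (fun t => connCoeff (a t) k l) s from h.smul continuousOn_const
  refine continuousOn_const.mul (continuousOn_finsetSum _ fun i _ =>
    continuousOn_finsetSum _ fun j _ => ?_)
  exact ((((J l).continuous.comp_continuousOn (ha _)).inner continuousOn_const).add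
    (continuousOn_const.inner (ha _))).mul continuousOn_const

section Transport

variable {M : Type*} [TopologicalSpace M] [ChartedSpace R8 M] [IsManifold (𝓡 8) ∞ M]

/-- The value at `q` of a coframe given in the chart at `p`. -/
def coframeAt (θ : R8 → R8 →L[ℝ] R8) (p q : M) : TangentSpace (𝓡 8) q →ₗ[ℝ] R8 :=
  (θ (extChartAt (𝓡 8) p q)).toLinearMap ∘ₗ (toCoords p q).toLinearMap

theorem coframeAt_apply (θ : R8 → R8 →L[ℝ] R8) (p q : M) (u : TangentSpace (𝓡 8) q) :
    coframeAt θ p q u = θ (extChartAt (𝓡 8) p q) (toCoords p q u) := rfl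

theorem coframeAt_change (θ : R8 → R8 →L[ℝ] R8) {p q z : M} (hp : z ∈ (chartAt R8 p).source)
    (hq : z ∈ (chartAt R8 q).source) :
    coframeAt (changeCoframe θ (transition q p)) q z = coframeAt θ p z := by
  ext1 u
  rw [coframeAt_apply, coframeAt_apply, toCoords_eq_fderiv hq hp, changeCoframe,
    transition_apply hq]
  rfl

variable {Φ : Π q : M, Form4 q} {Ω : Set R8} {θ : R8 → R8 →L[ℝ] R8} {γ : ℝ → M} {t : ℝ}

/-- The covariant derivative of a section of `Λ²₇M` along a curve, in a coframe. -/
theorem covDerivForm_eq (hγ : ContMDiffAt 𝓘(ℝ, ℝ) (𝓡 8) 2 γ t)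
    (h : IsLocalCoframe Φ (γ t) Ω θ) (hΩ : extChartAt (𝓡 8) (γ t) (γ t) ∈ Ω)
    {β : Π r, Form2 (γ r)} (hd : ∀ a b : R8, DifferentiableAt ℝ
      (fun r => β r ![ofCoords (γ t) (γ r) a, ofCoords (γ t) (γ r) b]) t)
    {s : Set ℝ} (hs : UniqueDiffWithinAt ℝ s t) (ht : t ∈ s) {c : ℝ → Fin 7 → ℝ}
    {c' : Fin 7 → ℝ} (hc : HasDerivWithinAt c c' s t)
    (hβ : ∀ r ∈ s, β r = pullForm (γ r) (coframeAt θ (γ t) (γ r)) (c r)) (a b : R8) :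
    covDerivForm Φ γ β t a b =
      ∑ k, (c' k * om k (θ (extChartAt (𝓡 8) (γ t) (γ t)) a) (θ (extChartAt (𝓡 8) (γ t) (γ t)) b)
        + c t k * (om k (conn θ (extChartAt (𝓡 8) (γ t) (γ t)) (velocity γ t)
            (θ (extChartAt (𝓡 8) (γ t) (γ t)) a)) (θ (extChartAt (𝓡 8) (γ t) (γ t)) b)
          + om k (θ (extChartAt (𝓡 8) (γ t) (γ t)) a)
            (conn θ (extChartAt (𝓡 8) (γ t) (γ t)) (velocity γ t)
              (θ (extChartAt (𝓡 8) (γ t) (γ t)) b)))) := by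
  set q := γ t with hq
  have hqq : γ t ∈ (chartAt R8 q).source := mem_chart_source R8 q
  set x : ℝ → R8 := fun r => extChartAt (𝓡 8) q (γ r) with hx
  have hx' : HasDerivAt x (velocity γ t) t :=
    ((contDiffAt_chart_comp hγ hqq).differentiableAt (by norm_num)).hasDerivAt
  have hi := h.isInvertible hΩ
  have hev : ∀ a b : R8, (fun r => β r ![ofCoords q (γ r) a, ofCoords q (γ r) b])
      =ᶠ[𝓝[s] t] fun r => ∑ k, c r k * om k (θ (x r) a) (θ (x r) b) := fun a b => by
    filter_upwards [self_mem_nhdsWithin,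
      mem_nhdsWithin_of_mem_nhds (eventually_mem_source hγ.continuousAt hqq)] with r hr hr'
    rw [hβ r hr, pullForm_apply]
    simp only [coframeAt_apply, toCoords_ofCoords hr', hx]
  have hθ : ∀ a : R8, HasDerivAt (fun r => θ (x r) a) (fderiv ℝ θ (x t) (velocity γ t) a) t :=
    fun a => by
      have h0 : HasFDerivAt θ (fderiv ℝ θ (x t)) (x t) := (h.differentiableAt hΩ).hasFDerivAt
      have h1 : HasDerivAt (fun r => θ (x r)) (fderiv ℝ θ (x t) (velocity γ t)) t :=
        h0.comp_hasDerivAt t hx'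
      have h2 := h1.clm_apply (hasDerivAt_const t a)
      rwa [map_zero, add_zero] at h2
  have hom : ∀ k, HasDerivAt (fun r => om k (θ (x r) a) (θ (x r) b))
      (om k (θ (x t) a) (fderiv ℝ θ (x t) (velocity γ t) b)
        + om k (fderiv ℝ θ (x t) (velocity γ t) a) (θ (x t) b)) t := fun k => by
    have h1 := ((J k).hasFDerivAt.comp_hasDerivAt t (hθ a)).inner ℝ (hθ b)
    exact h1
  have hder : HasDerivWithinAt (fun r => ∑ k, c r k * om k (θ (x r) a) (θ (x r) b))
      (∑ k, (c' k * om k (θ (x t) a) (θ (x t) b) + c t k *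
        (om k (θ (x t) a) (fderiv ℝ θ (x t) (velocity γ t) b)
        + om k (fderiv ℝ θ (x t) (velocity γ t) a) (θ (x t) b)))) s t :=
    HasDerivWithinAt.fun_sum fun k _ =>
      ((hasDerivWithinAt_pi.1 hc) k).mul (hom k).hasDerivWithinAt
  have hder' := hder.congr_of_eventuallyEq (hev a b) ((hev a b).eq_of_nhdsWithin ht)
  -- `β` is known in the coframe on `s` only, but is differentiable at `t`; since derivatives along
  -- `s` are unique, its derivative is the one computed along `s`.
  have e1 : deriv (fun r => β r ![ofCoords q (γ r) a, ofCoords q (γ r) b]) t = _ :=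
    hs.eq_deriv _ (hd a b).hasDerivAt.hasDerivWithinAt hder'
  have hΓ : ∀ u : R8, christoffel Φ q q (velocity γ t) u = gam θ (x t) (velocity γ t) u :=
    fun u => h.christoffel_eq hqq hΩ _ _
  have hβt : ∀ u v : R8, β t ![ofCoords q q u, ofCoords q q v] =
      ∑ k, c t k * om k (θ (x t) u) (θ (x t) v) := fun u v =>
    (hev u v).eq_of_nhdsWithin ht
  have hk : ∀ u : R8, conn θ (x t) (velocity γ t) (θ (x t) u) =
      fderiv ℝ θ (x t) (velocity γ t) u - θ (x t) (gam θ (x t) (velocity γ t) u) := fun u => by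
    rw [conn_apply hi, kap]
  change deriv (fun r => β r ![ofCoords q (γ r) a, ofCoords q (γ r) b]) t
    - β t ![ofCoords q q (christoffel Φ q q (velocity γ t) a), ofCoords q q b]
    - β t ![ofCoords q q a, ofCoords q q (christoffel Φ q q (velocity γ t) b)] = _
  rw [e1, hβt, hβt, hΓ, hΓ, ← Finset.sum_sub_distrib, ← Finset.sum_sub_distrib]
  refine Finset.sum_congr rfl fun k _ => ?_
  change _ = c' k * om k (θ (x t) a) (θ (x t) b) + c t k *
    (om k (conn θ (x t) (velocity γ t) (θ (x t) a)) (θ (x t) b)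
      + om k (θ (x t) a) (conn θ (x t) (velocity γ t) (θ (x t) b)))
  rw [hk, hk, om_sub_left, om_sub_right]
  ring

/-- The condition for a section of `Λ²₇M` along a curve to be parallel is an ordinary differential
equation for its components `c` in a coframe. The components are required on a set `s` of times
only, so that one-sided derivatives at end points are covered. -/
theorem parallel_iff_own_chart (hγ : ContMDiffAt 𝓘(ℝ, ℝ) (𝓡 8) 2 γ t)
    (h : IsLocalCoframe Φ (γ t) Ω θ) (hΩ : extChartAt (𝓡 8) (γ t) (γ t) ∈ Ω)
    {β : Π r, Form2 (γ r)} (hd : ∀ a b : R8, DifferentiableAt ℝ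
      (fun r => β r ![ofCoords (γ t) (γ r) a, ofCoords (γ t) (γ r) b]) t)
    {s : Set ℝ} (hs : UniqueDiffWithinAt ℝ s t) (ht : t ∈ s) {c : ℝ → Fin 7 → ℝ}
    {c' : Fin 7 → ℝ} (hc : HasDerivWithinAt c c' s t)
    (hβ : ∀ r ∈ s, β r = pullForm (γ r) (coframeAt θ (γ t) (γ r)) (c r)) :
    IsParallelAt Φ γ β t ↔
      c' = connOp (conn θ (extChartAt (𝓡 8) (γ t) (γ t)) (velocity γ t)) (c t) := by
  set q := γ t with hq
  have hqq : γ t ∈ (chartAt R8 q).source := mem_chart_source R8 q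
  set y := extChartAt (𝓡 8) q q with hy
  set a := conn θ y (velocity γ t) with ha
  have hL : IsCoframe Φ q (coframeAt θ q q) := h.at hqq hΩ
  have hb : ∀ i, θ y (toCoords q q (spin7Frame Φ q i)) = hL.onb i := fun i => by
    rw [IsCoframe.onb_apply]; rfl
  -- The contraction of the covariant derivative with the element of `Λ²₇` that has components `d`.
  have key : ∀ d : Fin 7 → ℝ, ∑ i, ∑ j,
      covDerivForm Φ γ β t (toCoords q q (spin7Frame Φ q i)) (toCoords q q (spin7Frame Φ q j))
        * pullForm q (coframeAt θ q q) d ![spin7Frame Φ q i, spin7Frame Φ q j] =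
      8 * ∑ l, d l * (c' l - connOp a (c t) l) := by
    intro d
    have h1 : ∀ i j, covDerivForm Φ γ β t (toCoords q q (spin7Frame Φ q i))
          (toCoords q q (spin7Frame Φ q j))
        * pullForm q (coframeAt θ q q) d ![spin7Frame Φ q i, spin7Frame Φ q j] =
        ∑ l, ∑ k, d l * (c' k * (om k (hL.onb i) (hL.onb j) * om l (hL.onb i) (hL.onb j))
          + c t k * ((om k (a (hL.onb i)) (hL.onb j) + om k (hL.onb i) (a (hL.onb j))) *
            om l (hL.onb i) (hL.onb j))) := by
      intro i j
      have e1 := covDerivForm_eq hγ h hΩ hd hs ht hc hβ (toCoords q q (spin7Frame Φ q i))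
        (toCoords q q (spin7Frame Φ q j))
      have e2 : covDerivForm Φ γ β t (toCoords q q (spin7Frame Φ q i))
          (toCoords q q (spin7Frame Φ q j)) =
          ∑ k, (c' k * om k (θ y (toCoords q q (spin7Frame Φ q i)))
              (θ y (toCoords q q (spin7Frame Φ q j)))
            + c t k * (om k (a (θ y (toCoords q q (spin7Frame Φ q i))))
                (θ y (toCoords q q (spin7Frame Φ q j)))
              + om k (θ y (toCoords q q (spin7Frame Φ q i)))
                (a (θ y (toCoords q q (spin7Frame Φ q j)))))) := e1
      rw [e2, pullForm_apply, Finset.sum_mul_sum, Finset.sum_comm]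
      refine Finset.sum_congr rfl fun l _ => Finset.sum_congr rfl fun k _ => ?_
      simp only [hb, ← hL.onb_apply]
      ring
    simp only [h1]
    have h2 : ∀ l, ∑ i, ∑ j, ∑ k, d l * (c' k * (om k (hL.onb i) (hL.onb j)
          * om l (hL.onb i) (hL.onb j))
          + c t k * ((om k (a (hL.onb i)) (hL.onb j) + om k (hL.onb i) (a (hL.onb j))) *
            om l (hL.onb i) (hL.onb j))) = 8 * (d l * (c' l - connOp a (c t) l)) := by
      intro l
      have h3 : ∀ k, ∑ i, ∑ j, (om k (a (hL.onb i)) (hL.onb j) + om k (hL.onb i) (a (hL.onb j))) *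
            om l (hL.onb i) (hL.onb j) = -8 * connCoeff a l k := fun k => by
        have h4 : connCoeff a l k = _ := connCoeff_eq (connLin θ y (velocity γ t)) l k hL.onb
        rw [h4]
        simp only [connLin_apply, ← ha]
        ring
      calc _ = ∑ k, ∑ i, ∑ j, d l * (c' k * (om k (hL.onb i) (hL.onb j)
            * om l (hL.onb i) (hL.onb j))
            + c t k * ((om k (a (hL.onb i)) (hL.onb j) + om k (hL.onb i) (a (hL.onb j))) *
              om l (hL.onb i) (hL.onb j))) := by
            rw [Finset.sum_comm]
            refine (Finset.sum_congr rfl fun j _ => Finset.sum_comm).trans ?_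
            rw [Finset.sum_comm]
            exact Finset.sum_congr rfl fun k _ => Finset.sum_comm
        _ = ∑ k, d l * (c' k * (if k = l then 8 else 0) + c t k * (-8 * connCoeff a l k)) := by
            refine Finset.sum_congr rfl fun k _ => ?_
            rw [← h3, ← IsCoframe.om_sum k l hL.onb]
            simp only [Finset.mul_sum, ← Finset.sum_add_distrib]
        _ = _ := by
            rw [← Finset.mul_sum, Finset.sum_add_distrib, connOp_apply]
            simp only [mul_ite, mul_zero, Finset.sum_ite_eq', Finset.mem_univ, if_true]
            have : ∑ k, c t k * (-8 * connCoeff a l k) = -8 * ∑ k, connCoeff a l k * c t k := by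
              rw [Finset.mul_sum]
              exact Finset.sum_congr rfl fun _ _ => by ring
            rw [this]
            ring
    calc _ = ∑ l, ∑ i, ∑ j, ∑ k, d l * (c' k * (om k (hL.onb i) (hL.onb j)
          * om l (hL.onb i) (hL.onb j))
          + c t k * ((om k (a (hL.onb i)) (hL.onb j) + om k (hL.onb i) (a (hL.onb j))) *
            om l (hL.onb i) (hL.onb j))) := by
          rw [Finset.sum_comm]
          refine (Finset.sum_congr rfl fun j _ => Finset.sum_comm).trans ?_
          rw [Finset.sum_comm]
          exact Finset.sum_congr rfl fun k _ => Finset.sum_comm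
      _ = _ := by
          rw [Finset.mul_sum]
          exact Finset.sum_congr rfl fun l _ => h2 l
  constructor
  · rintro ⟨-, -, hη⟩
    -- Test with the basis elements of `Λ²₇`.
    funext l
    have h5 := hη _ (hL.pullForm_mem (Pi.single l 1))
    have h6 := (key (Pi.single l 1)).symm.trans h5
    simp only [Pi.single_apply, ite_mul, one_mul, zero_mul, Finset.sum_ite_eq', Finset.mem_univ,
      if_true] at h6
    linarith
  · intro h7
    refine ⟨?_, hd, fun η hη => ?_⟩
    · rw [hβ t ht]
      exact hL.pullForm_mem _
    · obtain ⟨d, rfl⟩ := hL.mem_Lambda27_iff.1 hη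
      refine (key d).trans ?_
      rw [h7]
      simp

end Transport

/-- The connection matrix is a `1`-form. -/
theorem conn_changeCoframe {θ : R8 → R8 →L[ℝ] R8} {y : R8} {χ : R8 → R8}
    (hθ : DifferentiableAt ℝ θ (χ y)) (hχ : ContDiffAt ℝ 2 χ y) (h : (θ (χ y)).IsInvertible)
    (h' : (fderiv ℝ χ y).IsInvertible) (w u : R8) :
    conn (changeCoframe θ χ) y w u = conn θ (χ y) (fderiv ℝ χ y w) u := by
  have hi : ((changeCoframe θ χ) y).IsInvertible := h.comp h'
  rw [conn, kap_changeCoframe hθ hχ h h', conn]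
  congr 1
  have h1 : θ (χ y) (fderiv ℝ χ y ((changeCoframe θ χ y).inverse u)) = u := apply_inverse hi u
  conv_rhs => rw [← h1]
  rw [inverse_apply_self h]

section Coeffs

variable {M : Type*} [TopologicalSpace M] [ChartedSpace R8 M]

/-- The components of a `2`-form with respect to the pullbacks of the `ω_k` by `L`. -/
def coeffs {q : M} (L : TangentSpace (𝓡 8) q →ₗ[ℝ] R8) (η : Form2 q) (k : Fin 7) : ℝ :=
  1 / 8 * ∑ i, ∑ j, η ![Function.invFun L (EuclideanSpace.basisFun (Fin 8) ℝ i),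
    Function.invFun L (EuclideanSpace.basisFun (Fin 8) ℝ j)] *
    om k (EuclideanSpace.basisFun (Fin 8) ℝ i) (EuclideanSpace.basisFun (Fin 8) ℝ j)

theorem IsCoframe.coeffs_pullForm {Φ : Π q : M, Form4 q} {q : M}
    {L : TangentSpace (𝓡 8) q →ₗ[ℝ] R8} (hL : IsCoframe Φ q L) (c : Fin 7 → ℝ) :
    coeffs L (pullForm q L c) = c := by
  have h : ∀ u, Function.invFun L u = hL.equiv.symm u := fun u => hL.bijective.injective (by
    rw [Function.invFun_eq (hL.bijective.surjective u), hL.map_equiv_symm])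
  funext k
  have h1 := hL.coeff_pullForm c k (EuclideanSpace.basisFun (Fin 8) ℝ)
  rw [coeffs]
  simp only [h]
  rw [h1]
  ring

/-- A `2`-form as a bilinear map. -/
def form2Bilin {q : M} (η : Form2 q) :
    TangentSpace (𝓡 8) q →ₗ[ℝ] TangentSpace (𝓡 8) q →ₗ[ℝ] ℝ :=
  have e : ∀ u v w : TangentSpace (𝓡 8) q, Function.update ![u, v] 1 w = ![u, w] := fun u v w => by
    funext i; fin_cases i <;> rfl
  LinearMap.mk₂ ℝ (fun u v => η ![u, v])
    (fun u u' v => η.map_vecCons_add ![v] u u')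
    (fun a u v => η.map_vecCons_smul ![v] a u)
    (fun u v v' => by
      have := η.map_update_add ![u, 0] 1 v v'
      rwa [e, e, e] at this)
    (fun a u v => by
      have := η.map_update_smul ![u, 0] 1 a v
      rwa [e, e] at this)

theorem pullForm_zero (q : M) (L : TangentSpace (𝓡 8) q →ₗ[ℝ] R8) : pullForm q L 0 = 0 := by
  simp [pullForm]

theorem mem_change_domain {p q z : M} {Ω : Set R8} (hp : z ∈ (chartAt R8 p).source)
    (hq : z ∈ (chartAt R8 q).source) (hΩ : extChartAt (𝓡 8) p z ∈ Ω) :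
    extChartAt (𝓡 8) q z ∈ (extChartAt (𝓡 8) q).target ∩ (extChartAt (𝓡 8) q).symm ⁻¹'
      ((chartAt R8 p).source ∩ extChartAt (𝓡 8) p ⁻¹' Ω) := by
  refine ⟨chart_mem_target hq, ?_⟩
  rw [Set.mem_preimage, symm_chart hq]
  exact ⟨hp, hΩ⟩

end Coeffs

section Transport

variable {M : Type*} [TopologicalSpace M] [ChartedSpace R8 M] [IsManifold (𝓡 8) ∞ M]
variable {Φ : Π q : M, Form4 q} {p : M} {Ω : Set R8} {θ : R8 → R8 →L[ℝ] R8} {γ : ℝ → M} {t : ℝ}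

theorem IsLocalCoframe.conn_change (h : IsLocalCoframe Φ p Ω θ)
    (hγ : ContMDiffAt 𝓘(ℝ, ℝ) (𝓡 8) 2 γ t) (hp : γ t ∈ (chartAt R8 p).source)
    (hΩ : extChartAt (𝓡 8) p (γ t) ∈ Ω) :
    conn (changeCoframe θ (transition (γ t) p)) (extChartAt (𝓡 8) (γ t) (γ t)) (velocity γ t) =
      conn θ (extChartAt (𝓡 8) p (γ t)) (deriv (fun r => extChartAt (𝓡 8) p (γ r)) t) := by
  have hq := mem_chart_source R8 (γ t)
  have e := transition_apply (p := p) hq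
  funext u
  have h1 := conn_changeCoframe (θ := θ) (y := extChartAt (𝓡 8) (γ t) (γ t))
    (χ := transition (γ t) p) (by rw [e]; exact h.differentiableAt hΩ)
    ((transition_contDiffAt hq hp).of_le ENat.LEInfty.out) (by rw [e]; exact h.isInvertible hΩ)
    (fderiv_transition_isInvertible hq hp) (velocity γ t) u
  rw [h1, e, deriv_chart_comp hγ hq hp]
  rfl

/-- A family of `2`-forms is parallel if its components in a local coframe solve the linear
equation of parallel transport. -/
theorem isParallelAt_of_hasDerivAt (h : IsLocalCoframe Φ p Ω θ)
    (hγ : ContMDiffAt 𝓘(ℝ, ℝ) (𝓡 8) 2 γ t) (hp : γ t ∈ (chartAt R8 p).source)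
    (hΩ : extChartAt (𝓡 8) p (γ t) ∈ Ω) {c : ℝ → Fin 7 → ℝ}
    (hc : HasDerivAt c (connOp (conn θ (extChartAt (𝓡 8) p (γ t))
      (deriv (fun r => extChartAt (𝓡 8) p (γ r)) t)) (c t)) t) :
    IsParallelAt Φ γ (fun r => pullForm (γ r) (coframeAt θ p (γ r)) (c r)) t := by
  have hq := mem_chart_source R8 (γ t)
  have h' := h.change (γ t)
  have hΩ' := mem_change_domain hp hq hΩ
  set θ' := changeCoframe θ (transition (γ t) p) with hθ'
  set x : ℝ → R8 := fun r => extChartAt (𝓡 8) (γ t) (γ r) with hx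
  have hx' : DifferentiableAt ℝ x t :=
    (contDiffAt_chart_comp hγ hq).differentiableAt (by norm_num)
  set s : Set ℝ := {r | γ r ∈ (chartAt R8 p).source ∧ γ r ∈ (chartAt R8 (γ t)).source} with hs
  have hst : s ∈ 𝓝 t := (eventually_mem_source hγ.continuousAt hp).and
    (eventually_mem_source hγ.continuousAt hq)
  have hβ : ∀ r ∈ s, pullForm (γ r) (coframeAt θ p (γ r)) (c r) =
      pullForm (γ r) (coframeAt θ' (γ t) (γ r)) (c r) := fun r hr => by
    rw [coframeAt_change θ hr.1 hr.2]
  have hθx : DifferentiableAt ℝ (fun r => θ' (x r)) t :=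
    DifferentiableAt.comp t (g := θ') (h'.differentiableAt hΩ') hx'
  refine (parallel_iff_own_chart hγ h' hΩ' (fun a b => ?_) (uniqueDiffWithinAt_of_mem_nhds hst)
    (mem_of_mem_nhds hst) hc.hasDerivWithinAt hβ).2 ?_
  · have he : (fun r => pullForm (γ r) (coframeAt θ p (γ r)) (c r)
        ![ofCoords (γ t) (γ r) a, ofCoords (γ t) (γ r) b]) =ᶠ[𝓝 t]
        fun r => ∑ k, c r k * om k (θ' (x r) a) (θ' (x r) b) := by
      filter_upwards [hst] with r hr
      rw [hβ r hr, pullForm_apply]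
      simp only [coframeAt_apply, toCoords_ofCoords hr.2, hx]
    refine DifferentiableAt.congr_of_eventuallyEq ?_ he
    refine DifferentiableAt.fun_sum fun k _ => ?_
    have h1 : DifferentiableAt ℝ (fun r => θ' (x r) a) t :=
      hθx.clm_apply (differentiableAt_const a)
    have h2 : DifferentiableAt ℝ (fun r => θ' (x r) b) t :=
      hθx.clm_apply (differentiableAt_const b)
    have h3 : DifferentiableAt ℝ (fun r => J k (θ' (x r) a)) t :=
      (J k).differentiableAt.comp t h1
    exact ((differentiableAt_pi.1 hc.differentiableAt) k).mul (h3.inner ℝ h2)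
  · rw [h.conn_change hγ hp hΩ]

/-- The components of a parallel family of `2`-forms solve the linear equation of parallel
transport. -/
theorem hasDerivWithinAt_coeffs (h : IsLocalCoframe Φ p Ω θ) {β : Π r, Form2 (γ r)}
    (hγ : ∀ t ∈ Set.Icc (0 : ℝ) 1, ContMDiffAt 𝓘(ℝ, ℝ) (𝓡 8) 2 γ t)
    (hp : ∀ t ∈ Set.Icc (0 : ℝ) 1, γ t ∈ (chartAt R8 p).source)
    (hΩ : ∀ t ∈ Set.Icc (0 : ℝ) 1, extChartAt (𝓡 8) p (γ t) ∈ Ω)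
    (hβ : ∀ t ∈ Set.Icc (0 : ℝ) 1, IsParallelAt Φ γ β t) :
    ∀ t ∈ Set.Icc (0 : ℝ) 1,
      β t = pullForm (γ t) (coframeAt θ p (γ t)) (coeffs (coframeAt θ p (γ t)) (β t)) ∧
      HasDerivWithinAt (fun r => coeffs (coframeAt θ p (γ r)) (β r))
        (connOp (conn θ (extChartAt (𝓡 8) p (γ t)) (deriv (fun r => extChartAt (𝓡 8) p (γ r)) t))
          (coeffs (coframeAt θ p (γ t)) (β t))) (Set.Icc 0 1) t := by
  have hpull : ∀ t ∈ Set.Icc (0 : ℝ) 1,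
      β t = pullForm (γ t) (coframeAt θ p (γ t)) (coeffs (coframeAt θ p (γ t)) (β t)) := by
    intro t ht
    have hL : IsCoframe Φ (γ t) (coframeAt θ p (γ t)) := h.at (hp t ht) (hΩ t ht)
    obtain ⟨c, hc⟩ := hL.mem_Lambda27_iff.1 (hβ t ht).1
    rw [hc, hL.coeffs_pullForm]
  intro t ht
  refine ⟨hpull t ht, ?_⟩
  have hq := mem_chart_source R8 (γ t)
  have h' := h.change (γ t)
  have hΩ' := mem_change_domain (hp t ht) hq (hΩ t ht)
  set θ' := changeCoframe θ (transition (γ t) p) with hθ'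
  set x : ℝ → R8 := fun r => extChartAt (𝓡 8) (γ t) (γ r) with hx
  have hx' : DifferentiableAt ℝ x t :=
    (contDiffAt_chart_comp (hγ t ht) hq).differentiableAt (by norm_num)
  set c : ℝ → Fin 7 → ℝ := fun r => coeffs (coframeAt θ p (γ r)) (β r) with hc
  -- Parallel forms are differentiable on constant vectors of the chart at `γ t`; the components of
  -- `β` are its values on the frame dual to `θ'`, which moves smoothly.
  have hinv : DifferentiableAt ℝ (fun r => (θ' (x r)).inverse) t := by
    have h1 := (contDiffOn_inverse h'.contDiffOn (fun y hy => h'.isInvertible hy)).contDiffAt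
      (h'.isOpen.mem_nhds hΩ')
    exact DifferentiableAt.comp t (g := fun y => (θ' y).inverse)
      (h1.differentiableAt (by simp)) hx'
  set b := EuclideanSpace.basisFun (Fin 8) ℝ with hb
  have hcomp : ∀ U V : ℝ → R8, DifferentiableAt ℝ U t → DifferentiableAt ℝ V t →
      DifferentiableAt ℝ
        (fun r => β r ![ofCoords (γ t) (γ r) (U r), ofCoords (γ t) (γ r) (V r)]) t := by
    intro U V hU hV
    have e1 : ∀ r, β r ![ofCoords (γ t) (γ r) (U r), ofCoords (γ t) (γ r) (V r)] =
        ∑ i, ∑ j, U r i * V r j *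
          β r ![ofCoords (γ t) (γ r) (b i), ofCoords (γ t) (γ r) (b j)] := by
      intro r
      let S : R8 →ₗ[ℝ] R8 →ₗ[ℝ] ℝ := (form2Bilin (β r)).compl₁₂
        (ofCoords (γ t) (γ r)).toLinearMap (ofCoords (γ t) (γ r)).toLinearMap
      change S (U r) (V r) = ∑ i, ∑ j, U r i * V r j * S (b i) (b j)
      conv_lhs => rw [← b.sum_repr (U r), ← b.sum_repr (V r)]
      simp only [map_sum, map_smul, LinearMap.sum_apply, LinearMap.smul_apply, smul_eq_mul,
        Finset.mul_sum, hb, EuclideanSpace.basisFun_repr]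
      rw [Finset.sum_comm]
      exact Finset.sum_congr rfl fun i _ => Finset.sum_congr rfl fun j _ => by ring
    simp only [e1]
    refine DifferentiableAt.fun_sum fun i _ => DifferentiableAt.fun_sum fun j _ => ?_
    refine DifferentiableAt.mul (DifferentiableAt.mul ?_ ?_) ((hβ t ht).2.1 _ _)
    · exact (EuclideanSpace.proj (𝕜 := ℝ) i).differentiableAt.comp t hU
    · exact (EuclideanSpace.proj (𝕜 := ℝ) j).differentiableAt.comp t hV
  have hcd : DifferentiableWithinAt ℝ c (Set.Icc 0 1) t := by
    refine differentiableWithinAt_pi.2 fun k => ?_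
    have e2 : ∀ r ∈ Set.Icc (0 : ℝ) 1, γ r ∈ (chartAt R8 (γ t)).source → c r k = 1 / 8 *
        ∑ i, ∑ j, β r ![ofCoords (γ t) (γ r) ((θ' (x r)).inverse (b i)),
          ofCoords (γ t) (γ r) ((θ' (x r)).inverse (b j))] * om k (b i) (b j) := by
      intro r hr hr'
      have hL : IsCoframe Φ (γ r) (coframeAt θ p (γ r)) := h.at (hp r hr) (hΩ r hr)
      have hi : (θ' (x r)).IsInvertible :=
        h'.isInvertible (mem_change_domain (hp r hr) hr' (hΩ r hr))
      have e3 : ∀ u, Function.invFun (coframeAt θ p (γ r)) u =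
          ofCoords (γ t) (γ r) ((θ' (x r)).inverse u) := fun u => hL.bijective.injective (by
        rw [Function.invFun_eq (hL.bijective.surjective u), ← coframeAt_change θ (hp r hr) hr',
          coframeAt_apply, toCoords_ofCoords hr', apply_inverse hi])
      simp only [hc, coeffs, e3, ← hb]
    have e4 : (fun r => c r k) =ᶠ[𝓝[Set.Icc 0 1] t] fun r => 1 / 8 *
        ∑ i, ∑ j, β r ![ofCoords (γ t) (γ r) ((θ' (x r)).inverse (b i)),
          ofCoords (γ t) (γ r) ((θ' (x r)).inverse (b j))] * om k (b i) (b j) := by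
      filter_upwards [self_mem_nhdsWithin, mem_nhdsWithin_of_mem_nhds
        (eventually_mem_source (hγ t ht).continuousAt hq)] with r hr hr'
      exact e2 r hr hr'
    refine DifferentiableWithinAt.congr_of_eventuallyEq ?_ e4 (e4.eq_of_nhdsWithin ht)
    refine DifferentiableAt.differentiableWithinAt ?_
    refine DifferentiableAt.const_mul (DifferentiableAt.fun_sum fun i _ =>
      DifferentiableAt.fun_sum fun j _ => DifferentiableAt.mul_const ?_ _) _
    exact hcomp _ _ (hinv.clm_apply (differentiableAt_const _))
      (hinv.clm_apply (differentiableAt_const _))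
  set s : Set ℝ := Set.Icc 0 1 ∩ {r | γ r ∈ (chartAt R8 (γ t)).source} with hs
  have hnear := eventually_mem_source (hγ t ht).continuousAt hq
  have hu : UniqueDiffWithinAt ℝ s t :=
    (uniqueDiffOn_Icc zero_lt_one t ht).inter hnear
  have hcs : HasDerivWithinAt c (derivWithin c (Set.Icc 0 1) t) s t :=
    hcd.hasDerivWithinAt.mono Set.inter_subset_left
  have key := (parallel_iff_own_chart (hγ t ht) h' hΩ' (hβ t ht).2.1 hu ⟨ht, hq⟩ hcs
    (fun r hr => by
      rw [coframeAt_change θ (hp r hr.1) hr.2]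
      exact hpull r hr.1)).1 (hβ t ht)
  rw [h.conn_change (hγ t ht) (hp t ht) (hΩ t ht)] at key
  have := hcd.hasDerivWithinAt
  rwa [key] at this

end Transport

section ExpChart

variable {M : Type*} [TopologicalSpace M] [ChartedSpace R8 M] [IsManifold (𝓡 8) ∞ M]
variable {Φ : Π q : M, Form4 q} {p : M} {Ω : Set R8} {θ : R8 → R8 →L[ℝ] R8}

/-- The coordinates of a tangent vector in the chart at `p`. -/
def tangentCoords (p : M) (a : TangentBundle (𝓡 8) M) : R8 × R8 :=
  (extChartAt (𝓡 8) p a.proj, toCoords p a.proj a.2)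

/-- Near the point with coordinates `y₀` in the chart at `p`, the exponential map is given by the
smooth map `E` of the coordinates, and parallel transport in `Λ²₇M` along its geodesics differs
from the identity, in the coframe `θ`, by at most `C` times the length of the geodesic. -/
structure IsExpChart (Φ : Π q : M, Form4 q) (p : M) (Ω : Set R8) (θ : R8 → R8 →L[ℝ] R8) (y₀ : R8)
    (r C : ℝ) (E : R8 × R8 → R8) : Prop where
  coframe : IsLocalCoframe Φ p Ω θ
  pos : 0 < r
  const_pos : 0 < C
  contDiffOn : ContDiffOn ℝ ∞ E (Metric.ball (y₀, (0 : R8)) r)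
  mem : ∀ z ∈ Metric.ball (y₀, (0 : R8)) r, z.1 ∈ Ω ∧ E z ∈ Ω ∧ C * ‖z.2‖ ≤ 1 / 2
  apply_zero : ∀ y : R8, (y, (0 : R8)) ∈ Metric.ball (y₀, (0 : R8)) r → E (y, 0) = y
  hasFDerivAt : ∀ y : R8, (y, (0 : R8)) ∈ Metric.ball (y₀, (0 : R8)) r →
    HasFDerivAt E (ContinuousLinearMap.fst ℝ R8 R8 + ContinuousLinearMap.snd ℝ R8 R8) (y, 0)
  expDefined : ∀ a : TangentBundle (𝓡 8) M, a.proj ∈ (chartAt R8 p).source →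
    tangentCoords p a ∈ Metric.ball (y₀, (0 : R8)) r → ExpDefined Φ a
  expMap_eq : ∀ a : TangentBundle (𝓡 8) M, a.proj ∈ (chartAt R8 p).source →
    tangentCoords p a ∈ Metric.ball (y₀, (0 : R8)) r →
      expMap Φ a = (extChartAt (𝓡 8) p).symm (E (tangentCoords p a))
  transport_eq : ∀ a : TangentBundle (𝓡 8) M, a.proj ∈ (chartAt R8 p).source →
    tangentCoords p a ∈ Metric.ball (y₀, (0 : R8)) r → ∀ α : Fin 7 → ℝ, ∃ c : Fin 7 → ℝ,
      ‖c - α‖ ≤ C * ‖(tangentCoords p a).2‖ * ‖α‖ ∧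
      transport Φ a (pullForm (expMap Φ a) (coframeAt θ p (expMap Φ a)) α) =
        pullForm a.proj (coframeAt θ p a.proj) c

/-- Parallel transport along a geodesic inside a chart is computed by the linear equation for the
components. -/
theorem transport_eq_of_solution [T2Space M] (hΦ : IsSpin7Structure Φ)
    (h : IsLocalCoframe Φ p Ω θ) {a : TangentBundle (𝓡 8) M} {γ : ℝ → M}
    (hγ : IsGeodesicFrom Φ a γ) (hp : ∀ t ∈ Set.Icc (0 : ℝ) 1, γ t ∈ (chartAt R8 p).source)
    (hΩ : ∀ t ∈ Set.Icc (0 : ℝ) 1, extChartAt (𝓡 8) p (γ t) ∈ Ω) {A : ℝ → R8 → R8}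
    (hA : ∀ t ∈ Set.Icc (0 : ℝ) 1, A t = conn θ (extChartAt (𝓡 8) p (γ t))
      (deriv (fun r => extChartAt (𝓡 8) p (γ r)) t)) {K : ℝ}
    (hK : ∀ t ∈ Set.Icc (0 : ℝ) 1, ‖connOp (A t)‖ ≤ K) {c : ℝ → Fin 7 → ℝ}
    (hc : ∀ t ∈ Set.Icc (0 : ℝ) 1, HasDerivAt c (connOp (A t) (c t)) t) :
    transport Φ a (pullForm (expMap Φ a) (coframeAt θ p (expMap Φ a)) (c 1)) =
      pullForm a.proj (coframeAt θ p a.proj) (c 0) := by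
  have h01 : (0 : ℝ) ∈ Set.Icc (0 : ℝ) 1 := by simp
  have h11 : (1 : ℝ) ∈ Set.Icc (0 : ℝ) 1 := by simp
  have hexp : expMap Φ a = γ 1 := expMap_eq hΦ hγ
  let sec : (Fin 7 → ℝ) → M → Σ q : M, Form2 q := fun c q => ⟨q, pullForm q (coframeAt θ p q) c⟩
  -- The solution defines a parallel family. Every other parallel family with the same value at
  -- time `1` solves the same linear equation, so it has the same value at time `0`.
  have htr : IsTransported Φ a (pullForm (expMap Φ a) (coframeAt θ p (expMap Φ a)) (c 1))
      (pullForm a.proj (coframeAt θ p a.proj) (c 0)) := by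
    refine ⟨γ, fun r => pullForm (γ r) (coframeAt θ p (γ r)) (c r), hγ, fun t ht => ?_,
      congrArg (sec (c 1)) hexp.symm, congrArg (sec (c 0)) hγ.apply_zero⟩
    refine isParallelAt_of_hasDerivAt h (hγ.2 t ht).1 (hp t ht) (hΩ t ht) ?_
    rw [← hA t ht]
    exact hc t ht
  have huniq : ∀ α₀, IsTransported Φ a
      (pullForm (expMap Φ a) (coframeAt θ p (expMap Φ a)) (c 1)) α₀ →
      α₀ = pullForm a.proj (coframeAt θ p a.proj) (c 0) := by
    rintro α₀ ⟨δ, β, hδ, hβ, hβ1, hβ0⟩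
    have heq : Set.EqOn δ γ (Set.Icc 0 1) := hδ.eqOn hΦ hγ
    have hpδ : ∀ t ∈ Set.Icc (0 : ℝ) 1, δ t ∈ (chartAt R8 p).source := fun t ht => by
      rw [heq ht]; exact hp t ht
    have hΩδ : ∀ t ∈ Set.Icc (0 : ℝ) 1, extChartAt (𝓡 8) p (δ t) ∈ Ω := fun t ht => by
      rw [heq ht]; exact hΩ t ht
    have hcoef := hasDerivWithinAt_coeffs h (fun t ht => (hδ.2 t ht).1) hpδ hΩδ hβ
    have hdd : ∀ t ∈ Set.Icc (0 : ℝ) 1, deriv (fun r => extChartAt (𝓡 8) p (δ r)) t =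
        deriv (fun r => extChartAt (𝓡 8) p (γ r)) t := fun t ht => by
      have e1 := ((contDiffAt_chart_comp (hδ.2 t ht).1 (hpδ t ht)).differentiableAt
        (by norm_num)).hasDerivAt.hasDerivWithinAt (s := Set.Icc 0 1)
      have e2 := ((contDiffAt_chart_comp (hγ.2 t ht).1 (hp t ht)).differentiableAt
        (by norm_num)).hasDerivAt.hasDerivWithinAt (s := Set.Icc 0 1)
      have e3 := e2.congr (f₁ := fun r => extChartAt (𝓡 8) p (δ r))
        (fun s hs => by rw [heq hs]) (by rw [heq ht])
      exact (uniqueDiffOn_Icc zero_lt_one t ht).eq_deriv _ e1 e3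
    set d : ℝ → Fin 7 → ℝ := fun r => coeffs (coframeAt θ p (δ r)) (β r) with hd
    have hdA : ∀ t ∈ Set.Icc (0 : ℝ) 1,
        HasDerivWithinAt d (connOp (A t) (d t)) (Set.Icc 0 1) t := fun t ht => by
      have e : A t = conn θ (extChartAt (𝓡 8) p (δ t))
          (deriv (fun r => extChartAt (𝓡 8) p (δ r)) t) := by
        rw [hdd t ht, heq ht, hA t ht]
      rw [e]
      exact (hcoef t ht).2
    have hd1 : d 1 = c 1 := by
      have e4 := congrArg (fun z : Σ q : M, Form2 q => coeffs (coframeAt θ p z.1) z.2) hβ1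
      have hL : IsCoframe Φ (expMap Φ a) (coframeAt θ p (expMap Φ a)) := by
        rw [hexp]
        exact h.at (hp 1 h11) (hΩ 1 h11)
      exact e4.trans (hL.coeffs_pullForm _)
    have hcd : Set.EqOn d c (Set.Icc 0 1) := by
      refine ODE_solution_unique_of_mem_Icc_left (v := fun t x => connOp (A t) x)
        (s := fun _ => Set.univ) (K := K.toNNReal) (fun t ht => ?_)
        (fun t ht => (hdA t ht).continuousWithinAt) (fun t ht => ?_) (fun _ _ => trivial)
        (fun t ht => (hc t ht).continuousAt.continuousWithinAt)
        (fun t ht => (hc t ⟨ht.1.le, ht.2⟩).hasDerivWithinAt) (fun _ _ => trivial) hd1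
      · have hl := (connOp (A t)).lipschitz.lipschitzOnWith (s := Set.univ)
        refine hl.weaken ?_
        have := hK t ⟨ht.1.le, ht.2⟩
        rw [← NNReal.coe_le_coe, coe_nnnorm]
        exact this.trans (Real.le_coe_toNNReal K)
      · exact (hdA t ⟨ht.1.le, ht.2⟩).mono_of_mem_nhdsWithin (Icc_mem_nhdsLE_of_mem ht)
    have e5 : (⟨a.proj, α₀⟩ : Σ q : M, Form2 q) = sec (c 0) a.proj := by
      rw [← hβ0, ← hδ.apply_zero, ← hcd h01]
      exact congrArg (Sigma.mk (δ 0)) (hcoef 0 h01).1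
    exact eq_of_heq (Sigma.mk.inj e5).2
  have hex : ∃ α₀, IsTransported Φ a
      (pullForm (expMap Φ a) (coframeAt θ p (expMap Φ a)) (c 1)) α₀ := ⟨_, htr⟩
  have h1 : transport Φ a (pullForm (expMap Φ a) (coframeAt θ p (expMap Φ a)) (c 1)) =
    hex.choose := dif_pos hex
  rw [h1]
  exact huniq _ hex.choose_spec

/-- Around each point there is a chart that describes the exponential map near the zero section. -/
theorem exists_expChart [T2Space M] (hΦ : IsSpin7Structure Φ) {p q : M}
    (hq : q ∈ (chartAt R8 p).source) :
    ∃ Ω θ r C E, IsExpChart Φ p Ω θ (extChartAt (𝓡 8) p q) r C E := by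
  obtain ⟨Ω, θ, h, hy₀⟩ := exists_localCoframe hΦ hq
  set y₀ := extChartAt (𝓡 8) p q with hy
  have hi : ∀ y ∈ Ω, (θ y).IsInvertible := fun y hy => h.isInvertible hy
  obtain ⟨ρ, hρ, hρΩ⟩ := Metric.isOpen_iff.1 h.isOpen y₀ hy₀
  obtain ⟨B, hB, hBb⟩ := exists_bound_conn h.isOpen h.contDiffOn hi
    (isCompact_closedBall y₀ (ρ / 2)) ((Metric.closedBall_subset_ball (by linarith)).trans hρΩ)
  -- With `‖V‖ < η`, the operator of parallel transport has norm at most `112 B η ≤ 1 / 8`; the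
  -- constant of the estimate is `448 B = 2 * 2 * 112 B`, because `‖V‖` and the solution at most
  -- double.
  set η := min (ρ / 2) (1 / (896 * B)) with hη
  have hη0 : 0 < η := by positivity
  have hηB : 448 * B * η ≤ 1 / 2 := by
    calc 448 * B * η ≤ 448 * B * (1 / (896 * B)) := by
          gcongr
          exact min_le_right _ _
      _ = 1 / 2 := by field_simp; norm_num
  obtain ⟨r, hr, Y, V, hYV, hsm, hzero⟩ := exists_geodesic_flow h.isOpen h.contDiffOn hi hy₀ hη0
  have hIcc : ∀ t ∈ Set.Icc (0 : ℝ) 1, t ∈ Set.Ioo (-1 : ℝ) 2 := fun t ht =>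
    ⟨by linarith [ht.1], by linarith [ht.2]⟩
  have h0 : (0 : ℝ) ∈ Set.Ioo (-1 : ℝ) 2 := by norm_num
  have h1 : (1 : ℝ) ∈ Set.Ioo (-1 : ℝ) 2 := by norm_num
  have hgeo : ∀ a : TangentBundle (𝓡 8) M, a.proj ∈ (chartAt R8 p).source →
      tangentCoords p a ∈ Metric.ball (y₀, (0 : R8)) r →
      IsGeodesicFrom Φ a (fun t => (extChartAt (𝓡 8) p).symm (Y (tangentCoords p a) t)) := by
    intro a ha hz
    obtain ⟨e0, e1, e2, -⟩ := hYV _ hz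
    exact isGeodesicFrom_of_solution h (fun t ht => ⟨(e2 t ht).1, (e2 t ht).2.1, (e2 t ht).2.2.1⟩)
      ha e0 e1
  refine ⟨Ω, θ, r, 448 * B, fun z => Y z 1, h, hr, by positivity, hsm, fun z hz => ?_,
    fun y hy => (hzero y hy).1, fun y hy => (hzero y hy).2, fun a ha hz => ⟨_, hgeo a ha hz⟩,
    fun a ha hz => expMap_eq hΦ (hgeo a ha hz), fun a ha hz α => ?_⟩
  · obtain ⟨e0, e1, e2, -⟩ := hYV z hz
    refine ⟨?_, (e2 1 h1).2.2.1, ?_⟩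
    · rw [← e0]; exact (e2 0 h0).2.2.1
    · rw [← e1]
      calc 448 * B * ‖V z 0‖ ≤ 448 * B * η := by
            gcongr
            exact (e2 0 h0).2.2.2.2.le
        _ ≤ 1 / 2 := hηB
  · set z := tangentCoords p a with hzdef
    obtain ⟨e0, e1, e2, e3⟩ := hYV z hz
    set A : ℝ → R8 → R8 := fun t => conn θ (Y z t) (V z t) with hA
    have hAn : ∀ t ∈ Set.Ioo (-1 : ℝ) 2, ‖connOp (A t)‖ ≤ 112 * (B * ‖V z t‖) := by
      intro t ht
      refine norm_connOp_le fun u => hBb _ ?_ _ _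
      rw [Metric.mem_closedBall, dist_eq_norm]
      exact (e2 t ht).2.2.2.1.le.trans (min_le_left _ _)
    have hAc : ContinuousOn (fun t => connOp (A t)) (Set.Ioo (-1 : ℝ) 2) := by
      refine continuousOn_connOp fun u => ?_
      have k1 : ContDiffOn ℝ ∞ (fun w : R8 × R8 => conn θ w.1 w.2 u) (Ω ×ˢ Set.univ) :=
        contDiffOn_conn h.isOpen h.contDiffOn hi contDiff_fst.contDiffOn (fun _ hp => hp.1)
          contDiff_snd.contDiffOn contDiff_const.contDiffOn
      have k2 : ContinuousOn (fun t => (Y z t, V z t)) (Set.Ioo (-1 : ℝ) 2) := fun t ht =>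
        ((e2 t ht).1.continuousAt.prodMk (e2 t ht).2.1.continuousAt).continuousWithinAt
      have k3 : Set.MapsTo (fun t => (Y z t, V z t)) (Set.Ioo (-1 : ℝ) 2) (Ω ×ˢ Set.univ) :=
        fun t ht => ⟨(e2 t ht).2.2.1, trivial⟩
      have k4 := k1.continuousOn.comp k2 k3
      exact k4
    -- continue the coefficient by constants outside a smaller interval
    set σ : ℝ → ℝ := fun t => Set.projIcc (-1 / 2 : ℝ) (3 / 2) (by norm_num) t with hσ
    have hσI : ∀ t, σ t ∈ Set.Ioo (-1 : ℝ) 2 := fun t => by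
      have := (Set.projIcc (-1 / 2 : ℝ) (3 / 2) (by norm_num) t).2
      exact ⟨by linarith [this.1], by linarith [this.2]⟩
    have hσe : ∀ t ∈ Set.Icc (0 : ℝ) 1, σ t = t := fun t ht => by
      simp only [hσ]
      rw [Set.projIcc_of_mem (by norm_num) ⟨by linarith [ht.1], by linarith [ht.2]⟩]
    have hσc : Continuous (fun t => connOp (A (σ t))) :=
      hAc.comp_continuous (continuous_subtype_val.comp continuous_projIcc) hσI
    obtain ⟨c, hc1, hc⟩ := exists_linear_solution hσc (fun t => by
      refine (hAn _ (hσI t)).trans ?_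
      have k5 := (e2 _ (hσI t)).2.2.2.2
      nlinarith [norm_nonneg (V z (σ t))]) α
    have hc' : ∀ t ∈ Set.Icc (0 : ℝ) 1, HasDerivAt c (connOp (A t) (c t)) t := fun t ht => by
      have := (hc t (hIcc t ht)).1
      rwa [hσe t ht] at this
    refine ⟨c 0, ?_, ?_⟩
    -- Along the geodesic `‖V‖ ≤ 2 ‖z.2‖` and `‖c‖ ≤ 2 ‖α‖`, which bounds the derivative of `c`.
    · have k6 : ∀ t ∈ Set.Icc (0 : ℝ) 1, ‖connOp (A t) (c t)‖ ≤ 448 * B * ‖z.2‖ * ‖α‖ := by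
        intro t ht
        have k7 := e3 t ht
        calc ‖connOp (A t) (c t)‖ ≤ ‖connOp (A t)‖ * ‖c t‖ := ContinuousLinearMap.le_opNorm _ _
          _ ≤ (112 * (B * (2 * ‖z.2‖))) * (2 * ‖α‖) := by
              gcongr
              · exact (hAn t (hIcc t ht)).trans (by gcongr)
              · exact (hc t (hIcc t ht)).2
          _ = _ := by ring
      -- Integrate the bound for `c'` over `[0, 1]`.
      have k8 := norm_image_sub_le_of_norm_deriv_le_segment_01'
        (fun t ht => (hc' t ht).hasDerivWithinAt) (fun t ht => k6 t ⟨ht.1, ht.2.le⟩)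
      rwa [norm_sub_rev, hc1] at k8
    · rw [← hc1]
      have hs : ∀ t ∈ Set.Ioo (-1 : ℝ) 2,
          extChartAt (𝓡 8) p ((extChartAt (𝓡 8) p).symm (Y z t)) = Y z t :=
        fun t ht => chart_symm (h.subset (e2 t ht).2.2.1)
      refine transport_eq_of_solution hΦ h (hgeo a ha hz)
        (fun t ht => symm_mem_source (h.subset (e2 t (hIcc t ht)).2.2.1))
        (fun t ht => by rw [hs t (hIcc t ht)]; exact (e2 t (hIcc t ht)).2.2.1) (A := A)
        (fun t ht => ?_) (K := 1 / 2) (fun t ht => ?_) hc'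
      · rw [hs t (hIcc t ht)]
        have k9 : (fun r => extChartAt (𝓡 8) p ((extChartAt (𝓡 8) p).symm (Y z r)))
            =ᶠ[𝓝 t] Y z :=
          Filter.eventually_of_mem (isOpen_Ioo.mem_nhds (hIcc t ht)) hs
        have k10 : deriv (fun r => extChartAt (𝓡 8) p ((extChartAt (𝓡 8) p).symm (Y z r))) t
            = V z t := k9.deriv_eq.trans (e2 t (hIcc t ht)).1.deriv
        exact congrArg (conn θ (Y z t)) k10.symm
      · refine (hAn t (hIcc t ht)).trans ?_
        have k11 := (e2 t (hIcc t ht)).2.2.2.2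
        nlinarith [norm_nonneg (V z t)]

end ExpChart

/-! ### Maps into `M` in coordinates -/

section CoordRep

variable {M : Type*} [TopologicalSpace M] [ChartedSpace R8 M]
variable {X : Type*} [TopologicalSpace X] [ChartedSpace R4 X]

/-- The expression of `g : X → M` in the charts at `x₀` and `p`. -/
def coordRep (g : X → M) (p : M) (x₀ : X) (ξ : R4) : R8 :=
  extChartAt (𝓡 8) p (g ((extChartAt (𝓡 4) x₀).symm ξ))

/-- The points of the chart at `x₀` that `g` maps to the chart at `p`, in coordinates: the domain
of `coordRep g p x₀`. -/
def coordDomain (g : X → M) (p : M) (x₀ : X) : Set R4 :=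
  (extChartAt (𝓡 4) x₀).target ∩ (extChartAt (𝓡 4) x₀).symm ⁻¹' (g ⁻¹' (chartAt R8 p).source)

theorem coordRep_chart (g : X → M) (p : M) {x₀ x : X} (hx : x ∈ (chartAt R4 x₀).source) :
    coordRep g p x₀ (extChartAt (𝓡 4) x₀ x) = extChartAt (𝓡 8) p (g x) := by
  rw [coordRep, (extChartAt (𝓡 4) x₀).left_inv (by rwa [extChartAt_source])]

theorem mem_coordDomain {g : X → M} {p : M} {x₀ x : X} (hx : x ∈ (chartAt R4 x₀).source)
    (hp : g x ∈ (chartAt R8 p).source) : extChartAt (𝓡 4) x₀ x ∈ coordDomain g p x₀ := by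
  refine ⟨(extChartAt (𝓡 4) x₀).map_source (by rwa [extChartAt_source]), ?_⟩
  rwa [Set.mem_preimage, Set.mem_preimage,
    (extChartAt (𝓡 4) x₀).left_inv (by rwa [extChartAt_source])]

theorem symm_mem_source_of_mem_coordDomain {g : X → M} {p : M} {x₀ : X} {ξ : R4}
    (hξ : ξ ∈ coordDomain g p x₀) :
    (extChartAt (𝓡 4) x₀).symm ξ ∈ (chartAt R4 x₀).source := by
  have := (extChartAt (𝓡 4) x₀).map_target hξ.1
  rwa [extChartAt_source] at this

theorem isOpen_coordDomain {g : X → M} (hg : Continuous g) (p : M) (x₀ : X) :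
    IsOpen (coordDomain g p x₀) :=
  (continuousOn_extChartAt_symm x₀).isOpen_inter_preimage (isOpen_extChartAt_target x₀)
    ((chartAt R8 p).open_source.preimage hg)

variable [IsManifold (𝓡 8) ∞ M] [IsManifold (𝓡 4) ∞ X]

theorem contDiffOn_coordRep {g : X → M} (hg : ContMDiff (𝓡 4) (𝓡 8) ∞ g) (p : M) (x₀ : X) :
    ContDiffOn ℝ ∞ (coordRep g p x₀) (coordDomain g p x₀) := by
  intro ξ hξ
  have h1 : ContMDiffAt 𝓘(ℝ, R4) (𝓡 4) ∞ (extChartAt (𝓡 4) x₀).symm ξ :=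
    (contMDiffOn_extChartAt_symm x₀).contMDiffAt ((isOpen_extChartAt_target x₀).mem_nhds hξ.1)
  have h2 := (contMDiffAt_chart (n := ⊤) hξ.2).comp ξ ((hg _).comp ξ h1)
  exact (contMDiffAt_iff_contDiffAt.1 h2).contDiffWithinAt

theorem coordRep_contDiffAt {g : X → M} (hg : ContMDiff (𝓡 4) (𝓡 8) ∞ g) {p : M} {x₀ : X} {ξ : R4}
    (hξ : ξ ∈ coordDomain g p x₀) : ContDiffAt ℝ ∞ (coordRep g p x₀) ξ :=
  (contDiffOn_coordRep hg p x₀).contDiffAt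
    ((isOpen_coordDomain hg.continuous p x₀).mem_nhds hξ)

/-- The components of a tangent vector of `X` at `x` in the chart at `x₀`. -/
def toCoordsX (x₀ x : X) : TangentSpace (𝓡 4) x →L[ℝ] R4 :=
  mfderiv (𝓡 4) 𝓘(ℝ, R4) (extChartAt (𝓡 4) x₀) x

theorem toCoordsX_bijective {x₀ x : X} (hx : x ∈ (chartAt R4 x₀).source) :
    Function.Bijective (toCoordsX x₀ x) := by
  obtain ⟨e, he⟩ := isInvertible_mfderiv_extChartAt (I := 𝓡 4) (x := x₀) (y := x)
    (by rwa [extChartAt_source])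
  have h : (toCoordsX x₀ x : TangentSpace (𝓡 4) x → R4) = e := by
    rw [toCoordsX, ← he]; rfl
  rw [h]
  exact e.bijective

/-- The differential of a map, in coordinates. -/
theorem toCoords_dmap {g : X → M} {p : M} {x₀ x : X}
    (hx : x ∈ (chartAt R4 x₀).source) (hp : g x ∈ (chartAt R8 p).source)
    (hgx : MDifferentiableAt (𝓡 4) (𝓡 8) g x)
    (hd : DifferentiableAt ℝ (coordRep g p x₀) (extChartAt (𝓡 4) x₀ x))
    (w : TangentSpace (𝓡 4) x) :
    toCoords p (g x) (dmap g x w) =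
      fderiv ℝ (coordRep g p x₀) (extChartAt (𝓡 4) x₀ x) (toCoordsX x₀ x w) := by
  rw [toCoords_mfderiv hp hgx]
  have h1 : (fun y => extChartAt (𝓡 8) p (g y)) =ᶠ[𝓝 x]
      coordRep g p x₀ ∘ extChartAt (𝓡 4) x₀ := by
    filter_upwards [(chartAt R4 x₀).open_source.mem_nhds hx] with y hy
    exact (coordRep_chart g p hy).symm
  have h2 : MDifferentiableAt (𝓡 4) 𝓘(ℝ, R4) (extChartAt (𝓡 4) x₀) x :=
    (contMDiffAt_extChartAt' (n := ∞) hx).mdifferentiableAt (by simp)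
  rw [h1.mfderiv_eq, mfderiv_comp x hd.mdifferentiableAt h2, mfderiv_eq_fderiv]
  rfl

theorem toCoords_dmap_of_contMDiff {g : X → M} (hg : ContMDiff (𝓡 4) (𝓡 8) ∞ g) {p : M} {x₀ x : X}
    (hx : x ∈ (chartAt R4 x₀).source) (hp : g x ∈ (chartAt R8 p).source)
    (w : TangentSpace (𝓡 4) x) :
    toCoords p (g x) (dmap g x w) =
      fderiv ℝ (coordRep g p x₀) (extChartAt (𝓡 4) x₀ x) (toCoordsX x₀ x w) :=
  toCoords_dmap hx hp ((hg x).mdifferentiableAt (by simp))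
    ((coordRep_contDiffAt hg (mem_coordDomain hx hp)).differentiableAt (by simp)) w

theorem isNormal_iff {Φ : Π q : M, Form4 q} {p : M} {Ω : Set R8} {θ : R8 → R8 →L[ℝ] R8}
    (h : IsLocalCoframe Φ p Ω θ) {f : X → M} (hf : ContMDiff (𝓡 4) (𝓡 8) ∞ f) {x₀ x : X}
    (hx : x ∈ (chartAt R4 x₀).source) (hp : f x ∈ (chartAt R8 p).source)
    (hΩ : extChartAt (𝓡 8) p (f x) ∈ Ω) (n : TangentSpace (𝓡 8) (f x)) :
    IsNormal Φ f x n ↔ ∀ w : R4, inner ℝ (θ (extChartAt (𝓡 8) p (f x)) (toCoords p (f x) n))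
      (θ (extChartAt (𝓡 8) p (f x))
        (fderiv ℝ (coordRep f p x₀) (extChartAt (𝓡 4) x₀ x) w)) = 0 := by
  have h1 : ∀ w : TangentSpace (𝓡 4) x, metric Φ (f x) n (dmap f x w) =
      inner ℝ (θ (extChartAt (𝓡 8) p (f x)) (toCoords p (f x) n))
      (θ (extChartAt (𝓡 8) p (f x)) (fderiv ℝ (coordRep f p x₀) (extChartAt (𝓡 4) x₀ x)
        (toCoordsX x₀ x w))) := fun w => by
    rw [(h.at hp hΩ).metric_eq, ← toCoords_dmap_of_contMDiff hf hx hp]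
    rfl
  constructor
  · intro hn w
    obtain ⟨w', rfl⟩ := (toCoordsX_bijective hx).surjective w
    rw [← h1]
    exact hn w'
  · intro hn w
    rw [h1]
    exact hn _

end CoordRep

/-- A linear system in `R4` is tested on the standard basis. -/
theorem forall_inner_eq_zero_iff (L : R4 →L[ℝ] R8) (u : R8) :
    (∀ w : R4, inner ℝ u (L w) = (0 : ℝ)) ↔
      ∀ i : Fin 4, inner ℝ u (L (EuclideanSpace.single i 1)) = (0 : ℝ) := by
  refine ⟨fun h i => h _, fun h w => ?_⟩
  have hw : w = ∑ i, w i • (EuclideanSpace.single i (1 : ℝ) : R4) := by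
    conv_lhs => rw [← (EuclideanSpace.basisFun (Fin 4) ℝ).sum_repr w]
    simp
  rw [hw, map_sum, inner_sum]
  refine Finset.sum_eq_zero fun i _ => ?_
  rw [map_smul, real_inner_smul_right, h i, mul_zero]

section TubularMap

variable {F : R4 → R8} {A : R8 → R8 →L[ℝ] R8} {E : R8 × R8 → R8} {D : Set R4} {Ω : Set R8} {r : ℝ}

/-- The map whose inverse function gives normal coordinates: a point `ξ` of the submanifold and a
vector `v` at that point are sent to the end point of the geodesic and to the tangential components
of `v`. -/
def tubularMap (F : R4 → R8) (A : R8 → R8 →L[ℝ] R8) (E : R8 × R8 → R8) (z : R4 × R8) :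
    R8 × (Fin 4 → ℝ) :=
  (E (F z.1, z.2), fun i => inner ℝ (A (F z.1) z.2)
    (A (F z.1) (fderiv ℝ F z.1 (EuclideanSpace.single i 1))))

theorem contDiffOn_tubularMap (hD : IsOpen D) (hF : ContDiffOn ℝ ∞ F D)
    (hA : ContDiffOn ℝ ∞ A Ω) {B : Set (R8 × R8)} (hE : ContDiffOn ℝ ∞ E B) :
    ContDiffOn ℝ ∞ (tubularMap F A E)
      {z | z.1 ∈ D ∧ F z.1 ∈ Ω ∧ (F z.1, z.2) ∈ B} := by
  set s : Set (R4 × R8) := {z | z.1 ∈ D ∧ F z.1 ∈ Ω ∧ (F z.1, z.2) ∈ B} with hs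
  have h1 : ContDiffOn ℝ ∞ (fun z : R4 × R8 => F z.1) s :=
    hF.comp contDiff_fst.contDiffOn fun z hz => hz.1
  have h2 : ContDiffOn ℝ ∞ (fun z : R4 × R8 => fderiv ℝ F z.1) s :=
    (hF.fderiv_of_isOpen hD (m := ∞) (by simp)).comp contDiff_fst.contDiffOn fun z hz => hz.1
  have h3 : ContDiffOn ℝ ∞ (fun z : R4 × R8 => A (F z.1)) s :=
    hA.comp h1 fun z hz => hz.2.1
  refine ContDiffOn.prodMk (hE.comp (h1.prodMk contDiff_snd.contDiffOn) fun z hz => hz.2.2) ?_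
  rw [contDiffOn_pi]
  exact fun i => (h3.clm_apply contDiff_snd.contDiffOn).inner ℝ
    (h3.clm_apply (h2.clm_apply contDiffOn_const))

/-- Along the zero section the derivative of the tubular map is `(w, v) ↦ (dF w + v, vᵀ)`, with
`vᵀ` the tangential components of `v`; it is invertible because `v = -dF w` is tangential. -/
theorem exists_hasFDerivAt_tubularMap {ξ : R4} (hF : ContDiffAt ℝ ∞ F ξ)
    (hA : DifferentiableAt ℝ A (F ξ)) (hAi : Function.Injective (A (F ξ)))
    (hFi : Function.Injective (fderiv ℝ F ξ))
    (hE : HasFDerivAt E (ContinuousLinearMap.fst ℝ R8 R8 + ContinuousLinearMap.snd ℝ R8 R8)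
      (F ξ, 0)) :
    ∃ L : (R4 × R8) ≃L[ℝ] (R8 × (Fin 4 → ℝ)),
      HasFDerivAt (tubularMap F A E) (L : (R4 × R8) →L[ℝ] (R8 × (Fin 4 → ℝ))) (ξ, 0) := by
  let L₀ : (R4 × R8) →L[ℝ] (R8 × (Fin 4 → ℝ)) :=
    ((fderiv ℝ F ξ).comp (ContinuousLinearMap.fst ℝ R4 R8) + ContinuousLinearMap.snd ℝ R4 R8).prod
      (ContinuousLinearMap.pi fun i => (innerSL ℝ (A (F ξ)
        (fderiv ℝ F ξ (EuclideanSpace.single i 1)))).comp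
          ((A (F ξ)).comp (ContinuousLinearMap.snd ℝ R4 R8)))
  have hd : HasFDerivAt (tubularMap F A E) L₀ (ξ, 0) := by
    have h1 : HasFDerivAt (fun z : R4 × R8 => F z.1)
        ((fderiv ℝ F ξ).comp (ContinuousLinearMap.fst ℝ R4 R8)) (ξ, 0) :=
      (hF.differentiableAt (by simp)).hasFDerivAt.comp (ξ, (0 : R8)) hasFDerivAt_fst
    have h2 : DifferentiableAt ℝ (fun z : R4 × R8 => fderiv ℝ F z.1) (ξ, 0) :=
      ((hF.fderiv_right (m := ∞) (by simp)).differentiableAt (by simp)).comp (ξ, (0 : R8))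
        differentiableAt_fst
    have h3 : DifferentiableAt ℝ (fun z : R4 × R8 => A (F z.1)) (ξ, 0) :=
      hA.comp (ξ, (0 : R8)) h1.differentiableAt
    refine HasFDerivAt.prodMk ?_ (hasFDerivAt_pi.2 fun i => ?_)
    · have h4 := hE.comp (ξ, (0 : R8)) (h1.prodMk (hasFDerivAt_snd (𝕜 := ℝ) (p := (ξ, (0 : R8)))))
      refine h4.congr_fderiv (ContinuousLinearMap.ext fun z => ?_)
      simp
    · have h5 : HasFDerivAt (fun z : R4 × R8 => A (F z.1) z.2)
          ((A (F ξ)).comp (ContinuousLinearMap.snd ℝ R4 R8)) (ξ, 0) := by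
        refine (h3.hasFDerivAt.clm_apply
          (hasFDerivAt_snd (𝕜 := ℝ) (p := (ξ, (0 : R8))))).congr_fderiv
          (ContinuousLinearMap.ext fun z => ?_)
        simp
      have h6 : DifferentiableAt ℝ (fun z : R4 × R8 =>
          A (F z.1) (fderiv ℝ F z.1 (EuclideanSpace.single i 1))) (ξ, 0) :=
        h3.clm_apply (h2.clm_apply (differentiableAt_const _))
      refine (h5.inner ℝ h6.hasFDerivAt).congr_fderiv (ContinuousLinearMap.ext fun z => ?_)
      simp [fderivInnerCLM_apply, real_inner_comm]
  -- If `dF w + v = 0` and `v` is orthogonal to the image of `dF`, then `v` is orthogonal to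
  -- itself.
  have hinj : Function.Injective L₀ := by
    rw [injective_iff_map_eq_zero]
    rintro ⟨w, v⟩ h
    have h1 : fderiv ℝ F ξ w + v = 0 := congrArg Prod.fst h
    have h2 : ∀ i : Fin 4, inner ℝ (A (F ξ) v)
        ((A (F ξ)).comp (fderiv ℝ F ξ) (EuclideanSpace.single i 1)) = (0 : ℝ) := fun i => by
      rw [real_inner_comm]
      exact congrFun (congrArg Prod.snd h) i
    have h3 := (forall_inner_eq_zero_iff _ _).2 h2 (-w)
    have h4 : fderiv ℝ F ξ (-w) = v := by
      rw [map_neg]; exact (eq_neg_of_add_eq_zero_right h1).symm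
    rw [ContinuousLinearMap.comp_apply, h4, inner_self_eq_zero] at h3
    have h5 : v = 0 := hAi (by rw [h3, map_zero])
    have h6 : w = 0 := hFi (by rw [map_zero]; simpa [h5] using h1)
    rw [h5, h6]; rfl
  have hfin : finrank ℝ (R4 × R8) = finrank ℝ (R8 × (Fin 4 → ℝ)) := by simp
  let L := (LinearEquiv.ofInjectiveOfFinrankEq L₀.toLinearMap hinj hfin).toContinuousLinearEquiv
  refine ⟨L, ?_⟩
  have hL : (L : (R4 × R8) →L[ℝ] (R8 × (Fin 4 → ℝ))) = L₀ :=
    ContinuousLinearMap.ext fun z => rfl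
  rw [hL]
  exact hd

end TubularMap

section Tubular

variable {M : Type*} [TopologicalSpace M] [ChartedSpace R8 M] [IsManifold (𝓡 8) ∞ M]
variable {X : Type*} [TopologicalSpace X] [ChartedSpace R4 X] [IsManifold (𝓡 4) ∞ X]
variable {Φ : Π q : M, Form4 q} {f : X → M}

theorem trivializationAt_snd {p : M} {a : TangentBundle (𝓡 8) M}
    (ha : a.proj ∈ (chartAt R8 p).source) :
    (trivializationAt R8 (TangentSpace (𝓡 8)) p a).2 = toCoords p a.proj a.2 :=
  (Bundle.Trivialization.continuousLinearMapAt_apply_of_mem ℝ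
    (trivializationAt R8 (TangentSpace (𝓡 8)) p) ha a.2).symm

theorem isOpen_proj_preimage {s : Set M} (hs : IsOpen s) :
    IsOpen {a : TangentBundle (𝓡 8) M | a.proj ∈ s} :=
  hs.preimage (FiberBundle.continuous_proj R8 (TangentSpace (𝓡 8) (M := M)))

theorem contMDiffOn_tangentCoords (p : M) :
    ContMDiffOn (𝓡 8).tangent 𝓘(ℝ, R8 × R8) ∞ (tangentCoords p)
      {a : TangentBundle (𝓡 8) M | a.proj ∈ (chartAt R8 p).source} := by
  have h1 : ContMDiffOn (𝓡 8).tangent 𝓘(ℝ, R8) ∞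
      (fun a : TangentBundle (𝓡 8) M => extChartAt (𝓡 8) p a.proj)
      {a | a.proj ∈ (chartAt R8 p).source} :=
    (contMDiffOn_extChartAt (n := ∞)).comp (Bundle.contMDiff_proj _).contMDiffOn fun a ha => ha
  have h2 : ContMDiffOn (𝓡 8).tangent 𝓘(ℝ, R8) ∞
      (fun a : TangentBundle (𝓡 8) M => toCoords p a.proj a.2)
      {a | a.proj ∈ (chartAt R8 p).source} := by
    have h3 := ((trivializationAt R8 (TangentSpace (𝓡 8)) p).contMDiffOn_iff (n := ∞)
      (IM := (𝓡 8).tangent) (IB := 𝓡 8) (f := fun a : TangentBundle (𝓡 8) M => a)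
      (s := {a | a.proj ∈ (chartAt R8 p).source}) fun a ha =>
        ((trivializationAt R8 (TangentSpace (𝓡 8)) p).mem_source).2 ha).1 contMDiffOn_id
    exact h3.2.congr fun a ha => (trivializationAt_snd ha).symm
  exact h1.prodMk_space h2

theorem IsExpChart.contMDiffOn_expMap {p : M} {Ω : Set R8} {θ : R8 → R8 →L[ℝ] R8} {y₀ : R8}
    {r C : ℝ} {E : R8 × R8 → R8} (h : IsExpChart Φ p Ω θ y₀ r C E) :
    ContMDiffOn (𝓡 8).tangent (𝓡 8) ∞ (expMap Φ) {a | a.proj ∈ (chartAt R8 p).source ∧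
      tangentCoords p a ∈ Metric.ball (y₀, (0 : R8)) r} := by
  have h1 : ContMDiffOn 𝓘(ℝ, R8 × R8) (𝓡 8) ∞ (fun z => (extChartAt (𝓡 8) p).symm (E z))
      (Metric.ball (y₀, (0 : R8)) r) :=
    (contMDiffOn_extChartAt_symm p).comp h.contDiffOn.contMDiffOn fun z hz =>
      h.coframe.subset (h.mem z hz).2.1
  refine (h1.comp ((contMDiffOn_tangentCoords p).mono fun a ha => ha.1) fun a ha => ha.2).congr
    fun a ha => ?_
  exact h.expMap_eq a ha.1 ha.2

theorem IsExpChart.expMap_zero {p : M} {Ω : Set R8} {θ : R8 → R8 →L[ℝ] R8} {y₀ : R8}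
    {r C : ℝ} {E : R8 × R8 → R8} (h : IsExpChart Φ p Ω θ y₀ r C E) {q : M}
    (hq : q ∈ (chartAt R8 p).source)
    (hz : (extChartAt (𝓡 8) p q, (0 : R8)) ∈ Metric.ball (y₀, (0 : R8)) r) :
    expMap Φ (⟨q, 0⟩ : TangentBundle (𝓡 8) M) = q := by
  have e : tangentCoords p (⟨q, 0⟩ : TangentBundle (𝓡 8) M) = (extChartAt (𝓡 8) p q, 0) := by
    simp [tangentCoords]
  rw [h.expMap_eq _ hq (by rwa [e]), e, h.apply_zero _ hz, symm_chart hq]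

/-- Parallel transport along short geodesics is injective on `Λ²₇`. -/
theorem IsExpChart.transport_eq_zero_iff {p : M} {Ω : Set R8} {θ : R8 → R8 →L[ℝ] R8} {y₀ : R8}
    {r C : ℝ} {E : R8 × R8 → R8} (h : IsExpChart Φ p Ω θ y₀ r C E) {a : TangentBundle (𝓡 8) M}
    (ha : a.proj ∈ (chartAt R8 p).source)
    (hz : tangentCoords p a ∈ Metric.ball (y₀, (0 : R8)) r) (β : Form2 (expMap Φ a))
    (hβ : β ∈ Lambda27 Φ (expMap Φ a)) : transport Φ a β = 0 ↔ β = 0 := by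
  have hE := h.mem _ hz
  have hsub := h.coframe.subset hE.2.1
  have he := h.expMap_eq a ha hz
  have hes : expMap Φ a ∈ (chartAt R8 p).source := by rw [he]; exact symm_mem_source hsub
  have heΩ : extChartAt (𝓡 8) p (expMap Φ a) ∈ Ω := by rw [he, chart_symm hsub]; exact hE.2.1
  have hco : IsCoframe Φ (expMap Φ a) (coframeAt θ p (expMap Φ a)) := h.coframe.at hes heΩ
  have hco' : IsCoframe Φ a.proj (coframeAt θ p a.proj) := h.coframe.at ha hE.1
  obtain ⟨α, rfl⟩ := hco.mem_Lambda27_iff.1 hβ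
  obtain ⟨c, hc, hct⟩ := h.transport_eq a ha hz α
  rw [hct]
  have h1 : ‖c - α‖ ≤ 1 / 2 * ‖α‖ := hc.trans
    (mul_le_mul_of_nonneg_right hE.2.2 (norm_nonneg _))
  constructor
  · intro h0
    have hc0 : c = 0 := hco'.pullForm_injective (h0.trans (pullForm_zero _ _).symm)
    have hα : α = 0 := by
      rw [hc0, zero_sub, norm_neg] at h1
      exact norm_le_zero_iff.1 (by linarith [norm_nonneg α])
    rw [hα, pullForm_zero]
  · intro h0
    have hα : α = 0 := hco.pullForm_injective (h0.trans (pullForm_zero _ _).symm)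
    have hc0 : c = 0 := by
      rw [hα, sub_zero, norm_zero, mul_zero] at h1
      exact norm_le_zero_iff.1 h1
    rw [hc0, pullForm_zero]

theorem expMap_zero [T2Space M] (hΦ : IsSpin7Structure Φ) (q : M) :
    expMap Φ (⟨q, 0⟩ : TangentBundle (𝓡 8) M) = q := by
  obtain ⟨Ω, θ, r, C, E, h⟩ := exists_expChart hΦ (mem_chart_source R8 q)
  exact h.expMap_zero (mem_chart_source R8 q) (Metric.mem_ball_self h.pos)

/-- Near a point `f x₀`, the exponential map of the normal bundle has a smooth inverse `ρ`. The
neighbourhood `O` is open in the whole tangent bundle; `ρ` takes values in the normal bundle, and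
is inverse to `exp` on the part of `O` in it. -/
theorem exists_local_tubular [T2Space M] (hΦ : IsSpin7Structure Φ) (hf : IsSmoothEmb f) (x₀ : X) :
    ∃ (O : Set (TangentBundle (𝓡 8) M)) (W : Set M) (ρ : M → TangentBundle (𝓡 8) M),
      IsOpen O ∧ (⟨f x₀, 0⟩ : TangentBundle (𝓡 8) M) ∈ O ∧ IsOpen W ∧
      (∀ a ∈ O, ExpDefined Φ a) ∧ ContMDiffOn (𝓡 8).tangent (𝓡 8) ∞ (expMap Φ) O ∧
      ContMDiffOn (𝓡 8) (𝓡 8).tangent ∞ ρ W ∧ (∀ q ∈ W, ρ q ∈ normalBundle Φ f) ∧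
      (∀ q ∈ W, ρ q ∈ O → expMap Φ (ρ q) = q) ∧
      (∀ a ∈ O ∩ normalBundle Φ f, expMap Φ a ∈ W ∧ ρ (expMap Φ a) = a) ∧
      ∀ a ∈ O, ∀ β ∈ Lambda27 Φ (expMap Φ a), transport Φ a β = 0 ↔ β = 0 := by
  set p := f x₀ with hp
  have hpp : f x₀ ∈ (chartAt R8 p).source := mem_chart_source R8 p
  have hxx : x₀ ∈ (chartAt R4 x₀).source := mem_chart_source R4 x₀
  obtain ⟨Ω, θ, r, C, E, h⟩ := exists_expChart hΦ hpp
  set y₀ := extChartAt (𝓡 8) p p with hy₀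
  set ξ₀ := extChartAt (𝓡 4) x₀ x₀ with hξ₀
  set F := coordRep f p x₀ with hF
  have hFξ₀ : F ξ₀ = y₀ := coordRep_chart f p hxx
  have hball : (y₀, (0 : R8)) ∈ Metric.ball (y₀, (0 : R8)) r := Metric.mem_ball_self h.pos
  have hΩ₀ : y₀ ∈ Ω := (h.mem _ hball).1
  have hDo := isOpen_coordDomain hf.1.continuous p x₀
  have hξD : ξ₀ ∈ coordDomain f p x₀ := mem_coordDomain hxx hpp
  have hFs := contDiffOn_coordRep hf.1 p x₀
  set s : Set (R4 × R8) :=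
    {z | z.1 ∈ coordDomain f p x₀ ∧ F z.1 ∈ Ω ∧ (F z.1, z.2) ∈ Metric.ball (y₀, (0 : R8)) r}
    with hs
  have hso : IsOpen s := by
    have h1 : ContinuousOn (fun z : R4 × R8 => (F z.1, z.2))
        {z : R4 × R8 | z.1 ∈ coordDomain f p x₀} :=
      (hFs.continuousOn.comp continuousOn_fst fun z hz => hz).prodMk continuousOn_snd
    have h2 := h1.isOpen_inter_preimage (hDo.preimage continuous_fst)
      ((h.coframe.isOpen.preimage continuous_fst).inter
        (Metric.isOpen_ball (x := (y₀, (0 : R8))) (ε := r)))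
    exact h2
  have hs₀ : (ξ₀, (0 : R8)) ∈ s := by
    refine ⟨hξD, ?_, ?_⟩
    · change F ξ₀ ∈ Ω; rw [hFξ₀]; exact hΩ₀
    · change (F ξ₀, (0 : R8)) ∈ _; rw [hFξ₀]; exact hball
  have hGs := contDiffOn_tubularMap hDo hFs h.coframe.contDiffOn h.contDiffOn
  have hθi : ∀ y ∈ Ω, Function.Injective (θ y) := fun y hy => by
    obtain ⟨e, he⟩ := h.coframe.isInvertible hy
    rw [← he]; exact e.injective
  have hFinj : Function.Injective (fderiv ℝ F ξ₀) := by
    rw [injective_iff_map_eq_zero]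
    intro w hw
    obtain ⟨w', rfl⟩ := (toCoordsX_bijective hxx).surjective w
    have h1 := toCoords_dmap_of_contMDiff hf.1 hxx hpp w'
    have h2 : toCoords p (f x₀) (dmap f x₀ w') = 0 := h1.trans hw
    have h3 : dmap f x₀ w' = 0 :=
      (toCoords_bijective hpp).injective (by rw [h2, map_zero])
    have h4 : w' = 0 := hf.2.1 x₀ (by rw [h3, map_zero])
    rw [h4, map_zero]
  obtain ⟨L, hL⟩ := exists_hasFDerivAt_tubularMap (E := E) (A := θ) (F := F) (ξ := ξ₀)
    (coordRep_contDiffAt hf.1 hξD)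
    (by rw [hFξ₀]; exact h.coframe.differentiableAt hΩ₀) (by rw [hFξ₀]; exact hθi _ hΩ₀) hFinj
    (by rw [hFξ₀]; exact h.hasFDerivAt _ hball)
  obtain ⟨e, he, he₀, hes, hesm⟩ := exists_smooth_localInverse hso hGs hs₀ hL
  -- normality is the vanishing of the second component of the tubular map
  have hnor : ∀ ξ ∈ coordDomain f p x₀, F ξ ∈ Ω →
      ∀ n : TangentSpace (𝓡 8) (f ((extChartAt (𝓡 4) x₀).symm ξ)),
      IsNormal Φ f ((extChartAt (𝓡 4) x₀).symm ξ) n ↔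
        (tubularMap F θ E (ξ, toCoords p _ n)).2 = 0 := by
    intro ξ hξ hξΩ n
    have hx := symm_mem_source_of_mem_coordDomain hξ
    have e1 : extChartAt (𝓡 4) x₀ ((extChartAt (𝓡 4) x₀).symm ξ) = ξ :=
      (extChartAt (𝓡 4) x₀).right_inv hξ.1
    rw [isNormal_iff h.coframe hf.1 hx hξ.2 hξΩ, e1]
    have e2 := forall_inner_eq_zero_iff ((θ (F ξ)).comp (fderiv ℝ F ξ))
      (θ (F ξ) (toCoords p _ n))
    refine e2.trans ?_
    rw [funext_iff]
    rfl
  -- the neighbourhood of `(ξ₀, 0)` on which the inverse exists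
  obtain ⟨S₁, S₂, hS₁, hξS, hS₂, h0S, hSs⟩ :
      ∃ S₁ S₂, IsOpen S₁ ∧ ξ₀ ∈ S₁ ∧ IsOpen S₂ ∧ (0 : R8) ∈ S₂ ∧ S₁ ×ˢ S₂ ⊆ e.source := by
    obtain ⟨S₁, S₂, h1, h2, h3, h4, h5⟩ := isOpen_prod_iff.1 e.open_source ξ₀ 0 he₀
    exact ⟨S₁, S₂, h1, h3, h2, h4, h5⟩
  -- Since `f` is an embedding, closeness of base points in `M` controls the point of `X`; this
  -- keeps other sheets of `f` away.
  obtain ⟨W', hW', hW'f⟩ : ∃ W' : Set M, IsOpen W' ∧ f ⁻¹' W' =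
      (chartAt R4 x₀).source ∩ extChartAt (𝓡 4) x₀ ⁻¹' S₁ := by
    have h1 : IsOpen ((chartAt R4 x₀).source ∩ extChartAt (𝓡 4) x₀ ⁻¹' S₁) := by
      have := (continuousOn_extChartAt (I := 𝓡 4) x₀).isOpen_inter_preimage
        (isOpen_extChartAt_source x₀) hS₁
      rwa [extChartAt_source] at this
    exact hf.2.2.isInducing.isOpen_iff.1 h1
  set O : Set (TangentBundle (𝓡 8) M) := {a | a.proj ∈ (chartAt R8 p).source ∩ W' ∧
    tangentCoords p a ∈ Metric.ball (y₀, (0 : R8)) r ∩ Prod.snd ⁻¹' S₂} with hO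
  have hOo : IsOpen O := by
    have h1 : ContinuousOn (tangentCoords p)
        {a : TangentBundle (𝓡 8) M | a.proj ∈ (chartAt R8 p).source ∩ W'} :=
      (contMDiffOn_tangentCoords p).continuousOn.mono fun a ha => ha.1
    exact h1.isOpen_inter_preimage
      (isOpen_proj_preimage ((chartAt R8 p).open_source.inter hW'))
      (Metric.isOpen_ball.inter (hS₂.preimage continuous_snd))
  -- `ρ` inverts the tubular map at `(q, 0)`: the vanishing second component makes the vector
  -- normal.
  set W : Set M := (chartAt R8 p).source ∩
    {q | (extChartAt (𝓡 8) p q, (0 : Fin 4 → ℝ)) ∈ e.target} with hW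
  have hWo : IsOpen W := by
    have h1 : ContinuousOn (fun q => (extChartAt (𝓡 8) p q, (0 : Fin 4 → ℝ)))
        (chartAt R8 p).source := by
      have := (continuousOn_extChartAt (I := 𝓡 8) p)
      rw [extChartAt_source] at this
      exact this.prodMk continuousOn_const
    exact h1.isOpen_inter_preimage (chartAt R8 p).open_source e.open_target
  let κ : M → R4 × R8 := fun q => e.symm (extChartAt (𝓡 8) p q, 0)
  let ρ : M → TangentBundle (𝓡 8) M := fun q =>
    ⟨f ((extChartAt (𝓡 4) x₀).symm (κ q).1), ofCoords p _ (κ q).2⟩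
  have hκs : ∀ q ∈ W, κ q ∈ s := fun q hq => hes (e.map_target hq.2)
  have hκG : ∀ q ∈ W, tubularMap F θ E (κ q) = (extChartAt (𝓡 8) p q, 0) := fun q hq => by
    rw [← he]; exact e.right_inv hq.2
  have hκp : ∀ q ∈ W, f ((extChartAt (𝓡 4) x₀).symm (κ q).1) ∈ (chartAt R8 p).source :=
    fun q hq => (hκs q hq).1.2
  have hκc : ∀ q ∈ W, tangentCoords p (ρ q) = (F (κ q).1, (κ q).2) := fun q hq =>
    Prod.ext rfl (toCoords_ofCoords (hκp q hq) _)
  refine ⟨O, W, ρ, hOo, ?_, hWo, fun a ha => h.expDefined a ha.1.1 ha.2.1,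
    h.contMDiffOn_expMap.mono fun a ha => ⟨ha.1.1, ha.2.1⟩, ?_, ?_, ?_, ?_,
    fun a ha => h.transport_eq_zero_iff ha.1.1 ha.2.1⟩
  · have e1 : tangentCoords p (⟨f x₀, 0⟩ : TangentBundle (𝓡 8) M) = (y₀, 0) := by
      simp [tangentCoords, hy₀, hp]
    refine ⟨⟨hpp, ?_⟩, ?_⟩
    · have : x₀ ∈ f ⁻¹' W' := by rw [hW'f]; exact ⟨hxx, hξS⟩
      exact this
    · rw [e1]; exact ⟨hball, h0S⟩
  · -- smoothness of the inverse
    have h1 : ContMDiffOn (𝓡 8) 𝓘(ℝ, R4 × R8) ∞ κ W := by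
      have h2 : ContMDiffOn (𝓡 8) 𝓘(ℝ, R8 × (Fin 4 → ℝ)) ∞
          (fun q => (extChartAt (𝓡 8) p q, (0 : Fin 4 → ℝ))) W :=
        ((contMDiffOn_extChartAt (n := ∞)).mono fun q hq => hq.1).prodMk_space contMDiffOn_const
      exact hesm.contMDiffOn.comp h2 fun q hq => hq.2
    refine ((trivializationAt R8 (TangentSpace (𝓡 8)) p).contMDiffOn_iff
      (IM := 𝓡 8) (IB := 𝓡 8) (n := ∞) (f := ρ) (s := W) fun q hq =>
      ((trivializationAt R8 (TangentSpace (𝓡 8)) p).mem_source).2 (hκp q hq)).2 ⟨?_, ?_⟩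
    · have h3 : ContMDiffOn (𝓡 8) (𝓡 4) ∞ (fun q => (extChartAt (𝓡 4) x₀).symm (κ q).1) W :=
        (contMDiffOn_extChartAt_symm x₀).comp
          ((ContDiff.contMDiff (contDiff_fst (𝕜 := ℝ) (E := R4) (F := R8))).comp_contMDiffOn h1)
          fun q hq => (hκs q hq).1.1
      exact hf.1.comp_contMDiffOn h3
    · refine (ContDiff.contMDiff contDiff_snd).comp_contMDiffOn h1 |>.congr fun q hq => ?_
      rw [trivializationAt_snd (hκp q hq)]
      exact congrArg Prod.snd (hκc q hq)
  · intro q hq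
    refine ⟨_, _, ?_, rfl⟩
    rw [hnor _ (hκs q hq).1 (hκs q hq).2.1, toCoords_ofCoords (hκp q hq)]
    exact congrArg Prod.snd (hκG q hq)
  · intro q hq hρ
    rw [h.expMap_eq _ hρ.1.1 hρ.2.1, hκc q hq]
    have : E (F (κ q).1, (κ q).2) = extChartAt (𝓡 8) p q := congrArg Prod.fst (hκG q hq)
    rw [this, symm_chart hq.1]
  · rintro a ⟨ha, x, n, hn, rfl⟩
    have hxW : x ∈ f ⁻¹' W' := ha.1.2
    rw [hW'f] at hxW
    obtain ⟨hx, hxS⟩ := hxW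
    have hxp : f x ∈ (chartAt R8 p).source := ha.1.1
    set ξ := extChartAt (𝓡 4) x₀ x with hξ
    have hxsymm : (extChartAt (𝓡 4) x₀).symm ξ = x :=
      (extChartAt (𝓡 4) x₀).left_inv (by rwa [extChartAt_source])
    have hFξ : F ξ = extChartAt (𝓡 8) p (f x) := coordRep_chart f p hx
    have hzs : (ξ, toCoords p (f x) n) ∈ e.source := hSs ⟨hxS, ha.2.2⟩
    have hc : tangentCoords p (⟨f x, n⟩ : TangentBundle (𝓡 8) M) = (F ξ, toCoords p (f x) n) := by
      rw [hFξ]; rfl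
    have hG : tubularMap F θ E (ξ, toCoords p (f x) n) = (E (F ξ, toCoords p (f x) n), 0) := by
      refine Prod.ext rfl ?_
      have h1 := hnor ξ (hes hzs).1 (hes hzs).2.1
      rw [hxsymm] at h1
      exact (h1 n).1 hn
    have hE : expMap Φ (⟨f x, n⟩ : TangentBundle (𝓡 8) M) =
        (extChartAt (𝓡 8) p).symm (E (F ξ, toCoords p (f x) n)) := by
      rw [h.expMap_eq _ ha.1.1 ha.2.1, hc]
    have hEΩ : E (F ξ, toCoords p (f x) n) ∈ (extChartAt (𝓡 8) p).target := by
      rw [← hc]; exact h.coframe.subset (h.mem _ ha.2.1).2.1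
    have hφ : (extChartAt (𝓡 8) p (expMap Φ (⟨f x, n⟩ : TangentBundle (𝓡 8) M)), (0 : Fin 4 → ℝ))
        = e (ξ, toCoords p (f x) n) := by
      rw [he, hG, hE, chart_symm hEΩ]
    have hWm : expMap Φ (⟨f x, n⟩ : TangentBundle (𝓡 8) M) ∈ W := by
      refine ⟨by rw [hE]; exact symm_mem_source hEΩ, ?_⟩
      change (_, _) ∈ e.target
      rw [hφ]; exact e.map_source hzs
    refine ⟨hWm, ?_⟩
    have hκ : κ (expMap Φ (⟨f x, n⟩ : TangentBundle (𝓡 8) M)) = (ξ, toCoords p (f x) n) := by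
      change e.symm (_, _) = _
      rw [hφ, e.left_inv hzs]
    refine tangentBundle_ext (p := p) (hκp _ hWm) ?_ ?_
    · change f ((extChartAt (𝓡 4) x₀).symm (κ _).1) = f x
      rw [hκ, hxsymm]
    · have h2 := congrArg Prod.snd (hκc _ hWm)
      rw [hκ] at h2
      exact h2

end Tubular

section TubularGlobal

variable {M : Type*} [TopologicalSpace M] [ChartedSpace R8 M]
variable {X : Type*} [TopologicalSpace X] [ChartedSpace R4 X]

theorem zero_mem_normalBundle (Φ : Π q : M, Form4 q) (f : X → M) (x : X) :
    (⟨f x, 0⟩ : TangentBundle (𝓡 8) M) ∈ normalBundle Φ f :=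
  ⟨x, 0, fun w => by simp [metric], rfl⟩

variable [IsManifold (𝓡 8) ∞ M] [IsManifold (𝓡 4) ∞ X] {Φ : Π q : M, Form4 q} {f : X → M}

open Classical in
/-- The tubular neighbourhood theorem, together with the injectivity of parallel transport along the
normal geodesics in the neighbourhood. -/
theorem exists_tubularNeighbourhood [T2Space M] [CompactSpace X] (hΦ : IsSpin7Structure Φ)
    (hf : IsSmoothEmb f) :
    ∃ (O : Set (TangentBundle (𝓡 8) M)) (r : M → TangentBundle (𝓡 8) M),
      IsOpen O ∧ (∀ x, (⟨f x, 0⟩ : TangentBundle (𝓡 8) M) ∈ O) ∧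
      (∀ a ∈ O, ExpDefined Φ a) ∧ ContMDiffOn (𝓡 8).tangent (𝓡 8) ∞ (expMap Φ) O ∧
      IsOpen (expMap Φ '' (O ∩ normalBundle Φ f)) ∧
      ContMDiffOn (𝓡 8) (𝓡 8).tangent ∞ r (expMap Φ '' (O ∩ normalBundle Φ f)) ∧
      (∀ a ∈ O ∩ normalBundle Φ f, r (expMap Φ a) = a) ∧
      ∀ a ∈ O, ∀ β ∈ Lambda27 Φ (expMap Φ a), transport Φ a β = 0 ↔ β = 0 := by
  choose O W ρ hO h0 hW hdef hexp hρ hρN hρe hinv htr using exists_local_tubular hΦ hf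
  -- the exponential map is injective on a neighbourhood of the compact zero section
  let zs : X → normalBundle Φ f := fun x => ⟨⟨f x, 0⟩, zero_mem_normalBundle Φ f x⟩
  have hz : Continuous zs := by
    refine Continuous.subtype_mk ?_ _
    exact ((Bundle.contMDiff_zeroSection ℝ (TangentSpace (𝓡 8) (M := M))
      (n := ∞) (F := R8) (IB := 𝓡 8)).continuous).comp hf.1.continuous
  have hcomp : IsCompact (Set.range zs) := isCompact_range hz
  have hOn : ∀ x, {a : normalBundle Φ f | a.1 ∈ O x} ∈ 𝓝 (zs x) := fun x =>
    ((hO x).preimage continuous_subtype_val).mem_nhds (h0 x)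
  have hinj : Set.InjOn (fun a : normalBundle Φ f => expMap Φ a.1) (Set.range zs) := by
    rintro _ ⟨x, rfl⟩ _ ⟨y, rfl⟩ hxy
    have h1 : f x = f y := by
      have := hxy
      simp only [zs] at this
      rwa [expMap_zero hΦ, expMap_zero hΦ] at this
    rw [hf.2.2.injective h1]
  obtain ⟨V, hV, hVinj⟩ := hinj.exists_mem_nhdsSet hcomp
    (by
      rintro _ ⟨x, rfl⟩
      have h1 : ContinuousAt (expMap Φ) (zs x).1 :=
        (hexp x).continuousOn.continuousAt ((hO x).mem_nhds (h0 x))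
      exact h1.comp continuous_subtype_val.continuousAt)
    (by
      rintro _ ⟨x, rfl⟩
      refine ⟨_, hOn x, fun a ha b hb hab => ?_⟩
      have h1 := (hinv x a.1 ⟨ha, a.2⟩).2
      have h2 := (hinv x b.1 ⟨hb, b.2⟩).2
      refine Subtype.ext ?_
      rw [← h1, ← h2]
      exact congrArg (ρ x) hab)
  obtain ⟨V', hV', hzV', hV'V⟩ := mem_nhdsSet_iff_exists.1 hV
  obtain ⟨O₁, hO₁, rfl⟩ := isOpen_induced_iff.1 hV'
  have hexpinj : Set.InjOn (expMap Φ) (O₁ ∩ normalBundle Φ f) := fun a ha b hb hab =>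
    congrArg Subtype.val (hVinj (x₁ := ⟨a, ha.2⟩) (x₂ := ⟨b, hb.2⟩)
      (hV'V ha.1) (hV'V hb.1) hab)
  -- On `O₂` the exponential map of the normal bundle is injective with local smooth inverses, so
  -- the global inverse is smooth.
  set O₂ : Set (TangentBundle (𝓡 8) M) := O₁ ∩ ⋃ x, O x with hO₂
  let r : M → TangentBundle (𝓡 8) M := fun q =>
    if h : ∃ a ∈ O₂ ∩ normalBundle Φ f, expMap Φ a = q then h.choose else ⟨q, 0⟩
  have hr : ∀ a ∈ O₂ ∩ normalBundle Φ f, r (expMap Φ a) = a := fun a ha => by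
    have h : ∃ b ∈ O₂ ∩ normalBundle Φ f, expMap Φ b = expMap Φ a := ⟨a, ha, rfl⟩
    have h1 : r (expMap Φ a) = h.choose := dif_pos h
    rw [h1]
    exact hexpinj ⟨h.choose_spec.1.1.1, h.choose_spec.1.2⟩ ⟨ha.1.1, ha.2⟩ h.choose_spec.2
  -- the image of an open piece of the normal bundle is open, with the local inverse
  have hloc : ∀ x, IsOpen (W x ∩ ρ x ⁻¹' (O₁ ∩ O x)) := fun x =>
    (hρ x).continuousOn.isOpen_inter_preimage (hW x) (hO₁.inter (hO x))
  have hlocr : ∀ x, ∀ q ∈ W x ∩ ρ x ⁻¹' (O₁ ∩ O x),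
      q ∈ expMap Φ '' (O₂ ∩ normalBundle Φ f) ∧ r q = ρ x q := fun x q hq => by
    have h1 : ρ x q ∈ O₂ ∩ normalBundle Φ f :=
      ⟨⟨hq.2.1, Set.mem_iUnion.2 ⟨x, hq.2.2⟩⟩, hρN x q hq.1⟩
    have h2 := hρe x q hq.1 hq.2.2
    refine ⟨⟨_, h1, h2⟩, ?_⟩
    have h3 := hr _ h1
    rwa [h2] at h3
  have hcov : ∀ q ∈ expMap Φ '' (O₂ ∩ normalBundle Φ f), ∃ x, q ∈ W x ∩ ρ x ⁻¹' (O₁ ∩ O x) := by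
    rintro _ ⟨a, ha, rfl⟩
    obtain ⟨x, hx⟩ := Set.mem_iUnion.1 ha.1.2
    have h1 := hinv x a ⟨hx, ha.2⟩
    exact ⟨x, h1.1, by rw [Set.mem_preimage, h1.2]; exact ⟨ha.1.1, hx⟩⟩
  refine ⟨O₂, r, hO₁.inter (isOpen_iUnion hO), fun x => ⟨?_, Set.mem_iUnion.2 ⟨x, h0 x⟩⟩, ?_, ?_,
    ?_, ?_, hr, ?_⟩
  · exact hzV' ⟨x, rfl⟩
  · rintro a ⟨-, ha⟩
    obtain ⟨x, hx⟩ := Set.mem_iUnion.1 ha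
    exact hdef x a hx
  · rintro a ⟨-, ha⟩
    obtain ⟨x, hx⟩ := Set.mem_iUnion.1 ha
    exact ((hexp x).contMDiffAt ((hO x).mem_nhds hx)).contMDiffWithinAt
  · rw [isOpen_iff_mem_nhds]
    intro q hq
    obtain ⟨x, hx⟩ := hcov q hq
    exact Filter.mem_of_superset ((hloc x).mem_nhds hx) fun q' hq' => (hlocr x q' hq').1
  · intro q hq
    obtain ⟨x, hx⟩ := hcov q hq
    refine ContMDiffAt.contMDiffWithinAt ?_
    refine ((hρ x).contMDiffAt ((hW x).mem_nhds hx.1)).congr_of_eventuallyEq ?_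
    filter_upwards [(hloc x).mem_nhds hx] with q' hq' using (hlocr x q' hq').2
  · rintro a ⟨-, ha⟩
    obtain ⟨x, hx⟩ := Set.mem_iUnion.1 ha
    exact htr x a hx

end TubularGlobal

/-! ### Adapted frames -/

section AdaptedBasis

variable {V : Type*} [AddCommGroup V] [Module ℝ V]

/-- An injective map from a `4`-dimensional space to `ℝ⁸` admits a basis with orthonormal image and
an orthonormal frame of the orthogonal complement of its image. -/
theorem exists_adapted_basis (hV : finrank ℝ V = 4) (T : V →ₗ[ℝ] R8)
    (hT : Function.Injective T) :
    ∃ (e : Basis (Fin 4) ℝ V) (n : Fin 4 → R8), Orthonormal ℝ (fun i => T (e i)) ∧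
      Orthonormal ℝ n ∧ ∀ i v, inner ℝ (n i) (T v) = (0 : ℝ) := by
  have hW : finrank ℝ (LinearMap.range T) = 4 := by rw [LinearMap.finrank_range_of_inj hT, hV]
  have hW' : finrank ℝ (LinearMap.range T)ᗮ = 4 := by
    have h1 := Submodule.finrank_add_finrank_orthogonal (LinearMap.range T)
    rw [hW, finrank_euclideanSpace_fin] at h1
    omega
  let b := (stdOrthonormalBasis ℝ (LinearMap.range T)).reindex (finCongr hW)
  let c := (stdOrthonormalBasis ℝ (LinearMap.range T)ᗮ).reindex (finCongr hW')
  refine ⟨b.toBasis.map (LinearEquiv.ofInjective T hT).symm, fun i => c i, ?_, ?_, fun i v => ?_⟩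
  · have h1 : ∀ i, T ((b.toBasis.map (LinearEquiv.ofInjective T hT).symm) i) = (b i : R8) :=
      fun i => by
        rw [Basis.map_apply, OrthonormalBasis.coe_toBasis]
        exact congrArg Subtype.val ((LinearEquiv.ofInjective T hT).apply_symm_apply (b i))
    rw [funext h1]
    exact b.orthonormal.comp_linearIsometry (LinearMap.range T).subtypeₗᵢ
  · exact c.orthonormal.comp_linearIsometry (LinearMap.range T)ᗮ.subtypeₗᵢ
  · rw [real_inner_comm]
    exact (c i).2 _ ⟨v, rfl⟩

theorem orthonormal_adjustToOrientation (T : V →ₗ[ℝ] R8) {e : Basis (Fin 4) ℝ V}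
    (he : Orthonormal ℝ fun i => T (e i)) (o : Orientation ℝ V (Fin 4)) :
    Orthonormal ℝ fun i => T (e.adjustToOrientation o i) := by
  rw [orthonormal_iff_ite] at he ⊢
  intro i j
  by_cases hij : i = j
  · subst hij
    rcases e.adjustToOrientation_apply_eq_or_eq_neg o i with h | h <;> rw [h] <;>
      simpa using he i i
  · have h0 : inner ℝ (T (e i)) (T (e j)) = (0 : ℝ) := by rw [he, if_neg hij]
    rw [if_neg hij]
    rcases e.adjustToOrientation_apply_eq_or_eq_neg o i with h | h <;>
    rcases e.adjustToOrientation_apply_eq_or_eq_neg o j with h' | h' <;> rw [h, h'] <;> simp [h0]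

theorem det_eq_one_of_orthonormal (T : V →ₗ[ℝ] R8) {e c : Basis (Fin 4) ℝ V}
    (he : Orthonormal ℝ fun i => T (e i)) (hc : Orthonormal ℝ fun i => T (c i))
    (ho : e.orientation = c.orientation) : e.det c = 1 := by
  have h1 : (e.toMatrix c).transpose * e.toMatrix c = 1 := by
    ext i j
    have h2 : ∀ j, T (c j) = ∑ k, e.toMatrix c k j • T (e k) := fun j => by
      have h3 := congrArg T (e.sum_toMatrix_smul_self c j)
      rw [map_sum] at h3
      simpa only [map_smul] using h3.symm
    have h3 := orthonormal_iff_ite.1 hc i j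
    rw [h2 i, h2 j] at h3
    simp only [sum_inner, inner_sum, real_inner_smul_left, real_inner_smul_right,
      orthonormal_iff_ite.1 he] at h3
    rw [Matrix.mul_apply, Matrix.one_apply, ← h3]
    simp [mul_comm]
  have h2 : e.det c * e.det c = 1 := by
    have := congrArg Matrix.det h1
    rwa [Matrix.det_mul, Matrix.det_transpose, Matrix.det_one] at this
  have h3 : 0 < e.det c := (Basis.orientation_eq_iff_det_pos e c).1 ho
  nlinarith

end AdaptedBasis

section Frames

variable {M : Type*} [TopologicalSpace M] [ChartedSpace R8 M]
variable {X : Type*} [TopologicalSpace X] [ChartedSpace R4 X]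
variable {Φ : Π q : M, Form4 q} {f : X → M}
  {o : Π x : X, Orientation ℝ (TangentSpace (𝓡 4) x) (Fin 4)} {x : X}
  {L : TangentSpace (𝓡 8) (f x) →ₗ[ℝ] R8}

theorem finrank_tangentSpace (x : X) : finrank ℝ (TangentSpace (𝓡 4) x) = 4 :=
  (finrank_euclideanSpace_fin : finrank ℝ R4 = 4)

theorem isPosOrthonormal_iff (hL : IsCoframe Φ (f x) L)
    (e : Basis (Fin 4) ℝ (TangentSpace (𝓡 4) x)) :
    IsPosOrthonormal Φ f o x e ↔
      Orthonormal ℝ (fun i => (L ∘ₗ (dmap f x).toLinearMap) (e i)) ∧ e.orientation = o x := by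
  rw [IsPosOrthonormal, orthonormal_iff_ite]
  simp only [hL.metric_eq]
  rfl

theorem exists_isAdaptedFrame (hL : IsCoframe Φ (f x) L) (hf : Function.Injective (dmap f x)) :
    ∃ e n, IsAdaptedFrame Φ f o x e n := by
  obtain ⟨e, n, he, hn, hen⟩ := exists_adapted_basis (finrank_tangentSpace x)
    (L ∘ₗ (dmap f x).toLinearMap) (hL.bijective.injective.comp hf)
  refine ⟨e.adjustToOrientation (o x), fun i => hL.equiv.symm (n i),
    (isPosOrthonormal_iff hL _).2 ⟨orthonormal_adjustToOrientation _ he _,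
      e.orientation_adjustToOrientation (o x)⟩, fun i w => ?_, fun i j => ?_⟩
  · rw [hL.metric_eq, hL.map_equiv_symm]
    exact hen i w
  · rw [hL.metric_eq, hL.map_equiv_symm, hL.map_equiv_symm, orthonormal_iff_ite.1 hn]

/-- The volume form, defined through a chosen frame, is the determinant in every positive
orthonormal frame. -/
theorem vol_eq (hL : IsCoframe Φ (f x) L) {e : Basis (Fin 4) ℝ (TangentSpace (𝓡 4) x)}
    (he : IsPosOrthonormal Φ f o x e) (v : Fin 4 → TangentSpace (𝓡 4) x) :
    vol Φ f o x v = e.det v := by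
  have h : ∃ e : Basis (Fin 4) ℝ (TangentSpace (𝓡 4) x), IsPosOrthonormal Φ f o x e := ⟨e, he⟩
  have h1 : vol Φ f o x v = h.choose.det v := dif_pos h
  have h2 := (isPosOrthonormal_iff hL _).1 h.choose_spec
  have h3 := (isPosOrthonormal_iff hL _).1 he
  rw [h1, h.choose.det.eq_smul_basis_det e, AlternatingMap.smul_apply,
    det_eq_one_of_orthonormal _ h2.1 h3.1 (h2.2.trans h3.2.symm), one_smul]

theorem form_dmap_eq (Φ : Π q : M, Form4 q) (f : X → M) (e : Basis (Fin 4) ℝ (TangentSpace (𝓡 4) x))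
    (v : Fin 4 → TangentSpace (𝓡 4) x) :
    Φ (f x) (fun i => dmap f x (v i)) = Φ (f x) (fun i => dmap f x (e i)) * e.det v := by
  have h := ((Φ (f x)).compLinearMap (dmap f x).toLinearMap).eq_smul_basis_det e
  exact congrArg (fun F : TangentSpace (𝓡 4) x [⋀^Fin 4]→ₗ[ℝ] ℝ => F v) h

theorem isCalibrated_of_isPosOrthonormal (hL : IsCoframe Φ (f x) L)
    [IsManifold (𝓡 4) ∞ X] (ho : IsCayleyOrientation Φ f o)
    {e : Basis (Fin 4) ℝ (TangentSpace (𝓡 4) x)}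
    (he : IsPosOrthonormal Φ f o x e) : IsCalibrated fun i => L (dmap f x (e i)) := by
  refine ⟨((isPosOrthonormal_iff hL e).1 he).1, ?_⟩
  rw [← hL.form_eq, ho.2, vol_eq hL he, e.det_self]

/-- `τ` restricted to a tangent space is determined by its value on a basis. -/
theorem tau_dmap_eq (hL : IsCoframe Φ (f x) L) (e : Basis (Fin 4) ℝ (TangentSpace (𝓡 4) x))
    (v : Fin 4 → TangentSpace (𝓡 4) x) :
    tau Φ (f x) (fun i => dmap f x (v i)) = e.det v • tau Φ (f x) (fun i => dmap f x (e i)) := by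
  have h : ∀ k, fourfold k (fun i => L (dmap f x (v i))) =
      fourfold k (fun i => L (dmap f x (e i))) * e.det v := fun k => by
    have h := ((fourfold k).compLinearMap (L ∘ₗ (dmap f x).toLinearMap)).eq_smul_basis_det e
    exact congrArg (fun F : TangentSpace (𝓡 4) x [⋀^Fin 4]→ₗ[ℝ] ℝ => F v) h
  refine form2_ext fun a b => ?_
  rw [AlternatingMap.smul_apply, hL.tau_eq, hL.tau_eq, pullForm_apply, pullForm_apply, smul_eq_mul,
    Finset.mul_sum]
  refine Finset.sum_congr rfl fun k _ => ?_
  rw [h k]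
  ring

/-- On a tangent space `τ` vanishes if and only if `Φ = ±1` on an orthonormal basis. -/
theorem tau_eq_zero_iff (hL : IsCoframe Φ (f x) L) {e : Basis (Fin 4) ℝ (TangentSpace (𝓡 4) x)}
    (he : Orthonormal ℝ fun i => L (dmap f x (e i))) :
    (∀ v : Fin 4 → TangentSpace (𝓡 4) x, tau Φ (f x) (fun i => dmap f x (v i)) = 0) ↔
      Φ (f x) (fun i => dmap f x (e i)) ^ 2 = 1 := by
  have h1 := sum_fourfold_sq he
  rw [hL.form_eq]
  constructor
  · intro h
    have h2 := h e
    rw [hL.tau_eq] at h2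
    have h3 := hL.pullForm_injective (h2.trans (pullForm_zero _ L).symm)
    have h4 : ∀ k, fourfold k (fun i => L (dmap f x (e i))) = 0 := fun k => by
      have := congrFun h3 k
      simp only [Pi.zero_apply] at this
      linarith
    simp only [h4] at h1
    simp at h1
    linarith
  · intro h v
    rw [h, sub_self, Finset.sum_eq_zero_iff_of_nonneg fun k _ => sq_nonneg _] at h1
    have h2 : (fun k => 1 / 2 * fourfold k fun i => L (dmap f x (e i))) = 0 := by
      funext k
      have := pow_eq_zero_iff two_ne_zero |>.1 (h1 k (Finset.mem_univ k))
      simp [this]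
    rw [tau_dmap_eq hL e, hL.tau_eq, h2, pullForm_zero, smul_zero]

end Frames

section Multilinear

/-- An alternating form on `ℝ⁸`, as a continuous multilinear map. -/
def toContinuousMultilinear (F : R8 [⋀^Fin 4]→ₗ[ℝ] ℝ) :
    ContinuousMultilinearMap ℝ (fun _ : Fin 4 => R8) ℝ where
  toMultilinearMap := F.toMultilinearMap
  cont := by
    have h : ∀ v : Fin 4 → R8, F v = ∑ r : Fin 4 → Fin 8,
        (∏ i, v i (r i)) * F (fun i => EuclideanSpace.single (r i) 1) := fun v => by
      have h1 : v = fun i => ∑ c, v i c • (EuclideanSpace.single c (1 : ℝ) : R8) := by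
        funext i
        conv_lhs => rw [← (EuclideanSpace.basisFun (Fin 8) ℝ).sum_repr (v i)]
        simp
      conv_lhs => rw [h1]
      have h2 := F.toMultilinearMap.map_sum fun i c =>
        v i c • (EuclideanSpace.single c (1 : ℝ) : R8)
      refine h2.trans (Finset.sum_congr rfl fun r _ => ?_)
      exact F.toMultilinearMap.map_smul_univ (fun i => v i (r i)) _
    change Continuous fun v : Fin 4 → R8 => F v
    rw [funext h]
    fun_prop

theorem contDiff_alternating (F : R8 [⋀^Fin 4]→ₗ[ℝ] ℝ) :
    ContDiff ℝ ∞ fun v : Fin 4 → R8 => F v :=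
  (toContinuousMultilinear F).contDiff

theorem hasFDerivAt_alternating (F : R8 [⋀^Fin 4]→ₗ[ℝ] ℝ) (v : Fin 4 → R8) :
    HasFDerivAt (fun v : Fin 4 → R8 => F v) ((toContinuousMultilinear F).linearDeriv v) v :=
  (toContinuousMultilinear F).hasFDerivAt v

theorem linearDeriv_apply (F : R8 [⋀^Fin 4]→ₗ[ℝ] ℝ) (v w : Fin 4 → R8) :
    (toContinuousMultilinear F).linearDeriv v w = ∑ i, F (Function.update v i (w i)) :=
  (toContinuousMultilinear F).linearDeriv_apply v w

end Multilinear

section CoordFrame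

variable {M : Type*} [TopologicalSpace M] [ChartedSpace R8 M] [IsManifold (𝓡 8) ∞ M]
variable {X : Type*} [TopologicalSpace X] [ChartedSpace R4 X] [IsManifold (𝓡 4) ∞ X]

/-- The coordinate frame of the chart of `X` at `x₀`. -/
def coordFrame (x₀ x : X) (w : R4) : TangentSpace (𝓡 4) x :=
  (trivializationAt R4 (TangentSpace (𝓡 4)) x₀).symmL ℝ x w

theorem toCoordsX_coordFrame {x₀ x : X} (hx : x ∈ (chartAt R4 x₀).source) (w : R4) :
    toCoordsX x₀ x (coordFrame x₀ x w) = w := by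
  have h := (trivializationAt R4 (TangentSpace (𝓡 4)) x₀).continuousLinearMapAt_symmL
    (R := ℝ) (b := x) hx w
  rw [TangentBundle.continuousLinearMapAt_trivializationAt hx] at h
  exact h

theorem contMDiffOn_coordFrame (x₀ : X) (w : R4) :
    ContMDiffOn (𝓡 4) (𝓡 4).tangent ∞
      (fun x => (⟨x, coordFrame x₀ x w⟩ : TangentBundle (𝓡 4) X)) (chartAt R4 x₀).source := by
  refine ((trivializationAt R4 (TangentSpace (𝓡 4)) x₀).contMDiffOn_section_iff
    (IB := 𝓡 4) (n := ∞) (s := fun x => coordFrame x₀ x w) (a := (chartAt R4 x₀).source)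
    (chartAt R4 x₀).open_source subset_rfl).2 ?_
  refine contMDiffOn_const (c := w) |>.congr fun x hx => ?_
  have h := (trivializationAt R4 (TangentSpace (𝓡 4)) x₀).continuousLinearMapAt_symmL
    (R := ℝ) (b := x) hx w
  rw [Bundle.Trivialization.continuousLinearMapAt_apply_of_mem ℝ _ hx] at h
  exact h

/-- The coordinate frame as a basis. -/
def coordBasis (x₀ x : X) (hx : x ∈ (chartAt R4 x₀).source) :
    Basis (Fin 4) ℝ (TangentSpace (𝓡 4) x) :=
  (EuclideanSpace.basisFun (Fin 4) ℝ).toBasis.map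
    (LinearEquiv.ofBijective (toCoordsX x₀ x).toLinearMap (toCoordsX_bijective hx)).symm

theorem coordBasis_apply (x₀ x : X) (hx : x ∈ (chartAt R4 x₀).source) (i : Fin 4) :
    coordBasis x₀ x hx i = coordFrame x₀ x (EuclideanSpace.single i 1) := by
  refine (toCoordsX_bijective hx).injective ?_
  rw [toCoordsX_coordFrame hx, coordBasis, Basis.map_apply]
  refine ((LinearEquiv.ofBijective (toCoordsX x₀ x).toLinearMap
    (toCoordsX_bijective hx)).apply_symm_apply _).trans ?_
  simp

/-- The components of the images of coordinate vectors in a local coframe. -/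
theorem coframeAt_dmap_coordFrame (θ : R8 → R8 →L[ℝ] R8) {g : X → M}
    (hg : ContMDiff (𝓡 4) (𝓡 8) ∞ g) {p : M} {x₀ x : X} (hx : x ∈ (chartAt R4 x₀).source)
    (hp : g x ∈ (chartAt R8 p).source) (w : R4) :
    coframeAt θ p (g x) (dmap g x (coordFrame x₀ x w)) =
      θ (coordRep g p x₀ (extChartAt (𝓡 4) x₀ x))
        (fderiv ℝ (coordRep g p x₀) (extChartAt (𝓡 4) x₀ x) w) := by
  rw [coframeAt_apply, toCoords_dmap_of_contMDiff hg hx hp, toCoordsX_coordFrame hx,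
    coordRep_chart g p hx]

theorem contDiffOn_frame {Φ : Π q : M, Form4 q} {p : M} {Ω : Set R8} {θ : R8 → R8 →L[ℝ] R8}
    (h : IsLocalCoframe Φ p Ω θ) {g : X → M} (hg : ContMDiff (𝓡 4) (𝓡 8) ∞ g) (x₀ : X) (w : R4) :
    ContDiffOn ℝ ∞ (fun ξ => θ (coordRep g p x₀ ξ) (fderiv ℝ (coordRep g p x₀) ξ w))
      (coordDomain g p x₀ ∩ coordRep g p x₀ ⁻¹' Ω) := by
  have hF := contDiffOn_coordRep hg p x₀
  have h1 : ContDiffOn ℝ ∞ (fun ξ => θ (coordRep g p x₀ ξ))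
      (coordDomain g p x₀ ∩ coordRep g p x₀ ⁻¹' Ω) :=
    h.contDiffOn.comp (hF.mono Set.inter_subset_left) fun ξ hξ => hξ.2
  have h2 : ContDiffOn ℝ ∞ (fun ξ => fderiv ℝ (coordRep g p x₀) ξ w)
      (coordDomain g p x₀ ∩ coordRep g p x₀ ⁻¹' Ω) :=
    ((hF.fderiv_of_isOpen (isOpen_coordDomain hg.continuous p x₀) (m := ∞) (by simp)).mono
      Set.inter_subset_left).clm_apply contDiffOn_const
  exact h1.clm_apply h2

theorem isOpen_coordDomain_inter {p : M} {Ω : Set R8} (hΩ : IsOpen Ω) {g : X → M}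
    (hg : ContMDiff (𝓡 4) (𝓡 8) ∞ g) (x₀ : X) :
    IsOpen (coordDomain g p x₀ ∩ coordRep g p x₀ ⁻¹' Ω) :=
  (contDiffOn_coordRep hg p x₀).continuousOn.isOpen_inter_preimage
    (isOpen_coordDomain hg.continuous p x₀) hΩ

theorem continuousAt_form_coordFrame {Φ : Π q : M, Form4 q} (hΦ : IsSpin7Structure Φ) {g : X → M}
    (hg : ContMDiff (𝓡 4) (𝓡 8) ∞ g) (x₀ : X) (w : Fin 4 → R4) :
    ContinuousAt (fun x => Φ (g x) fun i => dmap g x (coordFrame x₀ x (w i))) x₀ := by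
  obtain ⟨Ω, θ, h, hΩ⟩ := exists_localCoframe hΦ (mem_chart_source R8 (g x₀))
  set p := g x₀ with hp
  have hx₀ : x₀ ∈ (chartAt R4 x₀).source := mem_chart_source R4 x₀
  have hp₀ : g x₀ ∈ (chartAt R8 p).source := mem_chart_source R8 p
  have hm : extChartAt (𝓡 4) x₀ x₀ ∈ coordDomain g p x₀ ∩ coordRep g p x₀ ⁻¹' Ω :=
    ⟨mem_coordDomain hx₀ hp₀, by rw [Set.mem_preimage, coordRep_chart g p hx₀]; exact hΩ⟩
  have hF : ContinuousAt (fun ξ => phi fun i => θ (coordRep g p x₀ ξ)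
      (fderiv ℝ (coordRep g p x₀) ξ (w i))) (extChartAt (𝓡 4) x₀ x₀) := by
    have h1 : ContinuousAt (fun ξ => fun i => θ (coordRep g p x₀ ξ)
        (fderiv ℝ (coordRep g p x₀) ξ (w i))) (extChartAt (𝓡 4) x₀ x₀) :=
      continuousAt_pi.2 fun i => (contDiffOn_frame h hg x₀ (w i)).continuousOn.continuousAt
        ((isOpen_coordDomain_inter h.isOpen hg x₀).mem_nhds hm)
    exact (contDiff_alternating phi).continuous.continuousAt.comp h1
  have hc : ContinuousAt (extChartAt (𝓡 4) x₀) x₀ := continuousAt_extChartAt x₀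
  refine (hF.comp hc).congr ?_
  have h3 : ∀ᶠ x in 𝓝 x₀, extChartAt (𝓡 4) x₀ x ∈ coordDomain g p x₀ ∩ coordRep g p x₀ ⁻¹' Ω :=
    hc.eventually ((isOpen_coordDomain_inter h.isOpen hg x₀).mem_nhds hm)
  filter_upwards [(chartAt R4 x₀).open_source.mem_nhds hx₀, h3,
    hg.continuous.continuousAt.eventually ((chartAt R8 p).open_source.mem_nhds hp₀)]
    with x hx hxΩ hxp
  have hxΩ' : extChartAt (𝓡 8) p (g x) ∈ Ω := by
    have := hxΩ.2
    rwa [Set.mem_preimage, coordRep_chart g p hx] at this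
  rw [(h.at hxp hxΩ').form_eq]
  exact congrArg phi (funext fun i => (coframeAt_dmap_coordFrame θ hg hx hxp (w i)).symm)

theorem exists_coframe {Φ : Π q : M, Form4 q} (hΦ : IsSpin7Structure Φ) (q : M) :
    ∃ L, IsCoframe Φ q L := by
  obtain ⟨Ω, θ, h, hΩ⟩ := exists_localCoframe hΦ (mem_chart_source R8 q)
  exact ⟨_, h.at (mem_chart_source R8 q) hΩ⟩

/-- A submanifold is Cayley if and only if `τ` vanishes on its tangent spaces. When `τ` vanishes,
`Φ = ±1` on orthonormal bases, so `Φ` itself selects an orientation. -/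
theorem isCayley_iff_tau_eq_zero {Φ : Π q : M, Form4 q} (hΦ : IsSpin7Structure Φ) {g : X → M}
    (hg : IsSmoothEmb g) : IsCayley Φ g ↔ ∀ (x : X) (v : Fin 4 → TangentSpace (𝓡 4) x),
      tau Φ (g x) (fun i => dmap g x (v i)) = 0 := by
  constructor
  · rintro ⟨-, o, ho⟩ x
    obtain ⟨L, hL⟩ := exists_coframe hΦ (g x)
    obtain ⟨e, n, he⟩ := exists_isAdaptedFrame (o := o) hL (hg.2.1 x)
    have hc := isCalibrated_of_isPosOrthonormal hL ho he.1
    rw [tau_eq_zero_iff hL hc.orthonormal, hL.form_eq, hc.phi_eq, one_pow]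
  · intro h
    have hne : ∀ x (e : Basis (Fin 4) ℝ (TangentSpace (𝓡 4) x)),
        Φ (g x) (fun i => dmap g x (e i)) ≠ 0 := fun x e h0 => by
      obtain ⟨L, hL⟩ := exists_coframe hΦ (g x)
      obtain ⟨b, -, hb, -⟩ := exists_adapted_basis (finrank_tangentSpace x)
        (L ∘ₗ (dmap g x).toLinearMap) (hL.bijective.injective.comp (hg.2.1 x))
      have h1 := (tau_eq_zero_iff hL hb).1 (h x)
      rw [form_dmap_eq Φ g e, h0, zero_mul] at h1
      norm_num at h1
    -- Reversing two vectors makes `Φ` positive on any given basis.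
    have hperm : ∀ x (e : Basis (Fin 4) ℝ (TangentSpace (𝓡 4) x)), ∃ σ : Equiv.Perm (Fin 4),
        0 < Φ (g x) (fun i => dmap g x (e (σ i))) := fun x e => by
      rcases lt_or_gt_of_ne (hne x e) with h1 | h1
      · refine ⟨Equiv.swap 0 1, ?_⟩
        have h2 := (Φ (g x)).map_swap (fun i => dmap g x (e i)) (i := 0) (j := 1) (by decide)
        exact (neg_pos.2 h1).trans_eq h2.symm
      · exact ⟨1, h1⟩
    -- a basis is positive if `Φ` is positive on it
    have hpos : ∀ x, ∃ o : Orientation ℝ (TangentSpace (𝓡 4) x) (Fin 4),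
        ∀ e : Basis (Fin 4) ℝ (TangentSpace (𝓡 4) x), e.orientation = o ↔
          0 < Φ (g x) fun i => dmap g x (e i) := fun x => by
      let x₁ : Basis (Fin 4) ℝ (TangentSpace (𝓡 4) x) := coordBasis x x (mem_chart_source R4 x)
      obtain ⟨σ, hσ⟩ := hperm x x₁
      refine ⟨(x₁.reindex σ.symm).orientation, fun e => ?_⟩
      have h1 : 0 < Φ (g x) (fun i => dmap g x (x₁.reindex σ.symm i)) := by
        simpa using hσ
      rw [form_dmap_eq Φ g (x₁.reindex σ.symm), mul_pos_iff_of_pos_left h1, eq_comm,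
        Basis.orientation_eq_iff_det_pos]
    choose o ho using hpos
    refine ⟨hg, o, fun x₀ => ?_, fun x v => ?_⟩
    -- The coordinate frame, suitably ordered, stays positive nearby by continuity of `Φ`.
    · have hx₀ : x₀ ∈ (chartAt R4 x₀).source := mem_chart_source R4 x₀
      obtain ⟨σ, hσ⟩ := hperm x₀ (coordBasis x₀ x₀ hx₀)
      simp only [coordBasis_apply] at hσ
      have hev := (continuousAt_form_coordFrame hΦ hg.1 x₀
        fun i => EuclideanSpace.single (σ i) 1).eventually (lt_mem_nhds hσ)
      obtain ⟨W, hW, hWo, hxW⟩ := eventually_nhds_iff.1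
        (hev.and ((chartAt R4 x₀).open_source.mem_nhds hx₀))
      refine ⟨W, hWo, hxW, fun i x => coordFrame x₀ x (EuclideanSpace.single (σ i) 1), fun i =>
        (contMDiffOn_coordFrame x₀ _).mono fun x hx => (hW x hx).2, fun x hx =>
        ⟨(coordBasis x₀ x (hW x hx).2).reindex σ.symm, fun i => ?_, ?_⟩⟩
      · rw [Basis.reindex_apply, coordBasis_apply, Equiv.symm_symm]
      · rw [ho]
        simpa only [Basis.reindex_apply, coordBasis_apply, Equiv.symm_symm] using (hW x hx).1
    · obtain ⟨L, hL⟩ := exists_coframe hΦ (g x)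
      obtain ⟨e, n, he⟩ := exists_isAdaptedFrame (o := o) hL (hg.2.1 x)
      have h1 := (ho x e).1 he.1.2
      have h2 := (tau_eq_zero_iff hL ((isPosOrthonormal_iff hL e).1 he.1).1).1 (h x)
      have h3 : Φ (g x) (fun i => dmap g x (e i)) = 1 := by nlinarith
      rw [vol_eq hL he.1, form_dmap_eq Φ g e, h3, one_mul]

end CoordFrame

/-! ### Cayley submanifolds near `X` -/

section Moduli

variable {M : Type*} [TopologicalSpace M] [ChartedSpace R8 M] [IsManifold (𝓡 8) ∞ M]
variable {X : Type*} [TopologicalSpace X] [ChartedSpace R4 X]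
variable {Φ : Π q : M, Form4 q} {f : X → M} {s : Π x : X, TangentSpace (𝓡 8) (f x)}

theorem contMDiff_section (hf : ContMDiff (𝓡 4) (𝓡 8) ∞ f) (hs : s ∈ NormalSections Φ f) :
    ContMDiff (𝓡 4) (𝓡 8).tangent ∞
      (fun x => (⟨f x, s x⟩ : TangentBundle (𝓡 8) M)) := by
  intro x₀
  have hp : f x₀ ∈ (chartAt R8 (f x₀)).source := mem_chart_source R8 (f x₀)
  have hW : IsOpen (f ⁻¹' (chartAt R8 (f x₀)).source) :=
    (chartAt R8 (f x₀)).open_source.preimage hf.continuous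
  refine ContMDiffOn.contMDiffAt ?_ (hW.mem_nhds hp)
  refine ((trivializationAt R8 (TangentSpace (𝓡 8)) (f x₀)).contMDiffOn_iff
    (IM := 𝓡 4) (IB := 𝓡 8) (n := ∞) (f := fun x => (⟨f x, s x⟩ : TangentBundle (𝓡 8) M))
    (s := f ⁻¹' (chartAt R8 (f x₀)).source) fun x hx =>
      ((trivializationAt R8 (TangentSpace (𝓡 8)) (f x₀)).mem_source).2 hx).2
    ⟨hf.contMDiffOn, (hs.1 (f x₀)).congr fun x hx => ?_⟩
  exact trivializationAt_snd (a := (⟨f x, s x⟩ : TangentBundle (𝓡 8) M)) hx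

theorem tau_mem_Lambda27 (hΦ : IsSpin7Structure Φ) (q : M) (v : Fin 4 → TangentSpace (𝓡 8) q) :
    tau Φ q v ∈ Lambda27 Φ q := by
  obtain ⟨L, hL⟩ := exists_coframe hΦ q
  rw [hL.tau_eq]
  exact hL.pullForm_mem _

/-- Sections with values in a tubular neighbourhood exponentiate to embeddings: the projection of
the tubular neighbourhood to `X` is a left inverse. -/
theorem isSmoothEmb_expSec [T2Space M] [CompactSpace X] (hf : IsSmoothEmb f)
    {O : Set (TangentBundle (𝓡 8) M)} {r : M → TangentBundle (𝓡 8) M}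
    (hO : IsOpen O) (hexp : ContMDiffOn (𝓡 8).tangent (𝓡 8) ∞ (expMap Φ) O)
    (hUo : IsOpen (expMap Φ '' (O ∩ normalBundle Φ f)))
    (hr : ContMDiffOn (𝓡 8) (𝓡 8).tangent ∞ r (expMap Φ '' (O ∩ normalBundle Φ f)))
    (hri : ∀ a ∈ O ∩ normalBundle Φ f, r (expMap Φ a) = a)
    (hs : s ∈ sectionsIn Φ f (O ∩ normalBundle Φ f)) : IsSmoothEmb (expSec Φ f s) := by
  have h1 : ContMDiff (𝓡 4) (𝓡 8) ∞ (expSec Φ f s) := fun x =>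
    (hexp.contMDiffAt (hO.mem_nhds (hs.2 x).1)).comp x (contMDiff_section hf.1 hs.1 x)
  have h2 : ∀ x, r (expSec Φ f s x) = ⟨f x, s x⟩ := fun x => hri _ (hs.2 x)
  refine ⟨h1, fun x => ?_, ?_⟩
  · have h3 : MDifferentiableAt (𝓡 8) (𝓡 8) (fun q => (r q).proj) (expSec Φ f s x) := by
      have h4 := hr.contMDiffAt (hUo.mem_nhds ⟨_, hs.2 x, rfl⟩)
      exact ((Bundle.contMDiff_proj (TangentSpace (𝓡 8) (M := M)) (n := ∞) (IB := 𝓡 8)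
        _).comp _ h4).mdifferentiableAt (by simp)
    have h5 : (fun q => (r q).proj) ∘ expSec Φ f s = f := funext fun x =>
      congrArg Bundle.TotalSpace.proj (h2 x)
    have h6 := mfderiv_comp x h3 ((h1 x).mdifferentiableAt (by simp))
    intro v w hvw
    refine hf.2.1 x ?_
    have h7 : ∀ v, mfderiv (𝓡 4) (𝓡 8) ((fun q => (r q).proj) ∘ expSec Φ f s) x v =
        mfderiv (𝓡 8) (𝓡 8) (fun q => (r q).proj) (expSec Φ f s x) (dmap (expSec Φ f s) x v) :=
      fun v => by rw [h6]; rfl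
    have h8 : mfderiv (𝓡 4) (𝓡 8) ((fun q => (r q).proj) ∘ expSec Φ f s) x v =
        mfderiv (𝓡 4) (𝓡 8) ((fun q => (r q).proj) ∘ expSec Φ f s) x w := by
      rw [h7, h7, hvw]
    rw [h5] at h8
    exact h8
  · refine (h1.continuous.isClosedEmbedding fun x y hxy => hf.2.2.injective ?_).isEmbedding
    exact congrArg Bundle.TotalSpace.proj ((h2 x).symm.trans ((congrArg r hxy).trans (h2 y)))

variable [IsManifold (𝓡 4) ∞ X]

/-- The moduli space of Cayley deformations near `X` is the zero set of the deformation map. -/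
theorem exists_moduli_description [T2Space M] [CompactSpace X] (hΦ : IsSpin7Structure Φ)
    (hf : IsSmoothEmb f) :
    ∃ U : Set (TangentBundle (𝓡 8) M), IsTubularNeighbourhood Φ f U ∧
      (∀ s ∈ sectionsIn Φ f U, IsSmoothEmb (expSec Φ f s) ∧
        (IsCayley Φ (expSec Φ f s) ↔ ∀ x v, deformationMap Φ f s x v = 0)) ∧
      Set.BijOn (fun s => Set.range (expSec Φ f s))
        {s ∈ sectionsIn Φ f U | ∀ x v, deformationMap Φ f s x v = 0} (moduliSpace Φ f U) := by
  obtain ⟨O, r, hO, h0, hdef, hexp, hUo, hr, hri, htr⟩ := exists_tubularNeighbourhood hΦ hf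
  have hemb : ∀ s ∈ sectionsIn Φ f (O ∩ normalBundle Φ f), IsSmoothEmb (expSec Φ f s) ∧
      (IsCayley Φ (expSec Φ f s) ↔ ∀ x v, deformationMap Φ f s x v = 0) := fun s hs => by
    have h1 := isSmoothEmb_expSec hf hO hexp hUo hr hri hs
    -- `F(s)` is the parallel transport of `τ`, which is injective on `Λ²₇`.
    refine ⟨h1, (isCayley_iff_tau_eq_zero hΦ h1).trans ?_⟩
    exact forall_congr' fun x => forall_congr' fun v =>
      (htr _ (hs.2 x).1 _ (tau_mem_Lambda27 hΦ _ _)).symm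
  refine ⟨O ∩ normalBundle Φ f, ⟨fun x => ⟨h0 x, zero_mem_normalBundle Φ f x⟩,
    ⟨O, hO, rfl, hdef, hexp⟩, hUo, r, hr, hri⟩, hemb, ?_, ?_, ?_⟩
  · rintro s ⟨hs, hs0⟩
    exact ⟨s, hs, (hemb s hs).2.2 hs0, rfl⟩
  · rintro s ⟨hs, -⟩ t ⟨ht, -⟩ hst
    funext x
    -- `r` recovers the section, including its base point, from the image of the submanifold.
    obtain ⟨y, hy⟩ : expSec Φ f s x ∈ Set.range (expSec Φ f t) := by
      have hst' : Set.range (expSec Φ f s) = Set.range (expSec Φ f t) := hst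
      rw [← hst']
      exact ⟨x, rfl⟩
    have h1 : (⟨f y, t y⟩ : TangentBundle (𝓡 8) M) = ⟨f x, s x⟩ :=
      (hri _ (ht.2 y)).symm.trans ((congrArg r hy).trans (hri _ (hs.2 x)))
    obtain rfl : y = x := hf.2.2.injective (congrArg Bundle.TotalSpace.proj h1)
    exact (eq_of_heq (Bundle.TotalSpace.mk.inj h1).2).symm
  · rintro Y ⟨s, hs, hY, rfl⟩
    exact ⟨s, ⟨hs, (hemb s hs).2.1 hY⟩, rfl⟩

end Moduli

/-! ### The deformation map in coordinates -/

section Taylor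

/-- A second order Taylor estimate in `t`, uniform in the parameter `ξ`: the `t`-derivative is
Lipschitz. -/
theorem exists_taylor_bound {V : Type*} [NormedAddCommGroup V] [NormedSpace ℝ V]
    {α : ℝ × R4 → V} {ξ₀ : R4} (hα : ContDiffAt ℝ ∞ α (0, ξ₀)) :
    ∃ K δ : ℝ, 0 < K ∧ 0 < δ ∧ ∀ ξ ∈ Metric.ball ξ₀ δ, ∀ t : ℝ, |t| < δ →
      ‖α (t, ξ) - α (0, ξ) - t • fderiv ℝ α (0, ξ) (1, 0)‖ ≤ K * t ^ 2 := by
  have h1 : ContDiffAt ℝ 1 (fun z => fderiv ℝ α z (1, 0)) (0, ξ₀) :=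
    ((hα.fderiv_right (m := ∞) (by simp)).clm_apply contDiffAt_const).of_le
      (by exact_mod_cast le_top)
  obtain ⟨K, U, hU, hK⟩ := h1.exists_lipschitzOnWith
  have h2 : ∀ᶠ z in 𝓝 ((0 : ℝ), ξ₀), DifferentiableAt ℝ α z := by
    have := (hα.of_le (m := 1) (by exact_mod_cast le_top)).eventually (by simp)
    exact this.mono fun z hz => hz.differentiableAt (by simp)
  obtain ⟨δ, hδ, hball⟩ := Metric.mem_nhds_iff.1 (Filter.inter_mem hU h2)
  refine ⟨K + 1, δ, by positivity, hδ, fun ξ hξ t ht => ?_⟩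
  have hz : ∀ r : ℝ, |r| < δ → (r, ξ) ∈ Metric.ball ((0 : ℝ), ξ₀) δ := fun r hr => by
    rw [← ball_prod_same]
    exact ⟨by simpa using hr, hξ⟩
  have hd : ∀ r ∈ Metric.ball (0 : ℝ) δ, HasDerivAt (fun r => α (r, ξ) - r •
      fderiv ℝ α (0, ξ) (1, 0)) (fderiv ℝ α (r, ξ) (1, 0) - fderiv ℝ α (0, ξ) (1, 0)) r :=
    fun r hr => by
      have h3 : DifferentiableAt ℝ α (r, ξ) := (hball (hz r (by simpa using hr))).2
      have h4 : HasDerivAt (fun r : ℝ => (r, ξ)) (1, 0) r :=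
        (hasDerivAt_id r).prodMk (hasDerivAt_const r ξ)
      have h5 := (h3.hasFDerivAt.comp_hasDerivAt r h4).sub
        ((hasDerivAt_id r).smul_const (fderiv ℝ α (0, ξ) (1, 0)))
      rw [one_smul] at h5
      exact h5
  have hb : ∀ r ∈ Metric.closedBall (0 : ℝ) |t|, ‖fderiv ℝ α (r, ξ) (1, 0)
      - fderiv ℝ α (0, ξ) (1, 0)‖ ≤ K * |t| := fun r hr => by
    have hr' : |r| ≤ |t| := by simpa using hr
    have h3 := hK.norm_sub_le (hball (hz r (hr'.trans_lt ht))).1 (hball (hz 0 (by simpa))).1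
    refine h3.trans (mul_le_mul_of_nonneg_left ?_ K.2)
    rw [Prod.mk_sub_mk, sub_zero, sub_self, Prod.norm_mk]
    simpa using hr'
  have h6 := (convex_closedBall (0 : ℝ) |t|).norm_image_sub_le_of_norm_hasDerivWithin_le
    (f := fun r => α (r, ξ) - r • fderiv ℝ α (0, ξ) (1, 0)) (x := 0) (y := t)
    (fun r hr => (hd r (by
      have : |r| ≤ |t| := by simpa using hr
      simpa using this.trans_lt ht)).hasDerivWithinAt) hb (by simp) (by simp)
  have h7 : α (t, ξ) - α (0, ξ) - t • fderiv ℝ α (0, ξ) (1, 0) =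
      (α (t, ξ) - t • fderiv ℝ α (0, ξ) (1, 0)) - (α (0, ξ) - (0 : ℝ) •
        fderiv ℝ α (0, ξ) (1, 0)) := by
    rw [zero_smul]; abel
  rw [h7]
  refine h6.trans ?_
  rw [sub_zero, Real.norm_eq_abs, mul_assoc, abs_mul_abs_self, ← sq]
  exact mul_le_mul_of_nonneg_right (by linarith) (sq_nonneg t)

end Taylor

section Variation

variable {F S : R4 → R8} {A : R8 → R8 →L[ℝ] R8} {E : R8 × R8 → R8} {D : Set R4} {Ω : Set R8}
  {y₀ : R8} {r : ℝ}

/-- The family of submanifolds `ξ ↦ exp (t s)` in coordinates, as a function of `(t, ξ)`. -/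
def variation (F S : R4 → R8) (E : R8 × R8 → R8) (z : ℝ × R4) : R8 := E (F z.2, z.1 • S z.2)

/-- The components of the `w`-derivative of the family in the coframe `A`. -/
def variationFrame (F S : R4 → R8) (A : R8 → R8 →L[ℝ] R8) (E : R8 × R8 → R8) (w : R4)
    (z : ℝ × R4) : R8 :=
  A (variation F S E z) (fderiv ℝ (variation F S E) z (0, w))

/-- The parameters for which `variation F S E` is given by the exponential map: the domain of
`variation`. -/
def variationDomain (F S : R4 → R8) (D : Set R4) (y₀ : R8) (r : ℝ) : Set (ℝ × R4) :=
  {z | z.2 ∈ D ∧ (F z.2, z.1 • S z.2) ∈ Metric.ball (y₀, (0 : R8)) r}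

theorem isOpen_variationDomain (hD : IsOpen D) (hF : ContinuousOn F D) (hS : ContinuousOn S D) :
    IsOpen (variationDomain F S D y₀ r) := by
  have h1 : ContinuousOn (fun z : ℝ × R4 => (F z.2, z.1 • S z.2)) {z : ℝ × R4 | z.2 ∈ D} :=
    (hF.comp continuousOn_snd fun z hz => hz).prodMk
      (continuousOn_fst.smul (hS.comp continuousOn_snd fun z hz => hz))
  exact h1.isOpen_inter_preimage (hD.preimage continuous_snd)
    (Metric.isOpen_ball (x := (y₀, (0 : R8))) (ε := r))

theorem contDiffOn_variation (hF : ContDiffOn ℝ ∞ F D) (hS : ContDiffOn ℝ ∞ S D)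
    (hE : ContDiffOn ℝ ∞ E (Metric.ball (y₀, (0 : R8)) r)) :
    ContDiffOn ℝ ∞ (variation F S E) (variationDomain F S D y₀ r) := by
  have h1 : ContDiffOn ℝ ∞ (fun z : ℝ × R4 => (F z.2, z.1 • S z.2))
      (variationDomain F S D y₀ r) :=
    (hF.comp contDiff_snd.contDiffOn fun z hz => hz.1).prodMk
      (contDiff_fst.contDiffOn.smul (hS.comp contDiff_snd.contDiffOn fun z hz => hz.1))
  exact hE.comp h1 fun z hz => hz.2

theorem contDiffOn_variationFrame (hD : IsOpen D) (hF : ContDiffOn ℝ ∞ F D)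
    (hS : ContDiffOn ℝ ∞ S D) (hE : ContDiffOn ℝ ∞ E (Metric.ball (y₀, (0 : R8)) r))
    (hA : ContDiffOn ℝ ∞ A Ω) (hm : ∀ z ∈ Metric.ball (y₀, (0 : R8)) r, E z ∈ Ω) (w : R4) :
    ContDiffOn ℝ ∞ (variationFrame F S A E w) (variationDomain F S D y₀ r) := by
  have h1 := contDiffOn_variation hF hS hE
  have h2 := isOpen_variationDomain (y₀ := y₀) (r := r) hD hF.continuousOn hS.continuousOn
  have h3 : ContDiffOn ℝ ∞ (fun z => A (variation F S E z)) (variationDomain F S D y₀ r) :=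
    hA.comp h1 fun z hz => hm _ hz.2
  have h4 : ContDiffOn ℝ ∞ (fun z => fderiv ℝ (variation F S E) z (0, w))
      (variationDomain F S D y₀ r) :=
    (h1.fderiv_of_isOpen h2 (m := ∞) (by simp)).clm_apply contDiffOn_const
  exact h3.clm_apply h4

theorem variation_zero (hE₀ : ∀ y : R8, (y, (0 : R8)) ∈ Metric.ball (y₀, (0 : R8)) r →
    E (y, 0) = y) {ξ : R4} (hξ : (0, ξ) ∈ variationDomain F S D y₀ r) :
    variation F S E (0, ξ) = F ξ := by
  have h := hξ.2
  simp only [zero_smul] at h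
  simp only [variation, zero_smul]
  exact hE₀ _ h

/-- The first derivatives of the family at `t = 0`. -/
theorem fderiv_variation_zero (hD : IsOpen D) (hF : ContDiffOn ℝ ∞ F D)
    (hS : ContDiffOn ℝ ∞ S D)
    (hE₁ : ∀ y : R8, (y, (0 : R8)) ∈ Metric.ball (y₀, (0 : R8)) r →
      HasFDerivAt E (ContinuousLinearMap.fst ℝ R8 R8 + ContinuousLinearMap.snd ℝ R8 R8) (y, 0))
    {ξ : R4} (hξ : (0, ξ) ∈ variationDomain F S D y₀ r) (τ : ℝ) (w : R4) :
    fderiv ℝ (variation F S E) (0, ξ) (τ, w) = fderiv ℝ F ξ w + τ • S ξ := by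
  have hFd : HasFDerivAt F (fderiv ℝ F ξ) ξ :=
    ((hF.contDiffAt (hD.mem_nhds hξ.1)).differentiableAt (by simp)).hasFDerivAt
  have hSd : HasFDerivAt S (fderiv ℝ S ξ) ξ :=
    ((hS.contDiffAt (hD.mem_nhds hξ.1)).differentiableAt (by simp)).hasFDerivAt
  have h1 : HasFDerivAt (fun z : ℝ × R4 => F z.2)
      ((fderiv ℝ F ξ).comp (ContinuousLinearMap.snd ℝ ℝ R4)) (0, ξ) :=
    hFd.comp ((0 : ℝ), ξ) hasFDerivAt_snd
  have h2 : HasFDerivAt (fun z : ℝ × R4 => S z.2)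
      ((fderiv ℝ S ξ).comp (ContinuousLinearMap.snd ℝ ℝ R4)) (0, ξ) :=
    hSd.comp ((0 : ℝ), ξ) hasFDerivAt_snd
  have h3 := (hasFDerivAt_fst (𝕜 := ℝ) (p := ((0 : ℝ), ξ))).smul h2
  have h4 : HasFDerivAt E (ContinuousLinearMap.fst ℝ R8 R8 + ContinuousLinearMap.snd ℝ R8 R8)
      (F ((0 : ℝ), ξ).2, ((0 : ℝ), ξ).1 • S ((0 : ℝ), ξ).2) := by
    have h := hξ.2
    simp only [zero_smul] at h ⊢
    exact hE₁ _ h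
  have h5 : HasFDerivAt (variation F S E) _ (0, ξ) := h4.comp ((0 : ℝ), ξ) (h1.prodMk h3)
  rw [h5.fderiv]
  simp

theorem variationFrame_zero (hD : IsOpen D) (hF : ContDiffOn ℝ ∞ F D)
    (hS : ContDiffOn ℝ ∞ S D)
    (hE₀ : ∀ y : R8, (y, (0 : R8)) ∈ Metric.ball (y₀, (0 : R8)) r → E (y, 0) = y)
    (hE₁ : ∀ y : R8, (y, (0 : R8)) ∈ Metric.ball (y₀, (0 : R8)) r →
      HasFDerivAt E (ContinuousLinearMap.fst ℝ R8 R8 + ContinuousLinearMap.snd ℝ R8 R8) (y, 0))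
    {ξ : R4} (hξ : (0, ξ) ∈ variationDomain F S D y₀ r) (w : R4) :
    variationFrame F S A E w (0, ξ) = A (F ξ) (fderiv ℝ F ξ w) := by
  rw [variationFrame, variation_zero hE₀ hξ, fderiv_variation_zero hD hF hS hE₁ hξ, zero_smul,
    add_zero]

/-- The `t`-derivative of the `w`-derivative of the family. The geodesics start with velocity `S`,
and the mixed second derivatives of the family agree, so second derivatives of `E` do not occur. -/
theorem fderiv_variationFrame_zero (hD : IsOpen D) (hF : ContDiffOn ℝ ∞ F D)
    (hS : ContDiffOn ℝ ∞ S D) (hE : ContDiffOn ℝ ∞ E (Metric.ball (y₀, (0 : R8)) r))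
    (hA : ∀ y ∈ Ω, DifferentiableAt ℝ A y)
    (hm : ∀ z ∈ Metric.ball (y₀, (0 : R8)) r, z.1 ∈ Ω)
    (hE₀ : ∀ y : R8, (y, (0 : R8)) ∈ Metric.ball (y₀, (0 : R8)) r → E (y, 0) = y)
    (hE₁ : ∀ y : R8, (y, (0 : R8)) ∈ Metric.ball (y₀, (0 : R8)) r →
      HasFDerivAt E (ContinuousLinearMap.fst ℝ R8 R8 + ContinuousLinearMap.snd ℝ R8 R8) (y, 0))
    {ξ : R4} (hξ : (0, ξ) ∈ variationDomain F S D y₀ r) (w : R4) :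
    fderiv ℝ (variationFrame F S A E w) (0, ξ) (1, 0) =
      fderiv ℝ A (F ξ) (S ξ) (fderiv ℝ F ξ w) + A (F ξ) (fderiv ℝ S ξ w) := by
  set G := variation F S E with hG
  have hopen := isOpen_variationDomain (y₀ := y₀) (r := r) hD hF.continuousOn hS.continuousOn
  have hGs : ContDiffAt ℝ ∞ G (0, ξ) :=
    (contDiffOn_variation hF hS hE).contDiffAt (hopen.mem_nhds hξ)
  have hG' : DifferentiableAt ℝ (fderiv ℝ G) (0, ξ) :=
    (hGs.fderiv_right (m := ∞) (by simp)).differentiableAt (by simp)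
  have hsymm : IsSymmSndFDerivAt ℝ G (0, ξ) := hGs.isSymmSndFDerivAt
    (by rw [minSmoothness_of_isRCLikeNormedField]; exact ENat.LEInfty.out)
  -- the mixed second derivative
  have hmix : fderiv ℝ (fderiv ℝ G) (0, ξ) (1, 0) (0, w) = fderiv ℝ S ξ w := by
    rw [hsymm.eq]
    have h1 : HasFDerivAt (fun η : R4 => fderiv ℝ G (0, η) (1, 0))
        ((ContinuousLinearMap.apply ℝ R8 ((1 : ℝ), (0 : R4))).comp
          ((fderiv ℝ (fderiv ℝ G) (0, ξ)).comp (ContinuousLinearMap.inr ℝ ℝ R4))) ξ := by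
      have h2 : HasFDerivAt (fun η : R4 => ((0 : ℝ), η)) (ContinuousLinearMap.inr ℝ ℝ R4) ξ :=
        hasFDerivAt_prodMk_right (0 : ℝ) ξ
      have h3 : HasFDerivAt (fun η : R4 => fderiv ℝ G (0, η))
        ((fderiv ℝ (fderiv ℝ G) (0, ξ)).comp (ContinuousLinearMap.inr ℝ ℝ R4)) ξ :=
        hG'.hasFDerivAt.comp ξ h2
      exact (ContinuousLinearMap.apply ℝ R8 ((1 : ℝ), (0 : R4))).hasFDerivAt.comp ξ h3
    have h4 : (fun η : R4 => fderiv ℝ G (0, η) (1, 0)) =ᶠ[𝓝 ξ] S := by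
      have h5 : ∀ᶠ η in 𝓝 ξ, ((0 : ℝ), η) ∈ variationDomain F S D y₀ r :=
        (Continuous.prodMk_right (0 : ℝ)).continuousAt.eventually (hopen.mem_nhds hξ)
      filter_upwards [h5] with η hη
      rw [fderiv_variation_zero hD hF hS hE₁ hη, map_zero, zero_add, one_smul]
    rw [← h4.fderiv_eq, h1.fderiv]
    rfl
  have hAd : HasFDerivAt A (fderiv ℝ A (F ξ)) (G (0, ξ)) := by
    have hm0 := hm _ hξ.2
    rw [hG, variation_zero hE₀ hξ]
    exact (hA _ hm0).hasFDerivAt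
  have hAG : HasFDerivAt (fun z => A (G z)) ((fderiv ℝ A (F ξ)).comp (fderiv ℝ G (0, ξ))) (0, ξ) :=
    hAd.comp ((0 : ℝ), ξ) (hGs.differentiableAt (by simp)).hasFDerivAt
  have hGw : HasFDerivAt (fun z => fderiv ℝ G z (0, w))
      ((ContinuousLinearMap.apply ℝ R8 ((0 : ℝ), w)).comp (fderiv ℝ (fderiv ℝ G) (0, ξ))) (0, ξ) :=
    (ContinuousLinearMap.apply ℝ R8 ((0 : ℝ), w)).hasFDerivAt.comp ((0 : ℝ), ξ) hG'.hasFDerivAt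
  have hfin : HasFDerivAt (variationFrame F S A E w) _ (0, ξ) := hAG.clm_apply hGw
  rw [hfin.fderiv]
  simp only [add_apply, ContinuousLinearMap.comp_apply,
    ContinuousLinearMap.flip_apply, ContinuousLinearMap.apply_apply]
  rw [hmix, hG, variation_zero hE₀ hξ, fderiv_variation_zero hD hF hS hE₁ hξ,
    fderiv_variation_zero hD hF hS hE₁ hξ]
  simp [add_comm]

end Variation

section TauCoeff

variable {F S : R4 → R8} {A : R8 → R8 →L[ℝ] R8} {E : R8 × R8 → R8} {D : Set R4} {Ω : Set R8}
  {y₀ : R8} {r : ℝ}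

/-- The components of `τ` on the `w`-derivatives of the family `variation F S E`. -/
def tauCoeff (F S : R4 → R8) (A : R8 → R8 →L[ℝ] R8) (E : R8 × R8 → R8) (w : Fin 4 → R4)
    (z : ℝ × R4) : Fin 7 → ℝ :=
  fun k => 1 / 2 * fourfold k fun i => variationFrame F S A E (w i) z

/-- The derivative of `tauCoeff` at `t = 0`. -/
def linCoeff (F S : R4 → R8) (A : R8 → R8 →L[ℝ] R8) (w : Fin 4 → R4) (ξ : R4) : Fin 7 → ℝ :=
  fun k => 1 / 2 * ∑ i, fourfold k (Function.update (fun j => A (F ξ) (fderiv ℝ F ξ (w j))) i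
    (fderiv ℝ A (F ξ) (S ξ) (fderiv ℝ F ξ (w i)) + A (F ξ) (fderiv ℝ S ξ (w i))))

theorem contDiffOn_tauCoeff (hD : IsOpen D) (hF : ContDiffOn ℝ ∞ F D)
    (hS : ContDiffOn ℝ ∞ S D) (hE : ContDiffOn ℝ ∞ E (Metric.ball (y₀, (0 : R8)) r))
    (hA : ContDiffOn ℝ ∞ A Ω) (hm : ∀ z ∈ Metric.ball (y₀, (0 : R8)) r, E z ∈ Ω)
    (w : Fin 4 → R4) :
    ContDiffOn ℝ ∞ (tauCoeff F S A E w) (variationDomain F S D y₀ r) := by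
  refine contDiffOn_pi.2 fun k => contDiffOn_const.mul ?_
  have h1 : ContDiffOn ℝ ∞ (fun z => fun i => variationFrame F S A E (w i) z)
      (variationDomain F S D y₀ r) :=
    contDiffOn_pi.2 fun i => contDiffOn_variationFrame hD hF hS hE hA hm (w i)
  exact (contDiff_alternating (fourfold k)).comp_contDiffOn h1

/-- The first variation of `τ`, by multilinearity. -/
theorem fderiv_tauCoeff_zero (hD : IsOpen D) (hF : ContDiffOn ℝ ∞ F D)
    (hS : ContDiffOn ℝ ∞ S D) (hE : ContDiffOn ℝ ∞ E (Metric.ball (y₀, (0 : R8)) r))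
    (hA : ContDiffOn ℝ ∞ A Ω) (hΩ : IsOpen Ω)
    (hm : ∀ z ∈ Metric.ball (y₀, (0 : R8)) r, z.1 ∈ Ω ∧ E z ∈ Ω)
    (hE₀ : ∀ y : R8, (y, (0 : R8)) ∈ Metric.ball (y₀, (0 : R8)) r → E (y, 0) = y)
    (hE₁ : ∀ y : R8, (y, (0 : R8)) ∈ Metric.ball (y₀, (0 : R8)) r →
      HasFDerivAt E (ContinuousLinearMap.fst ℝ R8 R8 + ContinuousLinearMap.snd ℝ R8 R8) (y, 0))
    {ξ : R4} (hξ : (0, ξ) ∈ variationDomain F S D y₀ r) (w : Fin 4 → R4) :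
    fderiv ℝ (tauCoeff F S A E w) (0, ξ) (1, 0) = linCoeff F S A w ξ := by
  have hopen := isOpen_variationDomain (y₀ := y₀) (r := r) hD hF.continuousOn hS.continuousOn
  have hd : ∀ i, HasFDerivAt (variationFrame F S A E (w i))
      (fderiv ℝ (variationFrame F S A E (w i)) (0, ξ)) (0, ξ) := fun i =>
    (((contDiffOn_variationFrame hD hF hS hE hA (fun z hz => (hm z hz).2) (w i)).contDiffAt
      (hopen.mem_nhds hξ)).differentiableAt (by simp)).hasFDerivAt
  have h1 : HasFDerivAt (fun z => fun i => variationFrame F S A E (w i) z)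
      (ContinuousLinearMap.pi fun i => fderiv ℝ (variationFrame F S A E (w i)) (0, ξ)) (0, ξ) :=
    hasFDerivAt_pi.2 hd
  have h2 : ∀ k, HasFDerivAt (fun z => tauCoeff F S A E w z k) _ (0, ξ) := fun k =>
    ((hasFDerivAt_alternating (fourfold k) _).comp ((0 : ℝ), ξ) h1).const_mul (1 / 2)
  have h3 : HasFDerivAt (tauCoeff F S A E w) _ (0, ξ) := hasFDerivAt_pi.2 h2
  rw [h3.fderiv]
  funext k
  change (1 / 2 : ℝ) * (toContinuousMultilinear (fourfold k)).linearDeriv _ _ = _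
  rw [linearDeriv_apply, linCoeff]
  congr 1
  refine Finset.sum_congr rfl fun i _ => ?_
  have e1 : (fun i => variationFrame F S A E (w i) (0, ξ)) =
      fun j => A (F ξ) (fderiv ℝ F ξ (w j)) :=
    funext fun i => variationFrame_zero hD hF hS hE₀ hE₁ hξ (w i)
  have e2 : (ContinuousLinearMap.pi fun i => fderiv ℝ (variationFrame F S A E (w i)) (0, ξ))
      ((1 : ℝ), (0 : R4)) i = fderiv ℝ A (F ξ) (S ξ) (fderiv ℝ F ξ (w i))
        + A (F ξ) (fderiv ℝ S ξ (w i)) :=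
    fderiv_variationFrame_zero hD hF hS hE
      (fun y hy => (hA.contDiffAt (hΩ.mem_nhds hy)).differentiableAt (by simp))
      (fun z hz => (hm z hz).1) hE₀ hE₁ hξ (w i)
  exact congrArg (fourfold k) (by rw [e1]; exact congrArg _ e2)

/-- `tauCoeff` is alternating in the tangent vectors. -/
theorem tauCoeff_eq_det (b : Basis (Fin 4) ℝ R4) (w : Fin 4 → R4) (z : ℝ × R4) :
    tauCoeff F S A E w z = b.det w • tauCoeff F S A E b z := by
  let T : R4 →ₗ[ℝ] R8 := (A (variation F S E z)).toLinearMap ∘ₗ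
    (fderiv ℝ (variation F S E) z).toLinearMap ∘ₗ LinearMap.inr ℝ ℝ R4
  funext k
  have h := ((fourfold k).compLinearMap T).eq_smul_basis_det b
  have h1 : fourfold k (fun i => variationFrame F S A E (w i) z) =
      fourfold k (fun i => variationFrame F S A E (b i) z) * b.det w :=
    congrArg (fun G : R4 [⋀^Fin 4]→ₗ[ℝ] ℝ => G w) h
  rw [tauCoeff, h1]
  simp only [Pi.smul_apply, tauCoeff, smul_eq_mul]
  ring

end TauCoeff

section DeformationCoords

variable {M : Type*} [TopologicalSpace M] [ChartedSpace R8 M] [IsManifold (𝓡 8) ∞ M]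
variable {X : Type*} [TopologicalSpace X] [ChartedSpace R4 X]

/-- The components of a section of `TM|_X` in the charts at `x₀` and `p`. -/
def secRep (f : X → M) (s : Π x : X, TangentSpace (𝓡 8) (f x)) (p : M) (x₀ : X) (ξ : R4) : R8 :=
  toCoords p (f ((extChartAt (𝓡 4) x₀).symm ξ)) (s ((extChartAt (𝓡 4) x₀).symm ξ))

theorem secRep_chart (f : X → M) (s : Π x : X, TangentSpace (𝓡 8) (f x)) (p : M) {x₀ x : X}
    (hx : x ∈ (chartAt R4 x₀).source) :
    secRep f s p x₀ (extChartAt (𝓡 4) x₀ x) = toCoords p (f x) (s x) := by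
  rw [secRep, (extChartAt (𝓡 4) x₀).left_inv (by rwa [extChartAt_source])]

theorem tangentCoords_smul_mem {f : X → M} {s : Π x : X, TangentSpace (𝓡 8) (f x)}
    {p : M} {y₀ : R8} {r : ℝ} {x₀ x : X}
    (hx : x ∈ (chartAt R4 x₀).source) {t : ℝ} (hz : (t, extChartAt (𝓡 4) x₀ x) ∈
      variationDomain (coordRep f p x₀) (secRep f s p x₀) (coordDomain f p x₀) y₀ r) :
    f x ∈ (chartAt R8 p).source ∧
      tangentCoords p (⟨f x, (t • s) x⟩ : TangentBundle (𝓡 8) M) =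
        (coordRep f p x₀ (extChartAt (𝓡 4) x₀ x), t • secRep f s p x₀ (extChartAt (𝓡 4) x₀ x)) := by
  have h1 : f x ∈ (chartAt R8 p).source := by
    have := hz.1.2
    rwa [Set.mem_preimage, Set.mem_preimage,
      (extChartAt (𝓡 4) x₀).left_inv (by rwa [extChartAt_source])] at this
  refine ⟨h1, ?_⟩
  rw [coordRep_chart f p hx, secRep_chart f s p hx]
  exact Prod.ext rfl ((toCoords p (f x)).map_smul t (s x))

variable [IsManifold (𝓡 4) ∞ X] {Φ : Π q : M, Form4 q} {f : X → M}
  {s : Π x : X, TangentSpace (𝓡 8) (f x)}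

theorem contDiffOn_secRep (hs : s ∈ NormalSections Φ f) (p : M) (x₀ : X) :
    ContDiffOn ℝ ∞ (secRep f s p x₀) (coordDomain f p x₀) := by
  have h1 : ContMDiffOn 𝓘(ℝ, R4) (𝓡 4) ∞ (extChartAt (𝓡 4) x₀).symm (coordDomain f p x₀) :=
    (contMDiffOn_extChartAt_symm x₀).mono Set.inter_subset_left
  exact ((hs.1 p).comp h1 fun ξ hξ => hξ.2).contDiffOn

variable {p : M} {Ω : Set R8} {θ : R8 → R8 →L[ℝ] R8} {y₀ : R8} {r C : ℝ} {E : R8 × R8 → R8}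

/-- The differential of `exp_{ts}` in coordinates. -/
theorem IsExpChart.coframeAt_dmap_expSec (h : IsExpChart Φ p Ω θ y₀ r C E)
    (hf : ContMDiff (𝓡 4) (𝓡 8) ∞ f) (hs : s ∈ NormalSections Φ f) {x₀ x : X}
    (hx : x ∈ (chartAt R4 x₀).source) {t : ℝ} (hz : (t, extChartAt (𝓡 4) x₀ x) ∈
      variationDomain (coordRep f p x₀) (secRep f s p x₀) (coordDomain f p x₀) y₀ r) (w : R4) :
    expSec Φ f (t • s) x ∈ (chartAt R8 p).source ∧
    extChartAt (𝓡 8) p (expSec Φ f (t • s) x) ∈ Ω ∧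
    coframeAt θ p (expSec Φ f (t • s) x) (dmap (expSec Φ f (t • s)) x (coordFrame x₀ x w)) =
      variationFrame (coordRep f p x₀) (secRep f s p x₀) θ E w (t, extChartAt (𝓡 4) x₀ x) := by
  set ξ := extChartAt (𝓡 4) x₀ x with hξ
  set F := coordRep f p x₀ with hF
  set S := secRep f s p x₀ with hS
  set D := coordDomain f p x₀ with hD
  have hDo : IsOpen D := isOpen_coordDomain hf.continuous p x₀
  have hFs : ContDiffOn ℝ ∞ F D := contDiffOn_coordRep hf p x₀
  have hSs : ContDiffOn ℝ ∞ S D := contDiffOn_secRep hs p x₀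
  have hopen := isOpen_variationDomain (y₀ := y₀) (r := r) hDo hFs.continuousOn hSs.continuousOn
  have hexp : ∀ x' ∈ (chartAt R4 x₀).source, (t, extChartAt (𝓡 4) x₀ x') ∈
      variationDomain F S D y₀ r → expSec Φ f (t • s) x' =
        (extChartAt (𝓡 8) p).symm (variation F S E (t, extChartAt (𝓡 4) x₀ x')) := by
    intro x' hx' hz'
    obtain ⟨h1, h2⟩ := tangentCoords_smul_mem hx' hz'
    have h3 := h.expMap_eq (⟨f x', (t • s) x'⟩ : TangentBundle (𝓡 8) M) h1 (by rw [h2]; exact hz'.2)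
    rw [h2] at h3
    exact h3
  have hsub : ∀ z ∈ variationDomain F S D y₀ r, variation F S E z ∈ Ω := fun z hz =>
    (h.mem _ hz.2).2.1
  have hG : ContDiffOn ℝ ∞ (variation F S E) (variationDomain F S D y₀ r) :=
    contDiffOn_variation hFs hSs h.contDiffOn
  have hes : expSec Φ f (t • s) x ∈ (chartAt R8 p).source := by
    rw [hexp x hx hz]; exact symm_mem_source (h.coframe.subset (hsub _ hz))
  have heq : extChartAt (𝓡 8) p (expSec Φ f (t • s) x) = variation F S E (t, ξ) := by
    rw [hexp x hx hz, chart_symm (h.coframe.subset (hsub _ hz))]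
  refine ⟨hes, by rw [heq]; exact hsub _ hz, ?_⟩
  -- the family at time `t`, as a map of the parameter
  have hGt : HasFDerivAt (fun η => variation F S E (t, η))
      ((fderiv ℝ (variation F S E) (t, ξ)).comp (ContinuousLinearMap.inr ℝ ℝ R4)) ξ :=
    ((hG.contDiffAt (hopen.mem_nhds hz)).differentiableAt (by simp)).hasFDerivAt.comp ξ
      (hasFDerivAt_prodMk_right t ξ)
  have hev : ∀ᶠ η in 𝓝 ξ, (t, η) ∈ variationDomain F S D y₀ r :=
    (Continuous.prodMk_right t).continuousAt.eventually (hopen.mem_nhds hz)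
  have hrep : coordRep (expSec Φ f (t • s)) p x₀ =ᶠ[𝓝 ξ] fun η => variation F S E (t, η) := by
    filter_upwards [hev] with η hη
    have h1 := symm_mem_source_of_mem_coordDomain hη.1
    have h2 : extChartAt (𝓡 4) x₀ ((extChartAt (𝓡 4) x₀).symm η) = η :=
      (extChartAt (𝓡 4) x₀).right_inv hη.1.1
    rw [coordRep, hexp _ h1 (by rw [h2]; exact hη), h2, chart_symm (h.coframe.subset (hsub _ hη))]
  have hmd : MDifferentiableAt (𝓡 4) (𝓡 8) (expSec Φ f (t • s)) x := by
    have h1 : ContMDiffAt (𝓡 4) 𝓘(ℝ, R8) ∞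
        (fun x' => variation F S E (t, extChartAt (𝓡 4) x₀ x')) x := by
      have h2 : ContMDiffAt 𝓘(ℝ, R4) 𝓘(ℝ, R8) ∞ (fun η => variation F S E (t, η)) ξ :=
        ((hG.contDiffAt (hopen.mem_nhds hz)).comp ξ
          (contDiff_prodMk_right t).contDiffAt).contMDiffAt
      exact h2.comp x (contMDiffAt_extChartAt' (n := ∞) hx)
    have h3 := (contMDiffAt_chart_symm (n := ⊤) (h.coframe.subset (hsub _ hz))).comp x h1
    refine (h3.congr_of_eventuallyEq ?_).mdifferentiableAt (by simp)
    have hc : ContinuousAt (extChartAt (𝓡 4) x₀) x := continuousAt_extChartAt' (by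
      rwa [extChartAt_source])
    filter_upwards [(chartAt R4 x₀).open_source.mem_nhds hx, hc.eventually hev] with x' hx' hη
    exact hexp x' hx' hη
  rw [coframeAt_apply, toCoords_dmap hx hes hmd
    (hrep.differentiableAt_iff.2 hGt.differentiableAt), toCoordsX_coordFrame hx,
    hrep.fderiv_eq, hGt.fderiv, heq]
  rfl

/-- In coordinates the deformation map is `tauCoeff` up to the parallel transport, which changes
the components by at most `C ‖t S‖` times their size. -/
theorem IsExpChart.exists_deformationMap_eq (h : IsExpChart Φ p Ω θ y₀ r C E)
    (hf : ContMDiff (𝓡 4) (𝓡 8) ∞ f) (hs : s ∈ NormalSections Φ f) {x₀ x : X}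
    (hx : x ∈ (chartAt R4 x₀).source) {t : ℝ} (hz : (t, extChartAt (𝓡 4) x₀ x) ∈
      variationDomain (coordRep f p x₀) (secRep f s p x₀) (coordDomain f p x₀) y₀ r)
    (v : Fin 4 → TangentSpace (𝓡 4) x) : ∃ c : Fin 7 → ℝ,
    deformationMap Φ f (t • s) x v = pullForm (f x) (coframeAt θ p (f x)) c ∧
    ‖c - (coordBasis x₀ x hx).det v • tauCoeff (coordRep f p x₀) (secRep f s p x₀) θ E
        (fun i => EuclideanSpace.single i 1) (t, extChartAt (𝓡 4) x₀ x)‖ ≤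
      C * ‖t • secRep f s p x₀ (extChartAt (𝓡 4) x₀ x)‖ *
      ‖(coordBasis x₀ x hx).det v • tauCoeff (coordRep f p x₀) (secRep f s p x₀) θ E
        (fun i => EuclideanSpace.single i 1) (t, extChartAt (𝓡 4) x₀ x)‖ := by
  obtain ⟨h1, h2⟩ := tangentCoords_smul_mem hx hz
  have hzb : tangentCoords p (⟨f x, (t • s) x⟩ : TangentBundle (𝓡 8) M) ∈
      Metric.ball (y₀, (0 : R8)) r := by rw [h2]; exact hz.2
  have h3 := fun w => h.coframeAt_dmap_expSec hf hs hx hz w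
  have hL : IsCoframe Φ (expSec Φ f (t • s) x) (coframeAt θ p (expSec Φ f (t • s) x)) :=
    h.coframe.at (h3 0).1 (h3 0).2.1
  obtain ⟨c, hc, hct⟩ := h.transport_eq _ h1 hzb ((coordBasis x₀ x hx).det v • tauCoeff
    (coordRep f p x₀) (secRep f s p x₀) θ E (fun i => EuclideanSpace.single i 1)
    (t, extChartAt (𝓡 4) x₀ x))
  refine ⟨c, ?_, ?_⟩
  · rw [deformationMap, ← hct]
    congr 1
    rw [tau_dmap_eq hL (coordBasis x₀ x hx), hL.tau_eq]
    refine form2_ext fun a b => ?_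
    rw [AlternatingMap.smul_apply]
    refine Eq.trans ?_ (pullForm_apply _ _ _ _ _).symm
    rw [pullForm_apply, smul_eq_mul, Finset.mul_sum]
    refine Finset.sum_congr rfl fun k _ => ?_
    simp only [coordBasis_apply, (h3 _).2.2, Pi.smul_apply, tauCoeff, smul_eq_mul]
    ring_nf
    rfl
  · rw [h2] at hc
    exact hc

end DeformationCoords

section Norms

variable {M : Type*} [TopologicalSpace M] [ChartedSpace R8 M] {Φ : Π q : M, Form4 q} {q : M}
  {L : TangentSpace (𝓡 8) q →ₗ[ℝ] R8}

theorem IsCoframe.len_eq (hL : IsCoframe Φ q L) (u : TangentSpace (𝓡 8) q) :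
    len Φ q u = ‖L u‖ := by
  rw [len, hL.metric_eq, real_inner_self_eq_norm_sq, Real.sqrt_sq (norm_nonneg _)]

theorem abs_pullForm_le (q : M) (L : TangentSpace (𝓡 8) q →ₗ[ℝ] R8) (c : Fin 7 → ℝ)
    (a b : TangentSpace (𝓡 8) q) : |pullForm q L c ![a, b]| ≤ 7 * ‖c‖ * ‖L a‖ * ‖L b‖ := by
  rw [pullForm_apply]
  refine (Finset.abs_sum_le_sum_abs _ _).trans ?_
  have h : ∀ k ∈ Finset.univ, |c k * om k (L a) (L b)| ≤ ‖c‖ * (‖L a‖ * ‖L b‖) := fun k _ => by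
    rw [abs_mul]
    exact mul_le_mul (norm_le_pi_norm c k) (abs_om_le k _ _) (abs_nonneg _) (norm_nonneg _)
  refine (Finset.sum_le_card_nsmul _ _ _ h).trans (le_of_eq ?_)
  simp only [Finset.card_univ, Fintype.card_fin, nsmul_eq_mul]
  push_cast
  ring

theorem pullForm_sub (q : M) (L : TangentSpace (𝓡 8) q →ₗ[ℝ] R8) (c d : Fin 7 → ℝ) :
    pullForm q L (c - d) = pullForm q L c - pullForm q L d := by
  refine form2_ext fun a b => ?_
  rw [AlternatingMap.sub_apply, pullForm_apply, pullForm_apply, pullForm_apply,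
    ← Finset.sum_sub_distrib]
  exact Finset.sum_congr rfl fun k _ => sub_mul _ _ _

theorem pullForm_smul (q : M) (L : TangentSpace (𝓡 8) q →ₗ[ℝ] R8) (t : ℝ) (c : Fin 7 → ℝ) :
    pullForm q L (t • c) = t • pullForm q L c := by
  simp [pullForm, Finset.smul_sum, smul_smul]

theorem pullForm_add (q : M) (L : TangentSpace (𝓡 8) q →ₗ[ℝ] R8) (c d : Fin 7 → ℝ) :
    pullForm q L (c + d) = pullForm q L c + pullForm q L d := by
  simp [pullForm, add_smul, Finset.sum_add_distrib]

end Norms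

theorem alternating_map_eq (G : R8 [⋀^Fin 4]→ₗ[ℝ] ℝ) (T : R4 →ₗ[ℝ] R8)
    (b : Basis (Fin 4) ℝ R4) (w : Fin 4 → R4) :
    G (fun i => T (w i)) = G (fun i => T (b i)) * b.det w :=
  congrArg (fun G : R4 [⋀^Fin 4]→ₗ[ℝ] ℝ => G w) ((G.compLinearMap T).eq_smul_basis_det b)

/-- The standard basis of the model space. -/
abbrev stdBasis : Basis (Fin 4) ℝ R4 := (EuclideanSpace.basisFun (Fin 4) ℝ).toBasis

theorem stdBasis_apply (i : Fin 4) : stdBasis i = EuclideanSpace.single i 1 := by simp [stdBasis]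

section Linearisation

variable {M : Type*} [TopologicalSpace M] [ChartedSpace R8 M] [IsManifold (𝓡 8) ∞ M]
variable {X : Type*} [TopologicalSpace X] [ChartedSpace R4 X] [IsManifold (𝓡 4) ∞ X]

theorem coordBasis_det {x₀ x : X} (hx : x ∈ (chartAt R4 x₀).source)
    (v : Fin 4 → TangentSpace (𝓡 4) x) :
    (coordBasis x₀ x hx).det v = stdBasis.det fun i => toCoordsX x₀ x (v i) := by
  rw [coordBasis, Basis.det_map]
  rfl

/-- The linearisation of the deformation map in the charts at `x₀` and `p`. -/
def linForm (θ : R8 → R8 →L[ℝ] R8) (f : X → M) (s : Π x : X, TangentSpace (𝓡 8) (f x)) (p : M)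
    (x₀ x : X) (v : Fin 4 → TangentSpace (𝓡 4) x) : Form2 (f x) :=
  pullForm (f x) (coframeAt θ p (f x)) (linCoeff (coordRep f p x₀) (secRep f s p x₀) θ
    (fun i => toCoordsX x₀ x (v i)) (extChartAt (𝓡 4) x₀ x))

variable {Φ : Π q : M, Form4 q} {f : X → M}
  {s : Π x : X, TangentSpace (𝓡 8) (f x)} {p : M} {Ω : Set R8} {θ : R8 → R8 →L[ℝ] R8} {y₀ : R8}
  {r C : ℝ} {E : R8 × R8 → R8}

theorem IsExpChart.fderiv_tauCoeff (h : IsExpChart Φ p Ω θ y₀ r C E)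
    (hf : ContMDiff (𝓡 4) (𝓡 8) ∞ f) (hs : s ∈ NormalSections Φ f) {x₀ : X} {ξ : R4}
    (hz : (0, ξ) ∈ variationDomain (coordRep f p x₀) (secRep f s p x₀) (coordDomain f p x₀) y₀ r)
    (w : Fin 4 → R4) :
    fderiv ℝ (tauCoeff (coordRep f p x₀) (secRep f s p x₀) θ E w) (0, ξ) (1, 0) =
      linCoeff (coordRep f p x₀) (secRep f s p x₀) θ w ξ :=
  fderiv_tauCoeff_zero (isOpen_coordDomain hf.continuous p x₀) (contDiffOn_coordRep hf p x₀)
    (contDiffOn_secRep hs p x₀) h.contDiffOn h.coframe.contDiffOn h.coframe.isOpen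
    (fun z hz => ⟨(h.mem z hz).1, (h.mem z hz).2.1⟩) h.apply_zero h.hasFDerivAt hz w

theorem IsExpChart.contDiffOn_tauCoeff (h : IsExpChart Φ p Ω θ y₀ r C E)
    (hf : ContMDiff (𝓡 4) (𝓡 8) ∞ f) (hs : s ∈ NormalSections Φ f) (x₀ : X) (w : Fin 4 → R4) :
    ContDiffOn ℝ ∞ (tauCoeff (coordRep f p x₀) (secRep f s p x₀) θ E w)
      (variationDomain (coordRep f p x₀) (secRep f s p x₀) (coordDomain f p x₀) y₀ r) :=
  CayleyDeformation.contDiffOn_tauCoeff (isOpen_coordDomain hf.continuous p x₀)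
    (contDiffOn_coordRep hf p x₀) (contDiffOn_secRep hs p x₀) h.contDiffOn h.coframe.contDiffOn
    (fun z hz => (h.mem z hz).2.1) w

theorem IsExpChart.isOpen_variationDomain (hf : ContMDiff (𝓡 4) (𝓡 8) ∞ f)
    (hs : s ∈ NormalSections Φ f) (x₀ : X) :
    IsOpen (variationDomain (coordRep f p x₀) (secRep f s p x₀) (coordDomain f p x₀) y₀ r) :=
  CayleyDeformation.isOpen_variationDomain (isOpen_coordDomain hf.continuous p x₀)
    (contDiffOn_coordRep hf p x₀).continuousOn (contDiffOn_secRep hs p x₀).continuousOn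

/-- The linearisation is alternating in the tangent vectors, as a limit of alternating forms. -/
theorem IsExpChart.linCoeff_eq_det (h : IsExpChart Φ p Ω θ y₀ r C E)
    (hf : ContMDiff (𝓡 4) (𝓡 8) ∞ f) (hs : s ∈ NormalSections Φ f) {x₀ : X} {ξ : R4}
    (hz : (0, ξ) ∈ variationDomain (coordRep f p x₀) (secRep f s p x₀) (coordDomain f p x₀) y₀ r)
    (w : Fin 4 → R4) :
    linCoeff (coordRep f p x₀) (secRep f s p x₀) θ w ξ =
      stdBasis.det w • linCoeff (coordRep f p x₀) (secRep f s p x₀) θ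
        (fun i => EuclideanSpace.single i 1) ξ := by
  have hd := ((h.contDiffOn_tauCoeff hf hs x₀ fun i => EuclideanSpace.single i 1).contDiffAt
    ((IsExpChart.isOpen_variationDomain hf hs x₀).mem_nhds hz)).differentiableAt (by simp)
  have h1 : tauCoeff (coordRep f p x₀) (secRep f s p x₀) θ E w = fun z => stdBasis.det w •
      tauCoeff (coordRep f p x₀) (secRep f s p x₀) θ E (fun i => EuclideanSpace.single i 1) z := by
    funext z
    rw [tauCoeff_eq_det stdBasis w z, funext stdBasis_apply]
  rw [← h.fderiv_tauCoeff hf hs hz w, h1, fderiv_fun_const_smul hd, smul_apply,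
    h.fderiv_tauCoeff hf hs hz]

theorem zero_mem_variationDomain {F S : R4 → R8} {D : Set R4} {ξ : R4} (hξ : ξ ∈ D)
    (hr : 0 < r) (hy : F ξ = y₀) : (0, ξ) ∈ variationDomain F S D y₀ r := by
  refine ⟨hξ, ?_⟩
  simp only [zero_smul, hy]
  exact Metric.mem_ball_self hr

/-- The components of the linearisation depend smoothly on the point. -/
theorem IsExpChart.contDiffOn_linCoeff (h : IsExpChart Φ p Ω θ y₀ r C E)
    (hf : ContMDiff (𝓡 4) (𝓡 8) ∞ f) (hs : s ∈ NormalSections Φ f) (x₀ : X) (w : Fin 4 → R4) :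
    ContDiffOn ℝ ∞ (linCoeff (coordRep f p x₀) (secRep f s p x₀) θ w)
      {ξ | (0, ξ) ∈ variationDomain (coordRep f p x₀) (secRep f s p x₀) (coordDomain f p x₀)
        y₀ r} := by
  have h1 := (h.contDiffOn_tauCoeff hf hs x₀ w).fderiv_of_isOpen
    (IsExpChart.isOpen_variationDomain hf hs x₀) (m := ∞) (by simp)
  have h2 : ContDiffOn ℝ ∞ (fun ξ : R4 => fderiv ℝ (tauCoeff (coordRep f p x₀)
      (secRep f s p x₀) θ E w) (0, ξ) (1, 0)) {ξ | (0, ξ) ∈ variationDomain (coordRep f p x₀)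
        (secRep f s p x₀) (coordDomain f p x₀) y₀ r} :=
    (h1.comp (contDiff_prodMk_right (0 : ℝ)).contDiffOn fun ξ hξ => hξ).clm_apply contDiffOn_const
  exact h2.congr fun ξ hξ => (h.fderiv_tauCoeff hf hs hξ w).symm

variable {o : Π x : X, Orientation ℝ (TangentSpace (𝓡 4) x) (Fin 4)}

/-- `Φ` does not vanish on the tangent spaces of a Cayley submanifold. -/
theorem form_dmap_ne_zero (hΦ : IsSpin7Structure Φ) (hf : IsSmoothEmb f)
    (ho : IsCayleyOrientation Φ f o) {x : X} (b : Basis (Fin 4) ℝ (TangentSpace (𝓡 4) x)) :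
    Φ (f x) (fun i => dmap f x (b i)) ≠ 0 := by
  obtain ⟨L, hL⟩ := exists_coframe hΦ (f x)
  obtain ⟨e, n, he⟩ := exists_isAdaptedFrame (o := o) hL (hf.2.1 x)
  have h1 := (isCalibrated_of_isPosOrthonormal hL ho he.1).phi_eq
  rw [← hL.form_eq, form_dmap_eq Φ f b] at h1
  intro h0
  rw [h0, zero_mul] at h1
  exact zero_ne_one h1

/-- `τ` vanishes on the tangent spaces of a Cayley submanifold, so parallel transport does not
contribute to the linearisation. -/
theorem tauCoeff_zero (hΦ : IsSpin7Structure Φ) (hf : IsSmoothEmb f)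
    (ho : IsCayleyOrientation Φ f o) (h : IsExpChart Φ p Ω θ y₀ r C E)
    (hs : s ∈ NormalSections Φ f) {x₀ x : X} (hx : x ∈ (chartAt R4 x₀).source)
    (hz : (0, extChartAt (𝓡 4) x₀ x) ∈
      variationDomain (coordRep f p x₀) (secRep f s p x₀) (coordDomain f p x₀) y₀ r) :
    tauCoeff (coordRep f p x₀) (secRep f s p x₀) θ E (fun i => EuclideanSpace.single i 1)
      (0, extChartAt (𝓡 4) x₀ x) = 0 := by
  have hp := (tangentCoords_smul_mem hx hz).1
  have hΩ : extChartAt (𝓡 8) p (f x) ∈ Ω := by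
    have := (h.mem _ hz.2).1
    rwa [coordRep_chart f p hx] at this
  have hL : IsCoframe Φ (f x) (coframeAt θ p (f x)) := h.coframe.at hp hΩ
  have h1 := (isCayley_iff_tau_eq_zero hΦ hf).1 ⟨hf, o, ho⟩ x
    fun i => coordFrame x₀ x (EuclideanSpace.single i 1)
  rw [hL.tau_eq] at h1
  have h2 := hL.pullForm_injective (h1.trans (pullForm_zero _ _).symm)
  rw [← h2]
  funext k
  rw [tauCoeff]
  refine congrArg (fun u => 1 / 2 * fourfold k u) (funext fun i => ?_)
  rw [coframeAt_dmap_coordFrame θ hf.1 hx hp]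
  exact variationFrame_zero (isOpen_coordDomain hf.1.continuous p x₀)
    (contDiffOn_coordRep hf.1 p x₀) (contDiffOn_secRep hs p x₀) h.apply_zero h.hasFDerivAt hz _

theorem deformationMap_zero [T2Space M] (hΦ : IsSpin7Structure Φ) (hf : IsSmoothEmb f)
    (ho : IsCayleyOrientation Φ f o) (x : X) (v : Fin 4 → TangentSpace (𝓡 4) x) :
    deformationMap Φ f 0 x v = 0 := by
  obtain ⟨Ω, θ, r, C, E, h⟩ := exists_expChart hΦ (mem_chart_source R8 (f x))
  have hx := mem_chart_source R4 x
  have hz := zero_mem_variationDomain (S := secRep f 0 (f x) x) (mem_coordDomain hx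
    (mem_chart_source R8 (f x))) h.pos (coordRep_chart f (f x) hx)
  obtain ⟨c, hc, hc'⟩ := h.exists_deformationMap_eq hf.1 (NormalSections Φ f).zero_mem hx hz v
  rw [tauCoeff_zero hΦ hf ho h (NormalSections Φ f).zero_mem hx hz, smul_zero, norm_zero, mul_zero,
    sub_zero] at hc'
  rw [norm_le_zero_iff.1 hc', pullForm_zero, smul_zero] at hc
  exact hc

/-- The volume of a frame is bounded by the product of the lengths, locally uniformly: the volume
is a multiple of `Φ`, which is bounded below on the coordinate frame and bounded above by the
product of the lengths. -/
theorem exists_det_bound (hΦ : IsSpin7Structure Φ) (hf : IsSmoothEmb f)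
    (ho : IsCayleyOrientation Φ f o) {x₀ : X} (hx₀ : f x₀ ∈ (chartAt R8 p).source)
    (h : IsLocalCoframe Φ p Ω θ) (hΩ : extChartAt (𝓡 8) p (f x₀) ∈ Ω) :
    ∃ K : ℝ, 0 < K ∧ ∀ᶠ ξ in 𝓝 (extChartAt (𝓡 4) x₀ x₀), ∀ w : Fin 4 → R4,
      |stdBasis.det w| ≤ K * ∏ i, ‖θ (coordRep f p x₀ ξ) (fderiv ℝ (coordRep f p x₀) ξ (w i))‖ := by
  set F := coordRep f p x₀ with hF
  set ξ₀ := extChartAt (𝓡 4) x₀ x₀ with hξ₀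
  have hxx : x₀ ∈ (chartAt R4 x₀).source := mem_chart_source R4 x₀
  have hm : ξ₀ ∈ coordDomain f p x₀ ∩ F ⁻¹' Ω :=
    ⟨mem_coordDomain hxx hx₀, by rw [Set.mem_preimage, hF, coordRep_chart f p hxx]; exact hΩ⟩
  set P : R4 → ℝ := fun ξ => phi fun i => θ (F ξ) (fderiv ℝ F ξ (stdBasis i)) with hP
  have hPc : ContinuousAt P ξ₀ := by
    have h1 : ContinuousAt (fun ξ => fun i => θ (F ξ) (fderiv ℝ F ξ (stdBasis i))) ξ₀ :=
      continuousAt_pi.2 fun i => (contDiffOn_frame h hf.1 x₀ _).continuousOn.continuousAt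
        ((isOpen_coordDomain_inter h.isOpen hf.1 x₀).mem_nhds hm)
    exact (contDiff_alternating phi).continuous.continuousAt.comp h1
  have hP0 : P ξ₀ ≠ 0 := by
    have h1 := form_dmap_ne_zero hΦ hf ho (coordBasis x₀ x₀ hxx)
    rw [(h.at hx₀ hΩ).form_eq] at h1
    refine fun h0 => h1 (Eq.trans ?_ h0)
    refine congrArg phi (funext fun i => ?_)
    rw [coordBasis_apply, stdBasis_apply]
    exact coframeAt_dmap_coordFrame θ hf.1 hxx hx₀ _
  set N := ‖toContinuousMultilinear phi‖ with hN
  have hpos : 0 < |P ξ₀| / 2 := by have := abs_pos.2 hP0; linarith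
  refine ⟨(N + 1) / (|P ξ₀| / 2), by positivity, ?_⟩
  filter_upwards [hPc.abs.eventually (lt_mem_nhds (half_lt_self (abs_pos.2 hP0)))] with ξ hξ w
  have h1 : phi (fun i => θ (F ξ) (fderiv ℝ F ξ (w i))) = P ξ * stdBasis.det w := by
    exact alternating_map_eq phi ((θ (F ξ)).toLinearMap ∘ₗ (fderiv ℝ F ξ).toLinearMap) stdBasis w
  have h2 : |phi fun i => θ (F ξ) (fderiv ℝ F ξ (w i))| ≤
      (N + 1) * ∏ i, ‖θ (F ξ) (fderiv ℝ F ξ (w i))‖ :=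
    ((toContinuousMultilinear phi).le_opNorm _).trans
      (mul_le_mul_of_nonneg_right (by linarith) (Finset.prod_nonneg fun _ _ => norm_nonneg _))
  rw [h1, abs_mul] at h2
  rw [div_mul_eq_mul_div, le_div_iff₀ hpos]
  refine le_trans ?_ h2
  rw [mul_comm]
  exact mul_le_mul_of_nonneg_right hξ.le (abs_nonneg _)

end Linearisation

section LinearisationBound

variable {M : Type*} [TopologicalSpace M] [ChartedSpace R8 M] [IsManifold (𝓡 8) ∞ M]
variable {X : Type*} [TopologicalSpace X] [ChartedSpace R4 X] [IsManifold (𝓡 4) ∞ X]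
variable {Φ : Π q : M, Form4 q} {f : X → M}
  {s : Π x : X, TangentSpace (𝓡 8) (f x)} {p : M} {Ω : Set R8} {θ : R8 → R8 →L[ℝ] R8} {y₀ : R8}
  {r C : ℝ} {E : R8 × R8 → R8} {o : Π x : X, Orientation ℝ (TangentSpace (𝓡 4) x) (Fin 4)}

/-- The deformation map differs from its linearisation by a quadratic error, locally uniformly. -/
theorem exists_linearisation_bound (hΦ : IsSpin7Structure Φ) (hf : IsSmoothEmb f)
    (ho : IsCayleyOrientation Φ f o) (hs : s ∈ NormalSections Φ f) {x₀ : X}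
    (hx₀ : f x₀ ∈ (chartAt R8 p).source)
    (h : IsExpChart Φ p Ω θ (extChartAt (𝓡 8) p (f x₀)) r C E) :
    ∃ K δ : ℝ, 0 < K ∧ 0 < δ ∧ ∀ᶠ x in 𝓝 x₀, x ∈ (chartAt R4 x₀).source ∧
      (0, extChartAt (𝓡 4) x₀ x) ∈ variationDomain (coordRep f p x₀) (secRep f s p x₀)
        (coordDomain f p x₀) (extChartAt (𝓡 8) p (f x₀)) r ∧
      ∀ t : ℝ, |t| < δ → ∀ (v : Fin 4 → TangentSpace (𝓡 4) x) (a b : TangentSpace (𝓡 8) (f x)),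
        |(deformationMap Φ f (t • s) x v - t • linForm θ f s p x₀ x v) ![a, b]| ≤
          K * t ^ 2 * (∏ i, len Φ (f x) (dmap f x (v i))) * len Φ (f x) a * len Φ (f x) b := by
  set F := coordRep f p x₀ with hF
  set S := secRep f s p x₀ with hS
  set ξ₀ := extChartAt (𝓡 4) x₀ x₀ with hξ₀
  set w₀ : Fin 4 → R4 := fun i => EuclideanSpace.single i 1 with hw₀
  set V := variationDomain F S (coordDomain f p x₀) (extChartAt (𝓡 8) p (f x₀)) r with hV
  have hxx : x₀ ∈ (chartAt R4 x₀).source := mem_chart_source R4 x₀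
  have hz₀ : (0, ξ₀) ∈ V :=
    zero_mem_variationDomain (mem_coordDomain hxx hx₀) h.pos (coordRep_chart f p hxx)
  have hVo : IsOpen V := IsExpChart.isOpen_variationDomain hf.1 hs x₀
  have hΩ₀ : extChartAt (𝓡 8) p (f x₀) ∈ Ω := (h.mem _ (Metric.mem_ball_self h.pos)).1
  have hα : ContDiffAt ℝ ∞ (tauCoeff F S θ E w₀) (0, ξ₀) :=
    (h.contDiffOn_tauCoeff hf.1 hs x₀ w₀).contDiffAt (hVo.mem_nhds hz₀)
  obtain ⟨K₁, δ₁, hK₁, hδ₁, hT⟩ := exists_taylor_bound hα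
  obtain ⟨K₂, hK₂, hdet⟩ := exists_det_bound hΦ hf ho hx₀ h.coframe hΩ₀
  -- local bounds for the section and the linearisation
  obtain ⟨B, hB, hSB⟩ : ∃ B : ℝ, 0 < B ∧ ∀ᶠ ξ in 𝓝 ξ₀, ‖S ξ‖ < B ∧ ‖linCoeff F S θ w₀ ξ‖ < B := by
    have h1 : ContinuousAt S ξ₀ := (contDiffOn_secRep hs p x₀).continuousOn.continuousAt
      ((isOpen_coordDomain hf.1.continuous p x₀).mem_nhds hz₀.1)
    have h2 : ContinuousAt (linCoeff F S θ w₀) ξ₀ :=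
      (h.contDiffOn_linCoeff hf.1 hs x₀ w₀).continuousOn.continuousAt
        ((hVo.preimage (Continuous.prodMk_right (0 : ℝ))).mem_nhds hz₀)
    refine ⟨max ‖S ξ₀‖ ‖linCoeff F S θ w₀ ξ₀‖ + 1, by positivity, ?_⟩
    exact (h1.norm.eventually (gt_mem_nhds ((le_max_left _ _).trans_lt (lt_add_one _)))).and
      (h2.norm.eventually (gt_mem_nhds ((le_max_right _ _).trans_lt (lt_add_one _))))
  obtain ⟨δ₂, hδ₂, hball⟩ := Metric.mem_nhds_iff.1 (hVo.mem_nhds hz₀)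
  have hC := h.const_pos
  -- The factor `7` is the number of the forms `ω_k`.
  refine ⟨7 * ((C * B * (K₁ + B) + K₁) * K₂), min 1 (min δ₁ δ₂), by positivity, by positivity, ?_⟩
  have hc : ContinuousAt (extChartAt (𝓡 4) x₀) x₀ := continuousAt_extChartAt x₀
  filter_upwards [(chartAt R4 x₀).open_source.mem_nhds hxx, hc.eventually hSB, hc.eventually hdet,
    hc.eventually (Metric.ball_mem_nhds ξ₀ hδ₁), hc.eventually (Metric.ball_mem_nhds ξ₀ hδ₂)]
    with x hx hx1 hx2 hx3 hx4
  set ξ := extChartAt (𝓡 4) x₀ x with hξ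
  have hz : ∀ t : ℝ, |t| < δ₂ → (t, ξ) ∈ V := fun t ht => hball (by
    rw [← ball_prod_same]
    exact ⟨by simpa using ht, hx4⟩)
  have hz0 : (0, ξ) ∈ V := hz 0 (by simpa using hδ₂)
  refine ⟨hx, hz0, fun t ht v a b => ?_⟩
  have ht1 : |t| ≤ 1 := (ht.trans_le (min_le_left _ _)).le
  have htδ1 : |t| < δ₁ := ht.trans_le ((min_le_right _ _).trans (min_le_left _ _))
  have htδ2 : |t| < δ₂ := ht.trans_le ((min_le_right _ _).trans (min_le_right _ _))
  have hp := (tangentCoords_smul_mem hx hz0).1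
  have hΩ : extChartAt (𝓡 8) p (f x) ∈ Ω := by
    have := (h.mem _ hz0.2).1
    rwa [hF, coordRep_chart f p hx] at this
  have hL : IsCoframe Φ (f x) (coframeAt θ p (f x)) := h.coframe.at hp hΩ
  obtain ⟨c, hcd, hcn⟩ := h.exists_deformationMap_eq hf.1 hs hx (hz t htδ2) v
  have hα1 := hT ξ hx3 t htδ1
  rw [tauCoeff_zero hΦ hf ho h hs hx hz0, h.fderiv_tauCoeff hf.1 hs hz0, sub_zero] at hα1
  set α := tauCoeff F S θ E w₀ (t, ξ) with hαd
  set l := linCoeff F S θ w₀ ξ with hl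
  set d := (coordBasis x₀ x hx).det v with hd
  have hlin : linForm θ f s p x₀ x v = pullForm (f x) (coframeAt θ p (f x)) (d • l) := by
    rw [linForm, h.linCoeff_eq_det hf.1 hs hz0, hd, coordBasis_det]
  have ht2 : t ^ 2 = |t| * |t| := by rw [sq, abs_mul_abs_self]
  -- Since `α` vanishes at `t = 0` it is `O(t)`; the error `C ‖t S‖ ‖α‖` of the parallel transport
  -- is therefore `O(t²)`, like the remainder of the Taylor expansion.
  have hαn : ‖α‖ ≤ (K₁ + B) * |t| := by
    have h1 : ‖α‖ ≤ ‖α - t • l‖ + ‖t • l‖ := by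
      simpa using norm_add_le (α - t • l) (t • l)
    rw [norm_smul, Real.norm_eq_abs] at h1
    have h2 : |t| * ‖l‖ ≤ |t| * B := mul_le_mul_of_nonneg_left hx1.2.le (abs_nonneg t)
    have h3 : K₁ * t ^ 2 ≤ K₁ * |t| := by
      rw [ht2]
      exact mul_le_mul_of_nonneg_left (mul_le_of_le_one_left (abs_nonneg t) ht1) hK₁.le
    linarith
  have hcl : ‖c - t • d • l‖ ≤ (C * B * (K₁ + B) + K₁) * t ^ 2 * |d| := by
    have h1 : ‖c - t • d • l‖ ≤ ‖c - d • α‖ + ‖d • (α - t • l)‖ := by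
      have : c - t • d • l = (c - d • α) + d • (α - t • l) := by
        rw [smul_sub, smul_comm t d]; abel
      rw [this]
      exact norm_add_le _ _
    rw [norm_smul d (α - t • l), Real.norm_eq_abs] at h1
    have h2 : ‖c - d • α‖ ≤ C * (|t| * B) * (|d| * ((K₁ + B) * |t|)) := by
      refine hcn.trans ?_
      rw [norm_smul, norm_smul, Real.norm_eq_abs, Real.norm_eq_abs]
      have := hx1.1.le
      gcongr
    have h3 : |d| * ‖α - t • l‖ ≤ |d| * (K₁ * t ^ 2) :=
      mul_le_mul_of_nonneg_left hα1 (abs_nonneg d)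
    have h4 : C * (|t| * B) * (|d| * ((K₁ + B) * |t|)) + |d| * (K₁ * t ^ 2) =
        (C * B * (K₁ + B) + K₁) * t ^ 2 * |d| := by rw [ht2]; ring
    linarith
  have hdn : |d| ≤ K₂ * ∏ i, len Φ (f x) (dmap f x (v i)) := by
    have h1 := hx2 fun i => toCoordsX x₀ x (v i)
    rw [hd, coordBasis_det]
    refine h1.trans (le_of_eq ?_)
    congr 1
    refine Finset.prod_congr rfl fun i _ => ?_
    rw [hL.len_eq, coframeAt_apply, toCoords_dmap_of_contMDiff hf.1 hx hp, ← coordRep_chart f p hx]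
  have hfin : (deformationMap Φ f (t • s) x v - t • linForm θ f s p x₀ x v) =
      pullForm (f x) (coframeAt θ p (f x)) (c - t • d • l) := by
    rw [hlin, pullForm_sub, pullForm_smul _ _ t, hcd]
  rw [hfin, hL.len_eq, hL.len_eq]
  refine (abs_pullForm_le _ _ _ _ _).trans ?_
  refine mul_le_mul_of_nonneg_right (mul_le_mul_of_nonneg_right ?_ (norm_nonneg _)) (norm_nonneg _)
  have hK0 : 0 ≤ (C * B * (K₁ + B) + K₁) * t ^ 2 := by positivity
  have h5 := mul_le_mul_of_nonneg_left hdn hK0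
  have h6 : (C * B * (K₁ + B) + K₁) * t ^ 2 * (K₂ * ∏ i, len Φ (f x) (dmap f x (v i))) =
    ((C * B * (K₁ + B) + K₁) * K₂) * t ^ 2 * ∏ i, len Φ (f x) (dmap f x (v i)) := by ring
  rw [h6] at h5
  linarith

end LinearisationBound

/-! ### The linearisation in an adapted frame -/

section AlternatingForms

theorem fderiv_alternating_comp (G : R8 [⋀^Fin 4]→ₗ[ℝ] ℝ) {θ : R8 → R8 →L[ℝ] R8} {y : R8}
    (hθ : DifferentiableAt ℝ θ y) (V : Fin 4 → R8) (σ : R8) :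
    fderiv ℝ (fun z => G fun i => θ z (V i)) y σ =
      ∑ m, G (Function.update (fun i => θ y (V i)) m (fderiv ℝ θ y σ (V m))) := by
  have h2 : HasFDerivAt (fun z => fun i => θ z (V i))
      (ContinuousLinearMap.pi fun i => (fderiv ℝ θ y).flip (V i)) y := by
    refine hasFDerivAt_pi.2 fun i => ?_
    simpa using hθ.hasFDerivAt.clm_apply (hasFDerivAt_const (V i) y)
  have h4 := (hasFDerivAt_alternating G (fun i => θ y (V i))).comp y h2
  have h5 : HasFDerivAt (fun z => G fun i => θ z (V i)) _ y := h4
  rw [h5.fderiv]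
  exact linearDeriv_apply G _ _

theorem alternating_update_sub (G : R8 [⋀^Fin 4]→ₗ[ℝ] ℝ) (u : Fin 4 → R8) (m : Fin 4)
    (a b : R8) : G (Function.update u m (a - b)) =
      G (Function.update u m a) - G (Function.update u m b) :=
  G.map_update_sub u m a b

end AlternatingForms

section NablaPhi

variable {M : Type*} [TopologicalSpace M] [ChartedSpace R8 M] [IsManifold (𝓡 8) ∞ M]
variable {Φ : Π q : M, Form4 q} {p : M} {Ω : Set R8} {θ : R8 → R8 →L[ℝ] R8}

/-- In a coframe the Cayley form is constant, so that its covariant derivative only involves the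
connection matrix. -/
theorem nablaPhi_eq (h : IsLocalCoframe Φ p Ω θ) (hΩ : extChartAt (𝓡 8) p p ∈ Ω)
    (w : TangentSpace (𝓡 8) p) (v : Fin 4 → TangentSpace (𝓡 8) p) :
    nablaPhi Φ p w v = ∑ m, phi (Function.update (fun i => coframeAt θ p p (v i)) m
      (conn θ (extChartAt (𝓡 8) p p) (toCoords p p w) (coframeAt θ p p (v m)))) := by
  have hp : p ∈ (chartAt R8 p).source := mem_chart_source R8 p
  set y := extChartAt (𝓡 8) p p with hy
  set V : Fin 4 → R8 := fun i => toCoords p p (v i) with hV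
  set σ := toCoords p p w with hσ
  have hI := h.isInvertible hΩ
  have hL : IsCoframe Φ p (coframeAt θ p p) := h.at hp hΩ
  have h1 : (fun z : R8 => Φ ((extChartAt (𝓡 8) p).symm z) fun i => ofCoords p _ (V i)) =ᶠ[𝓝 y]
      fun z => phi fun i => θ z (V i) := by
    filter_upwards [h.isOpen.mem_nhds hΩ] with z hz
    rw [(h.coframe z hz).form_eq]
    refine congrArg phi (funext fun i => ?_)
    exact congrArg (θ z) (toCoords_ofCoords (symm_mem_source (h.subset hz)) (V i))
  have h3 : fderiv ℝ (fun z : R8 => Φ ((extChartAt (𝓡 8) p).symm z) fun i => ofCoords p _ (V i)) y σ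
      = ∑ m, phi (Function.update (fun i => θ y (V i)) m (fderiv ℝ θ y σ (V m))) := by
    rw [h1.fderiv_eq]
    exact fderiv_alternating_comp phi (h.differentiableAt hΩ) V σ
  have h6 : ∀ m, Φ p (Function.update v m (ofCoords p p (christoffel Φ p p σ (V m)))) =
      phi (Function.update (fun i => θ y (V i)) m (θ y (gam θ y σ (V m)))) := fun m => by
    rw [hL.form_eq]
    refine congrArg phi (funext fun i => ?_)
    by_cases hi : i = m
    · subst hi
      rw [Function.update_self, Function.update_self, coframeAt_apply, toCoords_ofCoords hp,
        h.christoffel_eq hp hΩ]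
    · rw [Function.update_of_ne hi, Function.update_of_ne hi]
      rfl
  rw [nablaPhi, h3, Finset.sum_congr rfl fun m _ => h6 m, ← Finset.sum_sub_distrib]
  refine Finset.sum_congr rfl fun m _ => ?_
  have h7 : conn θ y σ (coframeAt θ p p (v m)) =
      fderiv ℝ θ y σ (V m) - θ y (gam θ y σ (V m)) := by
    rw [conn, coframeAt_apply, inverse_apply_self hI]
    rfl
  have h8 : (fun i => coframeAt θ p p (v i)) = fun i => θ y (V i) := rfl
  rw [h7, h8, alternating_update_sub]

end NablaPhi

section OperatorFormula

variable {M : Type*} [TopologicalSpace M] [ChartedSpace R8 M]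
variable {X : Type*} [TopologicalSpace X] [ChartedSpace R4 X]
variable {Φ : Π q : M, Form4 q} {f : X → M}
  {s : Π x : X, TangentSpace (𝓡 8) (f x)} {Ω : Set R8} {θ : R8 → R8 →L[ℝ] R8}
  {o : Π x : X, Orientation ℝ (TangentSpace (𝓡 4) x) (Fin 4)} {x : X}
  {L : TangentSpace (𝓡 8) (f x) →ₗ[ℝ] R8}

/-- The decomposition of a vector along the image into a tangential and a normal part, which
`normalPart` chooses, exists: subtract the orthogonal projection onto a positive orthonormal frame.
-/
theorem normalPart_spec (hL : IsCoframe Φ (f x) L) {e : Basis (Fin 4) ℝ (TangentSpace (𝓡 4) x)}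
    (he : IsPosOrthonormal Φ f o x e) (v : TangentSpace (𝓡 8) (f x)) :
    IsNormal Φ f x (normalPart Φ f x v) ∧ ∃ w, v = dmap f x w + normalPart Φ f x v := by
  have h : ∃ n, IsNormal Φ f x n ∧ ∃ w, v = dmap f x w + n := by
    have ho := orthonormal_iff_ite.1 ((isPosOrthonormal_iff hL e).1 he).1
    refine ⟨v - dmap f x (∑ i, inner ℝ (L (dmap f x (e i))) (L v) • e i), fun w => ?_, _,
      (add_sub_cancel _ _).symm⟩
    rw [hL.metric_eq]
    have h1 : ∀ j, inner ℝ (L (v - dmap f x (∑ i, inner ℝ (L (dmap f x (e i))) (L v) • e i)))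
        (L (dmap f x (e j))) = (0 : ℝ) := fun j => by
      have h2 : L (dmap f x (∑ i, inner ℝ (L (dmap f x (e i))) (L v) • e i)) =
          ∑ i, inner ℝ (L (dmap f x (e i))) (L v) • L (dmap f x (e i)) := by
        rw [map_sum, map_sum]
        exact Finset.sum_congr rfl fun i _ => by rw [map_smul, map_smul]
      have ho' : ∀ i j, inner ℝ (L (dmap f x (e i))) (L (dmap f x (e j))) =
        if i = j then (1 : ℝ) else 0 := ho
      rw [map_sub, h2, inner_sub_left, sum_inner]
      simp only [real_inner_smul_left, ho']
      simp [real_inner_comm]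
    have h3 : L (dmap f x w) = ∑ j, e.repr w j • L (dmap f x (e j)) := by
      conv_lhs => rw [← e.sum_repr w]
      rw [map_sum, map_sum]
      exact Finset.sum_congr rfl fun i _ => by rw [map_smul, map_smul]
    rw [h3, inner_sum]
    refine Finset.sum_eq_zero fun j _ => ?_
    rw [real_inner_smul_right, h1, mul_zero]
  have h1 : normalPart Φ f x v = h.choose := dif_pos h
  rw [h1]
  exact h.choose_spec

variable [IsManifold (𝓡 8) ∞ M] [IsManifold (𝓡 4) ∞ X]

theorem mfderiv_secRep (hf : Continuous f) (hs : s ∈ NormalSections Φ f)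
    (w : TangentSpace (𝓡 4) x) :
    (show R8 from mfderiv (𝓡 4) 𝓘(ℝ, R8) (fun y => toCoords (f x) (f y) (s y)) x w) =
      fderiv ℝ (secRep f s (f x) x) (extChartAt (𝓡 4) x x) (toCoordsX x x w) := by
  have hx : x ∈ (chartAt R4 x).source := mem_chart_source R4 x
  have h1 : (fun y => toCoords (f x) (f y) (s y)) =ᶠ[𝓝 x]
      secRep f s (f x) x ∘ extChartAt (𝓡 4) x := by
    filter_upwards [(chartAt R4 x).open_source.mem_nhds hx] with y hy
    exact (secRep_chart f s (f x) hy).symm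
  have h2 : MDifferentiableAt (𝓡 4) 𝓘(ℝ, R4) (extChartAt (𝓡 4) x) x :=
    (contMDiffAt_extChartAt' (n := ∞) hx).mdifferentiableAt (by simp)
  have h3 : DifferentiableAt ℝ (secRep f s (f x) x) (extChartAt (𝓡 4) x x) :=
    ((contDiffOn_secRep hs (f x) x).contDiffAt ((isOpen_coordDomain hf (f x) x).mem_nhds
      (mem_coordDomain hx (mem_chart_source R8 (f x))))).differentiableAt (by simp)
  rw [h1.mfderiv_eq, mfderiv_comp x h3.mdifferentiableAt h2, mfderiv_eq_fderiv]
  rfl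

/-- In an adapted frame the linearisation of the deformation map is the operator `D`. The variation
of the coframe values of a tangent frame consists of the tangential and the normal part of the
covariant derivative of `s` and of a skew endomorphism. The tangential part does not contribute
since `fourfold` vanishes on tangent vectors, the normal part gives `e_i × ∇^⊥_{e_i} s`, and the
skew part gives the term with `∇_s Φ`. -/
theorem linForm_eq_operatorFormula (hf : ContMDiff (𝓡 4) (𝓡 8) ∞ f)
    (ho : IsCayleyOrientation Φ f o) (hs : s ∈ NormalSections Φ f)
    (h : IsLocalCoframe Φ (f x) Ω θ) (hΩ : extChartAt (𝓡 8) (f x) (f x) ∈ Ω)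
    {e : Basis (Fin 4) ℝ (TangentSpace (𝓡 4) x)} {n : Fin 4 → TangentSpace (𝓡 8) (f x)}
    (hen : IsAdaptedFrame Φ f o x e n) :
    linForm θ f s (f x) x x e = operatorFormula Φ f s x e n := by
  have hpp : f x ∈ (chartAt R8 (f x)).source := mem_chart_source R8 (f x)
  have hxx : x ∈ (chartAt R4 x).source := mem_chart_source R4 x
  set y := extChartAt (𝓡 8) (f x) (f x) with hy
  set F := coordRep f (f x) x with hF
  set S := secRep f s (f x) x with hS
  set ξ := extChartAt (𝓡 4) x x with hξ
  have hFξ : F ξ = y := coordRep_chart f (f x) hxx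
  have hI := h.isInvertible hΩ
  set L := coframeAt θ (f x) (f x) with hLd
  have hL : IsCoframe Φ (f x) L := h.at hpp hΩ
  set u : Fin 4 → R8 := fun i => L (dmap f x (e i)) with hu
  have hc : IsCalibrated u := isCalibrated_of_isPosOrthonormal hL ho hen.1
  set σ := toCoords (f x) (f x) (s x) with hσ
  have hSξ : S ξ = σ := secRep_chart f s (f x) hxx
  set W : Fin 4 → R4 := fun i => toCoordsX x x (e i) with hW
  have hFW : ∀ i, toCoords (f x) (f x) (dmap f x (e i)) = fderiv ℝ F ξ (W i) := fun i =>
    toCoords_dmap_of_contMDiff hf hxx hpp (e i)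
  have huW : ∀ i, u i = θ y (fderiv ℝ F ξ (W i)) := fun i => by
    rw [← hFW]; rfl
  set P : Fin 4 → R8 := fun i => L (covPerp Φ f s x (e i)) with hP
  -- the covariant derivative of the section
  have hN : ∀ i, L (covAlong Φ f s x (e i)) =
      θ y (fderiv ℝ S ξ (W i) + gam θ y (fderiv ℝ F ξ (W i)) σ) := fun i => by
    rw [hLd, coframeAt_apply, covAlong, toCoords_ofCoords hpp, h.christoffel_eq hpp hΩ]
    rw [hFW, mfderiv_secRep hf.continuous hs]
  have hPu : ∀ i j, inner ℝ (P i) (u j) = (0 : ℝ) := fun i j => by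
    have h1 := (normalPart_spec hL hen.1 (covAlong Φ f s x (e i))).1 (e j)
    rwa [hL.metric_eq] at h1
  have hNP : ∀ i, ∃ c : Fin 4 → ℝ, L (covAlong Φ f s x (e i)) = ∑ j, c j • u j + P i := fun i => by
    obtain ⟨w, hw⟩ := (normalPart_spec hL hen.1 (covAlong Φ f s x (e i))).2
    refine ⟨fun j => e.repr w j, ?_⟩
    have h3 : L (dmap f x w) = ∑ j, e.repr w j • L (dmap f x (e j)) := by
      conv_lhs => rw [← e.sum_repr w]
      rw [map_sum, map_sum]
      exact Finset.sum_congr rfl fun i _ => by rw [map_smul, map_smul]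
    conv_lhs => rw [hw, map_add, h3]
    rfl
  -- the variation of the frame is the covariant derivative plus a skew endomorphism
  have hvar : ∀ i, fderiv ℝ θ y σ (fderiv ℝ F ξ (W i)) + θ y (fderiv ℝ S ξ (W i)) =
      L (covAlong Φ f s x (e i)) + conn θ y σ (u i) := fun i => by
    rw [hN, huW, conn, inverse_apply_self hI, kap, map_add, gam_symm _ σ]
    abel
  -- The skew part is expressed by the values of `∇_s Φ` on the frame.
  have hn : Orthonormal ℝ fun j => L (n j) := by
    rw [orthonormal_iff_ite]
    intro i j
    rw [← hL.metric_eq, hen.2.2]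
  have hnu : ∀ i j, inner ℝ (L (n i)) (u j) = (0 : ℝ) := fun i j => by
    have h1 := hen.2.1 i (e j)
    rwa [hL.metric_eq] at h1
  have hskew := fun k => hc.sum_fourfold_update_skew k hn hnu (connLin θ y σ)
    (fun a b => conn_skew hI σ a b)
  simp only [connLin_apply] at hskew
  have hnab : ∀ j, nablaPhi Φ (f x) (s x) ![n j, dmap f x (e 1), dmap f x (e 2), dmap f x (e 3)] =
      ∑ m, phi (Function.update ![L (n j), u 1, u 2, u 3] m
        (conn θ y σ (![L (n j), u 1, u 2, u 3] m))) := fun j => by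
    have h1 : (fun i => L (![n j, dmap f x (e 1), dmap f x (e 2), dmap f x (e 3)] i)) =
        ![L (n j), u 1, u 2, u 3] := by
      funext i; fin_cases i <;> rfl
    have h2 := nablaPhi_eq h hΩ (s x) ![n j, dmap f x (e 1), dmap f x (e 2), dmap f x (e 3)]
    refine h2.trans (Finset.sum_congr rfl fun m _ => ?_)
    have h3 : L (![n j, dmap f x (e 1), dmap f x (e 2), dmap f x (e 3)] m) =
      ![L (n j), u 1, u 2, u 3] m := congrFun h1 m
    exact congrArg phi (congrArg₂ (fun g z => Function.update g m (conn θ y σ z)) h1 h3)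
  have hlin : ∀ k, linCoeff F S θ W ξ k = 1 / 2 * (∑ i, om k (u i) (P i) +
      ∑ j, nablaPhi Φ (f x) (s x) ![n j, dmap f x (e 1), dmap f x (e 2), dmap f x (e 3)] *
        om k (L (n j)) (u 0)) := fun k => by
    rw [linCoeff]
    congr 1
    have h1 : (fun j => θ (F ξ) (fderiv ℝ F ξ (W j))) = u := funext fun j => by
      rw [hFξ, huW]
    have h2 : ∀ i, fourfold k (Function.update (fun j => θ (F ξ) (fderiv ℝ F ξ (W j))) i
        (fderiv ℝ θ (F ξ) (S ξ) (fderiv ℝ F ξ (W i)) + θ (F ξ) (fderiv ℝ S ξ (W i)))) =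
        om k (u i) (P i) + fourfold k (Function.update u i (conn θ y σ (u i))) := fun i => by
      obtain ⟨c, hcN⟩ := hNP i
      rw [h1, hFξ, hSξ, hvar, hcN, (fourfold k).map_update_add, (fourfold k).map_update_add,
        hc.fourfold_update_sum, hc.fourfold_update k i (hPu i), zero_add]
    rw [Finset.sum_congr rfl fun i _ => h2 i, Finset.sum_add_distrib]
    congr 1
    refine (hskew k).trans (Finset.sum_congr rfl fun j _ => ?_)
    rw [hnab]
  refine form2_ext fun a b => ?_
  have hr : operatorFormula Φ f s x e n ![a, b] =
      ∑ i, cross2 Φ (f x) (dmap f x (e i)) (covPerp Φ f s x (e i)) ![a, b] +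
      ∑ i, nablaPhi Φ (f x) (s x) ![n i, dmap f x (e 1), dmap f x (e 2), dmap f x (e 3)] *
        cross2 Φ (f x) (n i) (dmap f x (e 0)) ![a, b] := by
    rw [operatorFormula, AlternatingMap.add_apply, alternatingMap_sum_apply,
      alternatingMap_sum_apply]
    rfl
  rw [hr, linForm, pullForm_apply]
  simp only [hL.cross2_apply]
  change ∑ k, linCoeff F S θ W ξ k * om k (L a) (L b) = ∑ i, 1 / 2 * ∑ k, om k (u i) (P i) *
    om k (L a) (L b) + ∑ j, nablaPhi Φ (f x) (s x) ![n j, dmap f x (e 1), dmap f x (e 2),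
      dmap f x (e 3)] * (1 / 2 * ∑ k, om k (L (n j)) (u 0) * om k (L a) (L b))
  simp only [hlin, Finset.mul_sum]
  rw [Finset.sum_comm, Finset.sum_comm (s := (Finset.univ : Finset (Fin 4)))
    (f := fun j k => nablaPhi Φ (f x) (s x) ![n j, dmap f x (e 1), dmap f x (e 2),
      dmap f x (e 3)] * (1 / 2 * (om k (L (n j)) (u 0) * om k (L a) (L b)))),
    ← Finset.sum_add_distrib]
  refine Finset.sum_congr rfl fun k _ => ?_
  rw [mul_add, add_mul, Finset.mul_sum, Finset.mul_sum, Finset.sum_mul, Finset.sum_mul]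
  congr 1
  · exact Finset.sum_congr rfl fun i _ => by ring
  · exact Finset.sum_congr rfl fun i _ => by ring

end OperatorFormula

/-! ### The bundle `E` -/

section BundleE

variable {M : Type*} [TopologicalSpace M] [ChartedSpace R8 M]

theorem cross2_swap {Φ : Π q : M, Form4 q} {q : M} {L : TangentSpace (𝓡 8) q →ₗ[ℝ] R8}
    (hL : IsCoframe Φ q L) (u v : TangentSpace (𝓡 8) q) :
    cross2 Φ q u v = -cross2 Φ q v u := by
  rw [hL.cross2_eq, hL.cross2_eq, ← neg_one_smul ℝ, ← pullForm_smul]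
  refine congrArg _ (funext fun k => ?_)
  rw [Pi.smul_apply, om_swap, smul_eq_mul]
  ring

variable {X : Type*} [TopologicalSpace X] [ChartedSpace R4 X]
variable {Φ : Π q : M, Form4 q} {f : X → M}
  {o : Π x : X, Orientation ℝ (TangentSpace (𝓡 4) x) (Fin 4)} {x : X}
  {L : TangentSpace (𝓡 8) (f x) →ₗ[ℝ] R8}
  {e : Basis (Fin 4) ℝ (TangentSpace (𝓡 4) x)} {n : Fin 4 → TangentSpace (𝓡 8) (f x)}

theorem IsAdaptedFrame.orthonormal (hL : IsCoframe Φ (f x) L) (hen : IsAdaptedFrame Φ f o x e n) :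
    Orthonormal ℝ fun j => L (n j) := by
  rw [orthonormal_iff_ite]
  intro i j
  rw [← hL.metric_eq, hen.2.2]

theorem IsNormal.inner_eq_zero (hL : IsCoframe Φ (f x) L) {w : TangentSpace (𝓡 8) (f x)}
    (hw : IsNormal Φ f x w) (v : TangentSpace (𝓡 4) x) :
    inner ℝ (L w) (L (dmap f x v)) = (0 : ℝ) := by
  rw [← hL.metric_eq, hw]

variable [IsManifold (𝓡 4) ∞ X]

/-- The cross product of a tangent vector and a normal vector of a Cayley submanifold vanishes on
the tangent space. -/
theorem pullForm_om_mem_bundleE (hL : IsCoframe Φ (f x) L) (ho : IsCayleyOrientation Φ f o)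
    (he : IsPosOrthonormal Φ f o x e) (i : Fin 4) {w : R8}
    (hw : ∀ j, inner ℝ w (L (dmap f x (e j))) = (0 : ℝ)) :
    pullForm (f x) L (fun k => om k (L (dmap f x (e i))) w) ∈ bundleE Φ f x := by
  refine ⟨hL.pullForm_mem _, fun u v => ?_⟩
  have hc := isCalibrated_of_isPosOrthonormal hL ho he
  have h : (pullForm (f x) L fun k => om k (L (dmap f x (e i))) w).compLinearMap
      (dmap f x).toLinearMap = 0 := by
    refine e.ext_alternating fun a _ => ?_
    have h1 : (fun j => (dmap f x).toLinearMap (e (a j))) =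
        ![dmap f x (e (a 0)), dmap f x (e (a 1))] := by
      funext j; fin_cases j <;> rfl
    rw [AlternatingMap.compLinearMap_apply, AlternatingMap.zero_apply, h1, pullForm_apply]
    exact hc.sum_om_mul_om i (a 0) (a 1) hw
  have h2 := DFunLike.congr_fun h ![u, v]
  rw [AlternatingMap.compLinearMap_apply, AlternatingMap.zero_apply] at h2
  refine Eq.trans (congrArg _ (funext fun j => ?_)) h2
  fin_cases j <;> rfl

theorem cross2_mem_bundleE (hL : IsCoframe Φ (f x) L) (ho : IsCayleyOrientation Φ f o)
    (he : IsPosOrthonormal Φ f o x e) (i : Fin 4) {w : TangentSpace (𝓡 8) (f x)}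
    (hw : IsNormal Φ f x w) : cross2 Φ (f x) (dmap f x (e i)) w ∈ bundleE Φ f x := by
  rw [hL.cross2_eq]
  exact (pullForm_smul (f x) L (1 / 2) fun k => om k (L (dmap f x (e i))) (L w)) ▸
    (bundleE Φ f x).smul_mem _ (pullForm_om_mem_bundleE hL ho he i fun j =>
      hw.inner_eq_zero hL (e j))

theorem operatorFormula_mem_bundleE [IsManifold (𝓡 8) ∞ M] (hL : IsCoframe Φ (f x) L)
    (ho : IsCayleyOrientation Φ f o) (hen : IsAdaptedFrame Φ f o x e n)
    (s : Π x : X, TangentSpace (𝓡 8) (f x)) : operatorFormula Φ f s x e n ∈ bundleE Φ f x := by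
  refine Submodule.add_mem _ (Submodule.sum_mem _ fun i _ => ?_) (Submodule.sum_mem _ fun i _ => ?_)
  · exact cross2_mem_bundleE hL ho hen.1 i (normalPart_spec hL hen.1 _).1
  · rw [cross2_swap hL]
    exact Submodule.smul_mem _ _
      (Submodule.neg_mem _ (cross2_mem_bundleE hL ho hen.1 0 (hen.2.1 i)))

/-- The fibre of `E` is isomorphic to the normal space, by the cross product with a unit tangent
vector. -/
theorem finrank_bundleE (hL : IsCoframe Φ (f x) L) (ho : IsCayleyOrientation Φ f o)
    (hen : IsAdaptedFrame Φ f o x e n) : finrank ℝ (bundleE Φ f x) = 4 := by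
  set u : Fin 4 → R8 := fun i => L (dmap f x (e i)) with hu
  have hc : IsCalibrated u := isCalibrated_of_isPosOrthonormal hL ho hen.1
  have hn := hen.orthonormal hL
  have hnu : ∀ i j, inner ℝ (L (n i)) (u j) = (0 : ℝ) := fun i j =>
    (hen.2.1 i).inner_eq_zero hL (e j)
  let T : (Fin 4 → ℝ) →ₗ[ℝ] Form2 (f x) :=
    { toFun := fun c => pullForm (f x) L fun k => om k (u 0) (∑ j, c j • L (n j))
      map_add' := fun c d => by
        rw [← pullForm_add]
        refine congrArg _ (funext fun k => ?_)
        rw [Pi.add_apply, ← om_add_right, ← Finset.sum_add_distrib]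
        simp only [Pi.add_apply, add_smul]
      map_smul' := fun t c => by
        rw [RingHom.id_apply, ← pullForm_smul]
        refine congrArg _ (funext fun k => ?_)
        rw [Pi.smul_apply, smul_eq_mul, ← om_smul_right, Finset.smul_sum]
        simp only [Pi.smul_apply, smul_smul, smul_eq_mul] }
  have hwu : ∀ (c : Fin 4 → ℝ) (i : Fin 4), inner ℝ (∑ j, c j • L (n j)) (u i) = (0 : ℝ) :=
    fun c i => by
      rw [sum_inner]
      exact Finset.sum_eq_zero fun j _ => by rw [real_inner_smul_left, hnu, mul_zero]
  have hinj : Function.Injective T := by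
    rw [injective_iff_map_eq_zero]
    intro c hT
    have hT' : pullForm (f x) L (fun k => om k (u 0) (∑ j, c j • L (n j))) = 0 := hT
    have h1 := hL.pullForm_injective (hT'.trans (pullForm_zero _ _).symm)
    have h2 := hc.eq_zero_of_om_eq_zero ((real_inner_comm _ _).trans (hwu c 0))
      fun k => congrFun h1 k
    exact funext fun j => Fintype.linearIndependent_iff.1 hn.linearIndependent c h2 j
  have hr : LinearMap.range T = bundleE Φ f x := by
    refine le_antisymm ?_ fun α hα => ?_
    · rintro _ ⟨c, rfl⟩
      exact pullForm_om_mem_bundleE hL ho hen.1 0 (hwu c)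
    · obtain ⟨d, rfl⟩ := hL.mem_Lambda27_iff.1 hα.1
      -- the form with coefficients `d` is the cross product with `∑ dₖ Jₖ u₀`
      set w : R8 := ∑ k, d k • J k (u 0) with hw
      have hwn : ∀ i, inner ℝ (u i) w = (0 : ℝ) := fun i => by
        have h1 := hα.2 (e 0) (e i)
        rw [pullForm_apply] at h1
        rw [real_inner_comm, hw, sum_inner, ← h1]
        exact Finset.sum_congr rfl fun k _ => by rw [real_inner_smul_left]; rfl
      refine ⟨fun j => inner ℝ (L (n j)) w, ?_⟩
      have h2 := hc.sum_inner_smul hn hnu w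
      simp only [hwn, zero_smul, Finset.sum_const_zero, zero_add] at h2
      change pullForm (f x) L (fun k => om k (u 0) (∑ j, inner ℝ (L (n j)) w • L (n j))) = _
      rw [h2]
      refine congrArg _ (funext fun k => ?_)
      have h3 : inner ℝ (u 0) (u 0) = (1 : ℝ) := by simpa using hc.inner_eq 0 0
      rw [hw, om_sum_right]
      simp only [om_smul_right, om_J, h3]
      simp
  rw [← hr, LinearMap.finrank_range_of_inj hinj, finrank_fin_fun]

end BundleE

/-! ### The operator -/

section Operator

variable {M : Type*} [TopologicalSpace M] [ChartedSpace R8 M] [IsManifold (𝓡 8) ∞ M]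
variable {X : Type*} [TopologicalSpace X] [ChartedSpace R4 X]

open Classical in
/-- The operator `D`, computed in a chosen adapted frame. The value where there is no adapted frame
plays no role: such frames exist wherever `f` is an immersion. -/
def cayleyOperator (Φ : Π q : M, Form4 q) (f : X → M)
    (o : Π x : X, Orientation ℝ (TangentSpace (𝓡 4) x) (Fin 4))
    (s : Π x : X, TangentSpace (𝓡 8) (f x)) (x : X) : Form2 (f x) :=
  if h : ∃ (e : Basis (Fin 4) ℝ (TangentSpace (𝓡 4) x)) (n : Fin 4 → TangentSpace (𝓡 8) (f x)),
    IsAdaptedFrame Φ f o x e n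
  then operatorFormula Φ f s x h.choose h.choose_spec.choose else 0

theorem exists_cayleyOperator_eq {Φ : Π q : M, Form4 q} (hΦ : IsSpin7Structure Φ) {f : X → M}
    {x : X} (hf : Function.Injective (dmap f x))
    (o : Π x : X, Orientation ℝ (TangentSpace (𝓡 4) x) (Fin 4)) :
    ∃ (e : Basis (Fin 4) ℝ (TangentSpace (𝓡 4) x)) (n : Fin 4 → TangentSpace (𝓡 8) (f x)),
      IsAdaptedFrame Φ f o x e n ∧
      ∀ s, cayleyOperator Φ f o s x = operatorFormula Φ f s x e n := by
  obtain ⟨L, hL⟩ := exists_coframe hΦ (f x)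
  have h := exists_isAdaptedFrame (o := o) hL hf
  exact ⟨_, _, h.choose_spec.choose_spec, fun s => dif_pos h⟩

theorem secRep_add {f : X → M} (s s' : Π x : X, TangentSpace (𝓡 8) (f x)) (p : M) (x₀ : X)
    (ξ : R4) : secRep f (s + s') p x₀ ξ = secRep f s p x₀ ξ + secRep f s' p x₀ ξ :=
  map_add _ _ _

theorem secRep_smul {f : X → M} (c : ℝ) (s : Π x : X, TangentSpace (𝓡 8) (f x)) (p : M) (x₀ : X)
    (ξ : R4) : secRep f (c • s) p x₀ ξ = c • secRep f s p x₀ ξ :=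
  (toCoords p _).map_smul c _

variable [IsManifold (𝓡 4) ∞ X]

variable {Φ : Π q : M, Form4 q} {f : X → M}
  {s : Π x : X, TangentSpace (𝓡 8) (f x)} {p : M} {Ω : Set R8} {θ : R8 → R8 →L[ℝ] R8} {y₀ : R8}
  {r C : ℝ} {E : R8 × R8 → R8} {o : Π x : X, Orientation ℝ (TangentSpace (𝓡 4) x) (Fin 4)}

theorem IsExpChart.linForm_eq_coordBasis (h : IsExpChart Φ p Ω θ y₀ r C E)
    (hf : ContMDiff (𝓡 4) (𝓡 8) ∞ f) (hs : s ∈ NormalSections Φ f) {x₀ x : X}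
    (hx : x ∈ (chartAt R4 x₀).source)
    (hz : (0, extChartAt (𝓡 4) x₀ x) ∈
      variationDomain (coordRep f p x₀) (secRep f s p x₀) (coordDomain f p x₀) y₀ r)
    (v : Fin 4 → TangentSpace (𝓡 4) x) :
    linForm θ f s p x₀ x v = (coordBasis x₀ x hx).det v • pullForm (f x) (coframeAt θ p (f x))
      (linCoeff (coordRep f p x₀) (secRep f s p x₀) θ (fun i => EuclideanSpace.single i 1)
        (extChartAt (𝓡 4) x₀ x)) := by
  rw [linForm, h.linCoeff_eq_det hf hs hz, pullForm_smul, coordBasis_det]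

/-- The linearisation is an alternating form on the tangent space. -/
theorem IsExpChart.linForm_eq_det (h : IsExpChart Φ p Ω θ y₀ r C E)
    (hf : ContMDiff (𝓡 4) (𝓡 8) ∞ f) (hs : s ∈ NormalSections Φ f) {x₀ x : X}
    (hx : x ∈ (chartAt R4 x₀).source)
    (hz : (0, extChartAt (𝓡 4) x₀ x) ∈
      variationDomain (coordRep f p x₀) (secRep f s p x₀) (coordDomain f p x₀) y₀ r)
    (e : Basis (Fin 4) ℝ (TangentSpace (𝓡 4) x)) (v : Fin 4 → TangentSpace (𝓡 4) x) :
    linForm θ f s p x₀ x v = e.det v • linForm θ f s p x₀ x e := by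
  rw [h.linForm_eq_coordBasis hf hs hx hz v, h.linForm_eq_coordBasis hf hs hx hz e, smul_smul]
  congr 1
  have h1 := DFunLike.congr_fun ((coordBasis x₀ x hx).det.eq_smul_basis_det e) v
  rw [h1, AlternatingMap.smul_apply, smul_eq_mul, mul_comm]

/-- The linearisation at a point, in the charts centred there, is `vol_X ⊗ D s`. -/
theorem IsExpChart.linForm_self_eq {x : X} (hf : IsSmoothEmb f) (ho : IsCayleyOrientation Φ f o)
    (hs : s ∈ NormalSections Φ f)
    (h : IsExpChart Φ (f x) Ω θ (extChartAt (𝓡 8) (f x) (f x)) r C E)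
    {e : Basis (Fin 4) ℝ (TangentSpace (𝓡 4) x)} {n : Fin 4 → TangentSpace (𝓡 8) (f x)}
    (hen : IsAdaptedFrame Φ f o x e n) (v : Fin 4 → TangentSpace (𝓡 4) x) :
    linForm θ f s (f x) x x v = vol Φ f o x v • operatorFormula Φ f s x e n := by
  have hx := mem_chart_source R4 x
  have hp := mem_chart_source R8 (f x)
  have hΩ : extChartAt (𝓡 8) (f x) (f x) ∈ Ω :=
    (h.mem (_, 0) (Metric.mem_ball_self h.pos)).1
  have hz := zero_mem_variationDomain (S := secRep f s (f x) x) (mem_coordDomain hx hp) h.pos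
    (coordRep_chart f (f x) hx)
  rw [h.linForm_eq_det hf.1 hs hx hz e, vol_eq (h.coframe.at hp hΩ) hen.1,
    linForm_eq_operatorFormula hf.1 ho hs h.coframe hΩ hen]

theorem IsExpChart.linForm_self_eq_cayleyOperator {x : X} (hΦ : IsSpin7Structure Φ)
    (hf : IsSmoothEmb f) (ho : IsCayleyOrientation Φ f o) (hs : s ∈ NormalSections Φ f)
    (h : IsExpChart Φ (f x) Ω θ (extChartAt (𝓡 8) (f x) (f x)) r C E)
    (v : Fin 4 → TangentSpace (𝓡 4) x) :
    linForm θ f s (f x) x x v = vol Φ f o x v • cayleyOperator Φ f o s x := by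
  obtain ⟨e, n, hen, hD⟩ := exists_cayleyOperator_eq hΦ (hf.2.1 x) o
  rw [hD, h.linForm_self_eq hf ho hs hen]

/-- The operator formula does not depend on the adapted frame: in each of them it is the
linearisation of the deformation map, evaluated on a frame of volume `1`. -/
theorem cayleyOperator_eq [T2Space M] (hΦ : IsSpin7Structure Φ) (hf : IsSmoothEmb f)
    (ho : IsCayleyOrientation Φ f o) (hs : s ∈ NormalSections Φ f) {x : X}
    {e : Basis (Fin 4) ℝ (TangentSpace (𝓡 4) x)} {n : Fin 4 → TangentSpace (𝓡 8) (f x)}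
    (hen : IsAdaptedFrame Φ f o x e n) :
    cayleyOperator Φ f o s x = operatorFormula Φ f s x e n := by
  obtain ⟨Ω, θ, r, C, E, h⟩ := exists_expChart hΦ (mem_chart_source R8 (f x))
  obtain ⟨L, hL⟩ := exists_coframe hΦ (f x)
  have h1 := h.linForm_self_eq_cayleyOperator hΦ hf ho hs e
  rwa [h.linForm_self_eq hf ho hs hen, vol_eq hL hen.1, e.det_self, one_smul, one_smul,
    eq_comm] at h1

theorem linCoeff_add {F S S' : R4 → R8} {ξ : R4} (hS : DifferentiableAt ℝ S ξ)
    (hS' : DifferentiableAt ℝ S' ξ) (w : Fin 4 → R4) :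
    linCoeff F (fun η => S η + S' η) θ w ξ = linCoeff F S θ w ξ + linCoeff F S' θ w ξ := by
  funext k
  simp only [linCoeff, Pi.add_apply]
  rw [fderiv_fun_add hS hS', ← mul_add, ← Finset.sum_add_distrib]
  congr 1
  refine Finset.sum_congr rfl fun i _ => ?_
  rw [← (fourfold k).map_update_add]
  refine congrArg (fun z : R8 => fourfold k (Function.update _ i z)) ?_
  simp only [map_add, add_apply]
  abel

theorem linCoeff_smul {F S : R4 → R8} {ξ : R4} (hS : DifferentiableAt ℝ S ξ) (c : ℝ)
    (w : Fin 4 → R4) :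
    linCoeff F (fun η => c • S η) θ w ξ = c • linCoeff F S θ w ξ := by
  funext k
  simp only [linCoeff, Pi.smul_apply, smul_eq_mul]
  rw [fderiv_fun_const_smul hS, mul_left_comm c, Finset.mul_sum _ _ c]
  congr 1
  refine Finset.sum_congr rfl fun i _ => ?_
  refine Eq.trans ?_ ((fourfold k).map_update_smul _ i c _)
  refine congrArg (fun z : R8 => fourfold k (Function.update _ i z)) ?_
  simp only [map_smul, smul_apply, smul_add]

theorem differentiableAt_secRep (hf : Continuous f) (hs : s ∈ NormalSections Φ f) (x : X) :
    DifferentiableAt ℝ (secRep f s (f x) x) (extChartAt (𝓡 4) x x) :=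
  ((contDiffOn_secRep hs (f x) x).contDiffAt ((isOpen_coordDomain hf (f x) x).mem_nhds
    (mem_coordDomain (mem_chart_source R4 x) (mem_chart_source R8 (f x))))).differentiableAt
    (by simp)

theorem cayleyOperator_add [T2Space M] (hΦ : IsSpin7Structure Φ) (hf : IsSmoothEmb f)
    (ho : IsCayleyOrientation Φ f o) {s s' : Π x : X, TangentSpace (𝓡 8) (f x)}
    (hs : s ∈ NormalSections Φ f) (hs' : s' ∈ NormalSections Φ f) (x : X) :
    cayleyOperator Φ f o (s + s') x = cayleyOperator Φ f o s x + cayleyOperator Φ f o s' x := by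
  obtain ⟨Ω, θ, r, C, E, h⟩ := exists_expChart hΦ (mem_chart_source R8 (f x))
  obtain ⟨L, hL⟩ := exists_coframe hΦ (f x)
  obtain ⟨e, n, hen, hD⟩ := exists_cayleyOperator_eq hΦ (hf.2.1 x) o
  have hv : vol Φ f o x e = 1 := by rw [vol_eq hL hen.1, e.det_self]
  have h1 := h.linForm_self_eq_cayleyOperator hΦ hf ho hs e
  have h2 := h.linForm_self_eq_cayleyOperator hΦ hf ho hs' e
  have h3 := h.linForm_self_eq_cayleyOperator hΦ hf ho ((NormalSections Φ f).add_mem hs hs') e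
  rw [hv, one_smul] at h1 h2 h3
  rw [← h1, ← h2, ← h3, linForm, linForm, linForm, ← pullForm_add, ← linCoeff_add
    (differentiableAt_secRep hf.1.continuous hs x) (differentiableAt_secRep hf.1.continuous hs' x)]
  rw [funext (secRep_add s s' (f x) x)]

theorem cayleyOperator_smul [T2Space M] (hΦ : IsSpin7Structure Φ) (hf : IsSmoothEmb f)
    (ho : IsCayleyOrientation Φ f o) (c : ℝ) (hs : s ∈ NormalSections Φ f) (x : X) :
    cayleyOperator Φ f o (c • s) x = c • cayleyOperator Φ f o s x := by
  obtain ⟨Ω, θ, r, C, E, h⟩ := exists_expChart hΦ (mem_chart_source R8 (f x))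
  obtain ⟨L, hL⟩ := exists_coframe hΦ (f x)
  obtain ⟨e, n, hen, hD⟩ := exists_cayleyOperator_eq hΦ (hf.2.1 x) o
  have hv : vol Φ f o x e = 1 := by rw [vol_eq hL hen.1, e.det_self]
  have h1 := h.linForm_self_eq_cayleyOperator hΦ hf ho hs e
  have h3 := h.linForm_self_eq_cayleyOperator hΦ hf ho ((NormalSections Φ f).smul_mem c hs) e
  rw [hv, one_smul] at h1 h3
  rw [← h1, ← h3, linForm, linForm, ← pullForm_smul, ← linCoeff_smul
    (differentiableAt_secRep hf.1.continuous hs x)]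
  rw [funext (secRep_smul c s (f x) x)]

end Operator

/-! ### The linearisation of the deformation map -/

theorem eventually_mul_sq_le (K : ℝ) {ε : ℝ} (hε : 0 < ε) :
    ∀ᶠ t in 𝓝 (0 : ℝ), K * t ^ 2 ≤ ε * |t| := by
  have h : Filter.Tendsto (fun t : ℝ => |K| * |t|) (𝓝 0) (𝓝 0) := by
    have : Continuous fun t : ℝ => |K| * |t| := by fun_prop
    simpa using this.tendsto 0
  filter_upwards [h.eventually (gt_mem_nhds hε)] with t ht
  calc K * t ^ 2 ≤ |K| * t ^ 2 := mul_le_mul_of_nonneg_right (le_abs_self K) (sq_nonneg t)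
    _ = |K| * |t| * |t| := by rw [← sq_abs, sq, mul_assoc]
    _ ≤ ε * |t| := mul_le_mul_of_nonneg_right ht.le (abs_nonneg t)

section Uniqueness

variable {M : Type*} [TopologicalSpace M] [ChartedSpace R8 M] {q : M}

/-- A curve of forms has at most one derivative at `0`. -/
theorem form2_eq_of_eventually_le {G : ℝ → Form2 q} {A B : Form2 q}
    (hA : ∀ a b, ∀ ε > (0 : ℝ), ∀ᶠ t in 𝓝 (0 : ℝ), |(G t - t • A) ![a, b]| ≤ ε * |t|)
    (hB : ∀ a b, ∀ ε > (0 : ℝ), ∀ᶠ t in 𝓝 (0 : ℝ), |(G t - t • B) ![a, b]| ≤ ε * |t|) :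
    A = B := by
  refine form2_ext fun a b => ?_
  rw [← sub_eq_zero, ← abs_nonpos_iff]
  refine le_of_forall_pos_le_add fun ε hε => ?_
  rw [zero_add]
  have h := ((hA a b (ε / 2) (half_pos hε)).and (hB a b (ε / 2) (half_pos hε))).filter_mono
    (nhdsWithin_le_nhds (s := {0}ᶜ))
  obtain ⟨t, ⟨h1, h2⟩, ht⟩ := (h.and self_mem_nhdsWithin).exists
  have ht' : 0 < |t| := abs_pos.2 ht
  simp only [AlternatingMap.sub_apply, AlternatingMap.smul_apply, smul_eq_mul] at h1 h2
  have h3 : |t| * |A ![a, b] - B ![a, b]| ≤ |t| * ε := by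
    rw [← abs_mul]
    have h4 : t * (A ![a, b] - B ![a, b]) =
      (G t ![a, b] - t * B ![a, b]) - (G t ![a, b] - t * A ![a, b]) := by ring
    rw [h4]
    refine (abs_sub _ _).trans ?_
    linarith
  exact le_of_mul_le_mul_left h3 ht'

variable [IsManifold (𝓡 8) ∞ M]
variable {X : Type*} [TopologicalSpace X] [ChartedSpace R4 X]
variable {Φ : Π q : M, Form4 q} {f : X → M} {s : Π x : X, TangentSpace (𝓡 8) (f x)}

/-- The uniform estimates that define a linearisation determine it at every point. -/
theorem IsLinearisation.unique {L L' : Π x : X, (Fin 4 → TangentSpace (𝓡 4) x) → Form2 (f x)}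
    (h : IsLinearisation Φ f s L) (h' : IsLinearisation Φ f s L') (x : X)
    (v : Fin 4 → TangentSpace (𝓡 4) x) : L x v = L' x v := by
  have key : ∀ {L : Π x : X, (Fin 4 → TangentSpace (𝓡 4) x) → Form2 (f x)},
      IsLinearisation Φ f s L → ∀ a b, ∀ ε > (0 : ℝ), ∀ᶠ t in 𝓝 (0 : ℝ),
        |((deformationMap Φ f (t • s) x v - deformationMap Φ f 0 x v) - t • L x v) ![a, b]|
          ≤ ε * |t| := fun {L} h a b ε hε => by
    set c := (∏ i, len Φ (f x) (dmap f x (v i))) * len Φ (f x) a * len Φ (f x) b with hc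
    have hc0 : 0 ≤ c := mul_nonneg (mul_nonneg (Finset.prod_nonneg fun _ _ => Real.sqrt_nonneg _)
      (Real.sqrt_nonneg _)) (Real.sqrt_nonneg _)
    filter_upwards [h (ε / (c + 1)) (by positivity)] with t ht
    refine (ht x v a b).trans ?_
    calc ε / (c + 1) * |t| * (∏ i, len Φ (f x) (dmap f x (v i))) * len Φ (f x) a * len Φ (f x) b
        = ε * |t| * (c / (c + 1)) := by rw [hc]; ring
      _ ≤ ε * |t| * 1 := mul_le_mul_of_nonneg_left (div_le_one_of_le₀ (by linarith) (by linarith))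
          (by positivity)
      _ = ε * |t| := mul_one _
  exact form2_eq_of_eventually_le (key h) (key h')

end Uniqueness

section Linearisation

variable {M : Type*} [TopologicalSpace M] [T2Space M] [ChartedSpace R8 M]
  [IsManifold (𝓡 8) ∞ M]
variable {X : Type*} [TopologicalSpace X] [ChartedSpace R4 X] [IsManifold (𝓡 4) ∞ X]
variable {Φ : Π q : M, Form4 q} {f : X → M}
  {s : Π x : X, TangentSpace (𝓡 8) (f x)} {p : M} {Ω : Set R8} {θ : R8 → R8 →L[ℝ] R8}
  {r C : ℝ} {E : R8 × R8 → R8} {o : Π x : X, Orientation ℝ (TangentSpace (𝓡 4) x) (Fin 4)}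

/-- The linearisation computed in a fixed chart is `vol_X ⊗ D s` at all nearby points: at each of
these, this chart and the chart centred there describe the derivative of the same curve of forms.
-/
theorem IsExpChart.eventually_linForm_eq (hΦ : IsSpin7Structure Φ) (hf : IsSmoothEmb f)
    (ho : IsCayleyOrientation Φ f o) (hs : s ∈ NormalSections Φ f) {x₀ : X}
    (hx₀ : f x₀ ∈ (chartAt R8 p).source)
    (h : IsExpChart Φ p Ω θ (extChartAt (𝓡 8) p (f x₀)) r C E) :
    ∀ᶠ x in 𝓝 x₀, ∀ v, linForm θ f s p x₀ x v = vol Φ f o x v • cayleyOperator Φ f o s x := by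
  obtain ⟨K, δ, -, hδ, hK⟩ := exists_linearisation_bound hΦ hf ho hs hx₀ h
  filter_upwards [hK] with x hx v
  obtain ⟨Ω', θ', r', C', E', h'⟩ := exists_expChart hΦ (mem_chart_source R8 (f x))
  obtain ⟨K', δ', -, hδ', hK'⟩ := exists_linearisation_bound hΦ hf ho hs
    (mem_chart_source R8 (f x)) h'
  rw [← h'.linForm_self_eq_cayleyOperator hΦ hf ho hs v]
  refine form2_eq_of_eventually_le (G := fun t => deformationMap Φ f (t • s) x v)
    (fun a b ε hε => ?_) fun a b ε hε => ?_
  · filter_upwards [eventually_mul_sq_le (K * (∏ i, len Φ (f x) (dmap f x (v i))) *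
      len Φ (f x) a * len Φ (f x) b) hε, eventually_abs_sub_lt 0 hδ] with t h1 h2
    rw [sub_zero] at h2
    exact (hx.2.2 t h2 v a b).trans ((by ring : _ = _).trans_le h1)
  · filter_upwards [eventually_mul_sq_le (K' * (∏ i, len Φ (f x) (dmap f x (v i))) *
      len Φ (f x) a * len Φ (f x) b) hε, eventually_abs_sub_lt 0 hδ'] with t h1 h2
    rw [sub_zero] at h2
    exact (hK'.self_of_nhds.2.2 t h2 v a b).trans ((by ring : _ = _).trans_le h1)

/-- On a compact `X` the deformation map differs from its linear part by a quadratic error with a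
uniform constant; the local bounds are patched by compactness. -/
theorem exists_deformationMap_bound [CompactSpace X] (hΦ : IsSpin7Structure Φ) (hf : IsSmoothEmb f)
    (ho : IsCayleyOrientation Φ f o) (hs : s ∈ NormalSections Φ f) :
    ∃ K δ : ℝ, 0 < K ∧ 0 < δ ∧ ∀ x, ∀ t : ℝ, |t| < δ →
      ∀ (v : Fin 4 → TangentSpace (𝓡 4) x) (a b : TangentSpace (𝓡 8) (f x)),
        |(deformationMap Φ f (t • s) x v - t • vol Φ f o x v • cayleyOperator Φ f o s x) ![a, b]| ≤
          K * t ^ 2 * ((∏ i, len Φ (f x) (dmap f x (v i))) * len Φ (f x) a * len Φ (f x) b) := by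
  have hpos : ∀ (x : X) (v : Fin 4 → TangentSpace (𝓡 4) x) (a b : TangentSpace (𝓡 8) (f x)),
      0 ≤ (∏ i, len Φ (f x) (dmap f x (v i))) * len Φ (f x) a * len Φ (f x) b := fun x v a b =>
    mul_nonneg (mul_nonneg (Finset.prod_nonneg fun _ _ => Real.sqrt_nonneg _)
      (Real.sqrt_nonneg _)) (Real.sqrt_nonneg _)
  have key := isCompact_univ.induction_on (p := fun A : Set X => ∃ K δ : ℝ, 0 < K ∧ 0 < δ ∧
    ∀ x ∈ A, ∀ t : ℝ, |t| < δ →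
      ∀ (v : Fin 4 → TangentSpace (𝓡 4) x) (a b : TangentSpace (𝓡 8) (f x)),
        |(deformationMap Φ f (t • s) x v - t • vol Φ f o x v • cayleyOperator Φ f o s x) ![a, b]| ≤
          K * t ^ 2 * ((∏ i, len Φ (f x) (dmap f x (v i))) * len Φ (f x) a * len Φ (f x) b))
    ⟨1, 1, one_pos, one_pos, fun x hx => absurd hx (Set.notMem_empty x)⟩
    (fun A B hAB ⟨K, δ, hK, hδ, h⟩ => ⟨K, δ, hK, hδ, fun x hx => h x (hAB hx)⟩)
    (fun A B ⟨K, δ, hK, hδ, h⟩ ⟨K', δ', hK', hδ', h'⟩ =>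
      ⟨max K K', min δ δ', lt_max_of_lt_left hK, lt_min hδ hδ', fun x hx t ht v a b => by
        rcases hx with hx | hx
        · exact (h x hx t (ht.trans_le (min_le_left _ _)) v a b).trans
            (mul_le_mul_of_nonneg_right (mul_le_mul_of_nonneg_right (le_max_left _ _)
              (sq_nonneg t)) (hpos x v a b))
        · exact (h' x hx t (ht.trans_le (min_le_right _ _)) v a b).trans
            (mul_le_mul_of_nonneg_right (mul_le_mul_of_nonneg_right (le_max_right _ _)
              (sq_nonneg t)) (hpos x v a b))⟩)
    fun x₀ _ => by
      obtain ⟨Ω, θ, r, C, E, h⟩ := exists_expChart hΦ (mem_chart_source R8 (f x₀))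
      obtain ⟨K, δ, hK, hδ, hb⟩ := exists_linearisation_bound hΦ hf ho hs
        (mem_chart_source R8 (f x₀)) h
      refine ⟨_, mem_nhdsWithin_of_mem_nhds (hb.and (h.eventually_linForm_eq hΦ hf ho hs
        (mem_chart_source R8 (f x₀)))), K, δ, hK, hδ, fun x hx t ht v a b => ?_⟩
      have h1 := hx.1.2.2 t ht v a b
      rwa [hx.2, mul_assoc (K * t ^ 2), mul_assoc (K * t ^ 2)] at h1
  obtain ⟨K, δ, hK, hδ, h⟩ := key
  exact ⟨K, δ, hK, hδ, fun x => h x (Set.mem_univ x)⟩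

/-- The derivative of the deformation map at `0` is `s ↦ vol_X ⊗ D s`, uniformly on `X`. -/
theorem isLinearisation_cayleyOperator [CompactSpace X] (hΦ : IsSpin7Structure Φ)
    (hf : IsSmoothEmb f) (ho : IsCayleyOrientation Φ f o) (hs : s ∈ NormalSections Φ f) :
    IsLinearisation Φ f s fun x v => vol Φ f o x v • cayleyOperator Φ f o s x := by
  obtain ⟨K, δ, hK, hδ, h⟩ := exists_deformationMap_bound hΦ hf ho hs
  intro ε hε
  filter_upwards [eventually_mul_sq_le K hε, eventually_abs_sub_lt 0 hδ] with t h1 h2 x v a b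
  rw [sub_zero] at h2
  rw [deformationMap_zero hΦ hf ho, sub_zero, mul_assoc (ε * |t|), mul_assoc (ε * |t|)]
  exact (h x t h2 v a b).trans (mul_le_mul_of_nonneg_right h1
    (mul_nonneg (mul_nonneg (Finset.prod_nonneg fun _ _ => Real.sqrt_nonneg _)
      (Real.sqrt_nonneg _)) (Real.sqrt_nonneg _)))

end Linearisation

/-! ### Smoothness of the operator -/

section Smoothness

variable {M : Type*} [TopologicalSpace M] [T2Space M] [ChartedSpace R8 M]
  [IsManifold (𝓡 8) ∞ M]
variable {X : Type*} [TopologicalSpace X] [ChartedSpace R4 X] [IsManifold (𝓡 4) ∞ X]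
variable {Φ : Π q : M, Form4 q} {f : X → M}
  {s : Π x : X, TangentSpace (𝓡 8) (f x)}
  {o : Π x : X, Orientation ℝ (TangentSpace (𝓡 4) x) (Fin 4)}

/-- `D s` is a smooth section of `E`. In coordinates `vol_X ⊗ D s` is the linearisation, which is
smooth, and `vol_X`, being the restriction of `Φ`, is smooth and does not vanish; so `D s` is the
quotient of the two. -/
theorem cayleyOperator_mem_sectionsE (hΦ : IsSpin7Structure Φ) (hf : IsSmoothEmb f)
    (ho : IsCayleyOrientation Φ f o) (hs : s ∈ NormalSections Φ f) :
    cayleyOperator Φ f o s ∈ SectionsE Φ f := by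
  refine ⟨fun p' a b x₀ hx₀ => ContMDiffAt.contMDiffWithinAt ?_, fun x => ?_⟩
  swap
  · obtain ⟨L, hL⟩ := exists_coframe hΦ (f x)
    obtain ⟨e, n, hen, hD⟩ := exists_cayleyOperator_eq hΦ (hf.2.1 x) o
    rw [hD]
    exact operatorFormula_mem_bundleE hL ho hen s
  set p := f x₀ with hp
  have hpp : f x₀ ∈ (chartAt R8 p).source := mem_chart_source R8 (f x₀)
  have hxx : x₀ ∈ (chartAt R4 x₀).source := mem_chart_source R4 x₀
  obtain ⟨Ω, θ, r, C, E, h⟩ := exists_expChart hΦ hpp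
  have hΩ : extChartAt (𝓡 8) p (f x₀) ∈ Ω := (h.mem (_, 0) (Metric.mem_ball_self h.pos)).1
  set F := coordRep f p x₀ with hF
  set ξ₀ := extChartAt (𝓡 4) x₀ x₀ with hξ₀
  -- `c` represents `vol_X ⊗ D s`, `P` the form `vol_X`, both on the coordinate frame. Smoothness
  -- is tested in a chart `p'` of `M` that may differ from the one of the coframe, and `T` is the
  -- change of frame between the two.
  set c := linCoeff F (secRep f s p x₀) θ (fun i => EuclideanSpace.single i 1) with hc
  set P : R4 → ℝ := fun ξ => phi fun i => θ (F ξ) (fderiv ℝ F ξ (EuclideanSpace.single i 1))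
    with hP
  set T : R4 → R8 →L[ℝ] R8 := fun ξ => fderiv ℝ (transition p' p) (coordRep f p' x₀ ξ) with hT
  have hFξ : F ξ₀ = extChartAt (𝓡 8) p (f x₀) := coordRep_chart f p hxx
  have hm : ξ₀ ∈ coordDomain f p x₀ ∩ F ⁻¹' Ω :=
    ⟨mem_coordDomain hxx hpp, by rw [Set.mem_preimage, hFξ]; exact hΩ⟩
  have hz₀ := zero_mem_variationDomain (S := secRep f s p x₀) (mem_coordDomain hxx hpp) h.pos hFξ
  -- the components of `D s` in coordinates
  have hcs : ContDiffAt ℝ ∞ c ξ₀ := (h.contDiffOn_linCoeff hf.1 hs x₀ _).contDiffAt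
    (((IsExpChart.isOpen_variationDomain hf.1 hs x₀).preimage
      (Continuous.prodMk_right (0 : ℝ))).mem_nhds hz₀)
  have hPs : ContDiffAt ℝ ∞ P ξ₀ := by
    have h1 : ContDiffAt ℝ ∞ (fun ξ => fun i : Fin 4 =>
        θ (F ξ) (fderiv ℝ F ξ (EuclideanSpace.single i 1))) ξ₀ :=
      contDiffAt_pi.2 fun i => (contDiffOn_frame h.coframe hf.1 x₀ _).contDiffAt
        ((isOpen_coordDomain_inter h.coframe.isOpen hf.1 x₀).mem_nhds hm)
    exact (contDiff_alternating phi).contDiffAt.comp ξ₀ h1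
  have hP' : ∀ x (hx : x ∈ (chartAt R4 x₀).source), f x ∈ (chartAt R8 p).source →
      extChartAt (𝓡 8) p (f x) ∈ Ω →
      P (extChartAt (𝓡 4) x₀ x) = Φ (f x) fun i => dmap f x (coordBasis x₀ x hx i) :=
    fun x hx hpx hΩx => by
      rw [(h.coframe.at hpx hΩx).form_eq]
      refine congrArg phi (funext fun i => ?_)
      rw [coordBasis_apply]
      exact (coframeAt_dmap_coordFrame θ hf.1 hx hpx _).symm
  -- `Φ` restricts to `vol_X`, so `P` has no zero.
  have hP0 : P ξ₀ ≠ 0 := by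
    rw [hP' x₀ hxx hpp hΩ]
    exact form_dmap_ne_zero hΦ hf ho _
  have hθs : ContDiffAt ℝ ∞ (fun ξ => θ (F ξ)) ξ₀ :=
    (h.coframe.contDiffOn.contDiffAt (h.coframe.isOpen.mem_nhds (hFξ ▸ hΩ))).comp ξ₀
      ((contDiffOn_coordRep hf.1 p x₀).contDiffAt
        ((isOpen_coordDomain hf.1.continuous p x₀).mem_nhds hm.1))
  have hTs : ContDiffAt ℝ ∞ T ξ₀ := by
    have h1 : ContDiffAt ℝ ∞ (fderiv ℝ (transition p' p)) (coordRep f p' x₀ ξ₀) := by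
      rw [coordRep_chart f p' hxx]
      exact (transition_contDiffAt hx₀ hpp).fderiv_right (m := ∞) (by simp)
    exact h1.comp ξ₀ ((contDiffOn_coordRep hf.1 p' x₀).contDiffAt
      ((isOpen_coordDomain hf.1.continuous p' x₀).mem_nhds (mem_coordDomain hxx hx₀)))
  have hus : ∀ a, ContDiffAt ℝ ∞ (fun ξ => θ (F ξ) (T ξ a)) ξ₀ := fun a =>
    hθs.clm_apply (hTs.clm_apply contDiffAt_const)
  have hG : ContDiffAt ℝ ∞ (fun ξ => (P ξ)⁻¹ *
      ∑ k, c ξ k * om k (θ (F ξ) (T ξ a)) (θ (F ξ) (T ξ b))) ξ₀ := by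
    refine (hPs.inv hP0).mul (ContDiffAt.sum fun k _ => (contDiffAt_pi.1 hcs k).mul ?_)
    exact ((J k).contDiff.contDiffAt.comp ξ₀ (hus a)).inner ℝ (hus b)
  have hG' := hG.contMDiffAt.comp x₀ (contMDiffAt_extChartAt (I := 𝓡 4) (n := ∞) (x := x₀))
  refine hG'.congr_of_eventuallyEq ?_
  have hcont : ContinuousAt (fun x => extChartAt (𝓡 8) p (f x)) x₀ :=
    (continuousAt_extChartAt' (by rwa [extChartAt_source])).comp hf.1.continuous.continuousAt
  have hzc : ∀ᶠ x in 𝓝 x₀, (0, extChartAt (𝓡 4) x₀ x) ∈ variationDomain F (secRep f s p x₀)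
      (coordDomain f p x₀) (extChartAt (𝓡 8) p (f x₀)) r :=
    (continuousAt_const.prodMk (continuousAt_extChartAt x₀)).eventually
      ((IsExpChart.isOpen_variationDomain hf.1 hs x₀).mem_nhds hz₀)
  filter_upwards [h.eventually_linForm_eq hΦ hf ho hs hpp, hzc,
    (chartAt R4 x₀).open_source.mem_nhds hxx, hcont.eventually (h.coframe.isOpen.mem_nhds hΩ),
    hf.1.continuous.continuousAt.eventually ((chartAt R8 p).open_source.mem_nhds hpp),
    hf.1.continuous.continuousAt.eventually ((chartAt R8 p').open_source.mem_nhds hx₀)]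
    with x hx hz hxs hΩx hpx hpx'
  have h1 := hx (coordBasis x₀ x hxs)
  rw [h.linForm_eq_coordBasis hf.1 hs hxs hz, (coordBasis x₀ x hxs).det_self, one_smul, ← ho.2,
    ← hP' x hxs hpx hΩx] at h1
  have hPx : P (extChartAt (𝓡 4) x₀ x) ≠ 0 := by
    rw [hP' x hxs hpx hΩx]
    exact form_dmap_ne_zero hΦ hf ho _
  have h2 : ∀ a, coframeAt θ p (f x) (ofCoords p' (f x) a) =
      θ (F (extChartAt (𝓡 4) x₀ x)) (T (extChartAt (𝓡 4) x₀ x) a) := fun a => by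
    rw [coframeAt_apply, toCoords_eq_fderiv hpx' hpx, toCoords_ofCoords hpx', hF,
      coordRep_chart f p hxs]
    simp only [hT, coordRep_chart f p' hxs]
  rw [← inv_smul_smul₀ hPx (cayleyOperator Φ f o s x), ← h1, AlternatingMap.smul_apply,
    pullForm_apply, h2, h2, smul_eq_mul]
  rfl

end Smoothness

end CayleyDeformation

end

theorem mainTheorem7
    {M : Type*} [TopologicalSpace M] [T2Space M] [SecondCountableTopology M]
    [ChartedSpace CayleyDeformation.R8 M] [IsManifold (𝓡 8) ∞ M]
    {X : Type*} [TopologicalSpace X] [CompactSpace X]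
    [ChartedSpace CayleyDeformation.R4 X] [IsManifold (𝓡 4) ∞ X]
    (Φ : Π q : M, CayleyDeformation.Form4 q) (hΦ : CayleyDeformation.IsSpin7Structure Φ)
    (f : X → M) (hf : CayleyDeformation.IsSmoothEmb f)
    (o : Π x : X, Orientation ℝ (TangentSpace (𝓡 4) x) (Fin 4))
    (ho : CayleyDeformation.IsCayleyOrientation Φ f o) :
    (∀ x : X, Module.finrank ℝ (CayleyDeformation.bundleE Φ f x) = 4) ∧
    ∃ D : CayleyDeformation.NormalSections Φ f →ₗ[ℝ] CayleyDeformation.SectionsE Φ f,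
      -- `D` is given by the explicit formula in every adapted frame
      (∀ (s : CayleyDeformation.NormalSections Φ f) (x : X)
        (e : Module.Basis (Fin 4) ℝ (TangentSpace (𝓡 4) x))
        (n : Fin 4 → TangentSpace (𝓡 8) (f x)),
        CayleyDeformation.IsAdaptedFrame Φ f o x e n →
          (D s).1 x = CayleyDeformation.operatorFormula Φ f s.1 x e n) ∧
      -- such frames exist at every point, so that the formula determines `D`
      (∀ x : X, ∃ (e : Module.Basis (Fin 4) ℝ (TangentSpace (𝓡 4) x))
        (n : Fin 4 → TangentSpace (𝓡 8) (f x)),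
        CayleyDeformation.IsAdaptedFrame Φ f o x e n) ∧
      -- the moduli space of local Cayley deformations is the zero set of the deformation map
      (∃ U : Set (TangentBundle (𝓡 8) M), CayleyDeformation.IsTubularNeighbourhood Φ f U ∧
        (∀ s ∈ CayleyDeformation.sectionsIn Φ f U,
          CayleyDeformation.IsSmoothEmb (CayleyDeformation.expSec Φ f s) ∧
          (CayleyDeformation.IsCayley Φ (CayleyDeformation.expSec Φ f s) ↔
            ∀ x v, CayleyDeformation.deformationMap Φ f s x v = 0)) ∧
        Set.BijOn (fun s => Set.range (CayleyDeformation.expSec Φ f s))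
          {s ∈ CayleyDeformation.sectionsIn Φ f U |
            ∀ x v, CayleyDeformation.deformationMap Φ f s x v = 0}
          (CayleyDeformation.moduliSpace Φ f U)) ∧
      -- the linearisation of the deformation map at `0` is `s ↦ vol_X ⊗ D s`
      (∀ s : CayleyDeformation.NormalSections Φ f,
        CayleyDeformation.IsLinearisation Φ f s.1
          fun x v => CayleyDeformation.vol Φ f o x v • (D s).1 x) ∧
      -- the Zariski tangent space is the kernel of `D`
      CayleyDeformation.zariskiTangentSpace Φ f = (LinearMap.ker D : Set _) := by
  have hadapted : ∀ x : X, ∃ (e : Module.Basis (Fin 4) ℝ (TangentSpace (𝓡 4) x))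
      (n : Fin 4 → TangentSpace (𝓡 8) (f x)), CayleyDeformation.IsAdaptedFrame Φ f o x e n :=
    fun x => by
      obtain ⟨L, hL⟩ := CayleyDeformation.exists_coframe hΦ (f x)
      exact CayleyDeformation.exists_isAdaptedFrame hL (hf.2.1 x)
  have hlin : ∀ s : CayleyDeformation.NormalSections Φ f,
      CayleyDeformation.IsLinearisation Φ f s.1
        fun x v => CayleyDeformation.vol Φ f o x v • CayleyDeformation.cayleyOperator Φ f o s.1 x :=
    fun s => CayleyDeformation.isLinearisation_cayleyOperator hΦ hf ho s.2
  refine ⟨fun x => ?_,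
    { toFun := fun s => ⟨CayleyDeformation.cayleyOperator Φ f o s.1,
        CayleyDeformation.cayleyOperator_mem_sectionsE hΦ hf ho s.2⟩
      map_add' := fun s s' => Subtype.ext (funext
        (CayleyDeformation.cayleyOperator_add hΦ hf ho s.2 s'.2))
      map_smul' := fun c s => Subtype.ext (funext
        (CayleyDeformation.cayleyOperator_smul hΦ hf ho c s.2)) },
    fun s x e n hen => CayleyDeformation.cayleyOperator_eq hΦ hf ho s.2 hen, hadapted,
    CayleyDeformation.exists_moduli_description hΦ hf, hlin, ?_⟩
  · obtain ⟨L, hL⟩ := CayleyDeformation.exists_coframe hΦ (f x)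
    obtain ⟨e, n, hen⟩ := hadapted x
    exact CayleyDeformation.finrank_bundleE hL ho hen
  · ext s
    refine ⟨fun hs => Subtype.ext (funext fun x => ?_), fun hs => ?_⟩
    -- the linearisation is unique, and `vol_X` is `1` on a positive orthonormal frame
    · obtain ⟨L, hL⟩ := CayleyDeformation.exists_coframe hΦ (f x)
      obtain ⟨e, n, hen⟩ := hadapted x
      have h := (hlin s).unique hs x e
      rwa [CayleyDeformation.vol_eq hL hen.1, e.det_self, one_smul] at h
    · have h0 : CayleyDeformation.cayleyOperator Φ f o s.1 = 0 := congrArg Subtype.val hs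
      have h := hlin s
      simp only [h0, Pi.zero_apply, smul_zero] at h
      exact h
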